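/- For $z$ near $\tfrac12$ let $Q(w)=w(w-1)(w-z)$, with critical points $w_\pm=\frac{z+1}{3}\pm\frac13(z^2-z+1)^{1/2}$ and critical values $Q_\pm=Q(w_\pm)$ (so $Q_\pm\approx\mp\frac{\sqrt3}{36}$). Put $Q_-^C=e^{C\log Q_-}$ and $Q_+^C=e^{C\log Q_+}$, where $\log Q_-$ is principal and $\log Q_+=\log(-Q_+)+\pi i$. Let $$I_1(C,z)=\int_1^\infty Q(w)^C\,dw\quad(-1<\mathrm{Re}\,C<-\tfrac13),\qquad I_2(C,z)=\int_0^z Q(w)^C\,dw\quad(\mathrm{Re}\,C>-1),$$ both continued analytically in $C$ to $\mathrm{Im}\,C<0$. Let $w_0,w_1,w_2$ be the holomorphic germs at $Q=0$ of the roots of $w(w-1)(w-z)=Q$ with $w_0(0)=0$, $w_1(0)=1$, $w_2(0)=z$, and let $$\Psi(Q)=\frac{Q\,(2w_1-w_0-w_2)}{(w_0-w_1)(w_0-w_2)(w_1-w_2)},\qquad \Phi(Q)=\frac{Q\,(w_1+w_2-2w_0)}{(w_0-w_1)(w_0-w_2)(w_1-w_2)} .$$ Put $\widehat\psi(\zeta)=\Psi(Q_-e^{-\zeta})$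 and $\widehat\varphi(\zeta)=\Phi(Q_+e^{-\zeta})$, continued analytically from large $\zeta>0$ along the positive axis to near $\zeta=0$, and from there by turning counterclockwise to the ray of direction $\frac\pi2+\varepsilon$. Let $\mathfrak L^\theta f(C)=\int_0^{e^{i\theta}\infty}e^{-C\zeta}f(\zeta)\,d\zeta$. **Theorem.** There is $\varepsilon_0>0$ such that for every $0<\varepsilon<\varepsilon_0$ there is $\delta>0$ such that for all $z\in\mathbb C$ with $|z-\frac12|<\delta$ the following holds. The above continuations exist; for $f=\widehat\psi$ and $f=\widehat\varphi$ the integral $\mathfrak L^{\frac\pi2+\varepsilon}f(C)$ converges when $\mathrm{Im}\,C<0$ and $\mathrm{Re}\big((C+\tfrac13)e^{i(\frac\pi2+\varepsilon)}\big)>0$, and it extends to an analytic function of $C$ on $\{\mathrm{Im}\,C<0\}$, denoted by the same symbol. Moreover: 1. $I_2(C,z)=Q_-^C\,\mathfrak L^{0}\widehat\psi(C)$ for $\mathrm{Re}\,C>-1$ (convergent integral), and $I_1(C,z)=Q_+^C\,\frac{1}{e^{2\pi iC}-1}\,\mathfrak L^{\frac\pi2+\varepsilon}\widehat\varphi(C)$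 for $\mathrm{Im}\,C<0$. 2. (Stokes phenomenon.) For all $C$ with $\mathrm{Im}\,C<0$, $$I_2(C,z)=Q_-^C\,\frac{1+e^{-2\pi iC}}{1-e^{-2\pi iC}}\,\mathfrak L^{\frac\pi2+\varepsilon}\widehat\psi(C)+I_1(C,z).$$ 3. (Trans-series expansion.) For all $C$ with $\mathrm{Im}\,C<0$, with convergent sums over $m$, $$I_2(C,z)=Q_-^C\,\mathfrak L^{\frac\pi2+\varepsilon}\widehat\psi(C)+2Q_-^C\sum_{m\ge1}e^{-2\pi imC}\,\mathfrak L^{\frac\pi2+\varepsilon}\widehat\psi(C)+Q_+^C\sum_{m\ge1}e^{-2\pi imC}\,\mathfrak L^{\frac\pi2+\varepsilon}\widehat\varphi(C),$$ and there are expansions $\widehat\psi(\zeta)=\sum_{n\ge0}\frac{a_n}{\Gamma(n+1/2)}\zeta^{n-1/2}$, $\widehat\varphi(\zeta)=\sum_{n\ge0}\frac{b_n}{\Gamma(n+1/2)}\zeta^{n-1/2}$ convergent near $\zeta=0$ such that, for every $\eta>0$, as $C\to\infty$ in $\{-\pi<\arg C\le-\varepsilon-\eta\}$, $$\mathfrak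 L^{\frac\pi2+\varepsilon}\widehat\psi(C)\sim\sum_{n\ge0}a_nC^{-n-\frac12},\qquad \mathfrak L^{\frac\pi2+\varepsilon}\widehat\varphi(C)\sim\sum_{n\ge0}b_nC^{-n-\frac12}$$ in the sense of Poincaré. -/

import Mathlib

open Complex Filter Topology Set MeasureTheory Asymptotics

noncomputable section

namespace CoulombGas

/-- The cubic `Q(w) = w (w - 1) (w - z)`. -/
def cubic (z w : ℂ) : ℂ := w * (w - 1) * (w - z)

/-- The critical points `w_± = (z + 1)/3 ± (z² - z + 1)^{1/2}/3` of the cubic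
(principal square root; `z² - z + 1` is close to `3/4` for `z` near `1/2`). -/
def wPlus (z : ℂ) : ℂ := (z + 1) / 3 + (z ^ 2 - z + 1) ^ (1 / 2 : ℂ) / 3

def wMinus (z : ℂ) : ℂ := (z + 1) / 3 - (z ^ 2 - z + 1) ^ (1 / 2 : ℂ) / 3

/-- The critical values `Q_±`; `Q_- ≈ √3/36` and `Q_+ ≈ -√3/36` for `z` near `1/2`. -/
def QPlus (z : ℂ) : ℂ := cubic z (wPlus z)

def QMinus (z : ℂ) : ℂ := cubic z (wMinus z)

/-- `Q_-^C`, principal branch (`Q_-` is close to the positive number `√3/36`). -/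
def QMinusPow (z C : ℂ) : ℂ := QMinus z ^ C

/-- `Q_+^C = exp (C log Q_+)`, with the branch of `log Q_+` close to `log (√3/36) + π i`;
it is holomorphic in `z` near `1/2`. -/
def QPlusPow (z C : ℂ) : ℂ := exp (C * (log (-QPlus z) + Real.pi * I))

/-! ### The conformal blocks -/

/-- `Q(w)^C` on the ray `w > 1`. For `z` near `1/2` the number `Q(w)` has positive real part
there, and the power is the principal one. -/
def integrand₁ (z C : ℂ) (w : ℝ) : ℂ := cubic z w ^ C

/-- `Q(w)^C dw` on the segment from `0` to `z`, parametrized by `w = t z`, `0 < t < 1`. For `z`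
near `1/2` the number `Q(t z)` has positive real part, and the power is the principal one. -/
def integrand₂ (z C : ℂ) (t : ℝ) : ℂ := cubic z (t * z) ^ C * z

/-- `F` is `C ↦ I₁(C, z)`: the (convergent) integral `∫_1^∞ Q^C dw` on the strip
`-1 < Re C < -1/3`, continued analytically from this strip to `Im C < 0`. -/
structure IsBlock₁ (z : ℂ) (F : ℂ → ℂ) : Prop where
  analytic : DifferentiableOn ℂ F ({C | -1 < C.re ∧ C.re < -1 / 3} ∪ {C | C.im < 0})
  eq_integral : ∀ C : ℂ, -1 < C.re → C.re < -1 / 3 →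
    IntegrableOn (integrand₁ z C) (Ioi 1) ∧ F C = ∫ w in Ioi (1 : ℝ), integrand₁ z C w

/-- `F` is `C ↦ I₂(C, z)`: the (convergent) integral `∫_0^z Q^C dw` on the half-plane
`-1 < Re C`, continued analytically from this half-plane to `Im C < 0`. -/
structure IsBlock₂ (z : ℂ) (F : ℂ → ℂ) : Prop where
  analytic : DifferentiableOn ℂ F ({C | -1 < C.re} ∪ {C | C.im < 0})
  eq_integral : ∀ C : ℂ, -1 < C.re →
    IntegrableOn (integrand₂ z C) (Ioo 0 1) ∧ F C = ∫ t in Ioo (0 : ℝ) 1, integrand₂ z C t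

/-! ### The Borel germs -/

/-- `w₀, w₁, w₂` are the holomorphic germs at `Q = 0` of the roots of `w (w - 1) (w - z) = Q` with
`w₀(0) = 0`, `w₁(0) = 1`, `w₂(0) = z`. -/
structure IsRootGerms (z : ℂ) (w₀ w₁ w₂ : ℂ → ℂ) : Prop where
  analytic₀ : AnalyticAt ℂ w₀ 0
  analytic₁ : AnalyticAt ℂ w₁ 0
  analytic₂ : AnalyticAt ℂ w₂ 0
  value₀ : w₀ 0 = 0
  value₁ : w₁ 0 = 1
  value₂ : w₂ 0 = z
  root₀ : ∀ᶠ Q in 𝓝 0, cubic z (w₀ Q) = Q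
  root₁ : ∀ᶠ Q in 𝓝 0, cubic z (w₁ Q) = Q
  root₂ : ∀ᶠ Q in 𝓝 0, cubic z (w₂ Q) = Q

/-- `Ψ(Q) = Q (2w₁ - w₀ - w₂) / ((w₀ - w₁)(w₀ - w₂)(w₁ - w₂))`. -/
def Psi (w₀ w₁ w₂ : ℂ → ℂ) (Q : ℂ) : ℂ :=
  Q * ((2 * w₁ Q - w₀ Q - w₂ Q) / ((w₀ Q - w₁ Q) * (w₀ Q - w₂ Q) * (w₁ Q - w₂ Q)))

/-- `Φ(Q) = Q (w₁ + w₂ - 2w₀) / ((w₀ - w₁)(w₀ - w₂)(w₁ - w₂))`. -/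
def Phi (w₀ w₁ w₂ : ℂ → ℂ) (Q : ℂ) : ℂ :=
  Q * ((w₁ Q + w₂ Q - 2 * w₀ Q) / ((w₀ Q - w₁ Q) * (w₀ Q - w₂ Q) * (w₁ Q - w₂ Q)))

/-- A small slit disc at `0`, together with thin sectors around the directions `0` and `θ`
(arguments in `(-π, π)`). For `0 < θ < π` this is a connected open set containing the rays of
directions `0` and `θ`. -/
def rayDomain (θ ρ η : ℝ) : Set ℂ :=
  {ζ | ζ ∈ slitPlane ∧ (‖ζ‖ < ρ ∨ |arg ζ| < η ∨ |arg ζ - θ| < η)}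

/-- `f` is the analytic continuation of `ζ ↦ g (Qs * exp (-ζ))`, where `g` is a germ at `Q = 0`:
the continuation starts at large positive `ζ` (that is, small `Q`), goes along the positive real
axis to a punctured neighbourhood of `ζ = 0`, turns there counterclockwise from direction `0` to
direction `θ`, and then goes to infinity along the ray of direction `θ`. Since `rayDomain θ ρ η`
is connected, `f` is uniquely determined on it by `g`. -/
def IsRayContinuation (g : ℂ → ℂ) (Qs : ℂ) (θ : ℝ) (f : ℂ → ℂ) : Prop :=
  (∃ ρ > 0, ∃ η > 0, AnalyticOnNhd ℂ f (rayDomain θ ρ η)) ∧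
    ∀ᶠ t : ℝ in atTop, f t = g (Qs * exp (-(t : ℂ)))

/-! ### Laplace and Borel transforms -/

/-- The integrand of the Laplace transform along the ray `ζ = t e^{iθ}`, `t > 0`. -/
def laplaceIntegrand (θ : ℝ) (f : ℂ → ℂ) (C : ℂ) (t : ℝ) : ℂ :=
  exp (-C * (t * exp (θ * I))) * f (t * exp (θ * I)) * exp (θ * I)

/-- The Laplace transform `∫_0^{e^{iθ}∞} e^{-Cζ} f(ζ) dζ`. -/
def laplace (θ : ℝ) (f : ℂ → ℂ) (C : ℂ) : ℂ := ∫ t in Ioi (0 : ℝ), laplaceIntegrand θ f C t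

/-- `A` is the Laplace transform of `f` along the direction `θ`, as an analytic function on
`Im C < 0`: for a function `f` of growth `O(|e^{-ζ/3}|)` at infinity the integral converges on
the half-plane `Re ((C + 1/3) e^{iθ}) > 0`, and `A` is its analytic continuation to `Im C < 0`. -/
structure IsLaplace (θ : ℝ) (f A : ℂ → ℂ) : Prop where
  analytic : DifferentiableOn ℂ A {C | C.im < 0}
  eq_laplace : ∀ C : ℂ, C.im < 0 → 0 < ((C + 1 / 3) * exp (θ * I)).re →
    IntegrableOn (laplaceIntegrand θ f C) (Ioi 0) ∧ A C = laplace θ f C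

/-- The formal series `∑ aₙ C^{-n-1/2}` is the inverse Borel transform of `f`, that is,
`f(ζ) = ∑ aₙ / Γ(n + 1/2) ζ^{n - 1/2}` near `ζ = 0`. -/
def IsInverseBorel (f : ℂ → ℂ) (a : ℕ → ℂ) : Prop :=
  ∀ᶠ ζ in 𝓝[slitPlane] (0 : ℂ),
    HasSum (fun n : ℕ => a n / Complex.Gamma (n + 1 / 2) * ζ ^ ((n : ℂ) - 1 / 2)) (f ζ)

/-- `A(C) ∼ ∑ aₙ C^{-n-1/2}` as `C → ∞` in `S`, in the sense of Poincaré. -/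
def HasAsymptoticExpansion (S : Set ℂ) (A : ℂ → ℂ) (a : ℕ → ℂ) : Prop :=
  ∀ N : ℕ, (fun C : ℂ => A C - ∑ n ∈ Finset.range N, a n * C ^ (-(n : ℂ) - 1 / 2))
    =O[Bornology.cobounded ℂ ⊓ 𝓟 S] fun C : ℂ => ‖C‖ ^ (-(N : ℝ) - 1 / 2)

end CoulombGas

end

/-! The cubic is a Chebyshev polynomial in disguise. With m = (z+1)/3 and s = (z²-z+1)^{1/2}/3, the
substitution w = m + 2sW gives Q = 2s³(T₃(W) + κ), where T₃(W) = 4W³ - 3W (`cubic_center_add`). The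
critical values are therefore 2s³(κ ± 1), and the roots are W = cosh of one third of arcosh x, x =
Q/(2s³) - κ, up to shifts of the argument by 2πi/3. Everything becomes explicit: ψ̂ is a constant
multiple of e^{-ζ} cos(α/3)/sin α with cos α = (1+κ)e^{-ζ} - κ (`Psi_rootGerm_eq_borelPsi`). The
reflection w ↦ 1-w exchanges z with 1-z, κ with -κ and Q_- with -Q_+, so φ̂ is minus the ψ̂ of 1-z,
and statements about I₁ and φ̂ are read off from those at 1-z.

The heart is the case of real z and -1 < C < -1/3. Let e(x) be the derivative of the largest root
W(x). The function x ↦ e(-x) continues to the upper half-plane (`upperSlope`), and Q^C times this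
function at Q-κ is integrable along every ray there, so that its integrals along arg Q = 0 and arg Q
= π agree (`integral_slopeIntegrand_zero_eq_pi`). The imaginary part of this one identity expresses
the Laplace transform of the germ along the negative ζ-axis as -2i sin(πC) I₁(C, 1-z), up to the
factor Q_-^C (`reflected_block_ofReal`). Its real part, combined with the densities of the two
monotone pieces of the segment, gives I₂(C, z) = I₁(C, z) - 2cos(πC) I₁(C, 1-z)
(`connection_ofReal`). Eliminating I₁(C, 1-z) produces the Stokes factor cos(πC)/(i sin(πC)) =
(1+q)/(1-q) with q = e^{-2πiC}; the same Laplace formula at 1-z is the representation of I₁.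

These identities spread to complex z and C by the identity theorem. For Re C < -1/3 and Im C < 0 the
integrand e^{-Cζ} times the germ decays in the whole sector between the directions π/2+ε and π, so
both Laplace integrals agree (`integral_ray_eq_laplaceNeg`). Turning the path vertically upwards at
ζ = -1 yields an integral that converges for every C with Im C < 0 (`laplaceLower`); it is the
required continuation. The germ grows like |e^{-ζ/3}| to the left, whence the shift C + 1/3. Its
singularities lie on or close to the imaginary axis, and κ, hence |z - 1/2|, has to be small in
terms of ε to keep them off the sectors in use.

The trans-series is the geometric series in q, |q| < 1. The powers ζ^{n-1/2} appear because √ζ times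
the germ is an even holomorphic function of √ζ (`evenGerm_neg`), and the Poincaré expansions follow
by Watson's lemma (`hasAsymptoticExpansion_of_isInverseBorel`). -/

noncomputable section

namespace CoulombGas

/-! ### Holomorphic parameter integrals and rotation of rays -/

/-- Only a local majorant of the integrand itself is required: Cauchy's estimate on small discs
turns it into a majorant of the derivative. All holomorphy statements for parameter integrals below
rest on this. -/
theorem differentiableOn_integral_of_locally_dominated {U : Set ℂ} (hU : IsOpen U)
    {μ : Measure ℝ} {F : ℂ → ℝ → ℂ}
    (hmeas : ∀ c ∈ U, AEStronglyMeasurable (F c) μ)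
    (hdiff : ∀ᵐ t ∂μ, DifferentiableOn ℂ (fun c => F c t) U)
    (hbound : ∀ c ∈ U, ∃ r > 0, ∃ b : ℝ → ℝ, Integrable b μ ∧
      ∀ᵐ t ∂μ, ∀ c' ∈ Metric.ball c r ∩ U, ‖F c' t‖ ≤ b t) :
    DifferentiableOn ℂ (fun c => ∫ t, F c t ∂μ) U := by
  intro c hc
  obtain ⟨r, hr, b, hb, hFb⟩ := hbound c hc
  obtain ⟨ρ, hρ, hρU⟩ := Metric.isOpen_iff.1 hU c hc
  set R := min r ρ with hR
  have hRpos : 0 < R := lt_min hr hρ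
  have hsub : Metric.ball c R ⊆ Metric.ball c r ∩ U := fun x hx =>
    ⟨Metric.ball_subset_ball (min_le_left _ _) hx,
      hρU (Metric.ball_subset_ball (min_le_right _ _) hx)⟩
  have hder : ∀ᵐ t ∂μ, ∀ x ∈ Metric.ball c (R / 2),
      HasDerivAt (fun c => F c t) (deriv (fun c => F c t) x) x := by
    filter_upwards [hdiff] with t ht x hx
    exact ((ht x (hsub (Metric.ball_subset_ball (by linarith) hx)).2).differentiableAt
      (hU.mem_nhds (hsub (Metric.ball_subset_ball (by linarith) hx)).2)).hasDerivAt
  have hdb : ∀ᵐ t ∂μ, ∀ x ∈ Metric.ball c (R / 2),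
      ‖deriv (fun c => F c t) x‖ ≤ b t / (R / 4) := by
    filter_upwards [hdiff, hFb] with t ht hbt x hx
    have hcb : Metric.closedBall x (R / 4) ⊆ Metric.ball c R := by
      intro y hy
      rw [Metric.mem_closedBall] at hy
      rw [Metric.mem_ball] at hx ⊢
      linarith [dist_triangle y x c]
    refine Complex.norm_deriv_le_of_forall_mem_sphere_norm_le (by positivity) ?_ ?_
    · refine DifferentiableOn.diffContOnCl ?_
      rw [closure_ball _ (by positivity)]
      exact ht.mono (hcb.trans fun y hy => (hsub hy).2)
    · intro y hy
      exact hbt y (hsub (hcb (Metric.sphere_subset_closedBall hy)))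
  -- The derivative is a pointwise limit of difference quotients with steps (R/2)/(n+1), each of
  -- them measurable in `t`.
  have hmeas' : AEStronglyMeasurable (fun t => deriv (fun c => F c t) c) μ := by
    have hseq : Tendsto (fun n : ℕ => (((R / 2) / ((n : ℝ) + 1) : ℝ) : ℂ)) atTop (𝓝[≠] 0) := by
      rw [tendsto_nhdsWithin_iff]
      constructor
      · have h1 : Tendsto (fun n : ℕ => (R / 2) / ((n : ℝ) + 1)) atTop (𝓝 0) := by
          simpa [div_eq_mul_inv] using
            (tendsto_one_div_add_atTop_nhds_zero_nat (𝕜 := ℝ)).const_mul (R / 2)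
        exact (Complex.continuous_ofReal.tendsto' 0 0 ofReal_zero).comp h1
      · filter_upwards with n
        have : (R / 2) / ((n : ℝ) + 1) ≠ 0 := by positivity
        exact ofReal_ne_zero.2 this
    refine aestronglyMeasurable_of_tendsto_ae (u := atTop)
      (f := fun (n : ℕ) t => ((((R / 2) / ((n : ℝ) + 1) : ℝ) : ℂ))⁻¹ *
        (F (c + (((R / 2) / ((n : ℝ) + 1) : ℝ) : ℂ)) t - F c t)) ?_ ?_
    · intro n
      refine (AEStronglyMeasurable.const_mul ?_ _)
      refine (hmeas _ (hsub ?_).2).sub (hmeas c hc)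
      rw [Metric.mem_ball, dist_eq_norm, add_sub_cancel_left, norm_real, Real.norm_of_nonneg
        (by positivity)]
      have : (R / 2) / ((n : ℝ) + 1) ≤ R / 2 :=
        div_le_self (by positivity) (by linarith [n.cast_nonneg (α := ℝ)])
      linarith
    · filter_upwards [hder] with t ht
      have := (ht c (Metric.mem_ball_self (by positivity))).tendsto_slope_zero.comp hseq
      simpa [smul_eq_mul, Function.comp_def] using this
  have hint : Integrable (F c) μ := hb.mono' (hmeas c hc) (by
    filter_upwards [hFb] with t ht using ht c ⟨Metric.mem_ball_self hr, hc⟩)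
  have := hasDerivAt_integral_of_dominated_loc_of_deriv_le (μ := μ) (F := F) (x₀ := c)
    (bound := fun t => b t / (R / 4)) (s := Metric.ball c (R / 2))
    (F' := fun x t => deriv (fun c => F c t) x)
    (Metric.ball_mem_nhds c (by positivity))
    (by filter_upwards [hU.mem_nhds hc] with x hx using hmeas x hx) hint hmeas' hdb
    (hb.div_const _) hder
  exact this.2.differentiableAt.differentiableWithinAt

/-- Change of variable `r = e^σ`. -/
theorem integral_comp_exp_mul_exp (f : ℝ → ℂ) :
    ∫ σ : ℝ, f (Real.exp σ) * Real.exp σ = ∫ r in Ioi (0 : ℝ), f r := by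
  have h := integral_image_eq_integral_abs_deriv_smul (s := univ) MeasurableSet.univ
    (fun x _ => (Real.hasDerivAt_exp x).hasDerivWithinAt) Real.exp_injective.injOn f
  rw [image_univ, Real.range_exp, setIntegral_univ] at h
  rw [h]
  congr 1 with σ
  rw [abs_of_pos (Real.exp_pos _), real_smul, mul_comm]

theorem integrable_comp_exp_mul_exp {f : ℝ → ℂ} (hf : IntegrableOn f (Ioi 0)) :
    Integrable fun σ : ℝ => f (Real.exp σ) * Real.exp σ := by
  have h := integrableOn_image_iff_integrableOn_abs_deriv_smul (s := univ) MeasurableSet.univ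
    (fun x _ => (Real.hasDerivAt_exp x).hasDerivWithinAt) Real.exp_injective.injOn f
  rw [image_univ, Real.range_exp, integrableOn_univ] at h
  refine (h.1 hf).congr (ae_of_all _ fun σ => ?_)
  simp only [abs_of_pos (Real.exp_pos _), real_smul, mul_comm]

/-- Rotation of a ray in a closed sector in which the integrand is holomorphic and dominated. -/
theorem integral_ray_eq_of_dominated {φ₁ φ₂ : ℝ} (h12 : φ₁ ≤ φ₂) {F : ℂ → ℂ} {g : ℝ → ℝ}
    (hF : ∀ r : ℝ, 0 < r → ∀ φ ∈ Icc φ₁ φ₂, DifferentiableAt ℂ F (r * exp (φ * I)))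
    (hg : IntegrableOn g (Ioi 0))
    (hb : ∀ r : ℝ, 0 < r → ∀ φ ∈ Icc φ₁ φ₂, ‖F (r * exp (φ * I))‖ ≤ g r)
    (h0 : Tendsto (fun r => r * g r) (𝓝[>] 0) (𝓝 0))
    (hinf : Tendsto (fun r => r * g r) atTop (𝓝 0)) :
    ∫ r in Ioi (0 : ℝ), F (r * exp (φ₁ * I)) * exp (φ₁ * I) =
      ∫ r in Ioi (0 : ℝ), F (r * exp (φ₂ * I)) * exp (φ₂ * I) := by
  -- In the coordinate log ζ the rays become horizontal lines and the sector a strip, so Cauchy's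
  -- theorem on the rectangles [-n, n] × [φ₁, φ₂] applies.
  set G : ℂ → ℂ := fun τ => F (exp τ) * exp τ with hG
  have hexp : ∀ (σ φ : ℝ), exp ((σ : ℂ) + φ * I) = (Real.exp σ : ℝ) * exp (φ * I) := by
    intro σ φ; rw [exp_add, ofReal_exp]
  have hline : ∀ φ : ℝ, (∫ r in Ioi (0 : ℝ), F (r * exp (φ * I)) * exp (φ * I)) =
      ∫ σ : ℝ, G (σ + φ * I) := by
    intro φ
    rw [← integral_comp_exp_mul_exp]
    congr 1 with σ
    simp only [hG, hexp]; ring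
  have hGb : ∀ (σ : ℝ), ∀ φ ∈ Icc φ₁ φ₂, ‖G (σ + φ * I)‖ ≤ Real.exp σ * g (Real.exp σ) := by
    intro σ φ hφ
    simp only [hG, hexp, norm_mul, norm_real, norm_exp_ofReal_mul_I, mul_one, Real.norm_eq_abs,
      abs_of_pos (Real.exp_pos σ)]
    rw [mul_comm]
    exact mul_le_mul_of_nonneg_left (hb _ (Real.exp_pos σ) φ hφ) (Real.exp_pos σ).le
  have hGd : ∀ (σ : ℝ), ∀ φ ∈ Icc φ₁ φ₂, DifferentiableAt ℂ G (σ + φ * I) := by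
    intro σ φ hφ
    refine DifferentiableAt.mul (DifferentiableAt.comp _ ?_ differentiable_exp.differentiableAt)
      differentiable_exp.differentiableAt
    rw [hexp]; exact hF _ (Real.exp_pos σ) φ hφ
  have hlimint : ∀ φ ∈ Icc φ₁ φ₂, Tendsto (fun n : ℕ => ∫ σ in (-(n : ℝ))..n, G (σ + φ * I)) atTop
      (𝓝 (∫ σ : ℝ, G (σ + φ * I))) := by
    intro φ hφ
    refine intervalIntegral_tendsto_integral ?_
      (tendsto_neg_atTop_atBot.comp tendsto_natCast_atTop_atTop) tendsto_natCast_atTop_atTop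
    have hgi : Integrable fun σ : ℝ => Real.exp σ * g (Real.exp σ) := by
      have := (integrable_comp_exp_mul_exp (f := fun r => ((g r : ℝ) : ℂ)) hg.ofReal).re
      refine this.congr (ae_of_all _ fun σ => ?_)
      simp [mul_comm, -ofReal_exp]
    refine hgi.mono' ?_ (ae_of_all _ fun σ => hGb σ φ hφ)
    refine Continuous.aestronglyMeasurable ?_
    rw [continuous_iff_continuousAt]
    intro σ
    exact ContinuousAt.comp (f := fun σ : ℝ => (σ : ℂ) + φ * I) (hGd σ φ hφ).continuousAt
      (by fun_prop)
  -- The vertical sides are arcs of radius e^{±n}; they vanish because r g(r) tends to 0 at both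
  -- ends.
  have hside : ∀ u : ℕ → ℝ, Tendsto (fun n => Real.exp (u n) * g (Real.exp (u n))) atTop (𝓝 0) →
      Tendsto (fun n => I • ∫ y in φ₁..φ₂, G ((u n : ℝ) + y * I)) atTop (𝓝 0) := by
    intro u hu
    refine squeeze_zero_norm (a := fun n => Real.exp (u n) * g (Real.exp (u n)) * |φ₂ - φ₁|)
      (fun n => ?_) (by simpa using hu.mul_const |φ₂ - φ₁|)
    rw [norm_smul, norm_I, one_mul]
    refine intervalIntegral.norm_integral_le_of_norm_le_const fun y hy => ?_
    rw [uIoc_of_le h12] at hy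
    exact hGb _ y ⟨hy.1.le, hy.2⟩
  have hrect : ∀ n : ℕ, (∫ σ in (-(n : ℝ))..n, G (σ + φ₁ * I)) -
      (∫ σ in (-(n : ℝ))..n, G (σ + φ₂ * I)) + I • (∫ y in φ₁..φ₂, G ((n : ℝ) + y * I)) -
      I • (∫ y in φ₁..φ₂, G ((-(n : ℝ) : ℝ) + y * I)) = 0 := by
    intro n
    have := Complex.integral_boundary_rect_eq_zero_of_differentiableOn G
      ((-(n : ℝ) : ℝ) + φ₁ * I) ((n : ℝ) + φ₂ * I) ?_
    · simpa using this
    · intro τ hτ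
      rw [mem_reProdIm] at hτ
      have him : τ.im ∈ Icc φ₁ φ₂ := by
        have := hτ.2
        simpa [uIcc_of_le h12] using this
      have := hGd τ.re τ.im him
      rw [re_add_im] at this
      exact this.differentiableWithinAt
  have hlim := (((hlimint φ₁ ⟨le_rfl, h12⟩).sub (hlimint φ₂ ⟨h12, le_rfl⟩)).add
    (hside (fun n => (n : ℝ)) (hinf.comp (Real.tendsto_exp_atTop.comp
      tendsto_natCast_atTop_atTop)))).sub
    (hside (fun n => -(n : ℝ)) (h0.comp (Real.tendsto_exp_atBot_nhdsGT.comp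
      (tendsto_neg_atTop_atBot.comp tendsto_natCast_atTop_atTop))))
  have h := tendsto_nhds_unique (hlim.congr hrect) tendsto_const_nhds
  rw [hline, hline]
  rw [add_zero, sub_zero, sub_eq_zero] at h
  exact h

/-! ### The principal square root -/

/-- The principal square root. -/
def csqrt (x : ℂ) : ℂ := x ^ (2⁻¹ : ℂ)

theorem csqrt_sq (x : ℂ) : csqrt x ^ 2 = x := by
  simp [csqrt]

theorem csqrt_ne_zero {x : ℂ} (hx : x ≠ 0) : csqrt x ≠ 0 := by
  intro h
  apply hx
  rw [← csqrt_sq x, h]; simp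

theorem norm_csqrt_sq (x : ℂ) : ‖csqrt x‖ ^ 2 = ‖x‖ := by
  rw [← norm_pow, csqrt_sq]

theorem csqrt_re_nonneg (x : ℂ) : 0 ≤ (csqrt x).re := by
  rw [csqrt, cpow_inv_two_re]; positivity

/-- Halving the argument sends the right half-plane into |arg| < π/4. A product of two such roots
therefore stays in the right half-plane, which fixes many signs below. -/
theorem abs_csqrt_im_lt_re {x : ℂ} (hx : 0 < x.re) : |(csqrt x).im| < (csqrt x).re := by
  rw [csqrt, cpow_inv_two_re, abs_cpow_inv_two_im]
  exact Real.sqrt_lt_sqrt (by linarith [re_le_norm x]) (by linarith)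

theorem csqrt_re_pos {x : ℂ} (hx : x ∈ slitPlane) : 0 < (csqrt x).re := by
  rw [csqrt, cpow_inv_two_re, Real.sqrt_pos]
  rw [mem_slitPlane_iff_not_le_zero] at hx
  have h := abs_re_le_norm x
  have h1 : -x.re ≤ ‖x‖ := (neg_le_abs _).trans h
  rcases h1.lt_or_eq with h2 | h2
  · linarith
  · exfalso
    apply hx
    have h3 : x.im = 0 := by
      have h4 := Complex.sq_norm_sub_sq_re x
      rw [← h2] at h4
      nlinarith
    rw [Complex.le_def]
    simp only [zero_re, zero_im]
    exact ⟨by linarith [norm_nonneg x], h3⟩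

theorem csqrt_im_nonneg {x : ℂ} (hx : 0 ≤ x.im) : 0 ≤ (csqrt x).im := by
  rw [csqrt, cpow_inv_two_im_eq_sqrt hx]; positivity

theorem eq_csqrt_of_sq_eq {v x : ℂ} (h : v ^ 2 = x) (hv : 0 < v.re) : v = csqrt x := by
  have h1 : v ^ 2 = csqrt x ^ 2 := by rw [h, csqrt_sq]
  rcases sq_eq_sq_iff_eq_or_eq_neg.1 h1 with h2 | h2
  · exact h2
  · have := csqrt_re_nonneg x
    rw [h2, neg_re] at hv
    linarith

theorem csqrt_ofReal {x : ℝ} (hx : 0 ≤ x) : csqrt x = (√x : ℝ) := by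
  rw [csqrt, Real.sqrt_eq_rpow, ofReal_cpow hx]; norm_num

theorem csqrt_neg_ofReal {x : ℝ} (hx : 0 ≤ x) : csqrt (-x) = I * (√x : ℝ) := by
  have hsq : ((√x : ℝ) : ℂ) ^ 2 = x := by
    rw [← ofReal_pow, Real.sq_sqrt hx]
  have h1 : csqrt (-x) ^ 2 = (I * (√x : ℝ)) ^ 2 := by
    rw [csqrt_sq, mul_pow, I_sq, hsq]; ring
  have him := csqrt_im_nonneg (x := -(x : ℂ)) (by simp)
  rcases sq_eq_sq_iff_eq_or_eq_neg.1 h1 with h2 | h2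
  · exact h2
  · rw [h2] at him ⊢
    have h3 : √x = 0 := by
      have h4 : (-(I * ((√x : ℝ) : ℂ))).im = -√x := by simp
      rw [h4] at him
      linarith [Real.sqrt_nonneg x]
    simp [h3]

theorem csqrt_ofReal_mul {r : ℝ} (hr : 0 < r) (x : ℂ) : csqrt (r * x) = (√r : ℝ) * csqrt x := by
  rcases eq_or_ne x 0 with rfl | hx
  · simp [csqrt]
  rw [← csqrt_ofReal hr.le, csqrt, csqrt, csqrt, cpow_def_of_ne_zero (by
    simp [hr.ne', hx]), cpow_def_of_ne_zero (by simp [hr.ne']), cpow_def_of_ne_zero hx, ← exp_add,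
    log_ofReal_mul hr hx, ofReal_log hr.le]
  ring_nf

theorem csqrt_mul_ofReal {r : ℝ} (hr : 0 < r) (x : ℂ) : csqrt (x * r) = csqrt x * (√r : ℝ) := by
  rw [mul_comm, csqrt_ofReal_mul hr, mul_comm]

theorem differentiableAt_csqrt {x : ℂ} (hx : x ∈ slitPlane) : DifferentiableAt ℂ csqrt x :=
  DifferentiableAt.cpow differentiableAt_id (differentiableAt_const _) hx

/-- The principal argument takes the value π on the negative axis, its limit from above, so the root
is continuous up to the boundary of the upper half-plane. -/
theorem continuousWithinAt_csqrt (x : ℂ) : ContinuousWithinAt csqrt {y | 0 ≤ y.im} x := by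
  by_cases hx : x ∈ slitPlane
  · exact (differentiableAt_csqrt hx).continuousAt.continuousWithinAt
  rcases eq_or_ne x 0 with rfl | h0
  · refine ContinuousAt.continuousWithinAt ?_
    refine continuousAt_cpow_const_of_re_pos (Or.inl (by simp)) (by norm_num)
  · rw [mem_slitPlane_iff, not_or, not_lt, not_not] at hx
    have hre : x.re < 0 := lt_of_le_of_ne hx.1 fun h => h0 (Complex.ext h hx.2)
    have hlog := continuousWithinAt_log_of_re_neg_of_im_zero hre hx.2
    have h1 : ContinuousWithinAt (fun y => exp (log y * 2⁻¹)) {y : ℂ | 0 ≤ y.im} x :=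
      (hlog.mul continuousWithinAt_const).cexp
    refine h1.congr_of_eventuallyEq ?_ (by rw [csqrt, cpow_def_of_ne_zero h0])
    have : ∀ᶠ y in 𝓝 x, y ≠ 0 := isOpen_ne.mem_nhds h0
    filter_upwards [nhdsWithin_le_nhds this] with y hy
    rw [csqrt, cpow_def_of_ne_zero hy]

/-! ### Elementary bounds for hyperbolic functions and one third of a logarithm -/

theorem norm_cosh_le_exp_abs_re (w : ℂ) : ‖cosh w‖ ≤ Real.exp |w.re| := by
  have h : cosh w = (exp w + exp (-w)) / 2 := rfl
  rw [h, norm_div, norm_ofNat]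
  have h1 : ‖exp w‖ ≤ Real.exp |w.re| := by
    rw [norm_exp]; exact Real.exp_le_exp.2 (le_abs_self _)
  have h2 : ‖exp (-w)‖ ≤ Real.exp |w.re| := by
    rw [norm_exp]; exact Real.exp_le_exp.2 (by simpa using neg_le_abs w.re)
  linarith [norm_add_le (exp w) (exp (-w))]

theorem norm_sinh_le_exp_abs_re (w : ℂ) : ‖sinh w‖ ≤ Real.exp |w.re| := by
  have h : sinh w = (exp w - exp (-w)) / 2 := rfl
  rw [h, norm_div, norm_ofNat]
  have h1 : ‖exp w‖ ≤ Real.exp |w.re| := by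
    rw [norm_exp]; exact Real.exp_le_exp.2 (le_abs_self _)
  have h2 : ‖exp (-w)‖ ≤ Real.exp |w.re| := by
    rw [norm_exp]; exact Real.exp_le_exp.2 (by simpa using neg_le_abs w.re)
  linarith [norm_sub_le (exp w) (exp (-w))]

theorem exp_abs_log_div_three_le {y b : ℝ} (h1 : 1 / 4 ≤ y) (h2 : y ≤ 4) :
    Real.exp ((|Real.log y| + b) / 3) ≤ 2 * Real.exp (b / 3) := by
  have hlog4 : Real.log 4 = 2 * Real.log 2 := by
    rw [show (4 : ℝ) = 2 ^ 2 by norm_num, Real.log_pow]; norm_num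
  have hl2 : 0 < Real.log 2 := Real.log_pos (by norm_num)
  have h3 : |Real.log y| ≤ Real.log 4 := by
    rw [abs_le]
    constructor
    · rw [← Real.log_inv]
      exact Real.log_le_log (by norm_num) (by linarith)
    · exact Real.log_le_log (by linarith) h2
  calc Real.exp ((|Real.log y| + b) / 3) ≤ Real.exp (Real.log 2 + b / 3) := by
        apply Real.exp_le_exp.2; linarith
    _ = 2 * Real.exp (b / 3) := by rw [Real.exp_add, Real.exp_log (by norm_num)]

theorem div_one_add_le_one_sub_exp_neg {a : ℝ} (ha : 0 ≤ a) : a / (1 + a) ≤ 1 - Real.exp (-a) := by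
  have h1 : Real.exp (-a) ≤ 1 / (1 + a) := by
    rw [Real.exp_neg, ← one_div]
    exact one_div_le_one_div_of_le (by linarith) (by linarith [Real.add_one_le_exp a])
  have h2 : a / (1 + a) = 1 - 1 / (1 + a) := by field_simp; ring
  linarith

/-- If `σ² ≥ d a / (1 + a)` then `1 / σ ≤ d^{-1/2} (1 + a^{-1/2})`. -/
theorem inv_le_of_sq_ge {a d σ : ℝ} (ha : 0 < a) (hd : 0 < d) (hσ : 0 ≤ σ)
    (h : d * (a / (1 + a)) ≤ σ ^ 2) : σ⁻¹ ≤ (√d)⁻¹ * (1 + a ^ (-(1 / 2) : ℝ)) := by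
  have hq : 0 < a ^ (-(1 / 2) : ℝ) := Real.rpow_pos_of_pos ha _
  have hq2 : (a ^ (-(1 / 2) : ℝ)) ^ 2 = a⁻¹ := by
    rw [← Real.rpow_natCast, ← Real.rpow_mul ha.le]
    norm_num [Real.rpow_neg_one]
  have hσ0 : 0 < σ := by
    rcases hσ.lt_or_eq with h0 | h0
    · exact h0
    · exfalso
      rw [← h0] at h
      have : 0 < d * (a / (1 + a)) := by positivity
      norm_num at h
      linarith
  refine (abs_le_of_sq_le_sq' ?_ (by positivity)).2
  rw [mul_pow, inv_pow, inv_pow, Real.sq_sqrt hd.le]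
  have h1 : (σ ^ 2)⁻¹ ≤ (d * (a / (1 + a)))⁻¹ := inv_anti₀ (by positivity) h
  have h2 : (d * (a / (1 + a)))⁻¹ = d⁻¹ * (1 + a⁻¹) := by field_simp; ring
  rw [h2] at h1
  refine h1.trans (mul_le_mul_of_nonneg_left ?_ (by positivity))
  nlinarith

/-! ### The Borel germ to the left of the origin -/

/-- The square root of `1 - x²`, up to the factor `i e^ζ`, for `x = (1 + κ) e^{-ζ} - κ`. -/
def outerSqrt (κ ζ : ℂ) : ℂ :=
  csqrt (1 + κ) * csqrt (1 - exp ζ) * csqrt (1 + κ + (1 - κ) * exp ζ)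

/-- This is e^ζ e^{-iα}. The factor e^ζ compensates the growth of x as Re ζ → -∞, so the quantity
stays in a compact part of the right half-plane and its principal logarithm minus ζ is -iα without
jumps. -/
def outerExp (κ ζ : ℂ) : ℂ := 1 + κ - κ * exp ζ + outerSqrt κ ζ

/-- The Borel germ `e^{-ζ} cos (α/3) / sin α`, `cos α = (1 + κ) e^{-ζ} - κ`, in the left
half-plane. -/
def outerGerm (κ ζ : ℂ) : ℂ := -I * cosh ((log (outerExp κ ζ) - ζ) / 3) / outerSqrt κ ζ

/-- The last factor of `outerSqrt` is (1 + e^ζ) + κ(1 - e^ζ), whose zeros lie near the odd multiples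
of πi. The second condition keeps away from them with a margin that survives 8‖κ‖ ≤ c. -/
def outerRegion (c : ℝ) : Set ℂ := {ζ | ζ.re < 0 ∧ c < (1 + exp ζ).re}

theorem isOpen_outerRegion (c : ℝ) : IsOpen (outerRegion c) := by
  refine IsOpen.inter (isOpen_lt continuous_re continuous_const) ?_
  exact isOpen_lt continuous_const (continuous_re.comp (by fun_prop))

section outer

variable {c : ℝ} {κ ζ : ℂ}

theorem norm_exp_lt_one (hζ : ζ.re < 0) : ‖exp ζ‖ < 1 := by
  rw [norm_exp]; exact (Real.exp_lt_exp.2 hζ).trans_eq Real.exp_zero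

theorem one_sub_exp_re_pos (hζ : ζ.re < 0) : 0 < (1 - exp ζ).re := by
  rw [sub_re, one_re]
  linarith [re_le_norm (exp ζ), norm_exp_lt_one hζ]

theorem one_add_re_pos (hκ : 8 * ‖κ‖ ≤ 1) : 7 / 8 ≤ (1 + κ).re := by
  rw [add_re, one_re]
  linarith [(abs_le.1 (abs_re_le_norm κ)).1]

theorem outer_third_re (hκ : 8 * ‖κ‖ ≤ c) (hζ : ζ ∈ outerRegion c) :
    3 * c / 4 ≤ (1 + κ + (1 - κ) * exp ζ).re := by
  have h1 : 1 + κ + (1 - κ) * exp ζ = (1 + exp ζ) + κ * (1 - exp ζ) := by ring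
  rw [h1, add_re]
  have h2 : ‖κ * (1 - exp ζ)‖ ≤ ‖κ‖ * 2 := by
    rw [norm_mul]
    refine mul_le_mul_of_nonneg_left ?_ (norm_nonneg _)
    have := norm_sub_le 1 (exp ζ)
    rw [norm_one] at this
    linarith [norm_exp_lt_one hζ.1]
  have h3 := (abs_le.1 (abs_re_le_norm (κ * (1 - exp ζ)))).1
  linarith [hζ.2]

theorem outer_third_norm (hκ : 8 * ‖κ‖ ≤ 1) (hζ : ζ.re < 0) :
    ‖1 + κ + (1 - κ) * exp ζ‖ ≤ 9 / 4 := by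
  have h1 := norm_add_le (1 + κ) ((1 - κ) * exp ζ)
  have h2 := norm_add_le 1 κ
  have h3 := norm_sub_le 1 κ
  rw [norm_mul] at h1
  rw [norm_one] at h2 h3
  have h4 := norm_exp_lt_one hζ
  nlinarith [norm_nonneg (1 - κ), norm_nonneg (exp ζ), norm_nonneg κ]

theorem norm_outerSqrt_sq : ‖outerSqrt κ ζ‖ ^ 2 =
    ‖1 + κ‖ * ‖1 - exp ζ‖ * ‖1 + κ + (1 - κ) * exp ζ‖ := by
  rw [outerSqrt, norm_mul, norm_mul, mul_pow, mul_pow, norm_csqrt_sq, norm_csqrt_sq, norm_csqrt_sq]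

theorem norm_outerSqrt_le (hκ : 8 * ‖κ‖ ≤ 1) (hζ : ζ.re < 0) : ‖outerSqrt κ ζ‖ ≤ 9 / 4 := by
  refine (abs_le_of_sq_le_sq' ?_ (by norm_num)).2
  rw [norm_outerSqrt_sq]
  have h1 : ‖1 + κ‖ ≤ 9 / 8 := by
    have := norm_add_le 1 κ
    rw [norm_one] at this
    linarith
  have h2 : ‖1 - exp ζ‖ ≤ 2 := by
    have := norm_sub_le 1 (exp ζ)
    rw [norm_one] at this
    linarith [norm_exp_lt_one hζ]
  calc ‖1 + κ‖ * ‖1 - exp ζ‖ * ‖1 + κ + (1 - κ) * exp ζ‖ ≤ 9 / 8 * 2 * (9 / 4) := by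
        gcongr
        exact outer_third_norm hκ hζ
    _ ≤ (9 / 4) ^ 2 := by norm_num

/-- The product ab of the two roots has positive real part, since both arguments are below π/4.
Replacing √(1+κ) by 1 and dropping κ(1 - e^ζ) costs at most (9/4 + 2)‖κ‖ ≤ 17/32, so the leading 1
keeps the real part above 1/4. -/
theorem outerExp_re (hc : c ≤ 1) (hc0 : 0 < c) (hκ : 8 * ‖κ‖ ≤ c) (hζ : ζ ∈ outerRegion c) :
    1 / 4 ≤ (outerExp κ ζ).re := by
  have hκ1 : 8 * ‖κ‖ ≤ 1 := hκ.trans hc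
  set a := csqrt (1 - exp ζ)
  set b := csqrt (1 + κ + (1 - κ) * exp ζ)
  set d := csqrt (1 + κ)
  have ha : |a.im| < a.re := abs_csqrt_im_lt_re (one_sub_exp_re_pos hζ.1)
  have hb : |b.im| < b.re := abs_csqrt_im_lt_re
    (lt_of_lt_of_le (by linarith) (outer_third_re hκ hζ))
  have hab : 0 < (a * b).re := by
    rw [mul_re]
    have := abs_mul a.im b.im
    have h1 : |a.im * b.im| < a.re * b.re := by
      rw [abs_mul]
      exact mul_lt_mul'' ha hb (abs_nonneg _) (abs_nonneg _)
    linarith [le_abs_self (a.im * b.im)]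
  have hd : ‖d - 1‖ ≤ ‖κ‖ := by
    have h1 : (d - 1) * (d + 1) = κ := by
      have := csqrt_sq (1 + κ)
      linear_combination this
    have h2 : 1 ≤ ‖d + 1‖ := by
      refine le_trans ?_ (re_le_norm _)
      rw [add_re, one_re]
      linarith [csqrt_re_nonneg (1 + κ)]
    rw [← h1, norm_mul]
    exact le_mul_of_one_le_right (norm_nonneg _) h2
  have hab2 : ‖a * b‖ ≤ 9 / 4 := by
    refine (abs_le_of_sq_le_sq' ?_ (by norm_num)).2
    rw [norm_mul, mul_pow, norm_csqrt_sq, norm_csqrt_sq]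
    have h2 : ‖1 - exp ζ‖ ≤ 2 := by
      have := norm_sub_le 1 (exp ζ)
      rw [norm_one] at this
      linarith [norm_exp_lt_one hζ.1]
    nlinarith [outer_third_norm hκ1 hζ.1, norm_nonneg (1 - exp ζ),
      norm_nonneg (1 + κ + (1 - κ) * exp ζ)]
  have hS : outerSqrt κ ζ = a * b + (d - 1) * (a * b) := by
    rw [outerSqrt]; ring
  have h1 : ‖(d - 1) * (a * b)‖ ≤ ‖κ‖ * (9 / 4) := by
    rw [norm_mul]; gcongr
  have h2 := (abs_le.1 (abs_re_le_norm ((d - 1) * (a * b)))).1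
  have h3 : ‖κ * (1 - exp ζ)‖ ≤ ‖κ‖ * 2 := by
    rw [norm_mul]
    refine mul_le_mul_of_nonneg_left ?_ (norm_nonneg _)
    have := norm_sub_le 1 (exp ζ)
    rw [norm_one] at this
    linarith [norm_exp_lt_one hζ.1]
  have h4 := (abs_le.1 (abs_re_le_norm (κ * (1 - exp ζ)))).1
  have h5 : outerExp κ ζ = 1 + κ * (1 - exp ζ) + (a * b + (d - 1) * (a * b)) := by
    rw [outerExp, hS]; ring
  rw [h5, add_re, add_re, add_re, one_re]
  linarith

theorem norm_outerExp_le (hκ : 8 * ‖κ‖ ≤ 1) (hζ : ζ.re < 0) : ‖outerExp κ ζ‖ ≤ 4 := by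
  have h3 : ‖κ * (1 - exp ζ)‖ ≤ ‖κ‖ * 2 := by
    rw [norm_mul]
    refine mul_le_mul_of_nonneg_left ?_ (norm_nonneg _)
    have := norm_sub_le 1 (exp ζ)
    rw [norm_one] at this
    linarith [norm_exp_lt_one hζ]
  have h5 : outerExp κ ζ = 1 + κ * (1 - exp ζ) + outerSqrt κ ζ := by
    rw [outerExp]; ring
  rw [h5]
  have := norm_add₃_le (a := 1) (b := κ * (1 - exp ζ)) (c := outerSqrt κ ζ)
  rw [norm_one] at this
  linarith [norm_outerSqrt_le hκ hζ]

theorem outerSqrt_ne_zero (hc : c ≤ 1) (hc0 : 0 < c) (hκ : 8 * ‖κ‖ ≤ c)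
    (hζ : ζ ∈ outerRegion c) : outerSqrt κ ζ ≠ 0 := by
  refine mul_ne_zero (mul_ne_zero (csqrt_ne_zero ?_) (csqrt_ne_zero ?_)) (csqrt_ne_zero ?_)
  · exact fun h => absurd (one_add_re_pos (hκ.trans hc)) (by rw [h]; norm_num)
  · exact fun h => absurd (one_sub_exp_re_pos hζ.1) (by rw [h]; norm_num)
  · intro h
    have := outer_third_re hκ hζ
    rw [h, zero_re] at this
    linarith

theorem outerExp_mem_slitPlane (hc : c ≤ 1) (hc0 : 0 < c) (hκ : 8 * ‖κ‖ ≤ c)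
    (hζ : ζ ∈ outerRegion c) : outerExp κ ζ ∈ slitPlane :=
  Or.inl (by linarith [outerExp_re hc hc0 hκ hζ])

/-- Joint holomorphy in κ and ζ is needed because the identity theorem is used in z as well as along
the path of ζ. -/
theorem differentiableAt_outerGerm (hc : c ≤ 1) (hc0 : 0 < c) (hκ : 8 * ‖κ‖ ≤ c)
    (hζ : ζ ∈ outerRegion c) :
    DifferentiableAt ℂ (fun p : ℂ × ℂ => outerGerm p.1 p.2) (κ, ζ) := by
  have hS : DifferentiableAt ℂ (fun p : ℂ × ℂ => outerSqrt p.1 p.2) (κ, ζ) := by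
    refine DifferentiableAt.mul (DifferentiableAt.mul ?_ ?_) ?_
    · exact DifferentiableAt.comp (g := csqrt) (f := fun p : ℂ × ℂ => 1 + p.1) (κ, ζ)
        (differentiableAt_csqrt (Or.inl (by linarith [one_add_re_pos (hκ.trans hc)])))
        (by fun_prop)
    · exact DifferentiableAt.comp (g := csqrt) (f := fun p : ℂ × ℂ => 1 - exp p.2) (κ, ζ)
        (differentiableAt_csqrt (Or.inl (one_sub_exp_re_pos hζ.1))) (by fun_prop)
    · exact DifferentiableAt.comp (g := csqrt)
        (f := fun p : ℂ × ℂ => 1 + p.1 + (1 - p.1) * exp p.2) (κ, ζ)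
        (differentiableAt_csqrt (Or.inl (by linarith [outer_third_re hκ hζ]))) (by fun_prop)
  have hY : DifferentiableAt ℂ (fun p : ℂ × ℂ => outerExp p.1 p.2) (κ, ζ) :=
    DifferentiableAt.add (by fun_prop) hS
  have hlog : DifferentiableAt ℂ (fun p : ℂ × ℂ => log (outerExp p.1 p.2)) (κ, ζ) :=
    hY.clog (outerExp_mem_slitPlane hc hc0 hκ hζ)
  have harg : DifferentiableAt ℂ (fun p : ℂ × ℂ => (log (outerExp p.1 p.2) - p.2) / 3) (κ, ζ) :=
    (hlog.fun_sub differentiableAt_snd).mul_const 3⁻¹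
  have hcosh : DifferentiableAt ℂ
      (fun p : ℂ × ℂ => -I * cosh ((log (outerExp p.1 p.2) - p.2) / 3)) (κ, ζ) :=
    (differentiable_cosh.differentiableAt.comp (κ, ζ) harg).const_mul (-I)
  have hinv : DifferentiableAt ℂ (fun p : ℂ × ℂ => (outerSqrt p.1 p.2)⁻¹) (κ, ζ) :=
    hS.inv (outerSqrt_ne_zero hc hc0 hκ hζ)
  exact hcosh.mul hinv

/-- The exponential is the growth of cos(α/3) when |Im α| is about -Re ζ; the power -1/2 is the
branch point of sin α at ζ = 0. The first factor is the origin of the 1/3 in the half-planes of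
convergence. -/
theorem norm_outerGerm_le (hc : c ≤ 1) (hc0 : 0 < c) (hκ : 8 * ‖κ‖ ≤ c)
    (hζ : ζ ∈ outerRegion c) :
    ‖outerGerm κ ζ‖ ≤ 2 * (√(c / 2))⁻¹ *
      (Real.exp (-ζ.re / 3) * (1 + (-ζ.re) ^ (-(1 / 2) : ℝ))) := by
  set a := -ζ.re with ha
  have ha0 : 0 < a := by linarith [hζ.1]
  have hκ1 : 8 * ‖κ‖ ≤ 1 := hκ.trans hc
  rw [outerGerm, norm_div, norm_mul, norm_neg, norm_I, one_mul, div_eq_mul_inv]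
  have h1 : ‖cosh ((log (outerExp κ ζ) - ζ) / 3)‖ ≤ 2 * Real.exp (a / 3) := by
    refine (norm_cosh_le_exp_abs_re _).trans ?_
    refine le_trans (Real.exp_le_exp.2 ?_) (exp_abs_log_div_three_le
      ((outerExp_re hc hc0 hκ hζ).trans (re_le_norm _)) (norm_outerExp_le hκ1 hζ.1))
    rw [div_ofNat_re, sub_re, log_re, abs_div, sub_eq_add_neg, ← ha]
    norm_num
    gcongr
    exact (abs_add_le _ _).trans (by rw [abs_of_pos ha0])
  have h2 : ‖outerSqrt κ ζ‖⁻¹ ≤ (√(c / 2))⁻¹ * (1 + a ^ (-(1 / 2) : ℝ)) := by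
    refine inv_le_of_sq_ge ha0 (by linarith) (norm_nonneg _) ?_
    rw [norm_outerSqrt_sq]
    have e1 : 7 / 8 ≤ ‖1 + κ‖ := (one_add_re_pos hκ1).trans (re_le_norm _)
    have e2 : a / (1 + a) ≤ ‖1 - exp ζ‖ := by
      refine (div_one_add_le_one_sub_exp_neg ha0.le).trans ?_
      rw [ha, neg_neg, ← norm_exp, ← norm_one (α := ℂ)]
      exact norm_sub_norm_le _ _
    have e3 : 3 * c / 4 ≤ ‖1 + κ + (1 - κ) * exp ζ‖ :=
      (outer_third_re hκ hζ).trans (re_le_norm _)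
    have e4 : 0 < a / (1 + a) := by positivity
    calc c / 2 * (a / (1 + a)) ≤ 7 / 8 * (a / (1 + a)) * (3 * c / 4) := by nlinarith
      _ ≤ _ := by gcongr
  calc _ ≤ 2 * Real.exp (a / 3) * ((√(c / 2))⁻¹ * (1 + a ^ (-(1 / 2) : ℝ))) := by gcongr
    _ = _ := by ring

end outer

/-- Sectors in the left half-plane lie in an outer region. -/
theorem mem_outerRegion_of_sector {k : ℝ} (hk : 0 < k) (hk1 : k ≤ 1) {ζ : ℂ}
    (hζ : ζ.re < 0) (h : ‖ζ‖ * k ≤ -ζ.re) : ζ ∈ outerRegion (k / 4) := by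
  refine ⟨hζ, ?_⟩
  set a := -ζ.re with ha
  have ha0 : 0 < a := by linarith
  rw [add_re, one_re]
  -- Close to the imaginary axis the sector forces |Im ζ| ≤ 1, so Re e^ζ ≥ 0. Otherwise |e^ζ| =
  -- e^{-a} is bounded away from 1 by a/(1+a) > k/(1+k) ≥ k/2.
  by_cases hak : a ≤ k
  · have h1 : |ζ.im| ≤ 1 := by
      refine (abs_im_le_norm ζ).trans ?_
      by_contra hcon
      rw [not_le] at hcon
      nlinarith
    have h2 : 0 ≤ (exp ζ).re := by
      rw [exp_re]
      refine mul_nonneg (Real.exp_pos _).le (Real.cos_nonneg_of_mem_Icc ?_)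
      constructor <;> linarith [abs_le.1 h1, Real.pi_gt_three]
    linarith
  · have h1 := div_one_add_le_one_sub_exp_neg ha0.le
    have h2 : -Real.exp (-a) ≤ (exp ζ).re := by
      rw [ha, neg_neg, ← norm_exp]
      exact (abs_le.1 (abs_re_le_norm _)).1
    have h3 : k / 4 < a / (1 + a) := by
      rw [lt_div_iff₀ (by linarith)]
      nlinarith
    linarith

theorem mem_outerRegion_of_re_le {c : ℝ} (hc : c ≤ 1 / 4) {ζ : ℂ} (h : ζ.re ≤ -(1 / 2)) :
    ζ ∈ outerRegion c := by
  refine ⟨by linarith, ?_⟩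
  have h1 := div_one_add_le_one_sub_exp_neg (a := -ζ.re) (by linarith)
  have h2 : -Real.exp (-(-ζ.re)) ≤ (exp ζ).re := by
    rw [neg_neg, ← norm_exp]
    exact (abs_le.1 (abs_re_le_norm _)).1
  have h3 : 1 / 4 < -ζ.re / (1 + -ζ.re) := by
    rw [lt_div_iff₀ (by linarith)]
    linarith
  rw [add_re, one_re]
  linarith

theorem mem_outerRegion_of_norm_lt {c : ℝ} (hc : c ≤ 1 / 4) {ζ : ℂ} (h : ‖ζ‖ < 1)
    (hζ : ζ.re < 0) : ζ ∈ outerRegion c := by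
  refine ⟨hζ, ?_⟩
  have h2 : 0 ≤ (exp ζ).re := by
    rw [exp_re]
    refine mul_nonneg (Real.exp_pos _).le (Real.cos_nonneg_of_mem_Icc ?_)
    have := abs_le.1 (abs_im_le_norm ζ)
    constructor <;> linarith [Real.pi_gt_three]
  rw [add_re, one_re]
  linarith

/-! ### The Borel germ near the origin and to the right of it -/

/-- The square root of `1 - x²` for `x = (1 + κ) e^{-ζ} - κ`. -/
def innerSqrt (κ ζ : ℂ) : ℂ :=
  csqrt (1 + κ) * csqrt (1 - exp (-ζ)) * csqrt (1 - κ + (1 + κ) * exp (-ζ))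

def innerExp (κ ζ : ℂ) : ℂ := (1 + κ) * exp (-ζ) - κ - I * innerSqrt κ ζ

/-- The Borel germ `e^{-ζ} cos (α/3) / sin α`, `cos α = (1 + κ) e^{-ζ} - κ`, near the origin and
in the right half-plane. -/
def innerGerm (κ ζ : ℂ) : ℂ := exp (-ζ) * cosh (log (innerExp κ ζ) / 3) / innerSqrt κ ζ

/-- The first two conditions keep the nonconstant factors of `innerSqrt` off the cut once κ is
small. The bound 3 exceeds e, which leaves room for the whole slit unit disc. -/
def innerRegion (c : ℝ) : Set ℂ :=
  {ζ | 1 - exp (-ζ) ∈ slitPlane ∧ c < (1 + exp (-ζ)).re ∧ ‖exp (-ζ)‖ < 3}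

theorem isOpen_innerRegion (c : ℝ) : IsOpen (innerRegion c) := by
  refine IsOpen.inter (isOpen_slitPlane.preimage (by fun_prop)) (IsOpen.inter ?_ ?_)
  · exact isOpen_lt continuous_const (continuous_re.comp (by fun_prop))
  · exact isOpen_lt (continuous_norm.comp (by fun_prop)) continuous_const

/-- `x - i √(1 - x²)` avoids the negative axis unless `x ≤ -1`. -/
theorem sub_I_mul_mem_slitPlane {x σ : ℂ} (hσ : σ ^ 2 = (1 - x) * (1 + x))
    (hx : 1 + x ∈ slitPlane) : x - I * σ ∈ slitPlane := by
  have h1 : (x - I * σ) * (x + I * σ) = 1 := by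
    linear_combination -σ ^ 2 * I_sq + hσ
  by_contra hcon
  rw [mem_slitPlane_iff_not_le_zero, not_not] at hcon
  rw [Complex.le_def] at hcon
  set r := (x - I * σ).re with hr
  have hX : x - I * σ = (r : ℂ) := Complex.ext (by simp [hr]) (by simpa using hcon.2)
  have hr0 : r ≤ 0 := by simpa using hcon.1
  have hrne : r ≠ 0 := by
    intro h0
    rw [hX, h0] at h1
    simp at h1
  -- If one of the two inverse numbers x ∓ iσ were r < 0, then x = (r + 1/r)/2, and this is at most
  -- -1 for negative r.
  have hXi : x + I * σ = ((r⁻¹ : ℝ) : ℂ) := by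
    rw [hX] at h1
    rw [ofReal_inv]
    exact eq_inv_of_mul_eq_one_right h1
  have hxr : x = (((r + r⁻¹) / 2 : ℝ) : ℂ) := by
    push_cast
    push_cast at hXi
    linear_combination (hX + hXi) / 2
  have hle : 1 + (r + r⁻¹) / 2 ≤ 0 := by
    have hr1 : r < 0 := lt_of_le_of_ne hr0 hrne
    have : 1 + (r + r⁻¹) / 2 = (r + 1) ^ 2 / (2 * r) := by field_simp; ring
    rw [this]
    exact div_nonpos_of_nonneg_of_nonpos (sq_nonneg _) (by linarith)
  rw [mem_slitPlane_iff_not_le_zero] at hx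
  apply hx
  rw [hxr]
  have : (1 : ℂ) + (((r + r⁻¹) / 2 : ℝ) : ℂ) = ((1 + (r + r⁻¹) / 2 : ℝ) : ℂ) := by push_cast; ring
  rw [this]
  exact_mod_cast hle

section inner

variable {c : ℝ} {κ ζ : ℂ}

theorem innerSqrt_sq : innerSqrt κ ζ ^ 2 =
    (1 + κ) * (1 - exp (-ζ)) * (1 - κ + (1 + κ) * exp (-ζ)) := by
  rw [innerSqrt, mul_pow, mul_pow, csqrt_sq, csqrt_sq, csqrt_sq]

theorem innerExp_mul : innerExp κ ζ * ((1 + κ) * exp (-ζ) - κ + I * innerSqrt κ ζ) = 1 := by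
  rw [innerExp]
  linear_combination -innerSqrt κ ζ ^ 2 * I_sq + innerSqrt_sq (κ := κ) (ζ := ζ)

theorem inner_third_re (hκ : 8 * ‖κ‖ ≤ c) (hζ : ζ ∈ innerRegion c) :
    c / 2 ≤ (1 - κ + (1 + κ) * exp (-ζ)).re := by
  have h1 : 1 - κ + (1 + κ) * exp (-ζ) = (1 + exp (-ζ)) - κ * (1 - exp (-ζ)) := by ring
  rw [h1, sub_re]
  have h2 : ‖κ * (1 - exp (-ζ))‖ ≤ ‖κ‖ * 4 := by
    rw [norm_mul]
    refine mul_le_mul_of_nonneg_left ?_ (norm_nonneg _)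
    have := norm_sub_le 1 (exp (-ζ))
    rw [norm_one] at this
    linarith [hζ.2.2]
  have h3 := (abs_le.1 (abs_re_le_norm (κ * (1 - exp (-ζ))))).2
  linarith [hζ.2.1]

theorem innerSqrt_ne_zero (hc : c ≤ 1) (hc0 : 0 < c) (hκ : 8 * ‖κ‖ ≤ c)
    (hζ : ζ ∈ innerRegion c) : innerSqrt κ ζ ≠ 0 := by
  refine mul_ne_zero (mul_ne_zero (csqrt_ne_zero ?_) (csqrt_ne_zero ?_)) (csqrt_ne_zero ?_)
  · exact fun h => absurd (one_add_re_pos (hκ.trans hc)) (by rw [h]; norm_num)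
  · exact slitPlane_ne_zero hζ.1
  · intro h
    have := inner_third_re hκ hζ
    rw [h, zero_re] at this
    linarith

theorem innerExp_mem_slitPlane (hc0 : 0 < c) (hκ : 8 * ‖κ‖ ≤ c)
    (hζ : ζ ∈ innerRegion c) : innerExp κ ζ ∈ slitPlane := by
  refine sub_I_mul_mem_slitPlane ?_ ?_
  · rw [innerSqrt_sq]; ring
  · have := inner_third_re hκ hζ
    refine Or.inl (lt_of_lt_of_le (half_pos hc0) (this.trans_eq ?_))
    congr 1; ring

theorem differentiableAt_innerGerm (hc : c ≤ 1) (hc0 : 0 < c) (hκ : 8 * ‖κ‖ ≤ c)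
    (hζ : ζ ∈ innerRegion c) :
    DifferentiableAt ℂ (fun p : ℂ × ℂ => innerGerm p.1 p.2) (κ, ζ) := by
  have hS : DifferentiableAt ℂ (fun p : ℂ × ℂ => innerSqrt p.1 p.2) (κ, ζ) := by
    refine DifferentiableAt.mul (DifferentiableAt.mul ?_ ?_) ?_
    · exact DifferentiableAt.comp (g := csqrt) (f := fun p : ℂ × ℂ => 1 + p.1) (κ, ζ)
        (differentiableAt_csqrt (Or.inl (by linarith [one_add_re_pos (hκ.trans hc)])))
        (by fun_prop)
    · exact DifferentiableAt.comp (g := csqrt) (f := fun p : ℂ × ℂ => 1 - exp (-p.2)) (κ, ζ)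
        (differentiableAt_csqrt hζ.1) (by fun_prop)
    · exact DifferentiableAt.comp (g := csqrt)
        (f := fun p : ℂ × ℂ => 1 - p.1 + (1 + p.1) * exp (-p.2)) (κ, ζ)
        (differentiableAt_csqrt (Or.inl (by linarith [inner_third_re hκ hζ]))) (by fun_prop)
  have hY : DifferentiableAt ℂ (fun p : ℂ × ℂ => innerExp p.1 p.2) (κ, ζ) :=
    DifferentiableAt.sub (by fun_prop) (hS.const_mul I)
  have hlog : DifferentiableAt ℂ (fun p : ℂ × ℂ => log (innerExp p.1 p.2)) (κ, ζ) :=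
    hY.clog (innerExp_mem_slitPlane hc0 hκ hζ)
  have he : DifferentiableAt ℂ (fun p : ℂ × ℂ => exp (-p.2)) (κ, ζ) := by fun_prop
  have harg : DifferentiableAt ℂ (fun p : ℂ × ℂ => log (innerExp p.1 p.2) / 3) (κ, ζ) :=
    hlog.mul_const 3⁻¹
  have hcosh : DifferentiableAt ℂ
      (fun p : ℂ × ℂ => exp (-p.2) * cosh (log (innerExp p.1 p.2) / 3)) (κ, ζ) :=
    he.mul (differentiable_cosh.differentiableAt.comp (κ, ζ) harg)
  have hinv : DifferentiableAt ℂ (fun p : ℂ × ℂ => (innerSqrt p.1 p.2)⁻¹) (κ, ζ) :=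
    hS.inv (innerSqrt_ne_zero hc hc0 hκ hζ)
  exact hcosh.mul hinv

theorem mem_innerRegion_of_sector {k : ℝ} (hk : 0 < k) (hk1 : k ≤ 1)
    (hζ : 0 < ζ.re) (h : ‖ζ‖ * k ≤ ζ.re) : ζ ∈ innerRegion (k / 4) := by
  have h1 := mem_outerRegion_of_sector hk hk1 (ζ := -ζ) (by simpa using hζ) (by simpa using h)
  exact ⟨Or.inl (one_sub_exp_re_pos h1.1), h1.2, (norm_exp_lt_one h1.1).trans (by norm_num)⟩

theorem mem_innerRegion_of_norm_lt (hc : c ≤ 1 / 4) (h : ‖ζ‖ < 1) (hζ : ζ ∈ slitPlane) :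
    ζ ∈ innerRegion c := by
  have him := abs_lt.1 ((abs_im_le_norm ζ).trans_lt h)
  have hre := abs_lt.1 ((abs_re_le_norm ζ).trans_lt h)
  have hcos : 0 < Real.cos (-ζ).im := by
    refine Real.cos_pos_of_mem_Ioo ?_
    constructor <;> simp only [neg_im] <;> linarith [Real.pi_gt_three]
  refine ⟨?_, ?_, ?_⟩
  · by_cases h0 : ζ.im = 0
    · left
      have hre0 : 0 < ζ.re := by
        rcases hζ with h1 | h1
        · exact h1
        · exact absurd h0 h1
      exact one_sub_exp_re_pos (by simpa using hre0)
    · right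
      rw [sub_im, one_im, exp_im, neg_im, Real.sin_neg]
      have : Real.sin ζ.im ≠ 0 := by
        intro hs
        rw [Real.sin_eq_zero_iff_of_lt_of_lt (by linarith [Real.pi_gt_three])
          (by linarith [Real.pi_gt_three])] at hs
        exact h0 hs
      simpa using this
  · rw [add_re, one_re, exp_re]
    have := mul_pos (Real.exp_pos (-ζ).re) hcos
    linarith
  · rw [norm_exp]
    calc Real.exp (-ζ).re ≤ Real.exp 1 := Real.exp_le_exp.2 (by simp only [neg_re]; linarith)
      _ < 3 := by linarith [Real.exp_one_lt_d9]

/-- Comparison of the two branches of the square root. -/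
theorem csqrt_one_sub_exp (h0 : 0 < ζ.im) (h1 : ζ.im < 2 * Real.pi) :
    csqrt (1 - exp ζ) = -I * exp (ζ / 2) * csqrt (1 - exp (-ζ)) := by
  set S : Set ℂ := {ζ | 0 < ζ.im ∧ ζ.im < 2 * Real.pi} with hS
  have key : ∀ ζ ∈ S, 1 - exp ζ ∈ slitPlane := by
    rintro ζ ⟨h0, h1⟩
    rw [mem_slitPlane_iff_not_le_zero]
    intro hle
    rw [Complex.le_def] at hle
    simp only [sub_re, one_re, zero_re, sub_im, one_im, zero_im, exp_re, exp_im] at hle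
    have hs : Real.sin ζ.im = 0 := by
      have := hle.2
      have h2 := (Real.exp_pos ζ.re).ne'
      have h3 : Real.exp ζ.re * Real.sin ζ.im = 0 := by linarith
      exact (mul_eq_zero.1 h3).resolve_left h2
    have hpi : ζ.im = Real.pi := by
      have h4 : Real.sin (ζ.im - Real.pi) = 0 := by rw [Real.sin_sub_pi, hs, neg_zero]
      rw [Real.sin_eq_zero_iff_of_lt_of_lt (by linarith) (by linarith)] at h4
      linarith
    rw [hpi, Real.cos_pi] at hle
    linarith [hle.1, Real.exp_pos ζ.re]
  -- The map ζ ↦ -ζ + 2πi preserves the strip and carries one function into the other.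
  have key' : ∀ ζ ∈ S, 1 - exp (-ζ) ∈ slitPlane := by
    rintro ζ ⟨h0, h1⟩
    have h2 := key (-ζ + 2 * Real.pi * I) ⟨by simp; linarith, by simp; linarith⟩
    rwa [exp_periodic] at h2
  have hpre : IsPreconnected S := by
    have : Convex ℝ S := (convex_halfSpace_im_gt 0).inter (convex_halfSpace_im_lt _)
    exact this.isPreconnected
  -- Both sides have the same square on the connected strip and do not vanish, so they agree as soon
  -- as they agree at ζ = πi.
  refine hpre.eq_of_sq_eq (f := fun ζ => csqrt (1 - exp ζ))
    (g := fun ζ => -I * exp (ζ / 2) * csqrt (1 - exp (-ζ))) ?_ ?_ ?_ ?_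
    (y := Real.pi * I) ⟨by simp [Real.pi_pos], by simp; linarith [Real.pi_pos]⟩ ?_ ⟨h0, h1⟩
  · intro ζ hζ
    exact (ContinuousAt.comp (g := csqrt) (f := fun ζ => 1 - exp ζ)
      (differentiableAt_csqrt (key ζ hζ)).continuousAt (by fun_prop)).continuousWithinAt
  · intro ζ hζ
    refine ContinuousAt.continuousWithinAt ?_
    refine ContinuousAt.mul (by fun_prop) ?_
    exact (ContinuousAt.comp (g := csqrt) (f := fun ζ => 1 - exp (-ζ))
      (differentiableAt_csqrt (key' ζ hζ)).continuousAt (by fun_prop))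
  · intro ζ hζ
    simp only [Pi.pow_apply]
    rw [csqrt_sq, mul_pow, mul_pow, csqrt_sq, ← exp_nat_mul, neg_sq, I_sq]
    have : exp ((2 : ℕ) * (ζ / 2)) * exp (-ζ) = 1 := by
      rw [← exp_add]
      have : ((2 : ℕ) : ℂ) * (ζ / 2) + -ζ = 0 := by push_cast; ring
      rw [this, exp_zero]
    have h2 : exp ((2 : ℕ) * (ζ / 2)) = exp ζ := by congr 1; push_cast; ring
    rw [mul_sub, mul_one, mul_assoc (-1 : ℂ), this, h2]
    ring
  · intro ζ hζ
    refine mul_ne_zero (mul_ne_zero (by simp) (exp_ne_zero _))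
      (csqrt_ne_zero (slitPlane_ne_zero (key' ζ hζ)))
  · have h2 : exp (Real.pi * I / 2) = I := by
      rw [mul_div_right_comm, exp_pi_div_two_mul_I]
    have h3 : exp (-(Real.pi * I)) = -1 := by rw [exp_neg, exp_pi_mul_I]; norm_num
    simp only [h2, h3, exp_pi_mul_I]
    have : -I * I = 1 := by rw [neg_mul, I_mul_I, neg_neg]
    rw [this, one_mul]

/-- Each of the two ζ-dependent factors contributes e^{ζ/2}; the factor -i comes from 1 - e^ζ. For
the last factor the sign is right because |Im ζ| < 1 keeps arg e^{ζ/2} below π/4, and the root is in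
the same sector. -/
theorem outerSqrt_eq (hc : c ≤ 1 / 4) (hc0 : 0 < c) (hκ : 8 * ‖κ‖ ≤ c) (h : ‖ζ‖ < 1)
    (him : 0 < ζ.im) : outerSqrt κ ζ = -I * exp ζ * innerSqrt κ ζ := by
  have hreg := mem_innerRegion_of_norm_lt hc h (Or.inr him.ne')
  have him1 := abs_lt.1 ((abs_im_le_norm ζ).trans_lt h)
  have h3 : exp (ζ / 2) * csqrt (1 - κ + (1 + κ) * exp (-ζ)) =
      csqrt (1 + κ + (1 - κ) * exp ζ) := by
    refine eq_csqrt_of_sq_eq ?_ ?_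
    · rw [mul_pow, csqrt_sq, ← exp_nat_mul]
      have h2 : exp ((2 : ℕ) * (ζ / 2)) = exp ζ := by congr 1; push_cast; ring
      have : exp ζ * exp (-ζ) = 1 := by rw [← exp_add, add_neg_cancel, exp_zero]
      rw [h2]
      linear_combination (1 + κ) * this
    · have ha := abs_csqrt_im_lt_re (lt_of_lt_of_le (half_pos hc0) (inner_third_re hκ hreg))
      set b := csqrt (1 - κ + (1 + κ) * exp (-ζ))
      have he : |(exp (ζ / 2)).im| ≤ (exp (ζ / 2)).re := by
        rw [exp_im, exp_re, abs_mul, abs_of_pos (Real.exp_pos _)]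
        refine mul_le_mul_of_nonneg_left ?_ (Real.exp_pos _).le
        have hi : (ζ / 2).im = ζ.im / 2 := by simp
        rw [hi, abs_of_nonneg (Real.sin_nonneg_of_nonneg_of_le_pi (by linarith)
          (by linarith [Real.pi_gt_three]))]
        have h5 := Real.sin_le (x := ζ.im / 2) (by linarith)
        have h6 := Real.one_sub_sq_div_two_le_cos (x := ζ.im / 2)
        nlinarith
      have he0 : 0 < (exp (ζ / 2)).re := by
        rw [exp_re]
        refine mul_pos (Real.exp_pos _) (Real.cos_pos_of_mem_Ioo ?_)
        have hi : (ζ / 2).im = ζ.im / 2 := by simp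
        rw [hi]
        constructor <;> linarith [Real.pi_gt_three]
      rw [mul_re]
      have h7 : |(exp (ζ / 2)).im * b.im| < (exp (ζ / 2)).re * b.re := by
        rw [abs_mul]
        calc _ ≤ (exp (ζ / 2)).re * |b.im| := by gcongr
          _ < _ := by gcongr
      linarith [le_abs_self ((exp (ζ / 2)).im * b.im)]
  rw [outerSqrt, innerSqrt, ← h3, csqrt_one_sub_exp him (by linarith [Real.pi_gt_three])]
  have h2 : exp ζ = exp (ζ / 2) * exp (ζ / 2) := by rw [← exp_add]; congr 1; ring
  rw [h2]; ring

/-- The logarithms match without a multiple of 2πi: `outerExp` has positive real part and |Im ζ| <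
1, so the difference has imaginary part between -π and π. This gluing makes `borelGerm` the
counterclockwise continuation. -/
theorem outerGerm_eq_innerGerm (hc : c ≤ 1 / 4) (hc0 : 0 < c) (hκ : 8 * ‖κ‖ ≤ c)
    (h : ‖ζ‖ < 1) (him : 0 < ζ.im) (hre : ζ.re < 0) : outerGerm κ ζ = innerGerm κ ζ := by
  have hreg := mem_innerRegion_of_norm_lt hc h (Or.inr him.ne')
  have hreg' := mem_outerRegion_of_norm_lt hc h hre
  have him1 := abs_lt.1 ((abs_im_le_norm ζ).trans_lt h)
  have hS := outerSqrt_eq hc hc0 hκ h him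
  have hee : exp ζ * exp (-ζ) = 1 := by rw [← exp_add, add_neg_cancel, exp_zero]
  have hE : outerExp κ ζ = exp ζ * innerExp κ ζ := by
    rw [outerExp, hS, innerExp]
    linear_combination -(1 + κ) * hee
  have hYre := outerExp_re (by linarith) hc0 hκ hreg'
  have hlog : log (outerExp κ ζ) - ζ = log (innerExp κ ζ) := by
    have harg : |arg (outerExp κ ζ)| < Real.pi / 2 :=
      abs_arg_lt_pi_div_two_iff.2 (Or.inl (by linarith))
    have h1 : exp (log (outerExp κ ζ) - ζ) = innerExp κ ζ := by
      have hne : outerExp κ ζ ≠ 0 := fun h0 => by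
        rw [h0, zero_re] at hYre; linarith
      rw [exp_sub, exp_log hne, hE, mul_div_cancel_left₀ _ (exp_ne_zero _)]
    rw [← h1, log_exp]
    · rw [sub_im, log_im]; linarith [(abs_lt.1 harg).1, Real.pi_gt_three]
    · rw [sub_im, log_im]; linarith [(abs_lt.1 harg).2, Real.pi_gt_three]
  have hne := innerSqrt_ne_zero (by linarith) hc0 hκ hreg
  rw [outerGerm, innerGerm, hlog, hS, exp_neg]
  have h1 := exp_ne_zero ζ
  field_simp

end inner

/-! ### The Borel germ on the ray domain -/

/-- The Borel germ: `e^{-ζ} cos (α/3) / sin α`, `cos α = (1 + κ) e^{-ζ} - κ`, continued from the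
positive axis counterclockwise to the second quadrant. -/
def borelGerm (κ ζ : ℂ) : ℂ := if ζ.re < 0 ∧ 0 < ζ.im then outerGerm κ ζ else innerGerm κ ζ

theorem re_eq_norm_mul_cos (ζ : ℂ) : ζ.re = ‖ζ‖ * Real.cos (arg ζ) := (norm_mul_cos_arg ζ).symm

theorem im_eq_norm_mul_sin (ζ : ℂ) : ζ.im = ‖ζ‖ * Real.sin (arg ζ) := (norm_mul_sin_arg ζ).symm

theorem sin_half_pos {ε : ℝ} (h0 : 0 < ε) (h1 : ε < 1 / 2) : 0 < Real.sin (ε / 2) :=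
  Real.sin_pos_of_pos_of_lt_pi (by linarith) (by linarith [Real.pi_gt_three])

/-- A direction in the second quadrant making an angle `> ε / 2` with the imaginary axis. -/
theorem sin_half_le_neg_cos {ε φ : ℝ} (h0 : 0 < ε)
    (hφ : Real.pi / 2 + ε / 2 ≤ φ) (hφ' : φ ≤ Real.pi) : Real.sin (ε / 2) ≤ -Real.cos φ := by
  have : -Real.cos φ = Real.sin (φ - Real.pi / 2) := by rw [Real.sin_sub_pi_div_two]
  rw [this]
  exact Real.sin_le_sin_of_le_of_le_pi_div_two (by linarith [Real.pi_gt_three]) (by linarith)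
    (by linarith)

/-- On the slit disc the two formulas agree wherever both are used, the sector about 0 lies in the
right half-plane, and the sector about π/2 + ε lies in the open second quadrant at angle at least
ε/2 from the imaginary axis. The number sin(ε/2) measures this distance from the remaining branch
points. -/
theorem analyticOnNhd_borelGerm {ε : ℝ} (h0 : 0 < ε) (h1 : ε < 1 / 2) {κ : ℂ}
    (hκ : 8 * ‖κ‖ ≤ Real.sin (ε / 2) / 4) :
    AnalyticOnNhd ℂ (borelGerm κ) (rayDomain (Real.pi / 2 + ε) 1 (ε / 2)) := by
  set k := Real.sin (ε / 2)
  have hk0 : 0 < k := sin_half_pos h0 h1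
  have hk1 : k ≤ 1 := Real.sin_le_one _
  have hpi := Real.pi_gt_three
  have hin : ∀ ζ ∈ innerRegion (k / 4), AnalyticAt ℂ (innerGerm κ) ζ := by
    intro ζ hζ
    refine DifferentiableOn.analyticAt (s := innerRegion (k / 4)) (fun ξ hξ => ?_)
      ((isOpen_innerRegion _).mem_nhds hζ)
    exact (DifferentiableAt.comp ξ
      (differentiableAt_innerGerm (by linarith) (by linarith) hκ hξ)
      ((differentiableAt_const κ).prodMk differentiableAt_id)).differentiableWithinAt
  have hout : ∀ ζ ∈ outerRegion (k / 4), AnalyticAt ℂ (outerGerm κ) ζ := by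
    intro ζ hζ
    refine DifferentiableOn.analyticAt (s := outerRegion (k / 4)) (fun ξ hξ => ?_)
      ((isOpen_outerRegion _).mem_nhds hζ)
    exact (DifferentiableAt.comp ξ
      (differentiableAt_outerGerm (by linarith) (by linarith) hκ hξ)
      ((differentiableAt_const κ).prodMk differentiableAt_id)).differentiableWithinAt
  have hq : IsOpen {ζ : ℂ | ζ.re < 0 ∧ 0 < ζ.im} :=
    (isOpen_lt continuous_re continuous_const).inter (isOpen_lt continuous_const continuous_im)
  rintro ζ ⟨hζ, hd⟩
  have hζ0 : 0 < ‖ζ‖ := norm_pos_iff.2 (slitPlane_ne_zero hζ)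
  rcases hd with hd | hd | hd
  · refine (hin ζ (mem_innerRegion_of_norm_lt (by linarith) hd hζ)).congr ?_
    filter_upwards [(isOpen_lt continuous_norm continuous_const).mem_nhds hd] with ξ hξ
    rw [borelGerm]
    split_ifs with hq
    · exact (outerGerm_eq_innerGerm (by linarith) (by linarith) hκ hξ hq.2 hq.1).symm
    · rfl
  · have hcos : k ≤ Real.cos (arg ζ) := by
      rw [← Real.cos_abs, show k = Real.cos (Real.pi / 2 - ε / 2) from
        (Real.cos_pi_div_two_sub _).symm]
      exact Real.cos_le_cos_of_nonneg_of_le_pi (abs_nonneg _) (by linarith) (by linarith)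
    have hre : ‖ζ‖ * k ≤ ζ.re := by
      rw [re_eq_norm_mul_cos ζ]
      exact mul_le_mul_of_nonneg_left hcos hζ0.le
    have hre0 : 0 < ζ.re := lt_of_lt_of_le (by positivity) hre
    refine (hin ζ (mem_innerRegion_of_sector hk0 hk1 hre0 hre)).congr ?_
    filter_upwards [(isOpen_lt continuous_const continuous_re).mem_nhds hre0] with ξ hξ
    rw [borelGerm, if_neg]
    rintro ⟨h2, -⟩
    exact absurd h2 (not_lt.2 (le_of_lt hξ))
  · rw [abs_lt] at hd
    have hre : ‖ζ‖ * k ≤ -ζ.re := by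
      rw [re_eq_norm_mul_cos ζ, ← mul_neg]
      exact mul_le_mul_of_nonneg_left
        (sin_half_le_neg_cos h0 (by linarith) (arg_le_pi ζ)) hζ0.le
    have hre0 : ζ.re < 0 := by
      have : 0 < ‖ζ‖ * k := by positivity
      linarith
    have him : 0 < ζ.im := by
      rw [im_eq_norm_mul_sin ζ]
      exact mul_pos hζ0 (Real.sin_pos_of_pos_of_lt_pi (by linarith) (by linarith))
    refine (hout ζ (mem_outerRegion_of_sector hk0 hk1 hre0 hre)).congr ?_
    filter_upwards [hq.mem_nhds ⟨hre0, him⟩] with ξ hξ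
    rw [borelGerm, if_pos hξ]

/-! ### Identity theorem from the real axis -/

theorem eqOn_of_eventually_eq_ofReal {U : Set ℂ} (hU : IsOpen U) (hpre : IsPreconnected U)
    {f g : ℂ → ℂ} (hf : DifferentiableOn ℂ f U) (hg : DifferentiableOn ℂ g U) {x₀ : ℝ}
    (hx₀ : (x₀ : ℂ) ∈ U) (h : ∀ᶠ x : ℝ in 𝓝 x₀, f x = g x) : EqOn f g U := by
  refine (hf.analyticOnNhd hU).eqOn_of_preconnected_of_frequently_eq (hg.analyticOnNhd hU) hpre
    hx₀ ?_
  have h1 : Tendsto (fun x : ℝ => (x : ℂ)) (𝓝[≠] x₀) (𝓝[≠] (x₀ : ℂ)) := by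
    refine tendsto_nhdsWithin_of_tendsto_nhds_of_eventually_within _
      (continuous_ofReal.continuousAt.mono_left nhdsWithin_le_nhds) ?_
    filter_upwards [self_mem_nhdsWithin] with x hx
    simpa using hx
  exact h1.frequently (h.filter_mono nhdsWithin_le_nhds).frequently

/-! ### The inner germ on the positive axis and near the origin -/

section

variable {c : ℝ} {κ ζ : ℂ}

theorem ofReal_mem_innerRegion {k : ℝ} (hk : 0 < k) (hk1 : k ≤ 1) {t : ℝ} (ht : 0 < t) :
    (t : ℂ) ∈ innerRegion (k / 4) := by
  refine mem_innerRegion_of_sector hk hk1 (by simpa using ht) ?_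
  rw [norm_real, Real.norm_of_nonneg ht.le, ofReal_re]
  nlinarith

theorem norm_innerGerm_le (hκ : 8 * ‖κ‖ ≤ 1) {t : ℝ} (ht : 0 < t) :
    ‖innerGerm κ t‖ ≤ 2 * (√(1 / 2))⁻¹ * (Real.exp (-t) * (1 + t ^ (-(1 / 2) : ℝ))) := by
  have he : exp (-(t : ℂ)) = (Real.exp (-t) : ℝ) := by push_cast; rfl
  have he1 : Real.exp (-t) < 1 := by
    rw [← Real.exp_zero]; exact Real.exp_lt_exp.2 (by linarith)
  have he0 := Real.exp_pos (-t)
  have hκ1 : ‖1 + κ‖ ≤ 9 / 8 := by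
    have := norm_add_le 1 κ
    rw [norm_one] at this
    linarith
  have hk2 : ‖1 - κ‖ ≤ 9 / 8 := by
    have := norm_sub_le 1 κ
    rw [norm_one] at this
    linarith
  have hne : ‖exp (-(t : ℂ))‖ = Real.exp (-t) := by
    rw [he, norm_real, Real.norm_of_nonneg he0.le]
  have h1e : ‖1 - exp (-(t : ℂ))‖ = 1 - Real.exp (-t) := by
    rw [he, ← ofReal_one, ← ofReal_sub, norm_real, Real.norm_of_nonneg (by linarith)]
  have h3u : ‖1 - κ + (1 + κ) * exp (-(t : ℂ))‖ ≤ 9 / 4 := by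
    have := norm_add_le (1 - κ) ((1 + κ) * exp (-(t : ℂ)))
    rw [norm_mul, hne] at this
    nlinarith [norm_nonneg (1 + κ)]
  have h3l : 7 / 8 ≤ ‖1 - κ + (1 + κ) * exp (-(t : ℂ))‖ := by
    have h1 : 1 - κ + (1 + κ) * exp (-(t : ℂ)) = (1 + exp (-(t : ℂ))) - κ * (1 - exp (-(t : ℂ))) := by
      ring
    have h2 : ‖κ * (1 - exp (-(t : ℂ)))‖ ≤ ‖κ‖ := by
      rw [norm_mul, h1e]
      exact mul_le_of_le_one_right (norm_nonneg _) (by linarith)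
    have h4 : ‖1 + exp (-(t : ℂ))‖ = 1 + Real.exp (-t) := by
      rw [he, ← ofReal_one, ← ofReal_add, norm_real, Real.norm_of_nonneg (by linarith)]
    rw [h1]
    linarith [norm_sub_norm_le (1 + exp (-(t : ℂ))) (κ * (1 - exp (-(t : ℂ))))]
  have hSsq : ‖innerSqrt κ t‖ ^ 2 = ‖1 + κ‖ * (1 - Real.exp (-t)) *
      ‖1 - κ + (1 + κ) * exp (-(t : ℂ))‖ := by
    rw [← norm_pow, innerSqrt_sq, norm_mul, norm_mul, h1e]
  have hSle : ‖innerSqrt κ t‖ ≤ 2 := by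
    refine (abs_le_of_sq_le_sq' ?_ (by norm_num)).2
    rw [hSsq]
    calc _ ≤ 9 / 8 * 1 * (9 / 4 : ℝ) := by
          gcongr
          linarith
      _ ≤ 2 ^ 2 := by norm_num
  have hx : ‖(1 + κ) * exp (-(t : ℂ)) - κ‖ ≤ 5 / 4 := by
    have := norm_sub_le ((1 + κ) * exp (-(t : ℂ))) κ
    rw [norm_mul, hne] at this
    nlinarith [norm_nonneg (1 + κ)]
  have hIS : ‖I * innerSqrt κ t‖ ≤ 2 := by rwa [norm_mul, norm_I, one_mul]
  have hX : ‖innerExp κ t‖ ≤ 4 :=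
    (norm_sub_le _ _).trans (by linarith)
  -- The number and its reciprocal x + i√(1-x²) are both bounded by 4.
  have hX' : 1 / 4 ≤ ‖innerExp κ t‖ := by
    have h1 := congrArg norm (innerExp_mul (κ := κ) (ζ := (t : ℂ)))
    rw [norm_mul, norm_one] at h1
    have h2 := norm_add_le ((1 + κ) * exp (-(t : ℂ)) - κ) (I * innerSqrt κ t)
    by_contra hcon
    rw [not_le] at hcon
    have h3 : ‖(1 + κ) * exp (-(t : ℂ)) - κ + I * innerSqrt κ t‖ ≤ 4 := by linarith
    nlinarith [norm_nonneg (innerExp κ t)]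
  have hcosh : ‖cosh (log (innerExp κ t) / 3)‖ ≤ 2 := by
    refine (norm_cosh_le_exp_abs_re _).trans ?_
    have := exp_abs_log_div_three_le (b := 0) hX' hX
    rw [zero_div, Real.exp_zero, mul_one, add_zero] at this
    refine le_trans (Real.exp_le_exp.2 ?_) this
    rw [div_ofNat_re, log_re, abs_div]
    norm_num
  have hinv : ‖innerSqrt κ t‖⁻¹ ≤ (√(1 / 2))⁻¹ * (1 + t ^ (-(1 / 2) : ℝ)) := by
    refine inv_le_of_sq_ge ht (by norm_num) (norm_nonneg _) ?_
    rw [hSsq]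
    have e1 : 7 / 8 ≤ ‖1 + κ‖ := (one_add_re_pos hκ).trans (re_le_norm _)
    have e2 := div_one_add_le_one_sub_exp_neg ht.le
    have e4 : 0 < t / (1 + t) := by positivity
    calc 1 / 2 * (t / (1 + t)) ≤ 7 / 8 * (t / (1 + t)) * (7 / 8) := by nlinarith
      _ ≤ _ := by gcongr
  rw [innerGerm, norm_div, norm_mul, hne, div_eq_mul_inv]
  calc _ ≤ Real.exp (-t) * 2 * ((√(1 / 2))⁻¹ * (1 + t ^ (-(1 / 2) : ℝ))) := by gcongr
    _ = _ := by ring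

/-- `√(1 - x²) / √ζ` -/
def reducedSqrt (κ ζ : ℂ) : ℂ :=
  csqrt (1 + κ) * csqrt (dslope (fun ζ => 1 - exp (-ζ)) 0 ζ) * csqrt (1 - κ + (1 + κ) * exp (-ζ))

/-- The function `√ζ` times the Borel germ, in the uniformizing variable `√ζ`. -/
def evenGerm (κ k : ℂ) : ℂ :=
  exp (-k ^ 2) * cosh (log ((1 + κ) * exp (-k ^ 2) - κ - I * (k * reducedSqrt κ (k ^ 2))) / 3) /
    reducedSqrt κ (k ^ 2)

theorem dslope_one_sub_exp_zero : dslope (fun ζ : ℂ => 1 - exp (-ζ)) 0 0 = 1 := by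
  rw [dslope_same]
  have : HasDerivAt (fun ζ : ℂ => 1 - exp (-ζ)) (-(exp (-0) * (-1))) 0 :=
    ((hasDerivAt_neg (0 : ℂ)).cexp).const_sub 1
  rw [this.deriv]; simp

theorem analyticAt_dslope_one_sub_exp (ζ : ℂ) :
    AnalyticAt ℂ (dslope (fun ζ : ℂ => 1 - exp (-ζ)) 0) ζ := by
  refine DifferentiableOn.analyticAt (s := univ) ?_ univ_mem
  rw [differentiableOn_dslope univ_mem]
  fun_prop

theorem analyticAt_csqrt {x : ℂ} (hx : x ∈ slitPlane) : AnalyticAt ℂ csqrt x :=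
  DifferentiableOn.analyticAt (fun _ hy => (differentiableAt_csqrt hy).differentiableWithinAt)
    (isOpen_slitPlane.mem_nhds hx)

theorem analyticAt_reducedSqrt : AnalyticAt ℂ (reducedSqrt κ) 0 := by
  refine AnalyticAt.mul (AnalyticAt.mul analyticAt_const ?_) ?_
  · refine AnalyticAt.comp (analyticAt_csqrt ?_) (analyticAt_dslope_one_sub_exp 0)
    rw [dslope_one_sub_exp_zero]; exact one_mem_slitPlane
  · refine AnalyticAt.comp (f := fun ζ => 1 - κ + (1 + κ) * exp (-ζ)) (analyticAt_csqrt ?_) ?_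
    · simp only [neg_zero, exp_zero]
      left; ring_nf; norm_num
    · fun_prop

theorem csqrt_one : csqrt 1 = 1 := by simp [csqrt]

theorem reducedSqrt_zero_ne_zero (hκ : 8 * ‖κ‖ ≤ 1) : reducedSqrt κ 0 ≠ 0 := by
  rw [reducedSqrt, dslope_one_sub_exp_zero, csqrt_one, neg_zero, exp_zero]
  refine mul_ne_zero (mul_ne_zero (csqrt_ne_zero ?_) one_ne_zero) (csqrt_ne_zero ?_)
  · exact fun h => absurd (one_add_re_pos hκ) (by rw [h]; norm_num)
  · ring_nf; norm_num

theorem analyticAt_evenGerm (hκ : 8 * ‖κ‖ ≤ 1) : AnalyticAt ℂ (evenGerm κ) 0 := by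
  have hN : AnalyticAt ℂ (fun k : ℂ => reducedSqrt κ (k ^ 2)) 0 :=
    AnalyticAt.comp (g := reducedSqrt κ) (f := fun k : ℂ => k ^ 2)
      (by simpa using analyticAt_reducedSqrt) (by fun_prop)
  have hL : AnalyticAt ℂ (fun k : ℂ =>
      log ((1 + κ) * exp (-k ^ 2) - κ - I * (k * reducedSqrt κ (k ^ 2))) / 3) 0 := by
    refine AnalyticAt.div (AnalyticAt.clog ?_ ?_) analyticAt_const (by norm_num)
    · exact AnalyticAt.sub (by fun_prop) (analyticAt_const.mul (analyticAt_id.mul hN))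
    · left; simp
  refine AnalyticAt.div (AnalyticAt.mul (by fun_prop) ?_) hN ?_
  · exact AnalyticAt.comp (g := cosh) (Complex.differentiable_cosh.analyticAt _) hL
  · simpa using reducedSqrt_zero_ne_zero hκ

theorem reducedSqrt_sq : ζ * reducedSqrt κ ζ ^ 2 =
    (1 + κ) * (1 - exp (-ζ)) * (1 - κ + (1 + κ) * exp (-ζ)) := by
  rw [reducedSqrt, mul_pow, mul_pow, csqrt_sq, csqrt_sq, csqrt_sq]
  have h : ζ * dslope (fun ζ : ℂ => 1 - exp (-ζ)) 0 ζ = 1 - exp (-ζ) := by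
    have := sub_smul_dslope (fun ζ : ℂ => 1 - exp (-ζ)) 0 ζ
    simpa using this
  linear_combination (1 + κ) * (1 - κ + (1 + κ) * exp (-ζ)) * h

/-- Changing the sign of k = √ζ replaces e^{-iα} by its inverse, that is α by -α, and cos(α/3) is
even. The condition on the slit plane makes the logarithm change sign too. -/
theorem evenGerm_neg : ∀ᶠ k in 𝓝 (0 : ℂ), evenGerm κ (-k) = evenGerm κ k := by
  have hc : ContinuousAt (fun k : ℂ =>
      (1 + κ) * exp (-k ^ 2) - κ - I * (k * reducedSqrt κ (k ^ 2))) 0 := by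
    have hN : ContinuousAt (fun k : ℂ => reducedSqrt κ (k ^ 2)) 0 :=
      ContinuousAt.comp (g := reducedSqrt κ) (f := fun k : ℂ => k ^ 2)
        (by simpa using (analyticAt_reducedSqrt (κ := κ)).continuousAt) (by fun_prop)
    exact ContinuousAt.sub (by fun_prop) (continuousAt_const.mul (continuousAt_id.mul hN))
  have hs := hc.eventually_mem (isOpen_slitPlane.mem_nhds (show _ ∈ slitPlane by
    left; simp))
  filter_upwards [hs] with k hk
  have hinv : (1 + κ) * exp (-k ^ 2) - κ - I * (-k * reducedSqrt κ (k ^ 2)) =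
      ((1 + κ) * exp (-k ^ 2) - κ - I * (k * reducedSqrt κ (k ^ 2)))⁻¹ := by
    refine eq_inv_of_mul_eq_one_right ?_
    linear_combination -(k ^ 2 * reducedSqrt κ (k ^ 2) ^ 2) * I_sq +
      reducedSqrt_sq (κ := κ) (ζ := k ^ 2)
  rw [evenGerm, evenGerm, neg_sq, hinv, log_inv _ (slitPlane_arg_ne_pi hk), neg_div, cosh_neg]

/-- Both sides are square roots of 1 - e^{-ζ} on a slit disc, which is star-shaped about a positive
number, and they coincide at that number. -/
theorem csqrt_one_sub_exp_neg : ∀ᶠ ζ in 𝓝[slitPlane] (0 : ℂ),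
    csqrt (1 - exp (-ζ)) = csqrt ζ * csqrt (dslope (fun ζ => 1 - exp (-ζ)) 0 ζ) := by
  have hev : ∀ᶠ ζ in 𝓝 (0 : ℂ), dslope (fun ζ : ℂ => 1 - exp (-ζ)) 0 ζ ∈ slitPlane :=
    (analyticAt_dslope_one_sub_exp 0).continuousAt.eventually_mem
      (isOpen_slitPlane.mem_nhds (by rw [dslope_one_sub_exp_zero]; exact one_mem_slitPlane))
  obtain ⟨r, hr, hball⟩ := Metric.eventually_nhds_iff_ball.1 hev
  set R := min r 1 with hR
  have hR0 : 0 < R := lt_min hr one_pos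
  set S : Set ℂ := slitPlane ∩ Metric.ball 0 R with hS
  have hy : ((R / 2 : ℝ) : ℂ) ∈ S := by
    refine ⟨Or.inl (by simpa using hR0), ?_⟩
    rw [Metric.mem_ball, dist_zero_right, norm_real, Real.norm_of_nonneg (by positivity)]
    linarith
  have hpre : IsPreconnected S := by
    have h1 : StarConvex ℝ ((R / 2 : ℝ) : ℂ) S :=
      (starConvex_ofReal_slitPlane (by positivity)).inter
        ((convex_ball (0 : ℂ) R).starConvex hy.2)
    exact (h1.isPathConnected hy).isConnected.isPreconnected
  have hslit : ∀ ζ ∈ S, 1 - exp (-ζ) ∈ slitPlane := fun ζ hζ =>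
    (mem_innerRegion_of_norm_lt (c := 1 / 4) le_rfl
      (by simpa using (Metric.mem_ball.1 hζ.2).trans_le (min_le_right _ _)) hζ.1).1
  have hsl2 : ∀ ζ ∈ S, dslope (fun ζ : ℂ => 1 - exp (-ζ)) 0 ζ ∈ slitPlane := fun ζ hζ =>
    hball ζ (Metric.ball_subset_ball (min_le_left _ _) hζ.2)
  have hmul : ∀ ζ : ℂ, ζ * dslope (fun ζ : ℂ => 1 - exp (-ζ)) 0 ζ = 1 - exp (-ζ) := by
    intro ζ
    have := sub_smul_dslope (fun ζ : ℂ => 1 - exp (-ζ)) 0 ζ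
    simpa using this
  have hEq : EqOn (fun ζ => csqrt (1 - exp (-ζ)))
      (fun ζ => csqrt ζ * csqrt (dslope (fun ζ => 1 - exp (-ζ)) 0 ζ)) S := by
    refine hpre.eq_of_sq_eq ?_ ?_ ?_ ?_ (y := ((R / 2 : ℝ) : ℂ)) hy ?_
    · intro ζ hζ
      exact (ContinuousAt.comp (g := csqrt) (f := fun ζ => 1 - exp (-ζ))
        (differentiableAt_csqrt (hslit ζ hζ)).continuousAt (by fun_prop)).continuousWithinAt
    · intro ζ hζ
      refine ContinuousAt.continuousWithinAt ?_
      refine ContinuousAt.mul (differentiableAt_csqrt hζ.1).continuousAt ?_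
      exact ContinuousAt.comp (g := csqrt) (differentiableAt_csqrt (hsl2 ζ hζ)).continuousAt
        (analyticAt_dslope_one_sub_exp ζ).continuousAt
    · intro ζ hζ
      simp only [Pi.pow_apply, mul_pow, csqrt_sq]
      rw [hmul]
    · intro ζ hζ
      exact mul_ne_zero (csqrt_ne_zero (slitPlane_ne_zero hζ.1))
        (csqrt_ne_zero (slitPlane_ne_zero (hsl2 ζ hζ)))
    · rw [← hmul, csqrt_ofReal_mul (by positivity), csqrt_ofReal (by positivity)]
  rw [eventually_nhdsWithin_iff]
  filter_upwards [Metric.ball_mem_nhds (0 : ℂ) hR0] with ζ hζ hζs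
  exact hEq ⟨hζs, hζ⟩

theorem innerGerm_eq_evenGerm :
    ∀ᶠ ζ in 𝓝[slitPlane] (0 : ℂ), innerGerm κ ζ = evenGerm κ (csqrt ζ) / csqrt ζ := by
  filter_upwards [csqrt_one_sub_exp_neg, self_mem_nhdsWithin] with ζ h hζ
  have h1 : innerSqrt κ ζ = csqrt ζ * reducedSqrt κ ζ := by
    rw [innerSqrt, h, reducedSqrt]; ring
  rw [evenGerm, csqrt_sq, innerGerm, innerExp, h1, div_div, mul_comm (csqrt ζ)]

theorem borelGerm_eq_evenGerm (hc : c ≤ 1 / 4) (hc0 : 0 < c) (hκ : 8 * ‖κ‖ ≤ c) :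
    ∀ᶠ ζ in 𝓝[slitPlane] (0 : ℂ), borelGerm κ ζ = evenGerm κ (csqrt ζ) / csqrt ζ := by
  filter_upwards [innerGerm_eq_evenGerm (κ := κ),
    nhdsWithin_le_nhds (Metric.ball_mem_nhds (0 : ℂ) one_pos)] with ζ h h1
  rw [← h, borelGerm]
  split_ifs with hq
  · exact outerGerm_eq_innerGerm hc hc0 hκ (by simpa using h1) hq.2 hq.1
  · rfl

end

/-! ### Inverse Borel transforms -/

/-- An even F has only the powers k^{2n}; putting k = √ζ and dividing by k leaves exactly the powers
ζ^{n-1/2}. The Gamma factors are absorbed in the coefficients. -/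
theorem exists_isInverseBorel_of_even {f F : ℂ → ℂ} (hF : AnalyticAt ℂ F 0)
    (heven : ∀ᶠ k in 𝓝 (0 : ℂ), F (-k) = F k)
    (hf : ∀ᶠ ζ in 𝓝[slitPlane] (0 : ℂ), f ζ = F (csqrt ζ) / csqrt ζ) :
    ∃ a, IsInverseBorel f a := by
  obtain ⟨p, hp⟩ := hF
  have hsum := hasFPowerSeriesAt_iff'.1 hp
  have hsumneg : ∀ᶠ k in 𝓝 (0 : ℂ), HasSum (fun n => (-k - 0) ^ n • p.coeff n) (F (-k)) :=
    (show Tendsto (fun k : ℂ => -k) (𝓝 0) (𝓝 0) from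
      (continuous_neg.tendsto' 0 0 neg_zero)).eventually hsum
  have hev : ∀ᶠ k in 𝓝 (0 : ℂ), HasSum (fun n => (k ^ 2) ^ n * p.coeff (2 * n)) (F k) := by
    filter_upwards [hsum, hsumneg, heven] with k h1 h2 h3
    rw [h3] at h2
    -- Averaging the series at k and -k removes the odd terms, and reindexing by n ↦ 2n loses
    -- nothing.
    have h4 := (h1.add h2).mul_left (1 / 2 : ℂ)
    have h5 : 1 / 2 * (F k + F k) = F k := by ring
    rw [h5] at h4
    rw [← (mul_right_injective₀ (two_ne_zero (α := ℕ))).hasSum_iff] at h4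
    · refine Eq.mp (congrArg (fun g => HasSum g _) (funext fun n => ?_)) h4
      simp only [Function.comp_apply, sub_zero, smul_eq_mul, (even_two_mul n).neg_pow, pow_mul]
      ring
    · intro n hn
      have hodd : Odd n := by
        rw [← Nat.not_even_iff_odd]
        rintro ⟨m, hm⟩
        exact hn ⟨m, by simp only; omega⟩
      simp [hodd.neg_pow]
  have hcs : Tendsto csqrt (𝓝[slitPlane] 0) (𝓝 0) := by
    have : ContinuousAt csqrt 0 :=
      continuousAt_cpow_const_of_re_pos (Or.inl (by simp)) (by norm_num)
    have h0 : csqrt 0 = 0 := by simp [csqrt]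
    rw [ContinuousAt, h0] at this
    exact this.mono_left nhdsWithin_le_nhds
  refine ⟨fun n => p.coeff (2 * n) * Complex.Gamma (n + 1 / 2), ?_⟩
  filter_upwards [hcs.eventually hev, hf, self_mem_nhdsWithin] with ζ h1 h2 hζ
  have hζ0 := slitPlane_ne_zero hζ
  rw [h2]
  have h3 := h1.div_const (csqrt ζ)
  refine Eq.mp (congrArg (fun g => HasSum g _) (funext fun n => ?_)) h3
  have hG : Complex.Gamma (n + 1 / 2) ≠ 0 := by
    refine Complex.Gamma_ne_zero_of_re_pos ?_
    simp only [add_re, natCast_re]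
    norm_num
    positivity
  rw [mul_div_cancel_right₀ _ hG, csqrt_sq, cpow_sub _ _ hζ0, cpow_natCast, csqrt]
  norm_num
  ring

/-! ### Watson's lemma -/

theorem integrableOn_rpow_mul_exp_neg_mul {s b : ℝ} (hs : -1 < s) (hb : 0 < b) :
    IntegrableOn (fun t : ℝ => t ^ s * Real.exp (-(b * t))) (Ioi 0) := by
  have := integrableOn_rpow_mul_exp_neg_mul_rpow hs one_pos hb
  simpa [Real.rpow_one, neg_mul] using this

/-- Euler's integral for a complex scale. -/
theorem integral_cpow_mul_exp_neg_mul_of_re_pos {a : ℝ} (ha : 0 < a) {r : ℂ} (hr : 0 < r.re) :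
    ∫ t in Ioi (0 : ℝ), (t : ℂ) ^ ((a : ℂ) - 1) * exp (-(r * t)) =
      r ^ (-(a : ℂ)) * Complex.Gamma a := by
  have hU : IsOpen {r : ℂ | 0 < r.re} := isOpen_lt continuous_const continuous_re
  have hnorm : ∀ (r : ℂ) (t : ℝ), 0 < t →
      ‖(t : ℂ) ^ ((a : ℂ) - 1) * exp (-(r * t))‖ = t ^ (a - 1) * Real.exp (-(r.re * t)) := by
    intro r t ht
    rw [norm_mul, norm_cpow_eq_rpow_re_of_pos ht, norm_exp]
    simp
  -- Both sides are holomorphic in the scale, and for positive real scale the formula is the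
  -- classical Euler integral.
  refine eqOn_of_eventually_eq_ofReal (x₀ := 1) hU (convex_halfSpace_re_gt 0).isPreconnected
    (f := fun r : ℂ => ∫ t in Ioi (0 : ℝ), (t : ℂ) ^ ((a : ℂ) - 1) * exp (-(r * t)))
    (g := fun r => r ^ (-(a : ℂ)) * Complex.Gamma a) ?_ ?_ (by simp) ?_ hr
  · refine differentiableOn_integral_of_locally_dominated hU ?_ ?_ ?_
    · intro r _
      refine ContinuousOn.aestronglyMeasurable ?_ measurableSet_Ioi
      intro t ht
      refine ContinuousAt.continuousWithinAt (ContinuousAt.mul ?_ (by fun_prop))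
      exact (continuousAt_cpow_const (Or.inl (by simpa using ht))).comp
        continuous_ofReal.continuousAt
    · refine ae_of_all _ fun t => ?_
      fun_prop
    · intro r hr
      have hr' : 0 < r.re := hr
      refine ⟨r.re / 2, half_pos hr', fun t => t ^ (a - 1) * Real.exp (-(r.re / 2 * t)),
        integrableOn_rpow_mul_exp_neg_mul (by linarith) (half_pos hr'), ?_⟩
      filter_upwards [ae_restrict_mem measurableSet_Ioi] with t ht r' hr'
      have ht0 : (0 : ℝ) < t := ht
      rw [hnorm r' t ht0]
      have h1 := (abs_le.1 (abs_re_le_norm (r' - r))).1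
      have h2 := hr'.1
      rw [Metric.mem_ball, dist_eq_norm] at h2
      rw [sub_re] at h1
      have h3 : r.re / 2 ≤ r'.re := by linarith
      have h4 : 0 ≤ t ^ (a - 1) := Real.rpow_nonneg ht0.le _
      gcongr
  · intro r hr
    exact ((differentiableAt_id.cpow_const (c := -(a : ℂ)) (Or.inl hr)).mul_const
      _).differentiableWithinAt
  · filter_upwards [lt_mem_nhds one_pos] with x hx
    rw [integral_cpow_mul_exp_neg_mul_Ioi (by simpa using ha) hx, one_div, inv_cpow, cpow_neg]
    rw [arg_ofReal_of_nonneg hx.le]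
    exact Real.pi_pos.ne

theorem cpow_ray {t θ : ℝ} (ht : 0 < t) (hθ : -Real.pi < θ) (hθ' : θ ≤ Real.pi) (s : ℂ) :
    ((t : ℂ) * exp (θ * I)) ^ s = (t : ℂ) ^ s * exp (θ * I * s) := by
  have h1 : log ((t : ℂ) * exp (θ * I)) = log t + θ * I := by
    rw [log_ofReal_mul ht (exp_ne_zero _), log_exp (by simpa using hθ) (by simpa using hθ'),
      ofReal_log ht.le]
  have h0 : (t : ℂ) ≠ 0 := by exact_mod_cast ht.ne'
  rw [cpow_def_of_ne_zero (mul_ne_zero h0 (exp_ne_zero _)), cpow_def_of_ne_zero h0, h1, ← exp_add]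
  ring_nf

theorem laplaceIntegrand_cpow {t θ : ℝ} (ht : 0 < t) (hθ : -Real.pi < θ) (hθ' : θ ≤ Real.pi)
    (C : ℂ) (n : ℕ) :
    laplaceIntegrand θ (fun ζ => ζ ^ ((n : ℂ) - 1 / 2)) C t =
      exp (θ * I * (n + 1 / 2)) *
        ((t : ℂ) ^ ((((n : ℝ) + 1 / 2 : ℝ) : ℂ) - 1) * exp (-(C * exp (θ * I) * t))) := by
  rw [laplaceIntegrand, cpow_ray ht hθ hθ']
  have h1 : exp (θ * I * (n + 1 / 2)) = exp (θ * I * ((n : ℂ) - 1 / 2)) * exp (θ * I) := by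
    rw [← exp_add]; congr 1; ring
  have h2 : (((n : ℝ) + 1 / 2 : ℝ) : ℂ) - 1 = (n : ℂ) - 1 / 2 := by push_cast; ring
  have h3 : -C * (t * exp (θ * I)) = -(C * exp (θ * I) * t) := by ring
  rw [h1, h2, h3]; ring

/-- The condition on arg C + θ gives convergence and also log(C e^{iθ}) = log C + iθ; hence the
phase of the ray cancels and the principal power of C is left for every direction. -/
theorem laplace_cpow {θ : ℝ} (hθ : -Real.pi < θ) (hθ' : θ ≤ Real.pi) {C : ℂ}
    (harg : |arg C + θ| < Real.pi / 2) (hC : C ≠ 0) (n : ℕ) :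
    laplace θ (fun ζ => ζ ^ ((n : ℂ) - 1 / 2)) C =
      Complex.Gamma (n + 1 / 2) * C ^ (-(n : ℂ) - 1 / 2) := by
  have hpi := Real.pi_pos
  have hlog : log (C * exp (θ * I)) = log C + θ * I := by
    have h1 : C * exp (θ * I) = exp (log C + θ * I) := by rw [exp_add, exp_log hC]
    have h2 : (log C + θ * I).im = arg C + θ := by simp [log_im]
    rw [h1, log_exp]
    · rw [h2]; linarith [(abs_lt.1 harg).1]
    · rw [h2]; linarith [(abs_lt.1 harg).2]
  have hr0 : C * exp (θ * I) ≠ 0 := mul_ne_zero hC (exp_ne_zero _)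
  have hr : 0 < (C * exp (θ * I)).re := by
    have h1 : |arg (C * exp (θ * I))| < Real.pi / 2 := by
      rw [← log_im, hlog]; simpa [log_im] using harg
    rcases abs_arg_lt_pi_div_two_iff.1 h1 with h | h
    · exact h
    · exact absurd h hr0
  have ha : (0 : ℝ) < n + 1 / 2 := by positivity
  rw [laplace, setIntegral_congr_fun measurableSet_Ioi
    (fun t ht => laplaceIntegrand_cpow ht hθ hθ' C n), integral_const_mul,
    integral_cpow_mul_exp_neg_mul_of_re_pos ha hr, cpow_def_of_ne_zero hr0, hlog,
    cpow_def_of_ne_zero hC]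
  have h4 : exp (θ * I * (n + 1 / 2)) * exp ((log C + θ * I) * -(((n : ℝ) + 1 / 2 : ℝ) : ℂ)) =
      exp (log C * (-(n : ℂ) - 1 / 2)) := by
    rw [← exp_add]; congr 1; push_cast; ring
  have h5 : (((n : ℝ) + 1 / 2 : ℝ) : ℂ) = (n : ℂ) + 1 / 2 := by push_cast; ring
  rw [← mul_assoc, h4, h5, mul_comm]

/-- Recasts the bounds of the germ in the single-power form used in Watson's lemma, at the price of
a factor e^t. -/
theorem one_add_rpow_neg_half_le {t : ℝ} (ht : 0 < t) :
    1 + t ^ (-(1 / 2) : ℝ) ≤ 2 * (t ^ (-(1 / 2) : ℝ) * Real.exp t) := by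
  set q := t ^ (-(1 / 2) : ℝ) with hq
  have hq0 : 0 < q := Real.rpow_pos_of_pos ht _
  have hq2 : q ^ 2 * t = 1 := by
    rw [hq, ← Real.rpow_natCast, ← Real.rpow_mul ht.le]
    norm_num
    rw [Real.rpow_neg_one, inv_mul_cancel₀ ht.ne']
  have h1 : 1 + t ≤ Real.exp t := by linarith [Real.add_one_le_exp t]
  have h2 : 1 ≤ q * (1 + t) := by
    have h3 : 1 ≤ (q * (1 + t)) ^ 2 := by nlinarith [mul_pos (pow_pos hq0 2) (mul_pos ht ht)]
    have h4 : 0 ≤ q * (1 + t) := by positivity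
    nlinarith
  have h5 : q * (1 + t) ≤ q * Real.exp t := by gcongr
  have h6 : q ≤ q * (1 + t) := by nlinarith
  linarith

/-- The remainders of the expansion of `f` on a ray. -/
theorem exists_norm_remainder_le {θ M b : ℝ} (hb : 0 ≤ b) (hθ : 0 < θ) (hθ' : θ < Real.pi)
    {f : ℂ → ℂ} {a : ℕ → ℂ} (hB : IsInverseBorel f a)
    (hbound : ∀ t : ℝ, 0 < t →
      ‖f (t * exp (θ * I))‖ ≤ M * (t ^ (-(1 / 2) : ℝ) * Real.exp (b * t))) (N : ℕ) :
    ∃ K, ∀ t : ℝ, 0 < t → ‖f (t * exp (θ * I)) - ∑ n ∈ Finset.range N,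
      a n / Complex.Gamma (n + 1 / 2) * (t * exp (θ * I)) ^ ((n : ℂ) - 1 / 2)‖ ≤
        K * (t ^ N * (t ^ (-(1 / 2) : ℝ) * Real.exp (b * t))) := by
  set c : ℕ → ℂ := fun n => a n / Complex.Gamma (n + 1 / 2) with hc
  have hnorm : ∀ (n : ℕ) (t : ℝ), 0 < t →
      ‖c n * (t * exp (θ * I)) ^ ((n : ℂ) - 1 / 2)‖ = ‖c n‖ * (t ^ n * t ^ (-(1 / 2) : ℝ)) := by
    intro n t ht
    rw [norm_mul, cpow_ray ht (by linarith [Real.pi_pos]) hθ'.le, norm_mul,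
      norm_cpow_eq_rpow_re_of_pos ht, norm_exp]
    have h1 : (θ * I * ((n : ℂ) - 1 / 2)).re = 0 := by simp
    have h2 : ((n : ℂ) - 1 / 2).re = n + -(1 / 2) := by simp; ring
    rw [h1, h2, Real.exp_zero, mul_one, Real.rpow_add ht, Real.rpow_natCast]
  have hray : Tendsto (fun t : ℝ => (t : ℂ) * exp (θ * I)) (𝓝[>] 0) (𝓝[slitPlane] 0) := by
    refine tendsto_nhdsWithin_of_tendsto_nhds_of_eventually_within _ ?_ ?_
    · refine Tendsto.mono_left ?_ nhdsWithin_le_nhds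
      exact (continuous_ofReal.mul continuous_const).tendsto' _ _ (by simp)
    · filter_upwards [self_mem_nhdsWithin] with t ht
      have ht0 : (0 : ℝ) < t := ht
      right
      rw [im_ofReal_mul, exp_ofReal_mul_I_im]
      exact (mul_pos ht0 (Real.sin_pos_of_pos_of_lt_pi hθ hθ')).ne'
  obtain ⟨t₀, ht₀, hsum⟩ : ∃ t₀ : ℝ, 0 < t₀ ∧ ∀ t : ℝ, 0 < t → t ≤ t₀ →
      HasSum (fun n : ℕ => c n * (t * exp (θ * I)) ^ ((n : ℂ) - 1 / 2)) (f (t * exp (θ * I))) := by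
    have h1 := hray.eventually hB
    rw [eventually_nhdsWithin_iff, Metric.eventually_nhds_iff] at h1
    obtain ⟨r, hr, h2⟩ := h1
    refine ⟨r / 2, half_pos hr, fun t ht ht2 => h2 ?_ ht⟩
    rw [dist_zero_right, Real.norm_of_nonneg ht.le]
    linarith
  -- The terms of a convergent series are bounded; this is a Cauchy estimate for the coefficients at
  -- radius t₀.
  obtain ⟨B, hBd⟩ : ∃ B, ∀ n, ‖c n‖ * (t₀ ^ n * t₀ ^ (-(1 / 2) : ℝ)) ≤ B := by
    have h1 := (hsum t₀ ht₀ le_rfl).summable.tendsto_atTop_zero.norm.bddAbove_range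
    obtain ⟨B, hB⟩ := h1
    refine ⟨B, fun n => ?_⟩
    rw [← hnorm n t₀ ht₀]
    exact hB ⟨n, rfl⟩
  set q₀ := t₀ ^ (-(1 / 2) : ℝ) with hq₀
  have hq₀0 : 0 < q₀ := Real.rpow_pos_of_pos ht₀ _
  -- Half the radius makes the tail of the series comparable to a geometric series of ratio 1/2.
  set t₁ := t₀ / 2 with ht₁
  have ht₁0 : 0 < t₁ := half_pos ht₀
  have hB0 : 0 ≤ B := le_trans (by positivity) (hBd 0)
  have hM0 : 0 ≤ M := by
    have h1 := (norm_nonneg _).trans (hbound 1 one_pos)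
    rw [Real.one_rpow, one_mul, mul_one] at h1
    exact nonneg_of_mul_nonneg_left h1 (Real.exp_pos _)
  set K₁ := 2 * (B / q₀ / t₀ ^ N) with hK₁
  set K₂ := (M + ∑ n ∈ Finset.range N, ‖c n‖ * t₁ ^ n) / t₁ ^ N with hK₂
  have hK₁0 : 0 ≤ K₁ := by positivity
  have hK₂0 : 0 ≤ K₂ := by positivity
  refine ⟨K₁ + K₂, fun t ht => ?_⟩
  set q := t ^ (-(1 / 2) : ℝ) with hq
  have hq0 : 0 < q := Real.rpow_pos_of_pos ht _
  have he1 : 1 ≤ Real.exp (b * t) := Real.one_le_exp (by positivity)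
  rcases le_total t t₁ with htt | htt
  · have h1 := (hasSum_nat_add_iff' N).2 (hsum t ht (by linarith))
    have hgeo : HasSum (fun n : ℕ => B / q₀ / t₀ ^ N * t ^ N * q * (1 / 2 : ℝ) ^ n)
        (B / q₀ / t₀ ^ N * t ^ N * q * 2) := hasSum_geometric_two.mul_left _
    have h2 : ∀ n, ‖c (n + N) * (t * exp (θ * I)) ^ (((n + N : ℕ) : ℂ) - 1 / 2)‖ ≤
        B / q₀ / t₀ ^ N * t ^ N * q * (1 / 2 : ℝ) ^ n := by
      intro n
      rw [hnorm _ t ht]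
      have h3 : ‖c (n + N)‖ ≤ B / q₀ / t₀ ^ (n + N) := by
        rw [le_div_iff₀ (by positivity), le_div_iff₀ hq₀0]
        have := hBd (n + N)
        linarith
      have h4 : t ^ n ≤ (t₀ / 2) ^ n := by gcongr
      calc ‖c (n + N)‖ * (t ^ (n + N) * q) ≤
          B / q₀ / t₀ ^ (n + N) * ((t₀ / 2) ^ n * t ^ N * q) := by
            rw [pow_add t]; gcongr
        _ = _ := by
            rw [pow_add, div_pow, div_pow, one_pow]
            field_simp
    have h3 := h1.norm_le_of_bounded hgeo h2
    calc _ ≤ _ := h3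
      _ = K₁ * (t ^ N * q) := by rw [hK₁]; ring
      _ ≤ (K₁ + K₂) * (t ^ N * (q * Real.exp (b * t))) := by
          have h5 : t ^ N * q ≤ t ^ N * (q * Real.exp (b * t)) := by
            gcongr
            exact le_mul_of_one_le_right hq0.le he1
          have h6 : 0 ≤ t ^ N * (q * Real.exp (b * t)) := by positivity
          nlinarith
  -- Away from 0 no cancellation is needed: each power t^n with n ≤ N is dominated by a multiple of
  -- t^N, so the function and the subtracted terms are estimated separately.
  · have hpow : ∀ n ≤ N, t ^ n ≤ t₁ ^ n / t₁ ^ N * t ^ N := by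
      intro n hn
      have h1 : (t / t₁) ^ n ≤ (t / t₁) ^ N :=
        pow_le_pow_right₀ ((one_le_div ht₁0).2 htt) hn
      rw [div_pow t, div_pow t, div_le_div_iff₀ (by positivity) (by positivity)] at h1
      rw [div_mul_eq_mul_div, le_div_iff₀ (by positivity)]
      linarith
    have h1 : ‖f (t * exp (θ * I))‖ ≤ M / t₁ ^ N * (t ^ N * (q * Real.exp (b * t))) := by
      refine (hbound t ht).trans ?_
      have h2 := hpow 0 (Nat.zero_le _)
      rw [pow_zero, pow_zero] at h2
      calc M * (q * Real.exp (b * t)) = M * 1 * (q * Real.exp (b * t)) := by ring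
        _ ≤ M * (1 / t₁ ^ N * t ^ N) * (q * Real.exp (b * t)) := by gcongr
        _ = _ := by ring
    have h3 : ‖∑ n ∈ Finset.range N, c n * (t * exp (θ * I)) ^ ((n : ℂ) - 1 / 2)‖ ≤
        (∑ n ∈ Finset.range N, ‖c n‖ * t₁ ^ n) / t₁ ^ N * (t ^ N * (q * Real.exp (b * t))) := by
      refine (norm_sum_le _ _).trans ?_
      rw [Finset.sum_div, Finset.sum_mul]
      refine Finset.sum_le_sum fun n hn => ?_
      rw [hnorm n t ht]
      have h4 := hpow n (Finset.mem_range.1 hn).le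
      calc ‖c n‖ * (t ^ n * q) ≤ ‖c n‖ * ((t₁ ^ n / t₁ ^ N * t ^ N) * (q * Real.exp (b * t))) := by
            gcongr
            exact le_mul_of_one_le_right hq0.le he1
        _ = _ := by ring
    refine (norm_sub_le _ _).trans ((add_le_add h1 h3).trans ?_)
    rw [← add_mul, ← add_div]
    have h6 : 0 ≤ t ^ N * (q * Real.exp (b * t)) := by positivity
    exact mul_le_mul_of_nonneg_right (le_add_of_nonneg_left hK₁0) h6

/-- Watson's lemma. -/
theorem hasAsymptoticExpansion_of_isInverseBorel {θ σ M b R : ℝ} (hb : 0 ≤ b) (hθ : 0 < θ)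
    (hθ' : θ < Real.pi) (hσ : 0 < σ) {f A : ℂ → ℂ} {a : ℕ → ℂ} {S : Set ℂ}
    (hB : IsInverseBorel f a) (hcont : ContinuousOn (fun t : ℝ => f (t * exp (θ * I))) (Ioi 0))
    (hbound : ∀ t : ℝ, 0 < t →
      ‖f (t * exp (θ * I))‖ ≤ M * (t ^ (-(1 / 2) : ℝ) * Real.exp (b * t)))
    (hS : ∀ C ∈ S, σ * ‖C‖ ≤ (C * exp (θ * I)).re)
    (harg : ∀ C ∈ S, |arg C + θ| < Real.pi / 2)
    (hA : ∀ C ∈ S, R ≤ ‖C‖ → A C = laplace θ f C) : HasAsymptoticExpansion S A a := by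
  intro N
  obtain ⟨K, hK⟩ := exists_norm_remainder_le hb hθ hθ' hB hbound N
  set c : ℕ → ℂ := fun n => a n / Complex.Gamma (n + 1 / 2) with hc
  set ρ : ℝ → ℂ := fun t => f (t * exp (θ * I)) - ∑ n ∈ Finset.range N,
      c n * (t * exp (θ * I)) ^ ((n : ℂ) - 1 / 2) with hρ
  have hK0 : 0 ≤ K := by
    have h1 := (norm_nonneg _).trans (hK 1 one_pos)
    rw [Real.one_rpow, one_pow, one_mul, one_mul] at h1
    exact nonneg_of_mul_nonneg_left h1 (Real.exp_pos _)
  have hpi := Real.pi_pos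
  have hpowc : ∀ n : ℕ, ContinuousOn (fun t : ℝ => ((t : ℂ) * exp (θ * I)) ^ ((n : ℂ) - 1 / 2))
      (Ioi 0) := by
    intro n t ht
    have ht0 : (0 : ℝ) < t := ht
    refine ContinuousAt.continuousWithinAt ?_
    refine ContinuousAt.comp (g := fun ζ : ℂ => ζ ^ ((n : ℂ) - 1 / 2))
      (f := fun t : ℝ => (t : ℂ) * exp (θ * I)) (continuousAt_cpow_const ?_) (by fun_prop)
    right
    rw [im_ofReal_mul, exp_ofReal_mul_I_im]
    exact (mul_pos ht0 (Real.sin_pos_of_pos_of_lt_pi hθ hθ')).ne'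
  have hρc : ContinuousOn ρ (Ioi 0) :=
    hcont.sub (continuousOn_finsetSum _ fun n _ => continuousOn_const.mul (hpowc n))
  refine IsBigO.of_bound (K * Real.Gamma (N + 1 / 2) * (2 / σ) ^ ((N : ℝ) + 1 / 2)) ?_
  rw [eventually_inf_principal]
  -- With 2b + 1 ≤ σ‖C‖ the decay rate that remains after the growth e^{bt} is at least σ‖C‖/2; this
  -- is where 2/σ in the constant comes from.
  have hlarge : ∀ᶠ C : ℂ in Bornology.cobounded ℂ, max (max R 1) ((2 * b + 1) / σ) ≤ ‖C‖ :=
    tendsto_norm_cobounded_atTop.eventually_ge_atTop _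
  filter_upwards [hlarge] with C hCl hCS
  have hC1 : 1 ≤ ‖C‖ := ((le_max_right _ _).trans (le_max_left _ _)).trans hCl
  have hC0 : C ≠ 0 := norm_pos_iff.1 (by linarith)
  have hCσ : 2 * b + 1 ≤ σ * ‖C‖ := by
    have := (le_max_right _ _).trans hCl
    rwa [div_le_iff₀ hσ, mul_comm ‖C‖] at this
  set r := C * exp (θ * I) with hr
  have hre : σ * ‖C‖ ≤ r.re := hS C hCS
  set d := r.re - b with hd
  have hd0 : 0 < d := by linarith
  have hexpn : ∀ t : ℝ, ‖exp (-C * (t * exp (θ * I)))‖ = Real.exp (-(r.re * t)) := by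
    intro t
    rw [norm_exp]
    congr 1
    have : -C * (t * exp (θ * I)) = -(r * t) := by rw [hr]; ring
    rw [this, neg_re, re_mul_ofReal]
  have hcontE : ∀ g : ℝ → ℂ, ContinuousOn g (Ioi 0) →
      ContinuousOn (fun t : ℝ => exp (-C * (t * exp (θ * I))) * g t * exp (θ * I)) (Ioi 0) :=
    fun g hg => (ContinuousOn.mul (by fun_prop) hg).mul continuousOn_const
  have hrem : ∀ t : ℝ, 0 < t → ‖exp (-C * (t * exp (θ * I))) * ρ t * exp (θ * I)‖ ≤
      K * (t ^ ((N : ℝ) + 1 / 2 - 1) * Real.exp (-(d * t))) := by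
    intro t ht
    rw [norm_mul, norm_mul, hexpn, norm_exp_ofReal_mul_I, mul_one]
    have h1 : t ^ ((N : ℝ) + 1 / 2 - 1) = t ^ N * t ^ (-(1 / 2) : ℝ) := by
      rw [← Real.rpow_natCast, ← Real.rpow_add ht]; ring_nf
    have h2 : Real.exp (-(d * t)) = Real.exp (-(r.re * t)) * Real.exp (b * t) := by
      rw [← Real.exp_add, hd]; ring_nf
    calc _ ≤ Real.exp (-(r.re * t)) *
          (K * (t ^ N * (t ^ (-(1 / 2) : ℝ) * Real.exp (b * t)))) := by
          gcongr; exact hK t ht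
      _ = _ := by rw [h1, h2]; ring
  have hint0 : IntegrableOn (fun t : ℝ => K * (t ^ ((N : ℝ) + 1 / 2 - 1) * Real.exp (-(d * t))))
      (Ioi 0) := (integrableOn_rpow_mul_exp_neg_mul (by
        have : (0 : ℝ) ≤ N := N.cast_nonneg
        linarith) hd0).const_mul K
  have hint1 : IntegrableOn (fun t : ℝ => exp (-C * (t * exp (θ * I))) * ρ t * exp (θ * I))
      (Ioi 0) := by
    refine hint0.mono' ((hcontE ρ hρc).aestronglyMeasurable measurableSet_Ioi) ?_
    filter_upwards [ae_restrict_mem measurableSet_Ioi] with t ht using hrem t ht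
  have hint2 : ∀ n ∈ Finset.range N, IntegrableOn (fun t : ℝ =>
      c n * laplaceIntegrand θ (fun ζ => ζ ^ ((n : ℂ) - 1 / 2)) C t) (Ioi 0) := by
    intro n _
    refine Integrable.const_mul ?_ _
    have hs : (-1 : ℝ) < (n : ℝ) + 1 / 2 - 1 := by
      have : (0 : ℝ) ≤ n := n.cast_nonneg
      linarith
    refine (integrableOn_rpow_mul_exp_neg_mul hs (b := r.re) (by linarith)).mono'
      ((hcontE _ (hpowc n)).aestronglyMeasurable measurableSet_Ioi) ?_
    filter_upwards [ae_restrict_mem measurableSet_Ioi] with t ht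
    have ht0 : (0 : ℝ) < t := ht
    rw [laplaceIntegrand, norm_mul, norm_mul, hexpn, norm_exp_ofReal_mul_I, mul_one,
      cpow_ray ht0 (by linarith) hθ'.le, norm_mul, norm_cpow_eq_rpow_re_of_pos ht0, norm_exp]
    have h1 : (θ * I * ((n : ℂ) - 1 / 2)).re = 0 := by simp
    have h2 : ((n : ℂ) - 1 / 2).re = (n : ℝ) + 1 / 2 - 1 := by simp; ring
    rw [h1, h2, Real.exp_zero, mul_one, mul_comm]
  have hsplit : ∀ t : ℝ, laplaceIntegrand θ f C t =
      (∑ n ∈ Finset.range N, c n * laplaceIntegrand θ (fun ζ => ζ ^ ((n : ℂ) - 1 / 2)) C t) +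
        exp (-C * (t * exp (θ * I))) * ρ t * exp (θ * I) := by
    intro t
    simp only [laplaceIntegrand, hρ]
    rw [mul_sub, sub_mul, Finset.mul_sum, Finset.sum_mul, add_comm, sub_add_eq_add_sub,
      eq_sub_iff_add_eq]
    congr 1
    refine Finset.sum_congr rfl fun n _ => by ring
  have hval : A C - ∑ n ∈ Finset.range N, a n * C ^ (-(n : ℂ) - 1 / 2) =
      ∫ t in Ioi (0 : ℝ), exp (-C * (t * exp (θ * I))) * ρ t * exp (θ * I) := by
    rw [hA C hCS (((le_max_left _ _).trans (le_max_left _ _)).trans hCl), laplace]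
    simp_rw [hsplit]
    rw [integral_add (integrable_finsetSum _ hint2) hint1, integral_finsetSum _ hint2,
      add_sub_right_comm, add_eq_right, sub_eq_zero]
    refine Finset.sum_congr rfl fun n _ => ?_
    have hG : Complex.Gamma (n + 1 / 2) ≠ 0 := by
      refine Complex.Gamma_ne_zero_of_re_pos ?_
      simp only [add_re, natCast_re]
      norm_num
      positivity
    rw [integral_const_mul]
    have := laplace_cpow (by linarith) hθ'.le (harg C hCS) hC0 n
    rw [laplace] at this
    rw [this, ← mul_assoc, hc, div_mul_cancel₀ _ hG]
  rw [hval]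
  have hΓ := Real.integral_rpow_mul_exp_neg_mul_Ioi (a := (N : ℝ) + 1 / 2) (r := d)
    (by positivity) hd0
  calc _ ≤ ∫ t in Ioi (0 : ℝ), K * (t ^ ((N : ℝ) + 1 / 2 - 1) * Real.exp (-(d * t))) :=
        norm_integral_le_of_norm_le hint0 (by
          filter_upwards [ae_restrict_mem measurableSet_Ioi] with t ht using hrem t ht)
    _ = K * ((1 / d) ^ ((N : ℝ) + 1 / 2) * Real.Gamma (N + 1 / 2)) := by
        rw [integral_const_mul, hΓ]
    _ ≤ K * ((2 / σ * ‖C‖⁻¹) ^ ((N : ℝ) + 1 / 2) * Real.Gamma (N + 1 / 2)) := by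
        have hG0 : 0 < Real.Gamma (N + 1 / 2) := Real.Gamma_pos_of_pos (by positivity)
        have h1 : 1 / d ≤ 2 / σ * ‖C‖⁻¹ := by
          rw [← div_eq_mul_inv, div_div, div_le_div_iff₀ hd0 (by positivity)]
          linarith
        gcongr
    _ = _ := by
        rw [Real.mul_rpow (by positivity) (by positivity), Real.inv_rpow (norm_nonneg _),
          ← Real.rpow_neg (norm_nonneg _), Real.norm_of_nonneg (Real.rpow_nonneg (norm_nonneg _) _)]
        have : -((N : ℝ) + 1 / 2) = -(N : ℝ) - 1 / 2 := by ring
        rw [this]; ring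

/-! ### The derivative of `cos (arccos x / 3)` in the upper half-plane -/

/-- Splitting √(x²-1) into two principal roots makes it holomorphic in the upper half-plane, with
growth like x and boundary values on the whole real line. -/
def upperSqrt (x : ℂ) : ℂ := csqrt (x - 1) * csqrt (x + 1)

def upperExp (x : ℂ) : ℂ := x + upperSqrt x

/-- The continuation to the upper half-plane of `x ↦ c'(-x)`, where `c (cosh u) = cosh (u/3)`. -/
def upperSlope (x : ℂ) : ℂ := sinh ((Real.pi * I - log (upperExp x)) / 3) / (3 * upperSqrt x)

section

variable {x : ℂ}

theorem upperSqrt_sq : upperSqrt x ^ 2 = (x - 1) * (x + 1) := by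
  rw [upperSqrt, mul_pow, csqrt_sq, csqrt_sq]

theorem upperExp_mul : upperExp x * (x - upperSqrt x) = 1 := by
  rw [upperExp]
  linear_combination -upperSqrt_sq (x := x)

theorem upperExp_ne_zero : upperExp x ≠ 0 := left_ne_zero_of_mul_eq_one upperExp_mul

/-- Both roots have arguments in [0, π/2]. Consequently `upperExp` stays in the closed upper
half-plane, where the logarithm is continuous up to the negative axis. -/
theorem upperSqrt_im_nonneg (hx : 0 ≤ x.im) : 0 ≤ (upperSqrt x).im := by
  rw [upperSqrt, mul_im]
  have h1 := csqrt_im_nonneg (x := x - 1) (by simpa using hx)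
  have h2 := csqrt_im_nonneg (x := x + 1) (by simpa using hx)
  have h3 := csqrt_re_nonneg (x - 1)
  have h4 := csqrt_re_nonneg (x + 1)
  positivity

theorem upperSqrt_ne_zero (h1 : x ≠ 1) (h2 : x ≠ -1) : upperSqrt x ≠ 0 :=
  mul_ne_zero (csqrt_ne_zero (sub_ne_zero.2 h1))
    (csqrt_ne_zero (by rwa [← sub_neg_eq_add, sub_ne_zero]))

theorem differentiableAt_upperSlope (hx : 0 < x.im) : DifferentiableAt ℂ upperSlope x := by
  have h1 : x ≠ 1 := fun h => by rw [h] at hx; simp at hx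
  have h2 : x ≠ -1 := fun h => by rw [h] at hx; simp at hx
  have hS : DifferentiableAt ℂ upperSqrt x := by
    refine DifferentiableAt.mul ?_ ?_
    · exact DifferentiableAt.comp (g := csqrt) (f := fun x : ℂ => x - 1) x
        (differentiableAt_csqrt (Or.inr (by simpa using hx.ne'))) (by fun_prop)
    · exact DifferentiableAt.comp (g := csqrt) (f := fun x : ℂ => x + 1) x
        (differentiableAt_csqrt (Or.inr (by simpa using hx.ne'))) (by fun_prop)
  have hX : DifferentiableAt ℂ upperExp x := differentiableAt_id.add hS
  have hL : DifferentiableAt ℂ (fun x => log (upperExp x)) x := by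
    refine hX.clog (Or.inr ?_)
    rw [upperExp, add_im]
    linarith [upperSqrt_im_nonneg hx.le]
  have harg : DifferentiableAt ℂ (fun x => (Real.pi * I - log (upperExp x)) / 3) x :=
    (hL.const_sub _).div_const 3
  exact (differentiable_sinh.differentiableAt.comp x harg).div (hS.const_mul 3)
    (mul_ne_zero (by norm_num) (upperSqrt_ne_zero h1 h2))

theorem continuousWithinAt_upperSlope (h1 : x ≠ 1) (h2 : x ≠ -1) :
    ContinuousWithinAt upperSlope {y | 0 ≤ y.im} x := by
  have hS : ContinuousWithinAt upperSqrt {y : ℂ | 0 ≤ y.im} x := by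
    refine ContinuousWithinAt.mul ?_ ?_
    · exact ContinuousWithinAt.comp (g := csqrt) (f := fun x : ℂ => x - 1)
        (t := {y : ℂ | 0 ≤ y.im}) (continuousWithinAt_csqrt _) (by fun_prop)
        (fun y hy => by simpa using hy)
    · exact ContinuousWithinAt.comp (g := csqrt) (f := fun x : ℂ => x + 1)
        (t := {y : ℂ | 0 ≤ y.im}) (continuousWithinAt_csqrt _) (by fun_prop)
        (fun y hy => by simpa using hy)
  have hX : ContinuousWithinAt upperExp {y : ℂ | 0 ≤ y.im} x := continuousWithinAt_id.add hS
  have hXim : ∀ y : ℂ, 0 ≤ y.im → 0 ≤ (upperExp y).im := by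
    intro y hy
    rw [upperExp, add_im]
    linarith [upperSqrt_im_nonneg hy]
  have hL : ContinuousWithinAt (fun x => log (upperExp x)) {y : ℂ | 0 ≤ y.im} x := by
    by_cases hs : upperExp x ∈ slitPlane
    · exact (continuousAt_clog hs).comp_continuousWithinAt hX
    · rw [mem_slitPlane_iff, not_or, not_lt, not_not] at hs
      have hre : (upperExp x).re < 0 :=
        lt_of_le_of_ne hs.1 fun h => upperExp_ne_zero (Complex.ext h hs.2)
      exact ContinuousWithinAt.comp (g := log) (t := {y : ℂ | 0 ≤ y.im})
        (continuousWithinAt_log_of_re_neg_of_im_zero hre hs.2) hX (fun y hy => hXim y hy)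
  have harg : ContinuousWithinAt (fun x => (Real.pi * I - log (upperExp x)) / 3)
      {y : ℂ | 0 ≤ y.im} x := (continuousWithinAt_const.sub hL).div_const 3
  exact (Complex.continuous_sinh.continuousAt.comp_continuousWithinAt harg).div
    (continuousWithinAt_const.mul hS) (mul_ne_zero (by norm_num) (upperSqrt_ne_zero h1 h2))

theorem norm_upperSqrt : ‖upperSqrt x‖ = √‖x - 1‖ * √‖x + 1‖ := by
  rw [upperSqrt, norm_mul, ← norm_csqrt_sq (x - 1), ← norm_csqrt_sq (x + 1),
    Real.sqrt_sq (norm_nonneg _), Real.sqrt_sq (norm_nonneg _)]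

theorem norm_upperSqrt_le : ‖upperSqrt x‖ ≤ ‖x‖ + 1 := by
  refine (abs_le_of_sq_le_sq' ?_ (by positivity)).2
  rw [← norm_pow, upperSqrt_sq, norm_mul, sq]
  have h1 := norm_sub_le x 1
  have h2 := norm_add_le x 1
  rw [norm_one] at h1 h2
  gcongr

/-- The hyperbolic sine grows like |x|^{1/3}. Of the two factors of `upperSqrt` the larger one
contributes |x|^{-1/2} and the other the square-root singularity. The total order is |x|^{-2/3} at
infinity, integrable against r^C exactly when C < -1/3. -/
theorem norm_upperSlope_le :
    ‖upperSlope x‖ ≤ 2 * ((1 + ‖x‖) ^ (-(1 / 6) : ℝ) *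
      (‖x - 1‖ ^ (-(1 / 2) : ℝ) + ‖x + 1‖ ^ (-(1 / 2) : ℝ))) := by
  set N := 1 + ‖x‖ with hN
  have hN1 : 1 ≤ N := by linarith [norm_nonneg x]
  have hN0 : 0 < N := by linarith
  have hX : ‖upperExp x‖ ≤ 2 * N := by
    refine (norm_add_le _ _).trans ?_
    linarith [norm_upperSqrt_le (x := x)]
  have hX' : (2 * N)⁻¹ ≤ ‖upperExp x‖ := by
    have h1 := congrArg norm (upperExp_mul (x := x))
    rw [norm_mul, norm_one] at h1
    have h2 : ‖x - upperSqrt x‖ ≤ 2 * N := by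
      refine (norm_sub_le _ _).trans ?_
      linarith [norm_upperSqrt_le (x := x)]
    rw [inv_le_iff_one_le_mul₀ (by linarith), ← h1]
    gcongr
  have hpos : 0 < ‖upperExp x‖ := norm_pos_iff.2 upperExp_ne_zero
  have hsinh : ‖sinh ((Real.pi * I - log (upperExp x)) / 3)‖ ≤ (2 * N) ^ (1 / 3 : ℝ) := by
    refine (norm_sinh_le_exp_abs_re _).trans ?_
    rw [Real.rpow_def_of_pos (by linarith)]
    refine Real.exp_le_exp.2 ?_
    have h1 : ((Real.pi * I - log (upperExp x)) / 3).re = -Real.log ‖upperExp x‖ / 3 := by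
      rw [div_ofNat_re, sub_re, log_re]; simp
    rw [h1, abs_div, abs_neg]
    have h2 : |Real.log ‖upperExp x‖| ≤ Real.log (2 * N) := by
      rw [abs_le]
      constructor
      · rw [← Real.log_inv]; exact Real.log_le_log (by positivity) hX'
      · exact Real.log_le_log hpos hX
    have h3 : |(3 : ℝ)| = 3 := by norm_num
    rw [h3]; linarith
  have h2N : (2 * N) ^ (1 / 3 : ℝ) ≤ 2 * N ^ (1 / 3 : ℝ) := by
    rw [Real.mul_rpow (by norm_num) hN0.le]
    have : (2 : ℝ) ^ (1 / 3 : ℝ) ≤ 2 := by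
      calc (2 : ℝ) ^ (1 / 3 : ℝ) ≤ 2 ^ (1 : ℝ) :=
            Real.rpow_le_rpow_of_exponent_le (by norm_num) (by norm_num)
        _ = 2 := Real.rpow_one 2
    have := Real.rpow_nonneg hN0.le (1 / 3)
    nlinarith
  -- the larger of `‖x - 1‖`, `‖x + 1‖` is at least `N / 2`
  have key : ∀ a b : ℝ, 0 ≤ a → N / 2 ≤ b →
      (√a * √b)⁻¹ ≤ 3 / 2 * (N ^ (-(1 / 2) : ℝ) * a ^ (-(1 / 2) : ℝ)) := by
    intro a b ha hb
    have hb0 : 0 < b := by linarith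
    rw [mul_inv, mul_comm, Real.sqrt_eq_rpow, Real.sqrt_eq_rpow, ← Real.rpow_neg ha,
      ← Real.rpow_neg hb0.le, ← mul_assoc]
    refine mul_le_mul_of_nonneg_right ?_ (Real.rpow_nonneg ha _)
    calc b ^ (-(1 / 2) : ℝ) ≤ (N / 2) ^ (-(1 / 2) : ℝ) :=
          Real.rpow_le_rpow_of_nonpos (by linarith) hb (by norm_num)
      _ = √2 * N ^ (-(1 / 2) : ℝ) := by
          rw [Real.div_rpow hN0.le (by norm_num), Real.rpow_neg (by norm_num : (0 : ℝ) ≤ 2),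
            div_inv_eq_mul, mul_comm, ← Real.sqrt_eq_rpow]
      _ ≤ 3 / 2 * N ^ (-(1 / 2) : ℝ) := by
          have : √2 ≤ 3 / 2 := by
            rw [Real.sqrt_le_left (by norm_num)]; norm_num
          gcongr
  have hinv : ‖upperSqrt x‖⁻¹ ≤ 3 / 2 * (N ^ (-(1 / 2) : ℝ) *
      (‖x - 1‖ ^ (-(1 / 2) : ℝ) + ‖x + 1‖ ^ (-(1 / 2) : ℝ))) := by
    have hp1 := Real.rpow_nonneg (norm_nonneg (x - 1)) (-(1 / 2))
    have hp2 := Real.rpow_nonneg (norm_nonneg (x + 1)) (-(1 / 2))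
    have hp3 := Real.rpow_nonneg hN0.le (-(1 / 2))
    have hsum1 : 2 * ‖x‖ ≤ ‖x - 1‖ + ‖x + 1‖ := by
      have := norm_add_le (x - 1) (x + 1)
      have h3 : x - 1 + (x + 1) = 2 * x := by ring
      rwa [h3, norm_mul, norm_ofNat] at this
    have hsum2 : 2 ≤ ‖x - 1‖ + ‖x + 1‖ := by
      have := norm_sub_le (x + 1) (x - 1)
      have h3 : x + 1 - (x - 1) = 2 := by ring
      rw [h3, norm_ofNat] at this
      linarith
    rw [norm_upperSqrt]
    rcases le_total ‖x - 1‖ ‖x + 1‖ with h | h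
    · refine (key ‖x - 1‖ ‖x + 1‖ (norm_nonneg _) (by linarith)).trans ?_
      gcongr
      linarith
    · rw [mul_comm (√_)]
      refine (key ‖x + 1‖ ‖x - 1‖ (norm_nonneg _) (by linarith)).trans ?_
      gcongr
      linarith
  rw [upperSlope, norm_div, norm_mul, norm_ofNat, div_eq_mul_inv, mul_inv]
  have h6 : N ^ (1 / 3 : ℝ) * N ^ (-(1 / 2) : ℝ) = N ^ (-(1 / 6) : ℝ) := by
    rw [← Real.rpow_add hN0]; norm_num
  calc _ ≤ (2 * N ^ (1 / 3 : ℝ)) * (3⁻¹ * (3 / 2 * (N ^ (-(1 / 2) : ℝ) *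
        (‖x - 1‖ ^ (-(1 / 2) : ℝ) + ‖x + 1‖ ^ (-(1 / 2) : ℝ))))) := by
        gcongr
        exact hsinh.trans h2N
    _ = N ^ (1 / 3 : ℝ) * N ^ (-(1 / 2) : ℝ) *
        (‖x - 1‖ ^ (-(1 / 2) : ℝ) + ‖x + 1‖ ^ (-(1 / 2) : ℝ)) := by ring
    _ ≤ _ := by
        rw [h6, ← mul_assoc]
        have := Real.rpow_nonneg hN0.le (-(1 / 6))
        have hp1 := Real.rpow_nonneg (norm_nonneg (x - 1)) (-(1 / 2))
        have hp2 := Real.rpow_nonneg (norm_nonneg (x + 1)) (-(1 / 2))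
        gcongr
        linarith

end

/-! ### Values on the real axis -/

theorem sqrt_cosh_sub_one_mul {u : ℝ} (hu : 0 < u) :
    √(Real.cosh u - 1) * √(Real.cosh u + 1) = Real.sinh u := by
  rw [← Real.sqrt_mul (by linarith [Real.one_le_cosh u])]
  have : (Real.cosh u - 1) * (Real.cosh u + 1) = Real.sinh u ^ 2 := by
    have := Real.cosh_sq u
    linear_combination this
  rw [this, Real.sqrt_sq (Real.sinh_pos_iff.2 hu).le]

theorem sqrt_one_sub_cos_mul {t : ℝ} (h0 : 0 < t) (h1 : t < Real.pi) :
    √(1 - Real.cos t) * √(1 + Real.cos t) = Real.sin t := by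
  rw [← Real.sqrt_mul (by linarith [Real.cos_le_one t])]
  have : (1 - Real.cos t) * (1 + Real.cos t) = Real.sin t ^ 2 := by
    have := Real.sin_sq_add_cos_sq t
    linear_combination -this
  rw [this, Real.sqrt_sq (Real.sin_pos_of_pos_of_lt_pi h0 h1).le]

theorem upperSlope_cosh {u : ℝ} (hu : 0 < u) :
    upperSlope ((Real.cosh u : ℝ) : ℂ) = sinh ((Real.pi * I - u) / 3) / (3 * Real.sinh u) := by
  have hS : upperSqrt ((Real.cosh u : ℝ) : ℂ) = (Real.sinh u : ℝ) := by
    have h1 : ((Real.cosh u : ℝ) : ℂ) - 1 = ((Real.cosh u - 1 : ℝ) : ℂ) := by simp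
    have h2 : ((Real.cosh u : ℝ) : ℂ) + 1 = ((Real.cosh u + 1 : ℝ) : ℂ) := by simp
    have := Real.one_le_cosh u
    rw [upperSqrt, h1, h2, csqrt_ofReal (by linarith), csqrt_ofReal (by linarith), ← ofReal_mul,
      sqrt_cosh_sub_one_mul hu]
  have hX : upperExp ((Real.cosh u : ℝ) : ℂ) = ((Real.exp u : ℝ) : ℂ) := by
    rw [upperExp, hS, ← ofReal_add, Real.cosh_add_sinh]
  rw [upperSlope, hS, hX, ← ofReal_log (Real.exp_pos u).le, Real.log_exp]

theorem upperSlope_cos {t : ℝ} (h0 : 0 < t) (h1 : t < Real.pi) :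
    upperSlope ((Real.cos t : ℝ) : ℂ) =
      ((Real.sin ((Real.pi - t) / 3) / (3 * Real.sin t) : ℝ) : ℂ) := by
  have hs := Real.sin_pos_of_pos_of_lt_pi h0 h1
  have hS : upperSqrt ((Real.cos t : ℝ) : ℂ) = I * (Real.sin t : ℝ) := by
    have e1 : ((Real.cos t : ℝ) : ℂ) - 1 = -((1 - Real.cos t : ℝ) : ℂ) := by push_cast; ring
    have e2 : ((Real.cos t : ℝ) : ℂ) + 1 = ((1 + Real.cos t : ℝ) : ℂ) := by push_cast; ring
    rw [upperSqrt, e1, e2, csqrt_neg_ofReal (by linarith [Real.cos_le_one t]),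
      csqrt_ofReal (by linarith [Real.neg_one_le_cos t]), mul_assoc, ← ofReal_mul,
      sqrt_one_sub_cos_mul h0 h1]
  have hX : upperExp ((Real.cos t : ℝ) : ℂ) = exp (t * I) := by
    rw [upperExp, hS, exp_mul_I]; push_cast; ring
  have hlog : log (exp (t * I)) = t * I := by
    rw [log_exp] <;> simp <;> linarith [Real.pi_pos]
  rw [upperSlope, hS, hX, hlog]
  have e3 : ((Real.pi : ℂ) * I - t * I) / 3 = ((Real.pi - t) / 3) * I := by ring
  rw [e3, sinh_mul_I]
  push_cast
  have hs' : sin (t : ℂ) ≠ 0 := by rw [← ofReal_sin]; exact_mod_cast hs.ne'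
  field_simp

/-- On this side the logarithm of -e^u has imaginary part π, its limit from above, which cancels the
πi in the definition; the boundary value is real. -/
theorem upperSlope_neg_cosh {u : ℝ} (hu : 0 < u) :
    upperSlope (-((Real.cosh u : ℝ) : ℂ)) =
      ((Real.sinh (u / 3) / (3 * Real.sinh u) : ℝ) : ℂ) := by
  have hsu := Real.sinh_pos_iff.2 hu
  have hS : upperSqrt (-((Real.cosh u : ℝ) : ℂ)) = -(Real.sinh u : ℝ) := by
    have h1 : -((Real.cosh u : ℝ) : ℂ) - 1 = -((Real.cosh u + 1 : ℝ) : ℂ) := by push_cast; ring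
    have h2 : -((Real.cosh u : ℝ) : ℂ) + 1 = -((Real.cosh u - 1 : ℝ) : ℂ) := by push_cast; ring
    have := Real.one_le_cosh u
    rw [upperSqrt, h1, h2, csqrt_neg_ofReal (by linarith), csqrt_neg_ofReal (by linarith),
      ← sqrt_cosh_sub_one_mul hu]
    push_cast
    linear_combination (√(Real.cosh u + 1) : ℂ) * (√(Real.cosh u - 1) : ℂ) * I_sq
  have hX : upperExp (-((Real.cosh u : ℝ) : ℂ)) = ((-Real.exp u : ℝ) : ℂ) := by
    rw [upperExp, hS, ← Real.cosh_add_sinh]; push_cast; ring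
  have hlog : log ((-Real.exp u : ℝ) : ℂ) = u + Real.pi * I := by
    have h1 : ((-Real.exp u : ℝ) : ℂ) = exp (u + Real.pi * I) := by
      rw [exp_add, exp_pi_mul_I]; push_cast; ring
    rw [h1, log_exp] <;> simp [Real.pi_pos]
  rw [upperSlope, hS, hX, hlog]
  have e3 : ((Real.pi : ℂ) * I - (u + Real.pi * I)) / 3 = -((u / 3 : ℝ) : ℂ) := by push_cast; ring
  rw [e3, sinh_neg]
  push_cast
  rw [mul_neg, neg_div_neg_eq]

/-! ### Rotation of the ray through the upper half-plane -/

/-- The majorant of the integrands `r ^ C * upperSlope (r e^{iφ} - κ)`. -/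
def slopeBound (C α r : ℝ) : ℝ := r ^ C * ((1 + r) ^ (-(1 / 6) : ℝ) * |r - α| ^ (-(1 / 2) : ℝ))

section

variable {C α : ℝ}

theorem slopeBound_nonneg {r : ℝ} (hr : 0 ≤ r) : 0 ≤ slopeBound C α r := by
  unfold slopeBound; positivity

theorem measurable_slopeBound : Measurable (slopeBound C α) := by
  unfold slopeBound; fun_prop

theorem slopeBound_le_of_le {r : ℝ} (hα : 0 < α) (hr : 2 * α < r) :
    slopeBound C α r ≤ 2 * r ^ (C - 2 / 3) := by
  have hr0 : 0 < r := by linarith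
  have h1 : (1 + r) ^ (-(1 / 6) : ℝ) ≤ r ^ (-(1 / 6) : ℝ) :=
    Real.rpow_le_rpow_of_nonpos hr0 (by linarith) (by norm_num)
  have h2 : |r - α| ^ (-(1 / 2) : ℝ) ≤ 2 * r ^ (-(1 / 2) : ℝ) := by
    calc |r - α| ^ (-(1 / 2) : ℝ) ≤ (r / 2 ^ 2) ^ (-(1 / 2) : ℝ) :=
          Real.rpow_le_rpow_of_nonpos (by positivity)
            (by rw [abs_of_pos (by linarith)]; linarith) (by norm_num)
      _ = 2 * r ^ (-(1 / 2) : ℝ) := by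
          rw [Real.div_rpow hr0.le (by norm_num), Real.rpow_neg (by norm_num : (0 : ℝ) ≤ 2 ^ 2),
            ← Real.sqrt_eq_rpow, Real.sqrt_sq (by norm_num), div_inv_eq_mul, mul_comm]
  calc slopeBound C α r ≤ r ^ C * (r ^ (-(1 / 6) : ℝ) * (2 * r ^ (-(1 / 2) : ℝ))) := by
        unfold slopeBound; gcongr
    _ = 2 * r ^ (C - 2 / 3) := by
        have : C - 2 / 3 = C + (-(1 / 6) + -(1 / 2)) := by ring
        rw [this, Real.rpow_add hr0, Real.rpow_add hr0]; ring

/-- Convergence at 0 needs C > -1, the singularity at α has exponent -1/2, and at infinity the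
exponent C - 2/3 is below -1. -/
theorem integrableOn_slopeBound (hα : 0 < α) (hC : -1 < C) (hC' : C < -1 / 3) :
    IntegrableOn (slopeBound C α) (Ioi 0) := by
  have hle1 : ∀ r : ℝ, 0 < r → (1 + r) ^ (-(1 / 6) : ℝ) ≤ 1 := fun r hr =>
    Real.rpow_le_one_of_one_le_of_nonpos (by linarith) (by norm_num)
  have hunion : Ioi (0 : ℝ) = Ioc 0 (α / 2) ∪ Ioc (α / 2) (2 * α) ∪ Ioi (2 * α) := by
    rw [Ioc_union_Ioc_eq_Ioc (by linarith) (by linarith), Ioc_union_Ioi_eq_Ioi (by linarith)]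
  rw [hunion]
  refine (IntegrableOn.union ?_ ?_).union ?_
  · have h1 : IntegrableOn (fun r : ℝ => r ^ C * (α / 2) ^ (-(1 / 2) : ℝ)) (Ioc 0 (α / 2)) :=
      ((intervalIntegrable_iff_integrableOn_Ioc_of_le (by linarith)).1
        (intervalIntegral.intervalIntegrable_rpow' hC)).mul_const _
    refine Integrable.mono' h1 measurable_slopeBound.aestronglyMeasurable ?_
    filter_upwards [ae_restrict_mem measurableSet_Ioc] with r hr
    rw [Real.norm_of_nonneg (slopeBound_nonneg hr.1.le)]
    have h3 : |r - α| ^ (-(1 / 2) : ℝ) ≤ (α / 2) ^ (-(1 / 2) : ℝ) :=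
      Real.rpow_le_rpow_of_nonpos (by positivity)
        (by rw [abs_of_neg (by linarith [hr.2])]; linarith [hr.2]) (by norm_num)
    have := hle1 r hr.1
    have h4 := Real.rpow_nonneg hr.1.le C
    unfold slopeBound
    refine mul_le_mul_of_nonneg_left ?_ h4
    calc _ ≤ 1 * (α / 2) ^ (-(1 / 2) : ℝ) := by gcongr
      _ = _ := one_mul _
  · have h1 : IntegrableOn (fun r : ℝ => (α / 2) ^ C * |r - α| ^ (-(1 / 2) : ℝ))
        (Ioc (α / 2) (2 * α)) := by
      refine Integrable.const_mul ?_ _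
      have h2 : IntegrableOn (fun r : ℝ => |r - α| ^ (-(1 / 2) : ℝ)) (Ioc (α / 2) α) := by
        have := (intervalIntegral.intervalIntegrable_rpow' (a := α / 2) (b := 0)
          (r := -(1 / 2)) (by norm_num)).comp_sub_left α
        rw [sub_zero, sub_half, intervalIntegrable_iff_integrableOn_Ioc_of_le (by linarith)] at this
        refine this.congr_fun (fun r hr => ?_) measurableSet_Ioc
        beta_reduce
        rw [abs_sub_comm, abs_of_nonneg (by linarith [hr.2])]
      have h3 : IntegrableOn (fun r : ℝ => |r - α| ^ (-(1 / 2) : ℝ)) (Ioc α (2 * α)) := by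
        have := (intervalIntegral.intervalIntegrable_rpow' (a := 0) (b := α)
          (r := -(1 / 2)) (by norm_num)).comp_sub_right α
        rw [zero_add, ← two_mul,
          intervalIntegrable_iff_integrableOn_Ioc_of_le (by linarith)] at this
        refine this.congr_fun (fun r hr => ?_) measurableSet_Ioc
        beta_reduce
        rw [abs_of_nonneg (by linarith [hr.1])]
      have := h2.union h3
      rwa [Ioc_union_Ioc_eq_Ioc (by linarith) (by linarith)] at this
    refine Integrable.mono' h1 measurable_slopeBound.aestronglyMeasurable ?_
    filter_upwards [ae_restrict_mem measurableSet_Ioc] with r hr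
    have hr0 : 0 < r := by linarith [hr.1]
    rw [Real.norm_of_nonneg (slopeBound_nonneg hr0.le)]
    have h3 : r ^ C ≤ (α / 2) ^ C :=
      Real.rpow_le_rpow_of_nonpos (by positivity) hr.1.le (by linarith)
    have h5 := hle1 r hr0
    unfold slopeBound
    refine mul_le_mul h3 ?_ (by positivity) (by positivity)
    calc _ ≤ 1 * |r - α| ^ (-(1 / 2) : ℝ) := by gcongr
      _ = _ := one_mul _
  · have h1 : IntegrableOn (fun r : ℝ => 2 * r ^ (C - 2 / 3)) (Ioi (2 * α)) :=
      (integrableOn_Ioi_rpow_of_lt (by linarith) (by linarith)).const_mul _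
    refine Integrable.mono' h1 measurable_slopeBound.aestronglyMeasurable ?_
    filter_upwards [ae_restrict_mem measurableSet_Ioi] with r hr
    rw [mem_Ioi] at hr
    rw [Real.norm_of_nonneg (slopeBound_nonneg (by linarith))]
    exact slopeBound_le_of_le hα hr

theorem tendsto_mul_slopeBound_nhdsGT (hα : 0 < α) (hC : -1 < C) :
    Tendsto (fun r => r * slopeBound C α r) (𝓝[>] 0) (𝓝 0) := by
  have h1 : Tendsto (fun r : ℝ => r ^ (C + 1) *
      ((1 + r) ^ (-(1 / 6) : ℝ) * |r - α| ^ (-(1 / 2) : ℝ))) (𝓝[>] 0)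
      (𝓝 (0 * ((1 + 0) ^ (-(1 / 6) : ℝ) * |0 - α| ^ (-(1 / 2) : ℝ)))) := by
    refine Tendsto.mul ?_ ?_
    · have : Tendsto (fun r : ℝ => r ^ (C + 1)) (𝓝[>] 0) (𝓝 (0 ^ (C + 1))) :=
        (Real.continuousAt_rpow_const 0 (C + 1) (Or.inr (by linarith))).continuousWithinAt
      rwa [Real.zero_rpow (by linarith)] at this
    · have h2 : ContinuousAt
          (fun r : ℝ => (1 + r) ^ (-(1 / 6) : ℝ) * |r - α| ^ (-(1 / 2) : ℝ)) 0 := by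
        refine ContinuousAt.mul ?_ ?_
        · exact ContinuousAt.rpow_const (by fun_prop) (Or.inl (by norm_num))
        · exact ContinuousAt.rpow_const (by fun_prop) (Or.inl (by simpa using hα.ne'))
      exact h2.continuousWithinAt
  rw [zero_mul] at h1
  refine h1.congr' ?_
  filter_upwards [self_mem_nhdsWithin] with r hr
  rw [Real.rpow_add_one (ne_of_gt hr), slopeBound]; ring

theorem tendsto_mul_slopeBound_atTop (hα : 0 < α) (hC' : C < -1 / 3) :
    Tendsto (fun r => r * slopeBound C α r) atTop (𝓝 0) := by
  have h1 : Tendsto (fun r : ℝ => 2 * r ^ (-(-1 / 3 - C))) atTop (𝓝 (2 * 0)) :=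
    (tendsto_rpow_neg_atTop (by linarith)).const_mul 2
  rw [mul_zero] at h1
  refine squeeze_zero' ?_ ?_ h1
  · filter_upwards [eventually_gt_atTop 0] with r hr
    exact mul_nonneg hr.le (slopeBound_nonneg hr.le)
  · filter_upwards [eventually_gt_atTop (2 * α), eventually_gt_atTop 0] with r hr hr0
    calc r * slopeBound C α r ≤ r * (2 * r ^ (C - 2 / 3)) := by
          gcongr; exact slopeBound_le_of_le hα hr
      _ = 2 * r ^ (-(-1 / 3 - C)) := by
          have : -(-1 / 3 - C) = C - 2 / 3 + 1 := by ring
          rw [this, Real.rpow_add_one hr0.ne']; ring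

end

/-! ### The rotated integrand on rays, up to the real axis -/

section

variable {C κ : ℝ}

/-- By the reverse triangle inequality the distance of r e^{iφ} to the branch points 1+κ and -(1-κ)
is at least |r - (1 ± κ)|, so the majorant does not depend on the angle. -/
theorem norm_upperSlope_sub_le {r φ : ℝ} (hκ : |κ| ≤ 1 / 8) (hr : 0 < r) (h1 : r ≠ 1 + κ)
    (h2 : r ≠ 1 - κ) :
    r ^ C * ‖upperSlope (r * exp (φ * I) - κ)‖ ≤
      4 * (slopeBound C (1 + κ) r + slopeBound C (1 - κ) r) := by
  set x : ℂ := r * exp (φ * I) - κ with hx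
  have hnr : ‖(r : ℂ) * exp (φ * I)‖ = r := by
    rw [norm_mul, norm_exp_ofReal_mul_I, mul_one, norm_real, Real.norm_of_nonneg hr.le]
  have hx0 : (1 + r) / 2 ≤ 1 + ‖x‖ := by
    have := norm_sub_norm_le ((r : ℂ) * exp (φ * I)) κ
    rw [hnr, norm_real, Real.norm_eq_abs] at this
    linarith
  have hN : (1 + ‖x‖) ^ (-(1 / 6) : ℝ) ≤ 2 * (1 + r) ^ (-(1 / 6) : ℝ) := by
    calc (1 + ‖x‖) ^ (-(1 / 6) : ℝ) ≤ ((1 + r) / 2) ^ (-(1 / 6) : ℝ) :=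
          Real.rpow_le_rpow_of_nonpos (by positivity) hx0 (by norm_num)
      _ = 2 ^ (1 / 6 : ℝ) * (1 + r) ^ (-(1 / 6) : ℝ) := by
          rw [Real.div_rpow (by positivity) (by norm_num),
            Real.rpow_neg (by norm_num : (0 : ℝ) ≤ 2), div_inv_eq_mul, mul_comm]
      _ ≤ 2 * (1 + r) ^ (-(1 / 6) : ℝ) := by
          have : (2 : ℝ) ^ (1 / 6 : ℝ) ≤ 2 := by
            calc (2 : ℝ) ^ (1 / 6 : ℝ) ≤ 2 ^ (1 : ℝ) :=
                  Real.rpow_le_rpow_of_exponent_le (by norm_num) (by norm_num)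
              _ = 2 := Real.rpow_one 2
          gcongr
  have hk := abs_le.1 hκ
  have hm1 : ‖x - 1‖ ^ (-(1 / 2) : ℝ) ≤ |r - (1 + κ)| ^ (-(1 / 2) : ℝ) := by
    refine Real.rpow_le_rpow_of_nonpos (abs_pos.2 (sub_ne_zero.2 h1)) ?_ (by norm_num)
    have := abs_norm_sub_norm_le ((r : ℂ) * exp (φ * I)) ((1 + κ : ℝ) : ℂ)
    rw [hnr, norm_real, Real.norm_of_nonneg (by linarith)] at this
    have e : x - 1 = r * exp (φ * I) - ((1 + κ : ℝ) : ℂ) := by rw [hx]; push_cast; ring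
    rwa [e]
  have hm2 : ‖x + 1‖ ^ (-(1 / 2) : ℝ) ≤ |r - (1 - κ)| ^ (-(1 / 2) : ℝ) := by
    refine Real.rpow_le_rpow_of_nonpos (abs_pos.2 (sub_ne_zero.2 h2)) ?_ (by norm_num)
    have := abs_norm_sub_norm_le ((r : ℂ) * exp (φ * I)) ((-(1 - κ) : ℝ) : ℂ)
    rw [hnr, norm_real, norm_neg, Real.norm_of_nonneg (by linarith)] at this
    have e : x + 1 = r * exp (φ * I) - ((-(1 - κ) : ℝ) : ℂ) := by rw [hx]; push_cast; ring
    rwa [e]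
  have := Real.rpow_nonneg hr.le C
  calc r ^ C * ‖upperSlope x‖ ≤ r ^ C * (2 * (2 * (1 + r) ^ (-(1 / 6) : ℝ) *
        (|r - (1 + κ)| ^ (-(1 / 2) : ℝ) + |r - (1 - κ)| ^ (-(1 / 2) : ℝ)))) := by
        refine mul_le_mul_of_nonneg_left (norm_upperSlope_le.trans ?_) this
        gcongr
    _ = _ := by unfold slopeBound; ring

/-- The integrand of the rotation, extended to the closed upper half-plane. -/
def slopeIntegrand (C κ φ r : ℝ) : ℂ :=
  (r ^ C : ℝ) * exp (φ * C * I) * upperSlope (r * exp (φ * I) - κ) * exp (φ * I)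

theorem norm_slopeIntegrand_le {r φ : ℝ} (hκ : |κ| ≤ 1 / 8) (hr : 0 < r) (h1 : r ≠ 1 + κ)
    (h2 : r ≠ 1 - κ) :
    ‖slopeIntegrand C κ φ r‖ ≤ 4 * (slopeBound C (1 + κ) r + slopeBound C (1 - κ) r) := by
  have e1 : (φ : ℂ) * C * I = ((φ * C : ℝ) : ℂ) * I := by push_cast; ring
  rw [slopeIntegrand, norm_mul, norm_mul, norm_mul, norm_exp_ofReal_mul_I, mul_one, e1,
    norm_exp_ofReal_mul_I, mul_one, norm_real, Real.norm_of_nonneg (Real.rpow_nonneg hr.le _)]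
  exact norm_upperSlope_sub_le hκ hr h1 h2

theorem im_ray_sub {r φ : ℝ} : ((r : ℂ) * exp (φ * I) - κ).im = r * Real.sin φ := by
  rw [sub_im, ofReal_im, sub_zero, im_ofReal_mul, exp_ofReal_mul_I_im]

theorem continuousWithinAt_slopeIntegrand {r φ : ℝ} (hr : 0 < r)
    (h1 : (r : ℂ) * exp (φ * I) - κ ≠ 1) (h2 : (r : ℂ) * exp (φ * I) - κ ≠ -1) :
    ContinuousWithinAt (fun φ => slopeIntegrand C κ φ r) (Icc 0 Real.pi) φ := by
  unfold slopeIntegrand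
  refine ContinuousWithinAt.mul (ContinuousWithinAt.mul ?_ ?_) ?_
  · fun_prop
  · refine ContinuousWithinAt.comp (g := upperSlope)
      (f := fun φ : ℝ => (r : ℂ) * exp (φ * I) - κ)
      (continuousWithinAt_upperSlope h1 h2) (by fun_prop) fun ψ hψ => ?_
    rw [mem_ofPred_eq, im_ray_sub]
    exact mul_nonneg hr.le (Real.sin_nonneg_of_mem_Icc hψ)
  · fun_prop

theorem continuousOn_slopeIntegrand_ray {φ : ℝ} (h0 : 0 ≤ φ) (h1 : φ ≤ Real.pi) :
    ContinuousOn (slopeIntegrand C κ φ) (Ioi 0 \ {r | (r : ℂ) * exp (φ * I) - κ = 1 ∨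
      (r : ℂ) * exp (φ * I) - κ = -1}) := by
  unfold slopeIntegrand
  refine ContinuousOn.mul (ContinuousOn.mul (ContinuousOn.mul ?_ ?_) ?_) ?_
  · refine continuous_ofReal.comp_continuousOn ?_
    exact fun r hr => (Real.continuousAt_rpow_const _ _
      (Or.inl (ne_of_gt hr.1))).continuousWithinAt
  · fun_prop
  · intro r hr
    rw [Set.mem_sdiff, mem_ofPred_eq, not_or] at hr
    refine ContinuousWithinAt.comp (g := upperSlope)
      (f := fun r : ℝ => (r : ℂ) * exp (φ * I) - κ)
      (continuousWithinAt_upperSlope hr.2.1 hr.2.2) (by fun_prop) fun r hr => ?_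
    rw [mem_ofPred_eq, im_ray_sub]
    exact mul_nonneg (le_of_lt hr.1) (Real.sin_nonneg_of_nonneg_of_le_pi h0 h1)
  · fun_prop

theorem ray_sub_eq_iff_norm {r φ a : ℝ} (hr : 0 < r)
    (h : (r : ℂ) * exp (φ * I) - κ = a) : r = |a + κ| := by
  have h1 : (r : ℂ) * exp (φ * I) = ((a + κ : ℝ) : ℂ) := by push_cast; rw [← h]; ring
  have := congrArg norm h1
  rwa [norm_mul, norm_exp_ofReal_mul_I, mul_one, norm_real, norm_real, Real.norm_of_nonneg hr.le,
    Real.norm_eq_abs] at this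

theorem ray_sub_ne_one {r φ : ℝ} (hκ : |κ| ≤ 1 / 8) (hr : 0 < r) (h1 : r ≠ 1 + κ) :
    (r : ℂ) * exp (φ * I) - κ ≠ 1 := fun h => h1 <| by
  have := ray_sub_eq_iff_norm (a := 1) hr (by simpa using h)
  rwa [abs_of_nonneg (by linarith [(abs_le.1 hκ).1])] at this

theorem ray_sub_ne_neg_one {r φ : ℝ} (hκ : |κ| ≤ 1 / 8) (hr : 0 < r) (h1 : r ≠ 1 - κ) :
    (r : ℂ) * exp (φ * I) - κ ≠ -1 := fun h => h1 <| by
  have := ray_sub_eq_iff_norm (a := -1) hr (by simpa using h)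
  rw [abs_of_nonpos (by linarith [(abs_le.1 hκ).2])] at this
  linarith

theorem ae_ne_ne (κ : ℝ) :
    ∀ᵐ r : ℝ ∂volume.restrict (Ioi 0), 0 < r ∧ r ≠ 1 + κ ∧ r ≠ 1 - κ := by
  have h : ∀ a : ℝ, ∀ᵐ r : ℝ ∂volume.restrict (Ioi 0), r ≠ a := fun a =>
    ae_restrict_of_ae (by simp [ae_iff])
  filter_upwards [ae_restrict_mem measurableSet_Ioi, h (1 + κ), h (1 - κ)] with r h1 h2 h3
  exact ⟨h1, h2, h3⟩

theorem aestronglyMeasurable_slopeIntegrand {φ : ℝ} (hκ : |κ| ≤ 1 / 8) (h0 : 0 ≤ φ)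
    (h1 : φ ≤ Real.pi) :
    AEStronglyMeasurable (slopeIntegrand C κ φ) (volume.restrict (Ioi 0)) := by
  have hset : (Ioi 0 \ {1 + κ, 1 - κ} : Set ℝ) =ᵐ[volume] (Ioi 0 : Set ℝ) :=
    sdiff_null_ae_eq_self ((Set.toFinite _).measure_zero _)
  rw [← Measure.restrict_congr_set hset]
  refine ContinuousOn.aestronglyMeasurable ((continuousOn_slopeIntegrand_ray h0 h1).mono ?_)
    (measurableSet_Ioi.diff (Set.toFinite _).measurableSet)
  rintro r ⟨hr, hr'⟩
  rw [mem_insert_iff, mem_singleton_iff, not_or] at hr'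
  refine ⟨hr, ?_⟩
  rw [mem_ofPred_eq, not_or]
  exact ⟨ray_sub_ne_one hκ hr hr'.1, ray_sub_ne_neg_one hκ hr hr'.2⟩

theorem integrableOn_slopeMajorant (hκ : |κ| ≤ 1 / 8) (hC : -1 < C) (hC' : C < -1 / 3) :
    IntegrableOn (fun r => 4 * (slopeBound C (1 + κ) r + slopeBound C (1 - κ) r)) (Ioi 0) := by
  have hk := abs_le.1 hκ
  exact ((integrableOn_slopeBound (by linarith) hC hC').add
    (integrableOn_slopeBound (by linarith) hC hC')).const_mul 4

theorem integrableOn_slopeIntegrand {φ : ℝ} (hκ : |κ| ≤ 1 / 8) (hC : -1 < C) (hC' : C < -1 / 3)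
    (h0 : 0 ≤ φ) (h1 : φ ≤ Real.pi) : IntegrableOn (slopeIntegrand C κ φ) (Ioi 0) := by
  refine Integrable.mono' (integrableOn_slopeMajorant hκ hC hC')
    (aestronglyMeasurable_slopeIntegrand hκ h0 h1) ?_
  filter_upwards [ae_ne_ne κ] with r hr
  exact norm_slopeIntegrand_le hκ hr.1 hr.2.1 hr.2.2

/-- Strictly between the directions 0 and π the integrand is holomorphic in Q, so the ray can be
rotated. -/
theorem integral_slopeIntegrand_eq_of_mem_Ioo {φ₁ φ₂ : ℝ} (hκ : |κ| ≤ 1 / 8) (hC : -1 < C)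
    (hC' : C < -1 / 3) (h1 : 0 < φ₁) (h12 : φ₁ ≤ φ₂) (h2 : φ₂ < Real.pi) :
    ∫ r in Ioi (0 : ℝ), slopeIntegrand C κ φ₁ r = ∫ r in Ioi (0 : ℝ), slopeIntegrand C κ φ₂ r := by
  have hk := abs_le.1 hκ
  set F : ℂ → ℂ := fun Q => exp (C * log Q) * upperSlope (Q - κ) with hF
  have hFeq : ∀ r : ℝ, 0 < r → ∀ φ ∈ Ioo 0 Real.pi,
      F (r * exp (φ * I)) * exp (φ * I) = slopeIntegrand C κ φ r := by
    intro r hr φ hφ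
    have hlog : log (r * exp (φ * I)) = Real.log r + φ * I := by
      rw [log_ofReal_mul hr (exp_ne_zero _), log_exp] <;> simp <;> linarith [hφ.1, hφ.2]
    simp only [hF]
    rw [hlog, slopeIntegrand, Real.rpow_def_of_pos hr]
    have : (C : ℂ) * (Real.log r + φ * I) = ((Real.log r * C : ℝ) : ℂ) + φ * C * I := by
      push_cast; ring
    rw [this, exp_add, ← ofReal_exp]
  have hmem : ∀ φ ∈ Icc φ₁ φ₂, φ ∈ Ioo 0 Real.pi := fun φ hφ =>
    ⟨h1.trans_le hφ.1, hφ.2.trans_lt h2⟩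
  have him : ∀ r : ℝ, 0 < r → ∀ φ ∈ Icc φ₁ φ₂, 0 < ((r : ℂ) * exp (φ * I)).im := by
    intro r hr φ hφ
    rw [im_ofReal_mul, exp_ofReal_mul_I_im]
    exact mul_pos hr (Real.sin_pos_of_mem_Ioo (hmem φ hφ))
  have hdiff : ∀ r : ℝ, 0 < r → ∀ φ ∈ Icc φ₁ φ₂, DifferentiableAt ℂ F (r * exp (φ * I)) := by
    intro r hr φ hφ
    refine DifferentiableAt.mul ?_ ?_
    · exact ((differentiableAt_id.clog (Or.inr (him r hr φ hφ).ne')).const_mul _).cexp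
    · exact DifferentiableAt.comp (g := upperSlope) (f := fun Q : ℂ => Q - κ) _
        (differentiableAt_upperSlope (by simpa using him r hr φ hφ)) (by fun_prop)
  -- the majorant is singular at two points; there the compact arc gives a bound
  have hpt : ∀ r : ℝ, 0 < r → ∃ M : ℝ, ∀ φ ∈ Icc φ₁ φ₂, ‖F (r * exp (φ * I))‖ ≤ M := by
    intro r hr
    refine isCompact_Icc.exists_bound_of_continuousOn fun φ hφ => ?_
    exact ContinuousAt.comp_continuousWithinAt (g := F) (f := fun φ : ℝ => (r : ℂ) * exp (φ * I))
      (hdiff r hr φ hφ).continuousAt (by fun_prop)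
  choose! M hM using hpt
  set g₀ : ℝ → ℝ := fun r => 4 * (slopeBound C (1 + κ) r + slopeBound C (1 - κ) r) with hg₀
  classical
  set g : ℝ → ℝ := fun r => if r = 1 + κ ∨ r = 1 - κ then M r else g₀ r with hg
  have hgg : g =ᵐ[volume.restrict (Ioi 0)] g₀ := by
    filter_upwards [ae_ne_ne κ] with r hr
    simp [hg, hr.2.1, hr.2.2]
  have hb : ∀ r : ℝ, 0 < r → ∀ φ ∈ Icc φ₁ φ₂, ‖F (r * exp (φ * I))‖ ≤ g r := by
    intro r hr φ hφ
    by_cases h : r = 1 + κ ∨ r = 1 - κ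
    · simpa [hg, h] using hM r hr φ hφ
    · have h3 := hFeq r hr φ (hmem φ hφ)
      have h4 := not_or.1 h
      have h5 := norm_slopeIntegrand_le (C := C) (φ := φ) hκ hr h4.1 h4.2
      rw [← h3, norm_mul, norm_exp_ofReal_mul_I, mul_one] at h5
      simpa [hg, h] using h5
  have key := integral_ray_eq_of_dominated h12 hdiff
    ((integrableOn_slopeMajorant hκ hC hC').congr_fun_ae hgg.symm) hb ?_ ?_
  · rw [← setIntegral_congr_fun measurableSet_Ioi
      (fun r hr => hFeq r hr φ₁ (hmem φ₁ (left_mem_Icc.2 h12))), key]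
    exact setIntegral_congr_fun measurableSet_Ioi
      (fun r hr => hFeq r hr φ₂ (hmem φ₂ (right_mem_Icc.2 h12)))
  · have h3 := ((tendsto_mul_slopeBound_nhdsGT (α := 1 + κ) (by linarith) hC).add
      (tendsto_mul_slopeBound_nhdsGT (α := 1 - κ) (by linarith) hC)).const_mul 4
    rw [add_zero, mul_zero] at h3
    refine h3.congr' ?_
    filter_upwards [Ioo_mem_nhdsGT (show (0 : ℝ) < 1 / 2 by norm_num)] with r hr
    have : ¬(r = 1 + κ ∨ r = 1 - κ) := by
      rintro (h | h) <;> linarith [hr.2]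
    simp only [hg, hg₀, this, if_false]
    ring
  · have h3 := ((tendsto_mul_slopeBound_atTop (α := 1 + κ) (by linarith) hC').add
      (tendsto_mul_slopeBound_atTop (α := 1 - κ) (by linarith) hC')).const_mul 4
    rw [add_zero, mul_zero] at h3
    refine h3.congr' ?_
    filter_upwards [eventually_gt_atTop 2] with r hr
    have : ¬(r = 1 + κ ∨ r = 1 - κ) := by
      rintro (h | h) <;> linarith
    simp only [hg, hg₀, this, if_false]
    ring

/-- For almost every r the integrand is continuous in φ up to both ends, so dominated convergence
carries the equality from interior directions to the real axis. This identity is the source of both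
connection formulas. -/
theorem integral_slopeIntegrand_zero_eq_pi (hκ : |κ| ≤ 1 / 8) (hC : -1 < C) (hC' : C < -1 / 3) :
    ∫ r in Ioi (0 : ℝ), slopeIntegrand C κ 0 r =
      ∫ r in Ioi (0 : ℝ), slopeIntegrand C κ Real.pi r := by
  have hpi := Real.pi_pos
  have hcont : ContinuousOn (fun φ => ∫ r in Ioi (0 : ℝ), slopeIntegrand C κ φ r)
      (Icc 0 Real.pi) := by
    intro φ hφ
    refine continuousWithinAt_of_dominated
      (bound := fun r => 4 * (slopeBound C (1 + κ) r + slopeBound C (1 - κ) r)) ?_ ?_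
      (integrableOn_slopeMajorant hκ hC hC') ?_
    · filter_upwards [self_mem_nhdsWithin] with ψ hψ
      exact aestronglyMeasurable_slopeIntegrand hκ hψ.1 hψ.2
    · refine Eventually.of_forall fun ψ => ?_
      filter_upwards [ae_ne_ne κ] with r hr
      exact norm_slopeIntegrand_le hκ hr.1 hr.2.1 hr.2.2
    · filter_upwards [ae_ne_ne κ] with r hr
      exact continuousWithinAt_slopeIntegrand hr.1 (ray_sub_ne_one hκ hr.1 hr.2.1)
        (ray_sub_ne_neg_one hκ hr.1 hr.2.2)
  have hconst : ∀ φ ∈ Ioo 0 Real.pi, ∫ r in Ioi (0 : ℝ), slopeIntegrand C κ φ r =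
      ∫ r in Ioi (0 : ℝ), slopeIntegrand C κ (Real.pi / 2) r := by
    intro φ hφ
    rcases le_total φ (Real.pi / 2) with h | h
    · exact integral_slopeIntegrand_eq_of_mem_Ioo hκ hC hC' hφ.1 h (by linarith)
    · exact (integral_slopeIntegrand_eq_of_mem_Ioo hκ hC hC' (by linarith) h hφ.2).symm
  have heq := Set.EqOn.of_subset_closure (s := Ioo 0 Real.pi) (t := Icc 0 Real.pi)
    (g := fun _ => ∫ r in Ioi (0 : ℝ), slopeIntegrand C κ (Real.pi / 2) r)
    (fun φ hφ => hconst φ hφ) hcont continuousOn_const Ioo_subset_Icc_self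
    (by rw [closure_Ioo hpi.ne])
  exact (heq (left_mem_Icc.2 hpi.le)).trans (heq (right_mem_Icc.2 hpi.le)).symm

end

/-! ### Real values of the slope -/

/-- The derivative of `x ↦ cosh (arcosh x / 3)` for `x > -1`. -/
def realSlope (y : ℝ) : ℝ := (upperSlope (-(y : ℂ))).re

theorem exists_cosh_eq {x : ℝ} (hx : 1 < x) : ∃ u : ℝ, 0 < u ∧ Real.cosh u = x := by
  refine ⟨Real.arcosh x, Real.arcosh_pos hx, Real.cosh_arcosh hx.le⟩

theorem exists_cos_eq {x : ℝ} (h1 : -1 < x) (h2 : x < 1) :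
    ∃ t : ℝ, 0 < t ∧ t < Real.pi ∧ Real.cos t = x :=
  ⟨Real.arccos x, Real.arccos_pos.2 h2, Real.arccos_lt_pi.2 h1, Real.cos_arccos h1.le h2.le⟩

theorem realSlope_cosh {u : ℝ} (hu : 0 < u) :
    realSlope (Real.cosh u) = Real.sinh (u / 3) / (3 * Real.sinh u) := by
  rw [realSlope, upperSlope_neg_cosh hu, ofReal_re]

theorem upperSlope_neg_cos {t : ℝ} (h0 : 0 < t) (h1 : t < Real.pi) :
    upperSlope (-((Real.cos t : ℝ) : ℂ)) = ((Real.sin (t / 3) / (3 * Real.sin t) : ℝ) : ℂ) := by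
  have := upperSlope_cos (t := Real.pi - t) (by linarith) (by linarith)
  rwa [Real.cos_pi_sub, Real.sin_pi_sub, sub_sub_cancel, ofReal_neg] at this

theorem realSlope_cos {t : ℝ} (h0 : 0 < t) (h1 : t < Real.pi) :
    realSlope (Real.cos t) = Real.sin (t / 3) / (3 * Real.sin t) := by
  rw [realSlope, upperSlope_neg_cos h0 h1, ofReal_re]

theorem upperSlope_neg_ofReal {y : ℝ} (h1 : -1 < y) (h2 : y ≠ 1) :
    upperSlope (-(y : ℂ)) = realSlope y := by
  rcases lt_or_gt_of_ne h2 with h | h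
  · obtain ⟨t, ht0, ht1, rfl⟩ := exists_cos_eq h1 h
    rw [upperSlope_neg_cos ht0 ht1, realSlope_cos ht0 ht1]
  · obtain ⟨u, hu, rfl⟩ := exists_cosh_eq h
    rw [upperSlope_neg_cosh hu, realSlope_cosh hu]

theorem upperSlope_ofReal {x : ℝ} (h1 : -1 < x) (h2 : x < 1) :
    upperSlope x = realSlope (-x) := by
  rw [← upperSlope_neg_ofReal (by linarith) (by linarith), ofReal_neg, neg_neg]

theorem sinh_pi_mul_I_sub_div_three (u : ℝ) :
    sinh ((Real.pi * I - u) / 3) =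
      ((-(1 / 2) * Real.sinh (u / 3) : ℝ) : ℂ) + ((√3 / 2 * Real.cosh (u / 3) : ℝ) : ℂ) * I := by
  have e : ((Real.pi : ℂ) * I - u) / 3 = ((-(u / 3) : ℝ) : ℂ) + ((Real.pi / 3 : ℝ) : ℂ) * I := by
    push_cast; ring
  rw [e, sinh_add, sinh_mul_I, cosh_mul_I, ← ofReal_cos, ← ofReal_sin, Real.cos_pi_div_three,
    Real.sin_pi_div_three, ← ofReal_sinh, ← ofReal_cosh, Real.sinh_neg, Real.cosh_neg]
  push_cast; ring

/-- The coefficient is -cos(π/3). It allows twice the real part to cancel, beyond the branch point,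
against the density of the ray block. -/
theorem upperSlope_cosh_re {u : ℝ} (hu : 0 < u) :
    (upperSlope ((Real.cosh u : ℝ) : ℂ)).re = -(1 / 2) * realSlope (Real.cosh u) := by
  have e : (3 : ℂ) * (Real.sinh u : ℝ) = ((3 * Real.sinh u : ℝ) : ℂ) := by push_cast; ring
  rw [upperSlope_cosh hu, realSlope_cosh hu, sinh_pi_mul_I_sub_div_three, e, div_ofReal_re, add_re,
    ofReal_re, re_ofReal_mul, I_re, mul_zero, add_zero, mul_div_assoc]

theorem upperSlope_cosh_im {u : ℝ} (hu : 0 < u) :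
    (upperSlope ((Real.cosh u : ℝ) : ℂ)).im =
      √3 / 6 * (Real.cosh (u / 3) / Real.sinh u) := by
  have e : (3 : ℂ) * (Real.sinh u : ℝ) = ((3 * Real.sinh u : ℝ) : ℂ) := by push_cast; ring
  rw [upperSlope_cosh hu, sinh_pi_mul_I_sub_div_three, e, div_ofReal_im, add_im,
    ofReal_im, im_ofReal_mul, I_im, mul_one, zero_add]
  have := (Real.sinh_pos_iff.2 hu).ne'
  field_simp
  norm_num

/-- `realSlope` inverts the derivative of the Chebyshev polynomial on `(1/2, ∞)`. -/
theorem realSlope_chebyshev {W : ℝ} (hW : 1 / 2 < W) (h1 : W ≠ 1) :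
    (12 * W ^ 2 - 3) * realSlope (4 * W ^ 3 - 3 * W) = 1 := by
  rcases lt_or_gt_of_ne h1 with h | h
  · obtain ⟨t, ht0, ht1, rfl⟩ := exists_cos_eq (by linarith) h
    have ht : t < Real.pi / 3 := by
      by_contra hcon
      have := Real.cos_le_cos_of_nonneg_of_le_pi (by positivity) ht1.le (not_lt.1 hcon)
      rw [Real.cos_pi_div_three] at this
      linarith
    have e : 3 * t / 3 = t := by ring
    rw [← Real.cos_three_mul, realSlope_cos (by linarith) (by linarith), Real.sin_three_mul, e]
    have hs := (Real.sin_pos_of_pos_of_lt_pi ht0 ht1).ne'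
    have h3 : 3 * Real.sin t - 4 * Real.sin t ^ 3 ≠ 0 := by
      rw [← Real.sin_three_mul]
      exact (Real.sin_pos_of_pos_of_lt_pi (by linarith) (by linarith)).ne'
    have := Real.sin_sq_add_cos_sq t
    rw [← mul_div_assoc, div_eq_one_iff_eq (mul_ne_zero (by norm_num) h3)]
    linear_combination 12 * Real.sin t * this
  · obtain ⟨u, hu, rfl⟩ := exists_cosh_eq h
    have e : 3 * u / 3 = u := by ring
    rw [← Real.cosh_three_mul, realSlope_cosh (by linarith), Real.sinh_three_mul, e]
    have hs := (Real.sinh_pos_iff.2 hu).ne'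
    have h3 : 4 * Real.sinh u ^ 3 + 3 * Real.sinh u ≠ 0 := by
      rw [← Real.sinh_three_mul]
      exact (Real.sinh_pos_iff.2 (by linarith)).ne'
    have := Real.cosh_sq u
    rw [← mul_div_assoc, div_eq_one_iff_eq (mul_ne_zero (by norm_num) h3)]
    linear_combination 12 * Real.sinh u * this

theorem sin_pi_sub_div_three (t : ℝ) :
    Real.sin ((Real.pi - t) / 3) = √3 / 2 * Real.cos (t / 3) - 1 / 2 * Real.sin (t / 3) := by
  rw [sub_div, Real.sin_sub, Real.sin_pi_div_three, Real.cos_pi_div_three]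

theorem realSlope_neg_cos {t : ℝ} (h0 : 0 < t) (h1 : t < Real.pi) :
    realSlope (-Real.cos t) = Real.sin ((Real.pi - t) / 3) / (3 * Real.sin t) := by
  rw [← Real.cos_pi_sub, realSlope_cos (by linarith) (by linarith), Real.sin_pi_sub]

/-- The combination that arises from the two monotone pieces of the segment is, by the addition
theorem, the function cos(α/3)/sin α of the Borel germ. -/
theorem two_mul_realSlope_neg_add {t : ℝ} (h0 : 0 < t) (h1 : t < Real.pi) :
    2 * realSlope (-Real.cos t) + realSlope (Real.cos t) =
      √3 / 3 * (Real.cos (t / 3) / Real.sin t) := by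
  have := (Real.sin_pos_of_pos_of_lt_pi h0 h1).ne'
  rw [realSlope_neg_cos h0 h1, realSlope_cos h0 h1, sin_pi_sub_div_three]
  field_simp
  ring

/-- The three roots of T₃(W) = x sum to zero, so the derivative of the middle root is minus the sum
e(x) + e(-x) of the outer ones. -/
theorem realSlope_add_chebyshev {W : ℝ} (h0 : -(1 / 2) < W) (h1 : W < 1 / 2) :
    (3 - 12 * W ^ 2) *
      (realSlope (-(4 * W ^ 3 - 3 * W)) + realSlope (4 * W ^ 3 - 3 * W)) = 1 := by
  obtain ⟨t, ht0, htpi, rfl⟩ := exists_cos_eq (show -1 < W by linarith) (by linarith)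
  have ht1 : Real.pi / 3 < t := by
    by_contra hcon
    have := Real.cos_le_cos_of_nonneg_of_le_pi ht0.le (by linarith [Real.pi_pos]) (not_lt.1 hcon)
    rw [Real.cos_pi_div_three] at this
    linarith
  have ht2 : t < 2 * Real.pi / 3 := by
    by_contra hcon
    have := Real.cos_le_cos_of_nonneg_of_le_pi (by positivity) htpi.le (not_lt.1 hcon)
    have e : 2 * Real.pi / 3 = Real.pi - Real.pi / 3 := by ring
    rw [e, Real.cos_pi_sub, Real.cos_pi_div_three] at this
    linarith
  -- Here 3t lies in (π, 2π); the representative 2π - 3t has the same cosine and lies in (0, π).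
  have hx : 4 * Real.cos t ^ 3 - 3 * Real.cos t = Real.cos (2 * Real.pi - 3 * t) := by
    rw [Real.cos_two_pi_sub, Real.cos_three_mul]
  have hsin : 0 < Real.sin (2 * Real.pi - 3 * t) :=
    Real.sin_pos_of_pos_of_lt_pi (by linarith) (by linarith)
  rw [hx, realSlope_neg_cos (by linarith) (by linarith),
    realSlope_cos (by linarith) (by linarith), ← add_div, sin_pi_sub_div_three]
  have e1 : √3 / 2 * Real.cos ((2 * Real.pi - 3 * t) / 3) -
      1 / 2 * Real.sin ((2 * Real.pi - 3 * t) / 3) + Real.sin ((2 * Real.pi - 3 * t) / 3) =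
      Real.sin t := by
    have e4 : (2 * Real.pi - 3 * t) / 3 = Real.pi - (Real.pi / 3 + t) := by ring
    rw [e4, Real.cos_pi_sub, Real.sin_pi_sub, Real.cos_add, Real.sin_add, Real.cos_pi_div_three,
      Real.sin_pi_div_three]
    have h3 : √3 * √3 = 3 := Real.mul_self_sqrt (by norm_num)
    linear_combination 1 / 4 * Real.sin t * h3
  rw [e1]
  rw [Real.sin_two_pi_sub, Real.sin_three_mul] at hsin ⊢
  have := Real.sin_sq_add_cos_sq t
  rw [← mul_div_assoc, div_eq_one_iff_eq (by linarith)]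
  linear_combination -12 * Real.sin t * this

/-! ### The connection formulas for real parameters -/

section

variable {C κ : ℝ}

/-- `∫_0^∞ r^C e(r + κ) dr` with `e = realSlope`. -/
def slopeMoment (C κ : ℝ) : ℝ := ∫ r in Ioi (0 : ℝ), r ^ C * realSlope (r + κ)

theorem slopeIntegrand_zero (r : ℝ) :
    slopeIntegrand C κ 0 r = (r ^ C : ℝ) * upperSlope ((r - κ : ℝ) : ℂ) := by
  simp [slopeIntegrand]

/-- The phase is e^{πiC} from Q^C times e^{πi} = -1 from dQ. -/
theorem slopeIntegrand_pi {r : ℝ} (hκ : |κ| ≤ 1 / 8) (hr : 0 < r) (h1 : r ≠ 1 - κ) :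
    slopeIntegrand C κ Real.pi r =
      -exp (Real.pi * C * I) * ((r ^ C * realSlope (r + κ) : ℝ) : ℂ) := by
  have e : (r : ℂ) * -1 - κ = -((r + κ : ℝ) : ℂ) := by push_cast; ring
  rw [slopeIntegrand, exp_pi_mul_I, e, upperSlope_neg_ofReal
    (by linarith [(abs_le.1 hκ).1]) (fun h => h1 (by linarith))]
  push_cast; ring

theorem integrableOn_rpow_mul_realSlope_add (hκ : |κ| ≤ 1 / 8) (hC : -1 < C) (hC' : C < -1 / 3) :
    IntegrableOn (fun r => r ^ C * realSlope (r + κ)) (Ioi 0) := by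
  have h := integrableOn_slopeIntegrand hκ hC hC' Real.pi_pos.le le_rfl
  have h2 := (h.const_mul (-exp (-(Real.pi * C * I)))).re
  refine h2.congr ?_
  filter_upwards [ae_ne_ne κ] with r hr
  have e : ∀ a b c : ℂ, -a * (-b * c) = a * b * c := fun a b c => by ring
  rw [slopeIntegrand_pi hκ hr.1 hr.2.2, e, ← exp_add, neg_add_cancel, exp_zero, one_mul]
  exact ofReal_re _

theorem integrableOn_rpow_mul_realSlope_sub (hκ : |κ| ≤ 1 / 8) (hC : -1 < C) (hC' : C < -1 / 3) :
    IntegrableOn (fun r => r ^ C * realSlope (r - κ)) (Ioi 0) := by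
  have := integrableOn_rpow_mul_realSlope_add (κ := -κ) (by rwa [abs_neg]) hC hC'
  simpa only [← sub_eq_add_neg] using this

theorem integrableOn_slopeIntegrand_zero (hκ : |κ| ≤ 1 / 8) (hC : -1 < C) (hC' : C < -1 / 3) :
    IntegrableOn (fun r : ℝ => ((r ^ C : ℝ) : ℂ) * upperSlope ((r - κ : ℝ) : ℂ)) (Ioi 0) :=
  (integrableOn_slopeIntegrand (φ := 0) hκ hC hC' le_rfl Real.pi_pos.le).congr
    (Eventually.of_forall fun r => slopeIntegrand_zero r)

theorem integral_rpow_mul_upperSlope (hκ : |κ| ≤ 1 / 8) (hC : -1 < C) (hC' : C < -1 / 3) :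
    ∫ r in Ioi (0 : ℝ), ((r ^ C : ℝ) : ℂ) * upperSlope ((r - κ : ℝ) : ℂ) =
      -exp (Real.pi * C * I) * slopeMoment C κ := by
  have h := integral_slopeIntegrand_zero_eq_pi hκ hC hC'
  simp only [slopeIntegrand_zero] at h
  rw [h, slopeMoment, ← integral_complex_ofReal, ← integral_const_mul]
  refine integral_congr_ae ?_
  filter_upwards [ae_ne_ne κ] with r hr
  exact slopeIntegrand_pi hκ hr.1 hr.2.2

theorem exp_pi_mul_mul_I (C : ℝ) : exp (Real.pi * C * I) =
    (Real.cos (Real.pi * C) : ℝ) + (Real.sin (Real.pi * C) : ℝ) * I := by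
  rw [exp_mul_I]; push_cast; ring

theorem integral_rpow_mul_upperSlope_re (hκ : |κ| ≤ 1 / 8) (hC : -1 < C) (hC' : C < -1 / 3) :
    ∫ r in Ioi (0 : ℝ), r ^ C * (upperSlope ((r - κ : ℝ) : ℂ)).re =
      -Real.cos (Real.pi * C) * slopeMoment C κ := by
  have h := congrArg re (integral_rpow_mul_upperSlope hκ hC hC')
  have h2 := integral_re (integrableOn_slopeIntegrand_zero hκ hC hC')
  rw [RCLike.re_eq_complex_re] at h2
  rw [← h2] at h
  simp only [re_ofReal_mul] at h
  rw [h, exp_pi_mul_mul_I, neg_mul, neg_re, re_mul_ofReal, add_re, ofReal_re, re_ofReal_mul, I_re]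
  ring

theorem integral_rpow_mul_upperSlope_im (hκ : |κ| ≤ 1 / 8) (hC : -1 < C) (hC' : C < -1 / 3) :
    ∫ r in Ioi (0 : ℝ), r ^ C * (upperSlope ((r - κ : ℝ) : ℂ)).im =
      -Real.sin (Real.pi * C) * slopeMoment C κ := by
  have h := congrArg im (integral_rpow_mul_upperSlope hκ hC hC')
  have h2 := integral_im (integrableOn_slopeIntegrand_zero hκ hC hC')
  rw [RCLike.im_eq_complex_im] at h2
  rw [← h2] at h
  simp only [im_ofReal_mul] at h
  rw [h, exp_pi_mul_mul_I, neg_mul, neg_im, im_mul_ofReal, add_im, ofReal_im, im_ofReal_mul, I_im]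
  ring

theorem integrableOn_rpow_mul_upperSlope_re (hκ : |κ| ≤ 1 / 8) (hC : -1 < C) (hC' : C < -1 / 3) :
    IntegrableOn (fun r : ℝ => r ^ C * (upperSlope ((r - κ : ℝ) : ℂ)).re) (Ioi 0) :=
  (integrableOn_slopeIntegrand_zero hκ hC hC').re.congr
    (Eventually.of_forall fun _ => re_ofReal_mul _ _)

/-- The part of the imaginary-part formula that is supported on `r > 1 + κ`. -/
theorem integral_Ioi_rpow_mul_upperSlope_im (hκ : |κ| ≤ 1 / 8) (hC : -1 < C) (hC' : C < -1 / 3) :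
    ∫ r in Ioi (1 + κ), r ^ C * (upperSlope ((r - κ : ℝ) : ℂ)).im =
      -Real.sin (Real.pi * C) * slopeMoment C κ := by
  have hk := abs_le.1 hκ
  rw [← integral_rpow_mul_upperSlope_im hκ hC hC']
  -- Below the branch point r = 1 + κ the boundary value is real and contributes nothing.
  refine (setIntegral_eq_of_subset_of_ae_sdiff_eq_zero measurableSet_Ioi.nullMeasurableSet
    (Ioi_subset_Ioi (by linarith)) ?_).symm
  have h : ∀ᵐ r : ℝ, r ≠ 1 + κ := by simp [ae_iff]
  filter_upwards [h] with r hr hr'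
  have h1 : r < 1 + κ := lt_of_le_of_ne (not_lt.1 hr'.2) hr
  have h2 : (0 : ℝ) < r := hr'.1
  rw [upperSlope_ofReal (by linarith) (by linarith), ofReal_im, mul_zero]

/-- The density of the segment block in the variable `r = Q / (2 s³)`. -/
def segmentDensity (x : ℝ) : ℝ := 2 * realSlope (-x) + realSlope x

theorem integrableOn_rpow_mul_realSlope_neg (hκ : |κ| ≤ 1 / 8) (hC : -1 < C) (hC' : C < -1 / 3) :
    IntegrableOn (fun r => r ^ C * realSlope (-(r - κ))) (Ioo 0 (1 + κ)) := by
  have hk := abs_le.1 hκ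
  refine ((integrableOn_rpow_mul_upperSlope_re hκ hC hC').mono_set
    Ioo_subset_Ioi_self).congr_fun (fun r hr => ?_) measurableSet_Ioo
  beta_reduce
  rw [upperSlope_ofReal (by linarith [hr.1]) (by linarith [hr.2]), ofReal_re]

/-- Twice the real part of the rotation formula reads 2e(κ-r) below 1+κ and -e(r-κ) above. Adding
the full moment of e(r-κ) cancels the part above and leaves the segment density below. -/
theorem integral_rpow_mul_segmentDensity (hκ : |κ| ≤ 1 / 8) (hC : -1 < C) (hC' : C < -1 / 3) :
    ∫ r in Ioo 0 (1 + κ), r ^ C * segmentDensity (r - κ) =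
      slopeMoment C (-κ) - 2 * Real.cos (Real.pi * C) * slopeMoment C κ := by
  have hk := abs_le.1 hκ
  have hsplit : ∀ f : ℝ → ℝ, IntegrableOn f (Ioi 0) → ∫ r in Ioi (0 : ℝ), f r =
      (∫ r in Ioo 0 (1 + κ), f r) + ∫ r in Ioi (1 + κ), f r := by
    intro f hf
    rw [← integral_Ioc_eq_integral_Ioo, ← setIntegral_union (Ioc_disjoint_Ioi le_rfl)
      measurableSet_Ioi (hf.mono_set Ioc_subset_Ioi_self)
      (hf.mono_set (Ioi_subset_Ioi (by linarith))), Ioc_union_Ioi_eq_Ioi (by linarith)]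
  have hsub := integrableOn_rpow_mul_realSlope_sub hκ hC hC'
  have h1 := hsplit _ hsub
  have h2 := hsplit _ (integrableOn_rpow_mul_upperSlope_re hκ hC hC')
  rw [integral_rpow_mul_upperSlope_re hκ hC hC'] at h2
  have h3 : ∫ r in Ioi (1 + κ), r ^ C * (upperSlope ((r - κ : ℝ) : ℂ)).re =
      -(1 / 2) * ∫ r in Ioi (1 + κ), r ^ C * realSlope (r - κ) := by
    rw [← integral_const_mul]
    refine setIntegral_congr_fun measurableSet_Ioi fun r hr => ?_
    rw [mem_Ioi] at hr
    obtain ⟨u, hu, hx⟩ := exists_cosh_eq (show 1 < r - κ by linarith)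
    rw [← hx, upperSlope_cosh_re hu]; ring
  have h4 : ∫ r in Ioo 0 (1 + κ), r ^ C * (upperSlope ((r - κ : ℝ) : ℂ)).re =
      ∫ r in Ioo 0 (1 + κ), r ^ C * realSlope (-(r - κ)) := by
    refine setIntegral_congr_fun measurableSet_Ioo fun r hr => ?_
    rw [upperSlope_ofReal (by linarith [hr.1]) (by linarith [hr.2]), ofReal_re]
  have h5 : ∫ r in Ioo 0 (1 + κ), r ^ C * segmentDensity (r - κ) =
      2 * (∫ r in Ioo 0 (1 + κ), r ^ C * realSlope (-(r - κ))) +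
        ∫ r in Ioo 0 (1 + κ), r ^ C * realSlope (r - κ) := by
    rw [← integral_const_mul, ← integral_add]
    · refine setIntegral_congr_fun measurableSet_Ioo fun r hr => ?_
      simp only [segmentDensity]; ring
    · exact (integrableOn_rpow_mul_realSlope_neg hκ hC hC').const_mul 2
    · exact hsub.mono_set Ioo_subset_Ioi_self
  have h6 : slopeMoment C (-κ) = ∫ r in Ioi (0 : ℝ), r ^ C * realSlope (r - κ) := by
    simp only [slopeMoment, sub_eq_add_neg]
  rw [h5, h6, h1]
  rw [h3, h4] at h2
  linarith

/-! ### Substitution in the Borel germs -/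

theorem image_mul_exp_Ioi {a : ℝ} (ha : 0 < a) :
    (fun t : ℝ => a * Real.exp t) '' Ioi 0 = Ioi a := by
  ext y
  constructor
  · rintro ⟨t, ht, rfl⟩
    have := Real.one_lt_exp_iff.2 ht
    exact (lt_mul_iff_one_lt_right ha).2 this
  · intro hy
    have hy0 : 0 < y / a := div_pos (ha.trans hy) ha
    exact ⟨Real.log (y / a), Real.log_pos ((one_lt_div ha).2 hy), by
      simp only [Real.exp_log hy0]; field_simp⟩

theorem image_mul_exp_neg_Ioi {a : ℝ} (ha : 0 < a) :
    (fun t : ℝ => a * Real.exp (-t)) '' Ioi 0 = Ioo 0 a := by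
  ext y
  constructor
  · rintro ⟨t, ht, rfl⟩
    have := Real.exp_lt_one_iff.2 (neg_lt_zero.2 ht)
    exact ⟨by positivity, (mul_lt_iff_lt_one_right ha).2 this⟩
  · rintro ⟨h0, h1⟩
    have hy0 : 0 < y / a := div_pos h0 ha
    exact ⟨-Real.log (y / a), neg_pos.2 (Real.log_neg hy0 ((div_lt_one ha).2 h1)), by
      simp only [neg_neg, Real.exp_log hy0]; field_simp⟩

theorem integral_Ioi_eq_integral_exp {a : ℝ} (ha : 0 < a) (g : ℝ → ℝ) :
    ∫ r in Ioi a, g r = ∫ t in Ioi (0 : ℝ), a * Real.exp t * g (a * Real.exp t) := by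
  rw [← image_mul_exp_Ioi ha, integral_image_eq_integral_abs_deriv_smul measurableSet_Ioi
    (fun t _ => ((Real.hasDerivAt_exp t).const_mul a).hasDerivWithinAt) ?_]
  · refine setIntegral_congr_fun measurableSet_Ioi fun t _ => ?_
    simp only [smul_eq_mul, abs_of_pos (mul_pos ha (Real.exp_pos t))]
  · intro x _ y _ h
    exact Real.exp_injective (mul_left_cancel₀ ha.ne' h)

theorem integral_Ioo_eq_integral_exp_neg {a : ℝ} (ha : 0 < a) (g : ℝ → ℝ) :
    ∫ r in Ioo 0 a, g r = ∫ t in Ioi (0 : ℝ), a * Real.exp (-t) * g (a * Real.exp (-t)) := by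
  rw [← image_mul_exp_neg_Ioi ha, integral_image_eq_integral_abs_deriv_smul measurableSet_Ioi
    (fun t _ => (((hasDerivAt_neg t).exp).const_mul a).hasDerivWithinAt) ?_]
  · refine setIntegral_congr_fun measurableSet_Ioi fun t _ => ?_
    have : a * (Real.exp (-t) * -1) = -(a * Real.exp (-t)) := by ring
    simp only [smul_eq_mul, this, abs_neg, abs_of_pos (mul_pos ha (Real.exp_pos (-t)))]
  · intro x _ y _ h
    exact neg_injective (Real.exp_injective (mul_left_cancel₀ ha.ne' h))

/-- On the positive axis x = cos α is real, `innerSqrt` is sin α and `innerExp` is e^{-iα}; the germ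
is then √3 e^{-t} times the segment density. -/
theorem innerGerm_ofReal {t : ℝ} (hκ : |κ| ≤ 1 / 8) (ht : 0 < t) :
    innerGerm κ t =
      ((√3 * (Real.exp (-t) * segmentDensity ((1 + κ) * Real.exp (-t) - κ)) : ℝ) : ℂ) := by
  have hk := abs_le.1 hκ
  have he0 := Real.exp_pos (-t)
  have he1 := Real.exp_lt_one_iff.2 (neg_lt_zero.2 ht)
  obtain ⟨α, hα0, hα1, hx⟩ := exists_cos_eq (x := (1 + κ) * Real.exp (-t) - κ)
    (by nlinarith) (by nlinarith)
  have hS : innerSqrt κ t = (Real.sin α : ℝ) := by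
    have e1 : (1 : ℂ) + κ = ((1 + κ : ℝ) : ℂ) := by push_cast; ring
    have e2 : 1 - exp (-(t : ℂ)) = ((1 - Real.exp (-t) : ℝ) : ℂ) := by push_cast; ring
    have e3 : (1 : ℂ) - κ + (1 + κ) * exp (-(t : ℂ)) =
        ((1 + ((1 + κ) * Real.exp (-t) - κ) : ℝ) : ℂ) := by push_cast; ring
    rw [innerSqrt, e3, e1, e2, csqrt_ofReal (by linarith), csqrt_ofReal (by linarith),
      csqrt_ofReal (by nlinarith), ← ofReal_mul, ← ofReal_mul, ← Real.sqrt_mul (by linarith),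
      ← sqrt_one_sub_cos_mul hα0 hα1, hx]
    congr 3
    ring
  have hX : innerExp κ t = exp ((-α : ℝ) * I) := by
    have : (1 + (κ : ℂ)) * exp (-(t : ℂ)) - κ = (Real.cos α : ℝ) := by rw [hx]; push_cast; ring
    rw [innerExp, hS, this, exp_mul_I, ← ofReal_cos, ← ofReal_sin, Real.cos_neg, Real.sin_neg]
    push_cast; ring
  have hlog : log (exp ((-α : ℝ) * I)) = (-α : ℝ) * I := by
    rw [log_exp] <;> simp <;> linarith
  have e4 : ((-α : ℝ) : ℂ) * I / 3 = -(((α / 3 : ℝ) : ℂ) * I) := by push_cast; ring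
  rw [innerGerm, hS, hX, hlog, e4, cosh_neg, cosh_mul_I, segmentDensity, ← hx,
    two_mul_realSlope_neg_add hα0 hα1]
  have h3 : (√3 : ℂ) * √3 = 3 := by
    rw [← ofReal_mul, Real.mul_self_sqrt (by norm_num)]; norm_num
  push_cast
  linear_combination -(exp (-(t : ℂ)) * (cos (α / 3) / sin α) / 3) * h3

/-- On the negative axis x = cosh u > 1, and the germ is a multiple of the imaginary part of
`upperSlope`. The factor 2√3 i absorbs the √3/6 of that imaginary part; the minus sign accounts for
dζ = -dt. -/
theorem outerGerm_ofReal {t : ℝ} (hκ : |κ| ≤ 1 / 8) (ht : 0 < t) :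
    -outerGerm κ (-t) = 2 * √3 * I *
      ((Real.exp t * (upperSlope (((1 + κ) * Real.exp t - κ : ℝ) : ℂ)).im : ℝ) : ℂ) := by
  have hk := abs_le.1 hκ
  have he0 := Real.exp_pos t
  have he1 := Real.one_lt_exp_iff.2 ht
  have hen := Real.exp_lt_one_iff.2 (neg_lt_zero.2 ht)
  have hee : Real.exp t * Real.exp (-t) = 1 := by rw [← Real.exp_add]; simp
  obtain ⟨u, hu, hx⟩ := exists_cosh_eq (x := (1 + κ) * Real.exp t - κ) (by nlinarith)
  have hsu := Real.sinh_pos_iff.2 hu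
  have hS : outerSqrt κ (-t) = (Real.exp (-t) * Real.sinh u : ℝ) := by
    have e1 : (1 : ℂ) + κ = ((1 + κ : ℝ) : ℂ) := by push_cast; ring
    have e2 : 1 - exp (-(t : ℂ)) = ((Real.exp (-t) * (Real.exp t - 1) : ℝ) : ℂ) := by
      rw [mul_sub, mul_comm, hee]; push_cast; ring
    have e3 : ((1 + κ : ℝ) : ℂ) + (1 - κ) * exp (-(t : ℂ)) =
        ((Real.exp (-t) * (Real.cosh u + 1) : ℝ) : ℂ) := by
      have : Real.exp (-t) * (Real.cosh u + 1) = 1 + κ + (1 - κ) * Real.exp (-t) := by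
        rw [hx]; linear_combination (1 + κ) * hee
      rw [this]; push_cast; ring
    have h1 : 0 ≤ Real.exp t - 1 := by linarith
    have h2 := Real.one_le_cosh u
    rw [outerSqrt, e1, e3, e2, csqrt_ofReal (by linarith), csqrt_ofReal (by positivity),
      csqrt_ofReal (by positivity), ← ofReal_mul, ← ofReal_mul, ← sqrt_cosh_sub_one_mul hu,
      ← Real.sqrt_mul (by linarith), Real.sqrt_mul (Real.exp_pos _).le (Real.cosh u + 1)]
    have e5 : (1 + κ) * (Real.exp (-t) * (Real.exp t - 1)) = Real.exp (-t) * (Real.cosh u - 1) := by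
      rw [hx]; ring
    rw [e5, Real.sqrt_mul (Real.exp_pos _).le]
    have e6 : √(Real.exp (-t)) * √(Real.exp (-t)) = Real.exp (-t) :=
      Real.mul_self_sqrt (Real.exp_pos _).le
    congr 1
    linear_combination √(Real.cosh u - 1) * √(Real.cosh u + 1) * e6
  have hX : outerExp κ (-t) = ((Real.exp (u - t) : ℝ) : ℂ) := by
    have : Real.exp (u - t) = 1 + κ - κ * Real.exp (-t) + Real.exp (-t) * Real.sinh u := by
      rw [Real.exp_sub, ← Real.cosh_add_sinh, hx, div_eq_mul_inv, ← Real.exp_neg]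
      linear_combination (1 + κ) * hee
    rw [outerExp, hS, this]; push_cast; ring
  have e4 : (((u - t : ℝ) : ℂ) - -(t : ℂ)) / 3 = ((u / 3 : ℝ) : ℂ) := by push_cast; ring
  rw [outerGerm, hS, hX, ← ofReal_log (Real.exp_pos _).le, Real.log_exp, e4, ← hx,
    upperSlope_cosh_im hu, Real.exp_neg]
  have h3 : (√3 : ℂ) * √3 = 3 := by
    rw [← ofReal_mul, Real.mul_self_sqrt (by norm_num)]; norm_num
  have hs' : sinh (u : ℂ) ≠ 0 := by rw [← ofReal_sinh]; exact_mod_cast hsu.ne'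
  push_cast
  have he' := exp_ne_zero (t : ℂ)
  field_simp
  linear_combination -2 * cosh (u / 3) * h3

theorem integral_innerGerm_eq (hκ : |κ| ≤ 1 / 8) :
    ∫ t in Ioi (0 : ℝ), exp (-C * t) * innerGerm κ t =
      ((√3 * (1 + κ) ^ (-(C + 1)) *
        ∫ r in Ioo 0 (1 + κ), r ^ C * segmentDensity (r - κ) : ℝ) : ℂ) := by
  have hk := abs_le.1 hκ
  have hk1 : 0 < 1 + κ := by linarith
  rw [integral_Ioo_eq_integral_exp_neg hk1, ← integral_const_mul, ← integral_complex_ofReal]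
  refine setIntegral_congr_fun measurableSet_Ioi fun t ht => ?_
  have h1 : exp (-C * t) = ((Real.exp (-t) ^ C : ℝ) : ℂ) := by
    rw [← Real.exp_mul]; push_cast; ring_nf
  have h2 : (1 + κ) ^ (-(C + 1)) * ((1 + κ) * (1 + κ) ^ C) = 1 := by
    rw [mul_comm (1 + κ), ← Real.rpow_add_one hk1.ne', ← Real.rpow_add hk1, neg_add_cancel,
      Real.rpow_zero]
  rw [innerGerm_ofReal hκ ht, h1, ← ofReal_mul, Real.mul_rpow hk1.le (Real.exp_pos _).le]
  congr 1
  linear_combination -(√3 * (Real.exp (-t) ^ C * (Real.exp (-t) *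
    segmentDensity ((1 + κ) * Real.exp (-t) - κ)))) * h2

theorem integral_outerGerm_eq (hκ : |κ| ≤ 1 / 8) (hC : -1 < C) (hC' : C < -1 / 3) :
    ∫ t in Ioi (0 : ℝ), exp (C * t) * -outerGerm κ (-t) =
      2 * √3 * I * (((1 + κ) ^ (-(C + 1)) *
        (-Real.sin (Real.pi * C) * slopeMoment C κ) : ℝ) : ℂ) := by
  have hk := abs_le.1 hκ
  have hk1 : 0 < 1 + κ := by linarith
  rw [← integral_Ioi_rpow_mul_upperSlope_im hκ hC hC', integral_Ioi_eq_integral_exp hk1,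
    ← integral_const_mul, ← integral_complex_ofReal, ← integral_const_mul]
  refine setIntegral_congr_fun measurableSet_Ioi fun t ht => ?_
  have h1 : exp (C * t) = ((Real.exp t ^ C : ℝ) : ℂ) := by
    rw [← Real.exp_mul]; push_cast; ring_nf
  have h2 : (1 + κ) ^ (-(C + 1)) * ((1 + κ) * (1 + κ) ^ C) = 1 := by
    rw [mul_comm (1 + κ), ← Real.rpow_add_one hk1.ne', ← Real.rpow_add hk1, neg_add_cancel,
      Real.rpow_zero]
  rw [outerGerm_ofReal hκ ht, h1, mul_left_comm, ← ofReal_mul,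
    Real.mul_rpow hk1.le (Real.exp_pos _).le]
  congr 2
  linear_combination -(Real.exp t ^ C * (Real.exp t *
    (upperSlope (((1 + κ) * Real.exp t - κ : ℝ) : ℂ)).im)) * h2

end

/-! ### The blocks for real parameters -/

/-- The half distance of the critical points. -/
def scale (z : ℂ) : ℂ := csqrt (z ^ 2 - z + 1) / 3

/-- The midpoint of the critical points. -/
def center (z : ℂ) : ℂ := (z + 1) / 3

/-- The mean of the critical values, normalized by their half distance. -/
def asymmetry (z : ℂ) : ℂ := cubic z (center z) / (2 * scale z ^ 3)

theorem scale_sq (z : ℂ) : 9 * scale z ^ 2 = z ^ 2 - z + 1 := by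
  rw [scale, div_pow, csqrt_sq]; ring

theorem scale_one_sub (z : ℂ) : scale (1 - z) = scale z := by
  rw [scale, scale]; ring_nf

theorem center_one_sub (z : ℂ) : center (1 - z) = 1 - center z := by
  rw [center, center]; ring

/-- The reflection that exchanges the two critical points and reverses the sign of Q; it transports
every result about ψ̂ to φ̂. -/
theorem cubic_one_sub (z w : ℂ) : cubic (1 - z) (1 - w) = -cubic z w := by
  rw [cubic, cubic]; ring

theorem asymmetry_one_sub (z : ℂ) : asymmetry (1 - z) = -asymmetry z := by
  rw [asymmetry, asymmetry, scale_one_sub, center_one_sub, cubic_one_sub, neg_div]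

/-- The shift to the midpoint removes the quadratic term, and scaling by the distance of the
critical points turns the rest into T₃. All trigonometric formulas rest on this normal form. -/
theorem cubic_center_add {z : ℂ} (hz : scale z ≠ 0) (W : ℂ) :
    cubic z (center z + 2 * scale z * W) =
      2 * scale z ^ 3 * (4 * W ^ 3 - 3 * W + asymmetry z) := by
  have h := scale_sq z
  rw [asymmetry, mul_add, mul_div_cancel₀ _ (mul_ne_zero two_ne_zero (pow_ne_zero 3 hz))]
  simp only [cubic, center]
  linear_combination (2 / 3 * scale z * W) * h

theorem wPlus_eq (z : ℂ) : wPlus z = center z + 2 * scale z * (1 / 2) := by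
  rw [wPlus, center, scale, csqrt, one_div]; ring

theorem wMinus_eq (z : ℂ) : wMinus z = center z + 2 * scale z * (-(1 / 2)) := by
  rw [wMinus, center, scale, csqrt, one_div]; ring

theorem QMinus_eq {z : ℂ} (hz : scale z ≠ 0) :
    QMinus z = 2 * scale z ^ 3 * (1 + asymmetry z) := by
  rw [QMinus, wMinus_eq, cubic_center_add hz]; ring

theorem QPlus_eq {z : ℂ} (hz : scale z ≠ 0) :
    QPlus z = -(2 * scale z ^ 3 * (1 - asymmetry z)) := by
  rw [QPlus, wPlus_eq, cubic_center_add hz]; ring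

/-! ### Change of variables along the monotone pieces of the real cubic -/

section

variable {f f' p : ℝ → ℝ} {S T : Set ℝ} {C k a : ℝ}

/-- The excluded point `a` allows for the preimage of a branch point, where the formula for the
density breaks down; it is a null set. -/
theorem setIntegral_rpow_mul_density (hS : MeasurableSet S) (hf : ∀ w ∈ S, HasDerivAt f (f' w) w)
    (hinj : InjOn f S) (hT : f '' S = T) (hk : k ≠ 0)
    (hp : ∀ w ∈ S, w ≠ a → |f' w| * p (f w) = k) :
    (∫ r in T, r ^ C * p r = k * ∫ w in S, f w ^ C) ∧
      (IntegrableOn (fun r => r ^ C * p r) T → IntegrableOn (fun w => f w ^ C) S) := by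
  have hd : ∀ w ∈ S, HasDerivWithinAt f (f' w) S w := fun w hw => (hf w hw).hasDerivWithinAt
  have hae : (fun w => |f' w| • (f w ^ C * p (f w))) =ᵐ[volume.restrict S]
      fun w => k * f w ^ C := by
    have h : ∀ᵐ w : ℝ ∂volume.restrict S, w ≠ a := ae_restrict_of_ae (by simp [ae_iff])
    filter_upwards [h, ae_restrict_mem hS] with w h1 h2
    rw [smul_eq_mul, ← hp w h2 h1]; ring
  rw [← hT]
  constructor
  · rw [integral_image_eq_integral_abs_deriv_smul hS hd hinj, integral_congr_ae hae,
      integral_const_mul]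
  · intro h
    rw [integrableOn_image_iff_integrableOn_abs_deriv_smul hS hd hinj] at h
    have h2 := (h.congr hae).const_mul k⁻¹
    refine h2.congr (Eventually.of_forall fun w => ?_)
    beta_reduce
    rw [← mul_assoc, inv_mul_cancel₀ hk, one_mul]

end

theorem image_Ioo_of_strictMonoOn {f : ℝ → ℝ} {a b : ℝ} (hab : a < b)
    (hc : ContinuousOn f (Icc a b)) (hm : StrictMonoOn f (Icc a b)) :
    f '' Ioo a b = Ioo (f a) (f b) := by
  refine Subset.antisymm ?_ (intermediate_value_Ioo hab.le hc)
  rintro _ ⟨w, hw, rfl⟩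
  exact ⟨hm (left_mem_Icc.2 hab.le) (Ioo_subset_Icc_self hw) hw.1,
    hm (Ioo_subset_Icc_self hw) (right_mem_Icc.2 hab.le) hw.2⟩

theorem image_Ioo_of_strictAntiOn {f : ℝ → ℝ} {a b : ℝ} (hab : a < b)
    (hc : ContinuousOn f (Icc a b)) (hm : StrictAntiOn f (Icc a b)) :
    f '' Ioo a b = Ioo (f b) (f a) := by
  refine Subset.antisymm ?_ (intermediate_value_Ioo' hab.le hc)
  rintro _ ⟨w, hw, rfl⟩
  exact ⟨hm (Ioo_subset_Icc_self hw) (right_mem_Icc.2 hab.le) hw.2,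
    hm (left_mem_Icc.2 hab.le) (Ioo_subset_Icc_self hw) hw.1⟩

section

variable {x σ κ C : ℝ}

/-- The normalized cubic in the coordinate `w`. -/
def realCubic (x σ κ w : ℝ) : ℝ :=
  4 * ((w - (x + 1) / 3) / (2 * σ)) ^ 3 - 3 * ((w - (x + 1) / 3) / (2 * σ)) + κ

theorem realCubic_eq (hσ : 0 < σ) (hσx : 9 * σ ^ 2 = x ^ 2 - x + 1)
    (hκ : 2 * σ ^ 3 * κ = (x + 1) / 3 * ((x + 1) / 3 - 1) * ((x + 1) / 3 - x)) (w : ℝ) :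
    2 * σ ^ 3 * realCubic x σ κ w = w * (w - 1) * (w - x) := by
  rw [realCubic, mul_add, hκ]
  field_simp
  linear_combination (-36 * w + 12 * x + 12) * hσx

theorem hasDerivAt_realCubic (w : ℝ) : HasDerivAt (realCubic x σ κ)
    ((12 * ((w - (x + 1) / 3) / (2 * σ)) ^ 2 - 3) / (2 * σ)) w := by
  have h1 : HasDerivAt (fun w : ℝ => (w - (x + 1) / 3) / (2 * σ)) (1 / (2 * σ)) w :=
    ((hasDerivAt_id w).sub_const _).div_const _
  have h2 := (((h1.pow 3).const_mul 4).sub (h1.const_mul 3)).add_const κ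
  refine h2.congr_deriv ?_
  simp only [Nat.cast_ofNat, Nat.add_one_sub_one]
  ring

theorem continuous_realCubic : Continuous (realCubic x σ κ) := by
  unfold realCubic; fun_prop

theorem critical_point_bounds (hσ : 0 < σ) (hσx : 9 * σ ^ 2 = x ^ 2 - x + 1) (h0 : 0 < x)
    (h1 : x < 1) :
    (x + 1) / 3 + σ < 1 ∧ 0 < (x + 1) / 3 - σ ∧ (x + 1) / 3 - σ < x ∧ x < (x + 1) / 3 + σ := by
  refine ⟨?_, ?_, ?_, ?_⟩ <;> nlinarith

theorem deriv_realCubic_pos_of_gt (hσ : 0 < σ) {w : ℝ} (hw : (x + 1) / 3 + σ < w) :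
    1 / 2 < (w - (x + 1) / 3) / (2 * σ) ∧
      0 < (12 * ((w - (x + 1) / 3) / (2 * σ)) ^ 2 - 3) / (2 * σ) := by
  have h : 1 / 2 < (w - (x + 1) / 3) / (2 * σ) := by
    rw [lt_div_iff₀ (by linarith)]; linarith
  exact ⟨h, div_pos (by nlinarith) (by linarith)⟩

theorem deriv_realCubic_pos_of_lt (hσ : 0 < σ) {w : ℝ} (hw : w < (x + 1) / 3 - σ) :
    (w - (x + 1) / 3) / (2 * σ) < -(1 / 2) ∧
      0 < (12 * ((w - (x + 1) / 3) / (2 * σ)) ^ 2 - 3) / (2 * σ) := by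
  have h : (w - (x + 1) / 3) / (2 * σ) < -(1 / 2) := by
    rw [div_lt_iff₀ (by linarith)]; linarith
  exact ⟨h, div_pos (by nlinarith) (by linarith)⟩

theorem deriv_realCubic_neg (hσ : 0 < σ) {w : ℝ} (hw : (x + 1) / 3 - σ < w)
    (hw' : w < (x + 1) / 3 + σ) :
    -(1 / 2) < (w - (x + 1) / 3) / (2 * σ) ∧ (w - (x + 1) / 3) / (2 * σ) < 1 / 2 ∧
      (12 * ((w - (x + 1) / 3) / (2 * σ)) ^ 2 - 3) / (2 * σ) < 0 := by
  have h : (w - (x + 1) / 3) / (2 * σ) < 1 / 2 := by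
    rw [div_lt_iff₀ (by linarith)]; linarith
  have h' : -(1 / 2) < (w - (x + 1) / 3) / (2 * σ) := by
    rw [lt_div_iff₀ (by linarith)]; linarith
  exact ⟨h', h, div_neg_of_neg_of_pos (by nlinarith) (by linarith)⟩

theorem integral_Ioi_realCubic_rpow (hσ : 0 < σ) (hσx : 9 * σ ^ 2 = x ^ 2 - x + 1) (h0 : 0 < x)
    (h1 : x < 1) (hκ : 2 * σ ^ 3 * κ = (x + 1) / 3 * ((x + 1) / 3 - 1) * ((x + 1) / 3 - x)) :
    ∫ w in Ioi (1 : ℝ), realCubic x σ κ w ^ C = 2 * σ * slopeMoment C (-κ) := by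
  obtain ⟨hb1, -, -, -⟩ := critical_point_bounds hσ hσx h0 h1
  have hmono : StrictMonoOn (realCubic x σ κ) (Ici 1) := by
    refine strictMonoOn_of_deriv_pos (convex_Ici 1) continuous_realCubic.continuousOn ?_
    rw [interior_Ici]
    intro w hw
    rw [(hasDerivAt_realCubic w).deriv]
    exact (deriv_realCubic_pos_of_gt hσ (hb1.trans hw)).2
  have hσ3 : 0 < 2 * σ ^ 3 := by positivity
  have hf1 : realCubic x σ κ 1 = 0 := by
    have := realCubic_eq hσ hσx hκ 1
    simpa [hσ.ne'] using this
  have himage : realCubic x σ κ '' Ioi 1 = Ioi 0 := by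
    refine Subset.antisymm ?_ fun y hy => ?_
    · rintro _ ⟨w, hw, rfl⟩
      rw [mem_Ioi, ← hf1]
      exact hmono (mem_Ici.2 le_rfl) (mem_Ici.2 (le_of_lt hw)) hw
    -- A crude preimage bound: at w = 2 + Y each of the factors w, w - 1 and w - x exceeds 1 or Y,
    -- so the cubic already exceeds Y.
    · set Y := 2 * σ ^ 3 * y with hY
      have hY0 : 0 < Y := mul_pos hσ3 hy
      have hB : y < realCubic x σ κ (2 + Y) := by
        have := realCubic_eq hσ hσx hκ (2 + Y)
        have h3 : Y < (2 + Y) * (2 + Y - 1) * (2 + Y - x) := by nlinarith [mul_pos hY0 hY0]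
        rw [← this, hY] at h3
        exact lt_of_mul_lt_mul_left h3 hσ3.le
      have := intermediate_value_Ioo (show (1 : ℝ) ≤ 2 + Y by linarith)
        (continuous_realCubic (x := x) (σ := σ) (κ := κ)).continuousOn
      obtain ⟨w, hw, hwy⟩ := this ⟨by rw [hf1]; exact hy, hB⟩
      exact ⟨w, hw.1, hwy⟩
  have key := (setIntegral_rpow_mul_density (C := C) (k := 1 / (2 * σ))
    (a := 2 * σ + (x + 1) / 3) (p := fun r => realSlope (r - κ))
    measurableSet_Ioi (fun w _ => hasDerivAt_realCubic w)
    (hmono.injOn.mono Ioi_subset_Ici_self) himage (by positivity) ?_).1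
  · rw [slopeMoment]
    simp only [← sub_eq_add_neg]
    rw [key]
    field_simp
  · intro w hw hwa
    obtain ⟨h3, h4⟩ := deriv_realCubic_pos_of_gt hσ (hb1.trans hw)
    rw [abs_of_pos h4, realCubic, add_sub_cancel_right, div_mul_eq_mul_div,
      realSlope_chebyshev h3]
    rw [ne_eq, div_eq_one_iff_eq (by positivity), sub_eq_iff_eq_add]
    exact hwa

/-- The cubic rises on (0, w_-) and falls on (w_-, x), with range (0, 1+κ) both times after
normalization. The densities are e(-x) on the left root and e(-x) + e(x) on the middle one, and
their sum is the segment density. -/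
theorem integral_Ioo_realCubic_rpow (hσ : 0 < σ) (hσx : 9 * σ ^ 2 = x ^ 2 - x + 1) (h0 : 0 < x)
    (h1 : x < 1) (hκ : 2 * σ ^ 3 * κ = (x + 1) / 3 * ((x + 1) / 3 - 1) * ((x + 1) / 3 - x))
    (hκ8 : |κ| ≤ 1 / 8) (hC : -1 < C) (hC' : C < -1 / 3) :
    ∫ w in Ioo 0 x, realCubic x σ κ w ^ C =
      2 * σ * ∫ r in Ioo 0 (1 + κ), r ^ C * segmentDensity (r - κ) := by
  have hk := abs_le.1 hκ8
  obtain ⟨-, hb0, hbx, hbx'⟩ := critical_point_bounds hσ hσx h0 h1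
  set m := (x + 1) / 3 - σ with hm
  have hmono : StrictMonoOn (realCubic x σ κ) (Icc 0 m) := by
    refine strictMonoOn_of_deriv_pos (convex_Icc _ _) continuous_realCubic.continuousOn ?_
    rw [interior_Icc]
    intro w hw
    rw [(hasDerivAt_realCubic w).deriv]
    exact (deriv_realCubic_pos_of_lt hσ hw.2).2
  have hanti : StrictAntiOn (realCubic x σ κ) (Icc m x) := by
    refine strictAntiOn_of_deriv_neg (convex_Icc _ _) continuous_realCubic.continuousOn ?_
    rw [interior_Icc]
    intro w hw
    rw [(hasDerivAt_realCubic w).deriv]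
    exact (deriv_realCubic_neg hσ hw.1 (hw.2.trans hbx')).2.2
  have hf0 : realCubic x σ κ 0 = 0 := by
    have := realCubic_eq hσ hσx hκ 0
    simpa [hσ.ne'] using this
  have hfx : realCubic x σ κ x = 0 := by
    have := realCubic_eq hσ hσx hκ x
    simpa [hσ.ne'] using this
  have hfm : realCubic x σ κ m = 1 + κ := by
    have : (m - (x + 1) / 3) / (2 * σ) = -(1 / 2) := by rw [hm]; field_simp; ring
    rw [realCubic, this]; norm_num
  have hI1 := image_Ioo_of_strictMonoOn hb0 continuous_realCubic.continuousOn hmono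
  have hI2 := image_Ioo_of_strictAntiOn hbx continuous_realCubic.continuousOn hanti
  rw [hf0, hfm] at hI1
  rw [hfx, hfm] at hI2
  have hneg := integrableOn_rpow_mul_realSlope_neg hκ8 hC hC'
  have hpos := (integrableOn_rpow_mul_realSlope_sub hκ8 hC hC').mono_set
    (Ioo_subset_Ioi_self : Ioo 0 (1 + κ) ⊆ Ioi 0)
  have hsum : IntegrableOn
      (fun r => r ^ C * (realSlope (-(r - κ)) + realSlope (r - κ))) (Ioo 0 (1 + κ)) := by
    refine (hneg.add hpos).congr (Eventually.of_forall fun r => ?_)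
    simp only [Pi.add_apply]
    ring
  have key1 := setIntegral_rpow_mul_density (C := C) (k := 1 / (2 * σ))
    (a := (x + 1) / 3 - 2 * σ) (p := fun r => realSlope (-(r - κ)))
    measurableSet_Ioo (fun w _ => hasDerivAt_realCubic w)
    (hmono.injOn.mono Ioo_subset_Icc_self) hI1 (by positivity) (by
      intro w hw hwa
      obtain ⟨h3, h4⟩ := deriv_realCubic_pos_of_lt hσ hw.2
      have e : ∀ W : ℝ, -(4 * W ^ 3 - 3 * W) = 4 * (-W) ^ 3 - 3 * (-W) := fun W => by ring
      have h5 := realSlope_chebyshev (W := -((w - (x + 1) / 3) / (2 * σ))) (by linarith) (by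
        rw [ne_eq, neg_eq_iff_eq_neg, div_eq_iff (by positivity)]
        intro h; exact hwa (by linarith))
      rw [abs_of_pos h4, realCubic, add_sub_cancel_right, div_mul_eq_mul_div, e]
      rw [neg_sq] at h5
      rw [h5])
  -- On the falling piece |W| < 1/2, so no point is excluded and the value 0 for `a` is arbitrary.
  have key2 := setIntegral_rpow_mul_density (C := C) (k := 1 / (2 * σ))
    (a := 0) (p := fun r => realSlope (-(r - κ)) + realSlope (r - κ))
    measurableSet_Ioo (fun w _ => hasDerivAt_realCubic w)
    (hanti.injOn.mono Ioo_subset_Icc_self) hI2 (by positivity) (by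
      intro w hw _
      obtain ⟨h3, h4, h5⟩ := deriv_realCubic_neg hσ hw.1 (hw.2.trans hbx')
      rw [abs_of_neg h5, realCubic, add_sub_cancel_right, ← neg_div, neg_sub, div_mul_eq_mul_div,
        realSlope_add_chebyshev h3 h4])
  have hsplit : ∫ w in Ioo 0 x, realCubic x σ κ w ^ C =
      (∫ w in Ioo 0 m, realCubic x σ κ w ^ C) + ∫ w in Ioo m x, realCubic x σ κ w ^ C := by
    rw [← integral_Ioc_eq_integral_Ioo (x := 0) (y := m), ← setIntegral_union
      (by rw [Set.disjoint_left]; intro r hr hr'; exact absurd hr.2 (not_le.2 hr'.1))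
      measurableSet_Ioo (by
        rw [integrableOn_Ioc_iff_integrableOn_Ioo]; exact key1.2 hneg) (key2.2 hsum),
      Ioc_union_Ioo_eq_Ioo hb0.le hbx]
  have hdens : ∫ r in Ioo 0 (1 + κ), r ^ C * segmentDensity (r - κ) =
      (∫ r in Ioo 0 (1 + κ), r ^ C * realSlope (-(r - κ))) +
        ∫ r in Ioo 0 (1 + κ), r ^ C * (realSlope (-(r - κ)) + realSlope (r - κ)) := by
    rw [← integral_add hneg hsum]
    refine setIntegral_congr_fun measurableSet_Ioo fun r _ => ?_
    simp only [segmentDensity]; ring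
  rw [hsplit, hdens, key1.1, key2.1]
  field_simp

end

/-! ### The connection formulas for real `z` and `C` -/

section

variable {x C : ℝ}

theorem exists_scale_asymmetry (x : ℝ) : ∃ σ κ : ℝ, 0 < σ ∧ 9 * σ ^ 2 = x ^ 2 - x + 1 ∧
    2 * σ ^ 3 * κ = (x + 1) / 3 * ((x + 1) / 3 - 1) * ((x + 1) / 3 - x) ∧
    scale x = σ ∧ asymmetry x = κ := by
  have hpos : 0 < x ^ 2 - x + 1 := by nlinarith [sq_nonneg (x - 1 / 2)]
  set σ := √(x ^ 2 - x + 1) / 3 with hσ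
  have hσ0 : 0 < σ := div_pos (Real.sqrt_pos.2 hpos) (by norm_num)
  have hs : scale x = σ := by
    have : (x : ℂ) ^ 2 - x + 1 = ((x ^ 2 - x + 1 : ℝ) : ℂ) := by push_cast; ring
    rw [scale, this, csqrt_ofReal hpos.le, hσ]; push_cast; ring
  refine ⟨σ, (x + 1) / 3 * ((x + 1) / 3 - 1) * ((x + 1) / 3 - x) / (2 * σ ^ 3), hσ0, ?_, ?_, hs, ?_⟩
  · rw [hσ, div_pow, Real.sq_sqrt hpos.le]; ring
  · field_simp
  · rw [asymmetry, hs, cubic, center]; push_cast; ring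

theorem cubic_ofReal (x w : ℝ) : cubic x w = ((w * (w - 1) * (w - x) : ℝ) : ℂ) := by
  rw [cubic]; push_cast; ring

theorem integral_integrand₁_ofReal {σ κ : ℝ} (hσ : 0 < σ) (hσx : 9 * σ ^ 2 = x ^ 2 - x + 1)
    (h0 : 0 < x) (h1 : x < 1)
    (hκ : 2 * σ ^ 3 * κ = (x + 1) / 3 * ((x + 1) / 3 - 1) * ((x + 1) / 3 - x)) :
    ∫ w in Ioi (1 : ℝ), integrand₁ x C w =
      (((2 * σ ^ 3) ^ C * (2 * σ * slopeMoment C (-κ)) : ℝ) : ℂ) := by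
  have hσ3 : 0 < 2 * σ ^ 3 := by positivity
  rw [← integral_Ioi_realCubic_rpow hσ hσx h0 h1 hκ, ← integral_const_mul,
    ← integral_complex_ofReal]
  refine setIntegral_congr_fun measurableSet_Ioi fun w hw => ?_
  rw [mem_Ioi] at hw
  have hpos : 0 < w * (w - 1) * (w - x) :=
    mul_pos (mul_pos (by linarith) (by linarith)) (by linarith)
  have hf : 0 ≤ realCubic x σ κ w := by
    rw [← realCubic_eq hσ hσx hκ w] at hpos
    exact (pos_of_mul_pos_right hpos hσ3.le).le
  simp only [integrand₁]
  rw [cubic_ofReal, ← ofReal_cpow hpos.le, ← realCubic_eq hσ hσx hκ w,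
    Real.mul_rpow hσ3.le hf]

theorem integral_integrand₂_ofReal {σ κ : ℝ} (hσ : 0 < σ) (hσx : 9 * σ ^ 2 = x ^ 2 - x + 1)
    (h0 : 0 < x) (h1 : x < 1)
    (hκ : 2 * σ ^ 3 * κ = (x + 1) / 3 * ((x + 1) / 3 - 1) * ((x + 1) / 3 - x))
    (hκ8 : |κ| ≤ 1 / 8) (hC : -1 < C) (hC' : C < -1 / 3) :
    ∫ t in Ioo (0 : ℝ) 1, integrand₂ x C t = (((2 * σ ^ 3) ^ C *
      (2 * σ * ∫ r in Ioo 0 (1 + κ), r ^ C * segmentDensity (r - κ)) : ℝ) : ℂ) := by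
  have hσ3 : 0 < 2 * σ ^ 3 := by positivity
  have himage : (fun t : ℝ => t * x) '' Ioo 0 1 = Ioo 0 x := by
    rw [image_mul_right_Ioo _ _ h0, zero_mul, one_mul]
  rw [← integral_Ioo_realCubic_rpow hσ hσx h0 h1 hκ hκ8 hC hC', ← integral_const_mul, ← himage,
    integral_image_eq_integral_abs_deriv_smul (f := fun t => t * x) measurableSet_Ioo
      (fun t _ => ((hasDerivAt_id t).mul_const x).hasDerivWithinAt)
      (fun a _ b _ h => mul_right_cancel₀ h0.ne' h), ← integral_complex_ofReal]
  refine setIntegral_congr_fun measurableSet_Ioo fun t ht => ?_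
  have hpos : 0 < t * x * (t * x - 1) * (t * x - x) := by
    have h3 : 0 < t * x := mul_pos ht.1 h0
    have h4 : t * x < 1 := by nlinarith [ht.2]
    have h5 : t * x < x := by nlinarith [ht.2]
    exact mul_pos_of_neg_of_neg (mul_neg_of_pos_of_neg h3 (by linarith)) (by linarith)
  have hf : 0 ≤ realCubic x σ κ (t * x) := by
    rw [← realCubic_eq hσ hσx hκ (t * x)] at hpos
    exact (pos_of_mul_pos_right hpos hσ3.le).le
  simp only [integrand₂, one_mul, abs_of_pos h0, smul_eq_mul]
  rw [← ofReal_mul t x, cubic_ofReal, ← ofReal_cpow hpos.le, ← realCubic_eq hσ hσx hκ (t * x),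
    Real.mul_rpow hσ3.le hf, mul_comm x, ofReal_mul _ x]

theorem QMinus_ofReal_cpow {σ κ : ℝ} (hσ : 0 < σ) (hs : scale x = σ) (hk : asymmetry x = κ)
    (hκ8 : |κ| ≤ 1 / 8) : QMinus x ^ (C : ℂ) = (((2 * σ ^ 3) ^ C * (1 + κ) ^ C : ℝ) : ℂ) := by
  have hκ := abs_le.1 hκ8
  have h1 : 0 < 1 + κ := by linarith
  have e : 2 * (σ : ℂ) ^ 3 * (1 + κ) = ((2 * σ ^ 3 * (1 + κ) : ℝ) : ℂ) := by push_cast; ring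
  rw [QMinus_eq (by rw [hs]; exact_mod_cast hσ.ne'), hs, hk, e, ← ofReal_cpow (by positivity),
    Real.mul_rpow (by positivity) h1.le]

/-- The Borel–Laplace representation of the second block. -/
theorem segment_block_ofReal (h0 : 0 < x) (h1 : x < 1) (hκ8 : ‖asymmetry x‖ ≤ 1 / 8)
    (hC : -1 < C) (hC' : C < -1 / 3) :
    ∫ t in Ioo (0 : ℝ) 1, integrand₂ x C t = QMinus x ^ (C : ℂ) *
      (2 * scale x / √3 * (1 + asymmetry x) *
        ∫ t in Ioi (0 : ℝ), exp (-C * t) * innerGerm (asymmetry x) t) := by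
  obtain ⟨σ, κ, hσ, hσx, hκ, hs, hk⟩ := exists_scale_asymmetry x
  rw [hk, norm_real, Real.norm_eq_abs] at hκ8
  have hk1 : 0 < 1 + κ := by linarith [(abs_le.1 hκ8).1]
  rw [integral_integrand₂_ofReal hσ hσx h0 h1 hκ hκ8 hC hC', QMinus_ofReal_cpow hσ hs hk hκ8, hk,
    hs, integral_innerGerm_eq hκ8]
  have h3 : (√3 : ℝ) ≠ 0 := by positivity
  have h2 : (1 + κ) ^ C * ((1 + κ) * (1 + κ) ^ (-(C + 1))) = 1 := by
    rw [← mul_assoc, ← Real.rpow_add_one hk1.ne', ← Real.rpow_add hk1, add_neg_cancel,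
      Real.rpow_zero]
  have e : 2 * (σ : ℂ) / (√3 : ℝ) * (1 + (κ : ℂ)) = ((2 * σ / √3 * (1 + κ) : ℝ) : ℂ) := by
    push_cast; ring
  rw [e, ← ofReal_mul, ← ofReal_mul]
  congr 1
  field_simp
  linear_combination -(∫ r in Ioo 0 (1 + κ), r ^ C * segmentDensity (r - κ)) * h2

theorem one_sub_mem {σ κ : ℝ} (hσx : 9 * σ ^ 2 = x ^ 2 - x + 1)
    (hκ : 2 * σ ^ 3 * κ = (x + 1) / 3 * ((x + 1) / 3 - 1) * ((x + 1) / 3 - x)) :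
    9 * σ ^ 2 = (1 - x) ^ 2 - (1 - x) + 1 ∧ 2 * σ ^ 3 * -κ =
      (1 - x + 1) / 3 * ((1 - x + 1) / 3 - 1) * ((1 - x + 1) / 3 - (1 - x)) :=
  ⟨by rw [hσx]; ring, by linear_combination -hκ⟩

theorem integral_integrand₁_one_sub_ofReal {σ κ : ℝ} (hσ : 0 < σ)
    (hσx : 9 * σ ^ 2 = x ^ 2 - x + 1) (h0 : 0 < x) (h1 : x < 1)
    (hκ : 2 * σ ^ 3 * κ = (x + 1) / 3 * ((x + 1) / 3 - 1) * ((x + 1) / 3 - x)) :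
    ∫ w in Ioi (1 : ℝ), integrand₁ (1 - x) C w =
      (((2 * σ ^ 3) ^ C * (2 * σ * slopeMoment C κ) : ℝ) : ℂ) := by
  obtain ⟨h3, h4⟩ := one_sub_mem hσx hκ
  have := integral_integrand₁_ofReal (C := C) hσ h3 (by linarith) (by linarith) h4
  rwa [neg_neg, ofReal_sub, ofReal_one] at this

/-- The connection formula between the blocks. -/
theorem connection_ofReal (h0 : 0 < x) (h1 : x < 1) (hκ8 : ‖asymmetry x‖ ≤ 1 / 8)
    (hC : -1 < C) (hC' : C < -1 / 3) :
    ∫ t in Ioo (0 : ℝ) 1, integrand₂ x C t = (∫ w in Ioi (1 : ℝ), integrand₁ x C w) -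
      2 * cos (Real.pi * C) * ∫ w in Ioi (1 : ℝ), integrand₁ (1 - x) C w := by
  obtain ⟨σ, κ, hσ, hσx, hκ, hs, hk⟩ := exists_scale_asymmetry x
  rw [hk, norm_real, Real.norm_eq_abs] at hκ8
  rw [integral_integrand₂_ofReal hσ hσx h0 h1 hκ hκ8 hC hC',
    integral_rpow_mul_segmentDensity hκ8 hC hC',
    integral_integrand₁_ofReal hσ hσx h0 h1 hκ, integral_integrand₁_one_sub_ofReal hσ hσx h0 h1 hκ]
  push_cast
  ring

/-- The Laplace transform along the negative axis is a multiple of the reflected first block. -/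
theorem reflected_block_ofReal (h0 : 0 < x) (h1 : x < 1) (hκ8 : ‖asymmetry x‖ ≤ 1 / 8)
    (hC : -1 < C) (hC' : C < -1 / 3) :
    QMinus x ^ (C : ℂ) * (2 * scale x / √3 * (1 + asymmetry x) *
        ∫ t in Ioi (0 : ℝ), exp (C * t) * -outerGerm (asymmetry x) (-t)) =
      -2 * I * sin (Real.pi * C) * ∫ w in Ioi (1 : ℝ), integrand₁ (1 - x) C w := by
  obtain ⟨σ, κ, hσ, hσx, hκ, hs, hk⟩ := exists_scale_asymmetry x
  rw [hk, norm_real, Real.norm_eq_abs] at hκ8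
  have hk1 : 0 < 1 + κ := by linarith [(abs_le.1 hκ8).1]
  rw [integral_integrand₁_one_sub_ofReal hσ hσx h0 h1 hκ, QMinus_ofReal_cpow hσ hs hk hκ8, hk,
    hs, integral_outerGerm_eq hκ8 hC hC']
  have h3 : (√3 : ℂ) ≠ 0 := by
    have : (√3 : ℝ) ≠ 0 := by positivity
    exact_mod_cast this
  have h2 : (1 + κ) ^ C * ((1 + κ) * (1 + κ) ^ (-(C + 1))) = 1 := by
    rw [← mul_assoc, ← Real.rpow_add_one hk1.ne', ← Real.rpow_add hk1, add_neg_cancel,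
      Real.rpow_zero]
  have h2' := congrArg (fun y : ℝ => (y : ℂ)) h2
  simp only [ofReal_mul, ofReal_one, ofReal_add] at h2'
  simp only [ofReal_mul, ofReal_neg, ofReal_sin, ofReal_ofNat]
  generalize (((1 + κ) ^ C : ℝ) : ℂ) = P at *
  generalize (((1 + κ) ^ (-(C + 1)) : ℝ) : ℂ) = R at *
  field_simp
  linear_combination -(((2 * σ ^ 3) ^ C : ℝ) : ℂ) * σ * sin (Real.pi * C) *
    slopeMoment C κ * h2'

end

/-! ### Holomorphy of the blocks -/

/-- The integral `∫_1^∞ Q^C dw`. -/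
def blockRay (z C : ℂ) : ℂ := ∫ w in Ioi (1 : ℝ), integrand₁ z C w

/-- The integral `∫_0^z Q^C dw`. -/
def blockSegment (z C : ℂ) : ℂ := ∫ t in Ioo (0 : ℝ) 1, integrand₂ z C t

theorem norm_cpow_le_rpow (z w : ℂ) : ‖z ^ w‖ ≤ Real.exp (Real.pi * |w.im|) * ‖z‖ ^ w.re := by
  refine (norm_cpow_le z w).trans ?_
  rw [div_eq_mul_inv, ← Real.exp_neg, mul_comm]
  refine mul_le_mul_of_nonneg_right (Real.exp_le_exp.2 ?_) (Real.rpow_nonneg (norm_nonneg _) _)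
  refine (neg_le_abs _).trans ?_
  rw [abs_mul]
  exact mul_le_mul_of_nonneg_right (abs_arg_le_pi z) (abs_nonneg _)

/-- Gives one majorant for all exponents with real part in an interval, whether the base is below or
above 1. -/
theorem rpow_le_add_of_mem_Icc {x a b y : ℝ} (hx : 0 < x) (ha : a ≤ y) (hb : y ≤ b) :
    x ^ y ≤ x ^ a + x ^ b := by
  have h1 := Real.rpow_nonneg hx.le a
  have h2 := Real.rpow_nonneg hx.le b
  rcases le_total 1 x with h | h
  · linarith [Real.rpow_le_rpow_of_exponent_le h hb]
  · linarith [Real.rpow_le_rpow_of_exponent_ge hx h ha]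

section

variable {z C : ℂ} {w t a b : ℝ}

theorem re_lt_of_mem_ball (hz : z ∈ Metric.ball (1 / 2 : ℂ) (1 / 16)) :
    ‖z - 1 / 2‖ < 1 / 16 ∧ 7 / 16 < z.re ∧ z.re < 9 / 16 ∧ ‖z‖ < 9 / 16 := by
  have h := mem_ball_iff_norm.1 hz
  have h1 := abs_le.1 ((abs_re_le_norm (z - 1 / 2)).trans h.le)
  have h3 : (z - 1 / 2).re = z.re - 1 / 2 := by norm_num
  have h2 := abs_re_le_norm (z - 1 / 2)
  rw [h3] at h1 h2
  have h4 := abs_lt.1 (h2.trans_lt h)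
  refine ⟨h, by linarith, by linarith, ?_⟩
  have h5 := norm_add_le (z - 1 / 2) (1 / 2)
  rw [sub_add_cancel] at h5
  norm_num at h5 ⊢
  linarith

/-! ### Majorant and holomorphy of the ray block -/

theorem cubic_mem_slitPlane_of_gt (hz : z ∈ Metric.ball (1 / 2 : ℂ) (1 / 16)) (hw : 1 < w) :
    cubic z w ∈ slitPlane ∧ w ^ 2 * (w - 1) / 4 ≤ ‖cubic z w‖ := by
  obtain ⟨-, -, h1, h2⟩ := re_lt_of_mem_ball hz
  have e : cubic z w = ((w * (w - 1) : ℝ) : ℂ) * (w - z) := by rw [cubic]; push_cast; ring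
  have hpos : 0 < w * (w - 1) := mul_pos (by linarith) (by linarith)
  rw [e]
  refine ⟨Or.inl ?_, ?_⟩
  · rw [re_ofReal_mul, sub_re, ofReal_re]
    exact mul_pos hpos (by linarith)
  · rw [norm_mul, norm_real, Real.norm_of_nonneg hpos.le]
    have h3 : w / 4 ≤ ‖(w : ℂ) - z‖ := by
      have := norm_sub_norm_le (w : ℂ) z
      rw [norm_real, Real.norm_of_nonneg (by linarith)] at this
      linarith
    calc w ^ 2 * (w - 1) / 4 = w * (w - 1) * (w / 4) := by ring
      _ ≤ _ := by gcongr

/-- The majorant of the first block. -/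
def rayMajorant (a w : ℝ) : ℝ := (w ^ 2 * (w - 1) / 4) ^ a

theorem measurable_rayMajorant : Measurable (rayMajorant a) := by
  unfold rayMajorant; fun_prop

/-- Near w = 1 the majorant behaves like (w-1)^a and at infinity like w^{3a}: the two conditions are
the edges of the strip. -/
theorem integrableOn_rayMajorant (ha : -1 < a) (ha' : a < -1 / 3) :
    IntegrableOn (rayMajorant a) (Ioi 1) := by
  rw [← Ioc_union_Ioi_eq_Ioi (show (1 : ℝ) ≤ 2 by norm_num)]
  refine IntegrableOn.union ?_ ?_
  · have h1 : IntegrableOn (fun w : ℝ => (w - 1) ^ a * 4⁻¹ ^ a) (Ioc 1 2) := by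
      have := (intervalIntegral.intervalIntegrable_rpow' (a := 0) (b := 1) ha).comp_sub_right 1
      norm_num at this
      exact ((intervalIntegrable_iff_integrableOn_Ioc_of_le (by norm_num)).1 this).mul_const _
    refine Integrable.mono' h1 measurable_rayMajorant.aestronglyMeasurable ?_
    filter_upwards [ae_restrict_mem measurableSet_Ioc] with w hw
    have hw0 : 0 < w - 1 := by linarith [hw.1]
    have hle : (w - 1) * 4⁻¹ ≤ w ^ 2 * (w - 1) / 4 := by
      have : 1 ≤ w ^ 2 := by nlinarith
      nlinarith
    rw [rayMajorant, Real.norm_of_nonneg (Real.rpow_nonneg ((by positivity : 0 ≤ (w - 1) * 4⁻¹).trans hle) _),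
      ← Real.mul_rpow hw0.le (by norm_num)]
    exact Real.rpow_le_rpow_of_nonpos (by positivity) hle (by linarith)
  · have h1 : IntegrableOn (fun w : ℝ => w ^ (3 * a) * 8⁻¹ ^ a) (Ioi 2) :=
      (integrableOn_Ioi_rpow_of_lt (by linarith) (by norm_num)).mul_const _
    refine Integrable.mono' h1 measurable_rayMajorant.aestronglyMeasurable ?_
    filter_upwards [ae_restrict_mem measurableSet_Ioi] with w hw
    rw [mem_Ioi] at hw
    have hle : w ^ 3 * 8⁻¹ ≤ w ^ 2 * (w - 1) / 4 := by nlinarith [sq_nonneg w]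
    have hw0 : 0 < w := by linarith
    rw [rayMajorant, Real.norm_of_nonneg (Real.rpow_nonneg ((by positivity : 0 ≤ w ^ 3 * 8⁻¹).trans hle) _),
      Real.rpow_mul hw0.le, ← Real.mul_rpow (by positivity) (by norm_num)]
    have e : w ^ (3 : ℝ) = w ^ 3 := by exact_mod_cast Real.rpow_natCast w 3
    rw [e]
    exact Real.rpow_le_rpow_of_nonpos (by positivity) hle (by linarith)

theorem norm_integrand₁_le (hz : z ∈ Metric.ball (1 / 2 : ℂ) (1 / 16)) (ha : a ≤ C.re)
    (hb : C.re ≤ b) (hb0 : b ≤ 0) (hw : 1 < w) : ‖integrand₁ z C w‖ ≤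
      Real.exp (Real.pi * |C.im|) * (rayMajorant a w + rayMajorant b w) := by
  obtain ⟨-, h2⟩ := cubic_mem_slitPlane_of_gt hz hw
  have hpos : 0 < w ^ 2 * (w - 1) / 4 := by
    have : 0 < w - 1 := by linarith
    positivity
  refine (norm_cpow_le_rpow _ _).trans (mul_le_mul_of_nonneg_left ?_ (Real.exp_pos _).le)
  exact (Real.rpow_le_rpow_of_nonpos hpos h2 (hb.trans hb0)).trans
    (rpow_le_add_of_mem_Icc hpos ha hb)

theorem aestronglyMeasurable_integrand₁ (hz : z ∈ Metric.ball (1 / 2 : ℂ) (1 / 16)) :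
    AEStronglyMeasurable (integrand₁ z C) (volume.restrict (Ioi 1)) := by
  refine ContinuousOn.aestronglyMeasurable (fun w hw => ?_) measurableSet_Ioi
  refine ContinuousWithinAt.cpow ?_ continuousWithinAt_const (cubic_mem_slitPlane_of_gt hz hw).1
  unfold cubic; fun_prop

theorem integrableOn_integrand₁ (hz : z ∈ Metric.ball (1 / 2 : ℂ) (1 / 16)) (hC : -1 < C.re)
    (hC' : C.re < -1 / 3) : IntegrableOn (integrand₁ z C) (Ioi 1) := by
  refine Integrable.mono' (((integrableOn_rayMajorant hC hC').add
    (integrableOn_rayMajorant hC hC')).const_mul (Real.exp (Real.pi * |C.im|)))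
    (aestronglyMeasurable_integrand₁ hz) ?_
  filter_upwards [ae_restrict_mem measurableSet_Ioi] with w hw
  exact norm_integrand₁_le hz le_rfl le_rfl (by linarith) hw

theorem differentiableOn_blockRay_left (hC : -1 < C.re) (hC' : C.re < -1 / 3) :
    DifferentiableOn ℂ (fun z => blockRay z C) (Metric.ball (1 / 2 : ℂ) (1 / 16)) := by
  refine differentiableOn_integral_of_locally_dominated Metric.isOpen_ball
    (fun z hz => aestronglyMeasurable_integrand₁ hz) ?_ ?_
  · filter_upwards [ae_restrict_mem measurableSet_Ioi] with w hw z hz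
    refine DifferentiableAt.differentiableWithinAt ?_
    refine DifferentiableAt.cpow ?_ (differentiableAt_const _) (cubic_mem_slitPlane_of_gt hz hw).1
    unfold cubic; fun_prop
  · refine fun z hz => ⟨1, one_pos, _, ((integrableOn_rayMajorant hC hC').add
      (integrableOn_rayMajorant hC hC')).const_mul (Real.exp (Real.pi * |C.im|)), ?_⟩
    filter_upwards [ae_restrict_mem measurableSet_Ioi] with w hw z' hz'
    exact norm_integrand₁_le hz'.2 le_rfl le_rfl (by linarith) hw

theorem abs_re_im_sub_lt {C C' : ℂ} {r : ℝ} (h : C' ∈ Metric.ball C r) :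
    C.re - r < C'.re ∧ C'.re < C.re + r ∧ |C'.im| ≤ |C.im| + r := by
  have h0 := mem_ball_iff_norm.1 h
  have h1 := abs_lt.1 ((abs_re_le_norm (C' - C)).trans_lt h0)
  have h2 := (abs_im_le_norm (C' - C)).trans h0.le
  rw [sub_re] at h1
  rw [sub_im] at h2
  refine ⟨by linarith, by linarith, ?_⟩
  have := abs_add_le C.im (C'.im - C.im)
  rw [add_sub_cancel] at this
  linarith

theorem isOpen_strip : IsOpen {C : ℂ | -1 < C.re ∧ C.re < -1 / 3} :=
  (isOpen_lt continuous_const continuous_re).inter (isOpen_lt continuous_re continuous_const)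

theorem differentiableOn_blockRay (hz : z ∈ Metric.ball (1 / 2 : ℂ) (1 / 16)) :
    DifferentiableOn ℂ (blockRay z) {C | -1 < C.re ∧ C.re < -1 / 3} := by
  refine differentiableOn_integral_of_locally_dominated isOpen_strip
    (fun C _ => aestronglyMeasurable_integrand₁ hz) ?_ ?_
  · filter_upwards [ae_restrict_mem measurableSet_Ioi] with w hw C _
    refine DifferentiableAt.differentiableWithinAt ?_
    exact DifferentiableAt.const_cpow differentiableAt_id
      (Or.inl (slitPlane_ne_zero (cubic_mem_slitPlane_of_gt hz hw).1))
  · rintro C ⟨hC, hC'⟩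
    obtain ⟨r, hr, hr1, hr2⟩ : ∃ r > 0, -1 < C.re - r ∧ C.re + r < -1 / 3 := by
      refine ⟨min (C.re + 1) (-1 / 3 - C.re) / 2, ?_, ?_, ?_⟩
      · have : 0 < min (C.re + 1) (-1 / 3 - C.re) := lt_min (by linarith) (by linarith)
        linarith
      · linarith [min_le_left (C.re + 1) (-1 / 3 - C.re)]
      · linarith [min_le_right (C.re + 1) (-1 / 3 - C.re)]
    refine ⟨r, hr, _, ((integrableOn_rayMajorant hr1 (by linarith)).add
      (integrableOn_rayMajorant (by linarith) hr2)).const_mul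
        (Real.exp (Real.pi * (|C.im| + r))), ?_⟩
    filter_upwards [ae_restrict_mem measurableSet_Ioi] with w hw C' hC'
    obtain ⟨h1, h2, h3⟩ := abs_re_im_sub_lt hC'.1
    refine (norm_integrand₁_le hz h1.le h2.le (by linarith) hw).trans ?_
    refine mul_le_mul_of_nonneg_right (Real.exp_le_exp.2 ?_) ?_
    · have := Real.pi_pos; gcongr
    · have hw0 : 0 < w - 1 := sub_pos.2 hw
      unfold rayMajorant; positivity

/-! ### Majorant and holomorphy of the segment block -/

/-- The cubic factors as t(1-t) · z²(1-tz) on the segment, and the second factor has real part at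
least 1/32 near z = 1/2. The upper bound 1 permits lowering the exponent. -/
theorem cubic_segment_bounds (hz : z ∈ Metric.ball (1 / 2 : ℂ) (1 / 16)) (h0 : 0 < t)
    (h1 : t < 1) : cubic z (t * z) ∈ slitPlane ∧ t * (1 - t) / 32 ≤ ‖cubic z (t * z)‖ ∧
      ‖cubic z (t * z)‖ ≤ 1 := by
  obtain ⟨hd, -, -, hn⟩ := re_lt_of_mem_ball hz
  have e : cubic z (t * z) = ((t * (1 - t) : ℝ) : ℂ) * (z ^ 2 * (1 - t * z)) := by
    rw [cubic]; push_cast; ring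
  have htt : 0 < t * (1 - t) := mul_pos h0 (by linarith)
  set d := z - 1 / 2 with hdd
  have hu : ‖1 - (t : ℂ) * z‖ ≤ 25 / 16 := by
    refine (norm_sub_le _ _).trans ?_
    rw [norm_one, norm_mul, norm_real, Real.norm_of_nonneg h0.le]
    nlinarith [norm_nonneg z]
  have hre : 1 / 32 ≤ (z ^ 2 * (1 - t * z)).re := by
    -- Expansion about z = 1/2 with d = z - 1/2: the main term is at least 1/8, and ‖d‖ < 1/16 makes
    -- the rest smaller than the gap to 1/32.
    have hz2 : z ^ 2 * (1 - t * z) = ((1 / 4 * (1 - t / 2) : ℝ) : ℂ) +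
        ((d ^ 2 + d) * ((1 - t / 2 : ℝ) - t * d) - 1 / 4 * (t * d)) := by
      have : z = d + 1 / 2 := by rw [hdd]; ring
      rw [this]; push_cast; ring
    have herr : ‖(d ^ 2 + d) * ((1 - t / 2 : ℝ) - t * d) - 1 / 4 * (t * d)‖ ≤
        17 / 256 * ((1 - t / 2) + 1 / 16) + 1 / 64 := by
      have htd : ‖(t : ℂ) * d‖ ≤ 1 / 16 := by
        rw [norm_mul, norm_real, Real.norm_of_nonneg h0.le]
        nlinarith [norm_nonneg d]
      have hdd2 : ‖d ^ 2 + d‖ ≤ 17 / 256 := by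
        refine (norm_add_le _ _).trans ?_
        rw [norm_pow]
        nlinarith [norm_nonneg d]
      refine (norm_sub_le _ _).trans (add_le_add ?_ ?_)
      · rw [norm_mul]
        refine mul_le_mul hdd2 ((norm_sub_le _ _).trans ?_) (norm_nonneg _) (by norm_num)
        rw [norm_real, Real.norm_of_nonneg (by linarith)]
        linarith
      · rw [norm_mul]
        have : ‖(1 / 4 : ℂ)‖ = 1 / 4 := by norm_num
        rw [this]
        linarith
    rw [hz2, add_re, ofReal_re]
    have := (abs_le.1 (abs_re_le_norm
      ((d ^ 2 + d) * ((1 - t / 2 : ℝ) - t * d) - 1 / 4 * (t * d)))).1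
    linarith
  rw [e]
  refine ⟨Or.inl ?_, ?_, ?_⟩
  · rw [re_ofReal_mul]; exact mul_pos htt (by linarith)
  · rw [norm_mul, norm_real, Real.norm_of_nonneg htt.le]
    have := hre.trans ((le_abs_self _).trans (abs_re_le_norm _))
    nlinarith
  · rw [norm_mul, norm_real, Real.norm_of_nonneg htt.le, norm_mul, norm_pow]
    have h2 : t * (1 - t) ≤ 1 := by nlinarith
    have h3 : ‖z‖ ^ 2 ≤ 81 / 256 := by nlinarith [norm_nonneg z]
    calc t * (1 - t) * (‖z‖ ^ 2 * ‖1 - (t : ℂ) * z‖) ≤ 1 * (81 / 256 * (25 / 16)) := by gcongr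
      _ ≤ 1 := by norm_num

/-- The majorant of the second block. -/
def segmentMajorant (a t : ℝ) : ℝ := (t * (1 - t) / 32) ^ a

theorem integrableOn_segmentMajorant (ha : -1 < a) (ha' : a ≤ 0) :
    IntegrableOn (segmentMajorant a) (Ioo 0 1) := by
  have hint := intervalIntegral.intervalIntegrable_rpow' (a := 0) (b := 1) ha
  -- On each half of the interval the other factor is at least 1/2, which turns 32 into 64.
  have h1 : IntegrableOn (fun t : ℝ => t ^ a * 64⁻¹ ^ a) (Ioo 0 1) :=
    (((intervalIntegrable_iff_integrableOn_Ioc_of_le (by norm_num)).1 hint).mono_set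
      Ioo_subset_Ioc_self).mul_const _
  have h2 : IntegrableOn (fun t : ℝ => (1 - t) ^ a * 64⁻¹ ^ a) (Ioo 0 1) := by
    have := (hint.comp_sub_left 1).symm
    norm_num at this
    exact (((intervalIntegrable_iff_integrableOn_Ioc_of_le (by norm_num)).1 this).mono_set
      Ioo_subset_Ioc_self).mul_const _
  refine Integrable.mono' (h1.add h2) (by
    unfold segmentMajorant
    exact Measurable.aestronglyMeasurable (by fun_prop)) ?_
  filter_upwards [ae_restrict_mem measurableSet_Ioo] with t ht
  have h3 : 0 < 1 - t := by linarith [ht.2]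
  have h0 := ht.1
  have htt : 0 < t * (1 - t) / 32 := by positivity
  have e1 : 0 ≤ t ^ a * (64⁻¹ : ℝ) ^ a := by positivity
  have e2 : 0 ≤ (1 - t) ^ a * (64⁻¹ : ℝ) ^ a := by positivity
  rw [segmentMajorant, Real.norm_of_nonneg (Real.rpow_nonneg htt.le _), Pi.add_apply]
  rcases le_total t (1 / 2) with h | h
  · have h5 : (t * (1 - t) / 32) ^ a ≤ (t * 64⁻¹) ^ a :=
      Real.rpow_le_rpow_of_nonpos (by positivity) (by nlinarith) ha'
    rw [Real.mul_rpow h0.le (by norm_num)] at h5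
    linarith
  · have h5 : (t * (1 - t) / 32) ^ a ≤ ((1 - t) * 64⁻¹) ^ a :=
      Real.rpow_le_rpow_of_nonpos (by positivity) (by nlinarith) ha'
    rw [Real.mul_rpow h3.le (by norm_num)] at h5
    linarith

theorem norm_integrand₂_le (hz : z ∈ Metric.ball (1 / 2 : ℂ) (1 / 16)) (ha : a ≤ C.re)
    (ha0 : a ≤ 0) (h0 : 0 < t) (h1 : t < 1) :
    ‖integrand₂ z C t‖ ≤ Real.exp (Real.pi * |C.im|) * segmentMajorant a t := by
  obtain ⟨hs, hlow, hup⟩ := cubic_segment_bounds hz h0 h1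
  have hpos : 0 < t * (1 - t) / 32 := by
    have : 0 < 1 - t := by linarith
    positivity
  have h2 : ‖cubic z (t * z) ^ C‖ ≤ Real.exp (Real.pi * |C.im|) * segmentMajorant a t := by
    refine (norm_cpow_le_rpow _ _).trans (mul_le_mul_of_nonneg_left ?_ (Real.exp_pos _).le)
    exact (Real.rpow_le_rpow_of_exponent_ge (hpos.trans_le hlow) hup ha).trans
      (Real.rpow_le_rpow_of_nonpos hpos hlow ha0)
  rw [integrand₂, norm_mul]
  have h3 : ‖z‖ ≤ 1 := by linarith [(re_lt_of_mem_ball hz).2.2.2]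
  calc _ ≤ ‖cubic z (t * z) ^ C‖ * 1 := by gcongr
    _ ≤ _ := by rwa [mul_one]

theorem aestronglyMeasurable_integrand₂ (hz : z ∈ Metric.ball (1 / 2 : ℂ) (1 / 16)) :
    AEStronglyMeasurable (integrand₂ z C) (volume.restrict (Ioo 0 1)) := by
  refine ContinuousOn.aestronglyMeasurable (fun t ht => ?_) measurableSet_Ioo
  refine ContinuousWithinAt.mul ?_ continuousWithinAt_const
  refine ContinuousWithinAt.cpow ?_ continuousWithinAt_const
    (cubic_segment_bounds hz ht.1 ht.2).1
  unfold cubic; fun_prop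

theorem integrableOn_integrand₂ (hz : z ∈ Metric.ball (1 / 2 : ℂ) (1 / 16)) (hC : -1 < C.re) :
    IntegrableOn (integrand₂ z C) (Ioo 0 1) := by
  -- The majorant is decreasing in its base only for nonpositive exponents; since |Q| ≤ 1, larger
  -- exponents may be replaced by 0.
  refine Integrable.mono' ((integrableOn_segmentMajorant (a := min C.re 0)
    (lt_min hC (by norm_num)) (min_le_right _ _)).const_mul (Real.exp (Real.pi * |C.im|)))
    (aestronglyMeasurable_integrand₂ hz) ?_
  filter_upwards [ae_restrict_mem measurableSet_Ioo] with t ht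
  exact norm_integrand₂_le hz (min_le_left _ _) (min_le_right _ _) ht.1 ht.2

theorem differentiableOn_blockSegment_left (hC : -1 < C.re) :
    DifferentiableOn ℂ (fun z => blockSegment z C) (Metric.ball (1 / 2 : ℂ) (1 / 16)) := by
  refine differentiableOn_integral_of_locally_dominated Metric.isOpen_ball
    (fun z hz => aestronglyMeasurable_integrand₂ hz) ?_ ?_
  · filter_upwards [ae_restrict_mem measurableSet_Ioo] with t ht z hz
    refine DifferentiableAt.differentiableWithinAt (DifferentiableAt.mul ?_ differentiableAt_id)
    refine DifferentiableAt.cpow ?_ (differentiableAt_const _)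
      (cubic_segment_bounds hz ht.1 ht.2).1
    unfold cubic; fun_prop
  · refine fun z hz => ⟨1, one_pos, _, (integrableOn_segmentMajorant (a := min C.re 0)
      (lt_min hC (by norm_num)) (min_le_right _ _)).const_mul (Real.exp (Real.pi * |C.im|)), ?_⟩
    filter_upwards [ae_restrict_mem measurableSet_Ioo] with t ht z' hz'
    exact norm_integrand₂_le hz'.2 (min_le_left _ _) (min_le_right _ _) ht.1 ht.2

theorem isOpen_re_gt (a : ℝ) : IsOpen {C : ℂ | a < C.re} := isOpen_lt continuous_const continuous_re

theorem isOpen_re_lt (a : ℝ) : IsOpen {C : ℂ | C.re < a} := isOpen_lt continuous_re continuous_const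

theorem isOpen_im_neg : IsOpen {C : ℂ | C.im < 0} := isOpen_lt continuous_im continuous_const

theorem differentiableOn_blockSegment (hz : z ∈ Metric.ball (1 / 2 : ℂ) (1 / 16)) :
    DifferentiableOn ℂ (blockSegment z) {C | -1 < C.re} := by
  refine differentiableOn_integral_of_locally_dominated (isOpen_re_gt _)
    (fun C _ => aestronglyMeasurable_integrand₂ hz) ?_ ?_
  · filter_upwards [ae_restrict_mem measurableSet_Ioo] with t ht C _
    refine DifferentiableAt.differentiableWithinAt (DifferentiableAt.mul_const ?_ _)
    exact DifferentiableAt.const_cpow differentiableAt_id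
      (Or.inl (slitPlane_ne_zero (cubic_segment_bounds hz ht.1 ht.2).1))
  · intro C hC
    rw [mem_ofPred_eq] at hC
    -- Half the distance to the edge Re C = -1, so that Re C' stays above (Re C - 1)/2 > -1 on the
    -- disc.
    refine ⟨(C.re + 1) / 2, by linarith, _, (integrableOn_segmentMajorant
      (a := min ((C.re - 1) / 2) 0) (lt_min (by linarith) (by norm_num))
      (min_le_right _ _)).const_mul (Real.exp (Real.pi * (|C.im| + (C.re + 1) / 2))), ?_⟩
    filter_upwards [ae_restrict_mem measurableSet_Ioo] with t ht C' hC'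
    obtain ⟨h1, -, h3⟩ := abs_re_im_sub_lt hC'.1
    refine (norm_integrand₂_le hz ((min_le_left _ _).trans (by linarith : (C.re - 1) / 2 ≤ C'.re))
      (min_le_right _ _) ht.1 ht.2).trans ?_
    refine mul_le_mul_of_nonneg_right (Real.exp_le_exp.2 ?_) ?_
    · have := Real.pi_pos; gcongr
    · have h4 : 0 < 1 - t := by linarith [ht.2]
      have h5 := ht.1
      unfold segmentMajorant; positivity

end

/-! ### Laplace transforms along the real axis -/

/-- The Laplace transform of the Borel germ along the positive axis. -/
def laplacePos (κ C : ℂ) : ℂ := ∫ t in Ioi (0 : ℝ), exp (-C * t) * innerGerm κ t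

/-- The Laplace transform of the Borel germ along the negative axis. -/
def laplaceNeg (κ C : ℂ) : ℂ := ∫ t in Ioi (0 : ℝ), exp (C * t) * -outerGerm κ (-t)

section

variable {κ C : ℂ} {t a : ℝ}

theorem integrableOn_one_add_rpow_mul_exp (ha : 0 < a) (M : ℝ) :
    IntegrableOn (fun t : ℝ => M * (Real.exp (-(a * t)) * (1 + t ^ (-(1 / 2) : ℝ)))) (Ioi 0) := by
  have h1 := integrableOn_rpow_mul_exp_neg_mul (s := 0) (by norm_num) ha
  have h2 := integrableOn_rpow_mul_exp_neg_mul (s := -(1 / 2)) (by norm_num) ha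
  refine ((h1.add h2).const_mul M).congr (Eventually.of_forall fun t => ?_)
  simp only [Pi.add_apply, Real.rpow_zero]
  ring

theorem norm_exp_mul_innerGerm_le (hκ : 8 * ‖κ‖ ≤ 1) (hC : a - 1 ≤ C.re) (ht : 0 < t) :
    ‖exp (-C * t) * innerGerm κ t‖ ≤
      2 * (√(1 / 2))⁻¹ * (Real.exp (-(a * t)) * (1 + t ^ (-(1 / 2) : ℝ))) := by
  rw [norm_mul, norm_exp, re_mul_ofReal, neg_re]
  have h1 := norm_innerGerm_le hκ ht
  have h2 := Real.rpow_nonneg ht.le (-(1 / 2))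
  calc _ ≤ Real.exp (-C.re * t) *
        (2 * (√(1 / 2))⁻¹ * (Real.exp (-t) * (1 + t ^ (-(1 / 2) : ℝ)))) := by gcongr
    _ = 2 * (√(1 / 2))⁻¹ * (Real.exp (-C.re * t + -t) * (1 + t ^ (-(1 / 2) : ℝ))) := by
        rw [Real.exp_add]; ring
    _ ≤ _ := by
        gcongr
        nlinarith

theorem neg_ofReal_mem_outerRegion (ht : 0 < t) : -(t : ℂ) ∈ outerRegion 1 := by
  refine ⟨by simpa using ht, ?_⟩
  have : 1 + exp (-(t : ℂ)) = ((1 + Real.exp (-t) : ℝ) : ℂ) := by push_cast; ring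
  rw [this, ofReal_re]
  linarith [Real.exp_pos (-t)]

theorem norm_exp_mul_outerGerm_le (hκ : 8 * ‖κ‖ ≤ 1) (hC : C.re ≤ -1 / 3 - a) (ht : 0 < t) :
    ‖exp (C * t) * -outerGerm κ (-t)‖ ≤
      2 * (√(1 / 2))⁻¹ * (Real.exp (-(a * t)) * (1 + t ^ (-(1 / 2) : ℝ))) := by
  have h1 := norm_outerGerm_le le_rfl one_pos hκ (neg_ofReal_mem_outerRegion ht)
  have h2 := Real.rpow_nonneg ht.le (-(1 / 2))
  rw [neg_re, ofReal_re, neg_neg] at h1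
  rw [norm_mul, norm_neg, norm_exp, re_mul_ofReal]
  calc _ ≤ Real.exp (C.re * t) *
        (2 * (√(1 / 2))⁻¹ * (Real.exp (t / 3) * (1 + t ^ (-(1 / 2) : ℝ)))) := by gcongr
    _ = 2 * (√(1 / 2))⁻¹ * (Real.exp (C.re * t + t / 3) * (1 + t ^ (-(1 / 2) : ℝ))) := by
        rw [Real.exp_add]; ring
    _ ≤ _ := by
        gcongr
        nlinarith

theorem continuousOn_innerGerm_ofReal (hκ : 8 * ‖κ‖ ≤ 1 / 4) :
    ContinuousOn (fun t : ℝ => innerGerm κ t) (Ioi 0) := by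
  intro t ht
  have h := (differentiableAt_innerGerm (c := 1 / 4) (by norm_num) (by norm_num) hκ
    (ofReal_mem_innerRegion one_pos le_rfl ht)).continuousAt
  exact (ContinuousAt.comp (g := fun p : ℂ × ℂ => innerGerm p.1 p.2) (f := fun t : ℝ => (κ, (t : ℂ)))
    h (by fun_prop)).continuousWithinAt

theorem continuousOn_outerGerm_neg_ofReal (hκ : 8 * ‖κ‖ ≤ 1) :
    ContinuousOn (fun t : ℝ => outerGerm κ (-t)) (Ioi 0) := by
  intro t ht
  have h := (differentiableAt_outerGerm le_rfl one_pos hκ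
    (neg_ofReal_mem_outerRegion ht)).continuousAt
  exact (ContinuousAt.comp (g := fun p : ℂ × ℂ => outerGerm p.1 p.2)
    (f := fun t : ℝ => (κ, -(t : ℂ))) h (by fun_prop)).continuousWithinAt

theorem aestronglyMeasurable_laplacePos (hκ : 8 * ‖κ‖ ≤ 1 / 4) :
    AEStronglyMeasurable (fun t : ℝ => exp (-C * t) * innerGerm κ t) (volume.restrict (Ioi 0)) :=
  ContinuousOn.aestronglyMeasurable (ContinuousOn.mul (by fun_prop)
    (continuousOn_innerGerm_ofReal hκ)) measurableSet_Ioi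

theorem aestronglyMeasurable_laplaceNeg (hκ : 8 * ‖κ‖ ≤ 1) :
    AEStronglyMeasurable (fun t : ℝ => exp (C * t) * -outerGerm κ (-t))
      (volume.restrict (Ioi 0)) :=
  ContinuousOn.aestronglyMeasurable (ContinuousOn.mul (by fun_prop)
    (continuousOn_outerGerm_neg_ofReal hκ).neg) measurableSet_Ioi

theorem integrableOn_laplacePos (hκ : 8 * ‖κ‖ ≤ 1 / 4) (hC : -1 < C.re) :
    IntegrableOn (fun t : ℝ => exp (-C * t) * innerGerm κ t) (Ioi 0) := by
  refine Integrable.mono' (integrableOn_one_add_rpow_mul_exp (a := C.re + 1) (by linarith)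
    (2 * (√(1 / 2))⁻¹)) (aestronglyMeasurable_laplacePos hκ) ?_
  filter_upwards [ae_restrict_mem measurableSet_Ioi] with t ht
  exact norm_exp_mul_innerGerm_le (by linarith) (by linarith) ht

theorem isOpen_asymmetry_region (c : ℝ) : IsOpen {κ : ℂ | 8 * ‖κ‖ < c} :=
  isOpen_lt (by fun_prop) continuous_const

theorem differentiableOn_laplacePos_left (hC : -1 < C.re) :
    DifferentiableOn ℂ (fun κ => laplacePos κ C) {κ | 8 * ‖κ‖ < 1 / 4} := by
  refine differentiableOn_integral_of_locally_dominated (isOpen_asymmetry_region _)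
    (fun κ hκ => aestronglyMeasurable_laplacePos (le_of_lt hκ)) ?_ ?_
  · filter_upwards [ae_restrict_mem measurableSet_Ioi] with t ht κ hκ
    have h := differentiableAt_innerGerm (c := 1 / 4) (by norm_num) (by norm_num) (le_of_lt hκ)
      (ofReal_mem_innerRegion one_pos le_rfl ht)
    exact ((DifferentiableAt.comp (g := fun p : ℂ × ℂ => innerGerm p.1 p.2)
      (f := fun κ : ℂ => (κ, (t : ℂ))) κ h (by fun_prop)).const_mul _).differentiableWithinAt
  · refine fun κ hκ => ⟨1, one_pos, _, integrableOn_one_add_rpow_mul_exp (a := C.re + 1)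
      (by linarith) (2 * (√(1 / 2))⁻¹), ?_⟩
    filter_upwards [ae_restrict_mem measurableSet_Ioi] with t ht κ' hκ'
    have := hκ'.2
    rw [mem_ofPred_eq] at this
    exact norm_exp_mul_innerGerm_le (by linarith) (by linarith) ht

theorem differentiableOn_laplacePos (hκ : 8 * ‖κ‖ ≤ 1 / 4) :
    DifferentiableOn ℂ (laplacePos κ) {C | -1 < C.re} := by
  refine differentiableOn_integral_of_locally_dominated (isOpen_re_gt _)
    (fun C _ => aestronglyMeasurable_laplacePos hκ) ?_ ?_
  · exact Eventually.of_forall fun t => by fun_prop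
  · intro C hC
    rw [mem_ofPred_eq] at hC
    refine ⟨(C.re + 1) / 2, by linarith, _, integrableOn_one_add_rpow_mul_exp
      (a := (C.re + 1) / 2) (by linarith) (2 * (√(1 / 2))⁻¹), ?_⟩
    filter_upwards [ae_restrict_mem measurableSet_Ioi] with t ht C' hC'
    obtain ⟨h1, -, -⟩ := abs_re_im_sub_lt hC'.1
    exact norm_exp_mul_innerGerm_le (by linarith) (by linarith) ht

theorem differentiableOn_laplaceNeg_left (hC : C.re < -1 / 3) :
    DifferentiableOn ℂ (fun κ => laplaceNeg κ C) {κ | 8 * ‖κ‖ < 1} := by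
  refine differentiableOn_integral_of_locally_dominated (isOpen_asymmetry_region _)
    (fun κ hκ => aestronglyMeasurable_laplaceNeg (le_of_lt hκ)) ?_ ?_
  · filter_upwards [ae_restrict_mem measurableSet_Ioi] with t ht κ hκ
    have h := differentiableAt_outerGerm le_rfl one_pos (le_of_lt hκ)
      (neg_ofReal_mem_outerRegion ht)
    exact ((DifferentiableAt.comp (g := fun p : ℂ × ℂ => outerGerm p.1 p.2)
      (f := fun κ : ℂ => (κ, -(t : ℂ))) κ h (by fun_prop)).neg.const_mul _).differentiableWithinAt
  · refine fun κ hκ => ⟨1, one_pos, _, integrableOn_one_add_rpow_mul_exp (a := -1 / 3 - C.re)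
      (by linarith) (2 * (√(1 / 2))⁻¹), ?_⟩
    filter_upwards [ae_restrict_mem measurableSet_Ioi] with t ht κ' hκ'
    exact norm_exp_mul_outerGerm_le (le_of_lt hκ'.2) (by linarith) ht

theorem differentiableOn_laplaceNeg (hκ : 8 * ‖κ‖ ≤ 1) :
    DifferentiableOn ℂ (laplaceNeg κ) {C | C.re < -1 / 3} := by
  refine differentiableOn_integral_of_locally_dominated (isOpen_re_lt _)
    (fun C _ => aestronglyMeasurable_laplaceNeg hκ) ?_ ?_
  · exact Eventually.of_forall fun t => by fun_prop
  · intro C hC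
    rw [mem_ofPred_eq] at hC
    refine ⟨(-1 / 3 - C.re) / 2, by linarith, _, integrableOn_one_add_rpow_mul_exp
      (a := (-1 / 3 - C.re) / 2) (by linarith) (2 * (√(1 / 2))⁻¹), ?_⟩
    filter_upwards [ae_restrict_mem measurableSet_Ioi] with t ht C' hC'
    obtain ⟨-, h1, -⟩ := abs_re_im_sub_lt hC'.1
    exact norm_exp_mul_outerGerm_le hκ (by linarith) ht

end

/-! ### The connection formulas near `z = 1/2` -/

section

variable {z : ℂ}

theorem re_discriminant_pos (hz : z ∈ Metric.ball (1 / 2 : ℂ) (1 / 16)) :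
    0 < (z ^ 2 - z + 1).re := by
  have h := (re_lt_of_mem_ball hz).1
  have e : z ^ 2 - z + 1 = ((3 / 4 : ℝ) : ℂ) + (z - 1 / 2) ^ 2 := by push_cast; ring
  rw [e, add_re, ofReal_re]
  have h1 := (abs_le.1 (abs_re_le_norm ((z - 1 / 2) ^ 2))).1
  rw [norm_pow] at h1
  nlinarith [norm_nonneg (z - 1 / 2)]

theorem scale_re_pos (hz : z ∈ Metric.ball (1 / 2 : ℂ) (1 / 16)) : 0 < (scale z).re := by
  rw [scale, div_ofNat_re]
  exact div_pos (csqrt_re_pos (Or.inl (re_discriminant_pos hz))) (by norm_num)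

theorem scale_ne_zero (hz : z ∈ Metric.ball (1 / 2 : ℂ) (1 / 16)) : scale z ≠ 0 := fun h => by
  have := scale_re_pos hz
  rw [h] at this
  exact lt_irrefl _ this

theorem differentiableAt_scale (hz : z ∈ Metric.ball (1 / 2 : ℂ) (1 / 16)) :
    DifferentiableAt ℂ scale z :=
  (DifferentiableAt.comp (g := csqrt) (f := fun z : ℂ => z ^ 2 - z + 1) z
    (differentiableAt_csqrt (Or.inl (re_discriminant_pos hz))) (by fun_prop)).div_const 3

theorem differentiableAt_asymmetry (hz : z ∈ Metric.ball (1 / 2 : ℂ) (1 / 16)) :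
    DifferentiableAt ℂ asymmetry z := by
  refine DifferentiableAt.div (DifferentiableAt.comp (g := fun p : ℂ × ℂ => cubic p.1 p.2)
    (f := fun z => (z, center z)) z ?_ ?_) (((differentiableAt_scale hz).pow 3).const_mul 2)
    (mul_ne_zero two_ne_zero (pow_ne_zero 3 (scale_ne_zero hz)))
  · unfold cubic; fun_prop
  · unfold center; fun_prop

theorem differentiableAt_QMinus (hz : z ∈ Metric.ball (1 / 2 : ℂ) (1 / 16)) :
    DifferentiableAt ℂ QMinus z := by
  have h : DifferentiableAt ℂ (fun z => 2 * scale z ^ 3 * (1 + asymmetry z)) z :=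
    (((differentiableAt_scale hz).pow 3).const_mul 2).mul
      ((differentiableAt_asymmetry hz).const_add 1)
  refine h.congr_of_eventuallyEq ?_
  filter_upwards [Metric.isOpen_ball.mem_nhds hz] with y hy
  exact QMinus_eq (scale_ne_zero hy)

end

/-! ### Good discs around 1/2 and continuation from real parameters -/

theorem half_mem_ball {r : ℝ} (hr : 0 < r) : (1 / 2 : ℂ) ∈ Metric.ball (1 / 2 : ℂ) r :=
  Metric.mem_ball_self hr

theorem asymmetry_half : asymmetry (1 / 2) = 0 := by
  have : cubic (1 / 2) (center (1 / 2)) = 0 := by rw [cubic, center]; norm_num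
  rw [asymmetry, this, zero_div]

theorem QMinus_half_re_pos : 0 < (QMinus (1 / 2)).re := by
  obtain ⟨σ, κ, hσ, -, -, hs, -⟩ := exists_scale_asymmetry (1 / 2)
  have h : QMinus (1 / 2) = ((2 * σ ^ 3 : ℝ) : ℂ) := by
    rw [QMinus_eq (scale_ne_zero (half_mem_ball (by norm_num))), asymmetry_half]
    push_cast at hs
    rw [hs]; push_cast; ring
  rw [h, ofReal_re]
  positivity

/-- A disc at `1/2` where the asymmetry is small and the critical value `Q_-` has positive real
part. -/
structure IsGoodRadius (c δ : ℝ) : Prop where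
  pos : 0 < δ
  le : δ ≤ 1 / 16
  asymmetry_lt : ∀ z ∈ Metric.ball (1 / 2 : ℂ) δ, 8 * ‖asymmetry z‖ < c
  re_pos : ∀ z ∈ Metric.ball (1 / 2 : ℂ) δ, 0 < (QMinus z).re

theorem exists_isGoodRadius {c : ℝ} (hc : 0 < c) : ∃ δ, IsGoodRadius c δ := by
  have hmem : (1 / 2 : ℂ) ∈ Metric.ball (1 / 2 : ℂ) (1 / 16) := half_mem_ball (by norm_num)
  have h1 : ∀ᶠ z in 𝓝 (1 / 2 : ℂ), 8 * ‖asymmetry z‖ < c := by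
    have : ContinuousAt (fun z => 8 * ‖asymmetry z‖) (1 / 2) :=
      (differentiableAt_asymmetry hmem).continuousAt.norm.const_mul 8
    refine this.eventually_lt continuousAt_const ?_
    rw [asymmetry_half, norm_zero, mul_zero]; exact hc
  have h2 : ∀ᶠ z in 𝓝 (1 / 2 : ℂ), 0 < (QMinus z).re := by
    have : ContinuousAt (fun z => (QMinus z).re) (1 / 2) :=
      continuous_re.continuousAt.comp (differentiableAt_QMinus hmem).continuousAt
    exact continuousAt_const.eventually_lt this QMinus_half_re_pos
  obtain ⟨δ, hδ, h⟩ := Metric.eventually_nhds_iff_ball.1 (h1.and h2)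
  refine ⟨min δ (1 / 16), lt_min hδ (by norm_num), min_le_right _ _, fun z hz => ?_, fun z hz => ?_⟩
  · exact (h z (Metric.ball_subset_ball (min_le_left _ _) hz)).1
  · exact (h z (Metric.ball_subset_ball (min_le_left _ _) hz)).2

section

variable {c δ : ℝ} {z C : ℂ}

theorem IsGoodRadius.mem (h : IsGoodRadius c δ) (hz : z ∈ Metric.ball (1 / 2 : ℂ) δ) :
    z ∈ Metric.ball (1 / 2 : ℂ) (1 / 16) := Metric.ball_subset_ball h.le hz

theorem IsGoodRadius.mono {c' : ℝ} (h : IsGoodRadius c δ) (hc : c ≤ c') : IsGoodRadius c' δ :=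
  ⟨h.pos, h.le, fun z hz => (h.asymmetry_lt z hz).trans_le hc, h.re_pos⟩

theorem one_sub_mem_ball (hz : z ∈ Metric.ball (1 / 2 : ℂ) δ) :
    1 - z ∈ Metric.ball (1 / 2 : ℂ) δ := by
  rw [mem_ball_iff_norm] at hz ⊢
  have : 1 - z - 1 / 2 = -(z - 1 / 2) := by ring
  rwa [this, norm_neg]

theorem QMinus_mem_slitPlane (h : IsGoodRadius c δ) (hz : z ∈ Metric.ball (1 / 2 : ℂ) δ) :
    QMinus z ∈ slitPlane := Or.inl (h.re_pos z hz)

theorem eventually_ofReal_mem_ball (hδ : 0 < δ) :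
    ∀ᶠ x : ℝ in 𝓝 (1 / 2), (x : ℂ) ∈ Metric.ball (1 / 2 : ℂ) δ := by
  have h : ContinuousAt (fun x : ℝ => (x : ℂ)) (1 / 2) := continuous_ofReal.continuousAt
  refine h.eventually_mem (Metric.isOpen_ball.mem_nhds ?_)
  have : ((1 / 2 : ℝ) : ℂ) = 1 / 2 := by norm_num
  rw [this]
  exact half_mem_ball hδ

theorem isPreconnected_ball : IsPreconnected (Metric.ball (1 / 2 : ℂ) δ) :=
  (convex_ball _ _).isPreconnected

theorem isPreconnected_strip : IsPreconnected {C : ℂ | -1 < C.re ∧ C.re < -1 / 3} :=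
  ((convex_halfSpace_re_gt (-1)).inter (convex_halfSpace_re_lt (-1 / 3))).isPreconnected

/-- Identities proved for real z spread to the disc; applied for each fixed real C in the strip,
before C itself is made complex. -/
theorem eqOn_ball_of_ofReal {f g : ℂ → ℂ} (hδ : 0 < δ)
    (hf : DifferentiableOn ℂ f (Metric.ball (1 / 2 : ℂ) δ))
    (hg : DifferentiableOn ℂ g (Metric.ball (1 / 2 : ℂ) δ))
    (h : ∀ x : ℝ, 0 < x → x < 1 → (x : ℂ) ∈ Metric.ball (1 / 2 : ℂ) δ → f x = g x) :
    EqOn f g (Metric.ball (1 / 2 : ℂ) δ) := by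
  refine eqOn_of_eventually_eq_ofReal Metric.isOpen_ball isPreconnected_ball hf hg (x₀ := 1 / 2)
    (by
      have : ((1 / 2 : ℝ) : ℂ) = 1 / 2 := by norm_num
      rw [this]; exact half_mem_ball hδ) ?_
  filter_upwards [eventually_ofReal_mem_ball hδ,
    Ioo_mem_nhds (show (0 : ℝ) < 1 / 2 by norm_num) (show (1 / 2 : ℝ) < 1 by norm_num)]
    with x hx hx'
  exact h x hx'.1 hx'.2 hx

theorem eventually_mem_Ioo_strip : ∀ᶠ x : ℝ in 𝓝 (-1 / 2), -1 < x ∧ x < -1 / 3 :=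
  Ioo_mem_nhds (by norm_num) (by norm_num)

theorem differentiableOn_QMinus_cpow_left (h : IsGoodRadius c δ) (C : ℂ) :
    DifferentiableOn ℂ (fun z => QMinus z ^ C) (Metric.ball (1 / 2 : ℂ) δ) := fun _ hz =>
  (DifferentiableAt.cpow (differentiableAt_QMinus (h.mem hz)) (differentiableAt_const _)
    (QMinus_mem_slitPlane h hz)).differentiableWithinAt

theorem differentiable_QMinus_cpow (h : IsGoodRadius c δ) (hz : z ∈ Metric.ball (1 / 2 : ℂ) δ) :
    Differentiable ℂ (fun C : ℂ => QMinus z ^ C) := fun _ =>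
  DifferentiableAt.const_cpow differentiableAt_id
    (Or.inl (slitPlane_ne_zero (QMinus_mem_slitPlane h hz)))

theorem differentiableOn_prefactor (h : IsGoodRadius c δ) :
    DifferentiableOn ℂ (fun z => 2 * scale z / √3 * (1 + asymmetry z))
      (Metric.ball (1 / 2 : ℂ) δ) := fun _ hz =>
  ((((differentiableAt_scale (h.mem hz)).const_mul 2).div_const _).mul
    ((differentiableAt_asymmetry (h.mem hz)).const_add 1)).differentiableWithinAt

theorem differentiableOn_asymmetry (h : IsGoodRadius c δ) :
    DifferentiableOn ℂ asymmetry (Metric.ball (1 / 2 : ℂ) δ) := fun _ hz =>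
  (differentiableAt_asymmetry (h.mem hz)).differentiableWithinAt

theorem differentiableOn_blockRay_one_sub (h : IsGoodRadius c δ) (hC : -1 < C.re)
    (hC' : C.re < -1 / 3) :
    DifferentiableOn ℂ (fun z => blockRay (1 - z) C) (Metric.ball (1 / 2 : ℂ) δ) :=
  DifferentiableOn.comp (g := fun z => blockRay z C) (f := fun z : ℂ => 1 - z)
    (differentiableOn_blockRay_left hC hC') (by fun_prop)
    (fun _ hz => h.mem (one_sub_mem_ball hz))

/-- The Borel–Laplace representation of the second block. -/
theorem blockSegment_eq_laplacePos (h : IsGoodRadius (1 / 4) δ)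
    (hz : z ∈ Metric.ball (1 / 2 : ℂ) δ) (hC : -1 < C.re) :
    blockSegment z C = QMinus z ^ C *
      (2 * scale z / √3 * (1 + asymmetry z) * laplacePos (asymmetry z) C) := by
  -- For real C the continuation takes place in z; the result at the given z is then continued in C
  -- from the interval (-1, -1/3).
  have hreal : ∀ y : ℝ, -1 < y → y < -1 / 3 → blockSegment z y = QMinus z ^ (y : ℂ) *
      (2 * scale z / √3 * (1 + asymmetry z) * laplacePos (asymmetry z) y) := by
    intro y hy hy'
    have hyre : -1 < (y : ℂ).re := by rwa [ofReal_re]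
    refine eqOn_ball_of_ofReal h.pos
      ((differentiableOn_blockSegment_left hyre).mono (Metric.ball_subset_ball h.le))
      ((differentiableOn_QMinus_cpow_left h y).mul ((differentiableOn_prefactor h).mul
        (DifferentiableOn.comp (g := fun κ => laplacePos κ y)
          (differentiableOn_laplacePos_left hyre) (differentiableOn_asymmetry h)
          h.asymmetry_lt))) (fun x h0 h1 hx => ?_) hz
    exact segment_block_ofReal h0 h1 (by linarith [h.asymmetry_lt x hx]) hy hy'
  refine eqOn_of_eventually_eq_ofReal (isOpen_re_gt (-1)) (convex_halfSpace_re_gt _).isPreconnected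
    (differentiableOn_blockSegment (h.mem hz))
    ((differentiable_QMinus_cpow h hz).differentiableOn.mul
      ((differentiableOn_laplacePos (h.asymmetry_lt z hz).le).const_mul _)) (x₀ := -1 / 2)
    (by rw [mem_ofPred_eq, ofReal_re]; norm_num) ?_ hC
  filter_upwards [eventually_mem_Ioo_strip] with y hy
  exact hreal y hy.1 hy.2

theorem strip_half_mem : ((-1 / 2 : ℝ) : ℂ) ∈ {C : ℂ | -1 < C.re ∧ C.re < -1 / 3} := by
  rw [mem_ofPred_eq, ofReal_re]; norm_num

/-- The connection formula between the blocks of `z` and `1 - z`. -/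
theorem blockSegment_eq_blockRay (h : IsGoodRadius (1 / 4) δ) (hz : z ∈ Metric.ball (1 / 2 : ℂ) δ)
    (hC : -1 < C.re) (hC' : C.re < -1 / 3) :
    blockSegment z C = blockRay z C - 2 * cos (Real.pi * C) * blockRay (1 - z) C := by
  have hreal : ∀ y : ℝ, -1 < y → y < -1 / 3 → blockSegment z y =
      blockRay z y - 2 * cos (Real.pi * y) * blockRay (1 - z) y := by
    intro y hy hy'
    have hyre : -1 < (y : ℂ).re := by rwa [ofReal_re]
    have hyre' : (y : ℂ).re < -1 / 3 := by rwa [ofReal_re]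
    refine eqOn_ball_of_ofReal h.pos
      ((differentiableOn_blockSegment_left hyre).mono (Metric.ball_subset_ball h.le))
      (((differentiableOn_blockRay_left hyre hyre').mono (Metric.ball_subset_ball h.le)).sub
        ((differentiableOn_blockRay_one_sub h hyre hyre').const_mul _))
      (fun x h0 h1 hx => ?_) hz
    exact connection_ofReal h0 h1 (by linarith [h.asymmetry_lt x hx]) hy hy'
  have hcos : DifferentiableOn ℂ (fun C : ℂ => 2 * cos (Real.pi * C))
      {C : ℂ | -1 < C.re ∧ C.re < -1 / 3} := by fun_prop
  refine eqOn_of_eventually_eq_ofReal isOpen_strip isPreconnected_strip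
    ((differentiableOn_blockSegment (h.mem hz)).mono fun _ hC => hC.1)
    ((differentiableOn_blockRay (h.mem hz)).sub
      (hcos.mul (differentiableOn_blockRay (h.mem (one_sub_mem_ball hz))))) strip_half_mem ?_
    ⟨hC, hC'⟩
  filter_upwards [eventually_mem_Ioo_strip] with y hy
  exact hreal y hy.1 hy.2

/-- The Laplace transform along the negative axis is a multiple of the reflected first block. -/
theorem laplaceNeg_eq_blockRay (h : IsGoodRadius (1 / 4) δ) (hz : z ∈ Metric.ball (1 / 2 : ℂ) δ)
    (hC : -1 < C.re) (hC' : C.re < -1 / 3) :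
    QMinus z ^ C * (2 * scale z / √3 * (1 + asymmetry z) * laplaceNeg (asymmetry z) C) =
      -2 * I * sin (Real.pi * C) * blockRay (1 - z) C := by
  have hκ1 : ∀ z ∈ Metric.ball (1 / 2 : ℂ) δ, 8 * ‖asymmetry z‖ < 1 := fun z hz => by
    linarith [h.asymmetry_lt z hz]
  have hreal : ∀ y : ℝ, -1 < y → y < -1 / 3 →
      QMinus z ^ (y : ℂ) * (2 * scale z / √3 * (1 + asymmetry z) * laplaceNeg (asymmetry z) y) =
        -2 * I * sin (Real.pi * y) * blockRay (1 - z) y := by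
    intro y hy hy'
    have hyre : -1 < (y : ℂ).re := by rwa [ofReal_re]
    have hyre' : (y : ℂ).re < -1 / 3 := by rwa [ofReal_re]
    refine eqOn_ball_of_ofReal h.pos
      ((differentiableOn_QMinus_cpow_left h y).mul ((differentiableOn_prefactor h).mul
        (DifferentiableOn.comp (g := fun κ => laplaceNeg κ y)
          (differentiableOn_laplaceNeg_left hyre') (differentiableOn_asymmetry h) hκ1)))
      ((differentiableOn_blockRay_one_sub h hyre hyre').const_mul _)
      (fun x h0 h1 hx => ?_) hz
    exact reflected_block_ofReal h0 h1 (by linarith [h.asymmetry_lt x hx]) hy hy'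
  have hsin : DifferentiableOn ℂ (fun C : ℂ => -2 * I * sin (Real.pi * C))
      {C : ℂ | -1 < C.re ∧ C.re < -1 / 3} := by fun_prop
  refine eqOn_of_eventually_eq_ofReal isOpen_strip isPreconnected_strip
    ((differentiable_QMinus_cpow h hz).differentiableOn.mul
      (((differentiableOn_laplaceNeg (hκ1 z hz).le).mono fun _ hC => hC.2).const_mul _))
    (hsin.mul (differentiableOn_blockRay (h.mem (one_sub_mem_ball hz)))) strip_half_mem ?_
    ⟨hC, hC'⟩
  filter_upwards [eventually_mem_Ioo_strip] with y hy
  exact hreal y hy.1 hy.2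

end

/-! ### Continuation of the Laplace transform to the lower half-plane -/

/-- The Laplace transform of the Borel germ along the path from `0` to `-1` and from there
vertically upwards; it converges for all `C` in the lower half-plane. -/
def laplaceLower (κ C : ℂ) : ℂ :=
  (∫ t in Ioc (0 : ℝ) 1, exp (C * t) * -outerGerm κ (-t)) +
    ∫ y in Ioi (0 : ℝ), exp (-C * (-1 + y * exp ((Real.pi / 2 : ℝ) * I))) *
      outerGerm κ (-1 + y * exp ((Real.pi / 2 : ℝ) * I)) * exp ((Real.pi / 2 : ℝ) * I)

theorem tendsto_mul_expBound_nhdsGT (b M : ℝ) :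
    Tendsto (fun t => t * (M * (Real.exp (-(b * t)) * (1 + t ^ (-(1 / 2) : ℝ))))) (𝓝[>] 0)
      (𝓝 0) := by
  have h1 : Tendsto (fun t : ℝ => M * (Real.exp (-(b * t)) * (t + t ^ (1 / 2 : ℝ)))) (𝓝[>] 0)
      (𝓝 (M * (Real.exp (-(b * 0)) * (0 + 0 ^ (1 / 2 : ℝ))))) := by
    refine Tendsto.const_mul _ (Tendsto.mul ?_ ?_)
    · exact (Continuous.tendsto (by fun_prop : Continuous fun t : ℝ => Real.exp (-(b * t))) 0).mono_left
        nhdsWithin_le_nhds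
    · exact (tendsto_id.add (Real.continuousAt_rpow_const 0 (1 / 2) (Or.inr (by norm_num)))).mono_left
        nhdsWithin_le_nhds
  rw [Real.zero_rpow (by norm_num), add_zero, mul_zero, mul_zero] at h1
  refine h1.congr' ?_
  filter_upwards [self_mem_nhdsWithin] with t ht
  have : t ^ (1 / 2 : ℝ) = t * t ^ (-(1 / 2) : ℝ) := by
    have e : (1 / 2 : ℝ) = 1 + -(1 / 2) := by norm_num
    nth_rewrite 1 [e]
    rw [Real.rpow_add ht, Real.rpow_one]
  rw [this]; ring

theorem tendsto_mul_expBound_atTop {b : ℝ} (hb : 0 < b) (M : ℝ) :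
    Tendsto (fun t => t * (M * (Real.exp (-(b * t)) * (1 + t ^ (-(1 / 2) : ℝ))))) atTop (𝓝 0) := by
  have h1 := (Real.tendsto_pow_mul_exp_neg_atTop_nhds_zero 1).comp
    (tendsto_id.const_mul_atTop hb)
  have h2 : Tendsto (fun t : ℝ => 1 + t ^ (-(1 / 2) : ℝ)) atTop (𝓝 (1 + 0)) :=
    (tendsto_rpow_neg_atTop (by norm_num)).const_add 1
  have h3 := (h1.mul h2).const_mul (M / b)
  rw [zero_mul, mul_zero] at h3
  refine h3.congr fun t => ?_
  simp only [Function.comp_apply, pow_one, id_eq]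
  field_simp

section

variable {κ C : ℂ} {ε φ k : ℝ}

/-- The constant in the bounds for the Borel germ in the left half-plane. -/
def germConst (k : ℝ) : ℝ := 2 * (√(k / 4 / 2))⁻¹ * k ^ (-(1 / 2) : ℝ)

theorem germConst_nonneg (hk : 0 < k) : 0 ≤ germConst k := by
  unfold germConst; positivity

/-- The growth e^{-Re ζ/3} of the germ combines with e^{-Cζ} into the exponential of -(C+1/3)ζ, so
only the direction of C + 1/3 decides convergence. -/
theorem exp_mul_norm_outerGerm_le {ζ : ℂ} (hk : 0 < k) (hk1 : k ≤ 1) (hκ : 8 * ‖κ‖ ≤ k / 4)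
    (hζ : ζ ∈ outerRegion (k / 4)) {r : ℝ} (hr : 0 < r) (h : r * k ≤ -ζ.re) :
    ‖exp (-C * ζ) * outerGerm κ ζ‖ ≤
      germConst k * (Real.exp (-((C + 1 / 3) * ζ).re) * (1 + r ^ (-(1 / 2) : ℝ))) := by
  have h1 := norm_outerGerm_le (by linarith) (by linarith) hκ hζ
  have hk2 : 1 ≤ k ^ (-(1 / 2) : ℝ) :=
    Real.one_le_rpow_of_pos_of_le_one_of_nonpos hk hk1 (by norm_num)
  have hrk : (-ζ.re) ^ (-(1 / 2) : ℝ) ≤ k ^ (-(1 / 2) : ℝ) * r ^ (-(1 / 2) : ℝ) := by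
    rw [mul_comm, ← Real.mul_rpow hr.le hk.le]
    exact Real.rpow_le_rpow_of_nonpos (by positivity) h (by norm_num)
  have h3 : 1 + (-ζ.re) ^ (-(1 / 2) : ℝ) ≤ k ^ (-(1 / 2) : ℝ) * (1 + r ^ (-(1 / 2) : ℝ)) := by
    linarith
  have h4 : 0 ≤ -ζ.re := (by positivity : 0 ≤ r * k).trans h
  have h5 := Real.rpow_nonneg h4 (-(1 / 2))
  rw [norm_mul, norm_exp]
  calc _ ≤ Real.exp (-C * ζ).re * (2 * (√(k / 4 / 2))⁻¹ *
        (Real.exp (-ζ.re / 3) * (k ^ (-(1 / 2) : ℝ) * (1 + r ^ (-(1 / 2) : ℝ))))) := by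
        refine mul_le_mul_of_nonneg_left (h1.trans ?_) (Real.exp_pos _).le
        gcongr
    _ = germConst k * (Real.exp ((-C * ζ).re + -ζ.re / 3) * (1 + r ^ (-(1 / 2) : ℝ))) := by
        rw [Real.exp_add, germConst]; ring
    _ = _ := by
        congr 4
        have : (C + 1 / 3) * ζ = C * ζ + ((1 / 3 : ℝ) : ℂ) * ζ := by push_cast; ring
        rw [this, add_re, re_ofReal_mul, neg_mul, neg_re]; ring

theorem ray_re {r φ : ℝ} : ((r : ℂ) * exp (φ * I)).re = r * Real.cos φ := by
  rw [re_ofReal_mul, exp_ofReal_mul_I_re]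

theorem norm_ray {r φ : ℝ} (hr : 0 < r) : ‖(r : ℂ) * exp (φ * I)‖ = r := by
  rw [norm_mul, norm_exp_ofReal_mul_I, mul_one, norm_real, Real.norm_of_nonneg hr.le]

theorem mul_ray_re {r φ : ℝ} (D : ℂ) :
    (D * (r * exp (φ * I))).re = r * (D * exp (φ * I)).re := by
  rw [mul_left_comm, re_ofReal_mul]

theorem ray_mem_outerRegion (hk : 0 < k) (hk1 : k ≤ 1) {r φ : ℝ} (hr : 0 < r)
    (hφ : k ≤ -Real.cos φ) : (r : ℂ) * exp (φ * I) ∈ outerRegion (k / 4) ∧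
      r * k ≤ -((r : ℂ) * exp (φ * I)).re := by
  have h : r * k ≤ -((r : ℂ) * exp (φ * I)).re := by rw [ray_re]; nlinarith
  refine ⟨mem_outerRegion_of_sector hk hk1 ?_ ?_, h⟩
  · have : 0 < r * k := mul_pos hr hk
    linarith
  · rw [norm_ray hr]; exact h

theorem norm_exp_mul_outerGerm_ray_le (hk : 0 < k) (hk1 : k ≤ 1) (hκ : 8 * ‖κ‖ ≤ k / 4)
    (hφ : k ≤ -Real.cos φ) {b : ℝ} (hb : b ≤ ((C + 1 / 3) * exp (φ * I)).re) {r : ℝ}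
    (hr : 0 < r) : ‖exp (-C * (r * exp (φ * I))) * outerGerm κ (r * exp (φ * I))‖ ≤
      germConst k * (Real.exp (-(b * r)) * (1 + r ^ (-(1 / 2) : ℝ))) := by
  obtain ⟨h1, h2⟩ := ray_mem_outerRegion hk hk1 hr hφ
  refine (exp_mul_norm_outerGerm_le hk hk1 hκ h1 hr h2).trans ?_
  have := germConst_nonneg hk
  have := Real.rpow_nonneg hr.le (-(1 / 2))
  rw [mul_ray_re, mul_comm r]
  gcongr

theorem norm_exp_mul_outerGerm_shift_le (hk : 0 < k) (hk1 : k ≤ 1) (hκ : 8 * ‖κ‖ ≤ k / 4)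
    {η : ℂ} (hη : η.re ≤ 0) : ‖exp (-C * (-1 + η)) * outerGerm κ (-1 + η)‖ ≤
      germConst k * 2 * Real.exp (C.re + 1 / 3) * Real.exp (-((C + 1 / 3) * η).re) := by
  have hre : (-1 + η).re ≤ -1 := by rw [add_re, neg_re, one_re]; linarith
  refine (exp_mul_norm_outerGerm_le hk hk1 hκ (mem_outerRegion_of_re_le (by linarith)
    (by linarith)) one_pos (by linarith)).trans (le_of_eq ?_)
  have : -((C + 1 / 3) * (-1 + η)).re = C.re + 1 / 3 + -((C + 1 / 3) * η).re := by
    have e : (C + 1 / 3) * (-1 + η) = -(C + ((1 / 3 : ℝ) : ℂ)) + (C + 1 / 3) * η := by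
      push_cast; ring
    rw [e, add_re, neg_re, add_re, ofReal_re]; ring
  rw [this, Real.exp_add, Real.one_rpow]; ring

/-- For D in the open third quadrant both terms of the real part are nonnegative, and |cos φ| + sin
φ ≥ 1. The decay is therefore uniform over all directions between π/2 and π. -/
theorem min_le_mul_exp_re {D : ℂ} (h1 : D.re < 0) (h2 : D.im < 0) (hφ : Real.pi / 2 ≤ φ)
    (hφ' : φ ≤ Real.pi) : min (-D.re) (-D.im) ≤ (D * exp (φ * I)).re := by
  rw [mul_re, exp_ofReal_mul_I_re, exp_ofReal_mul_I_im]
  have hc : Real.cos φ ≤ 0 := Real.cos_nonpos_of_pi_div_two_le_of_le hφ (by linarith [Real.pi_pos])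
  have hs : 0 ≤ Real.sin φ := Real.sin_nonneg_of_nonneg_of_le_pi (by linarith [Real.pi_pos]) hφ'
  have hsum : 1 ≤ -Real.cos φ + Real.sin φ := by
    nlinarith [Real.sin_sq_add_cos_sq φ, mul_nonneg (neg_nonneg.2 hc) hs]
  set m := min (-D.re) (-D.im) with hm
  have hm0 : 0 < m := lt_min (by linarith) (by linarith)
  have h3 : m * -Real.cos φ ≤ -D.re * -Real.cos φ :=
    mul_le_mul_of_nonneg_right (min_le_left _ _) (by linarith)
  have h4 : m * Real.sin φ ≤ -D.im * Real.sin φ :=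
    mul_le_mul_of_nonneg_right (min_le_right _ _) hs
  nlinarith

theorem add_third_re (C : ℂ) : (C + 1 / 3).re = C.re + 1 / 3 := by
  have : C + 1 / 3 = C + ((1 / 3 : ℝ) : ℂ) := by push_cast; ring
  rw [this, add_re, ofReal_re]

theorem add_third_im (C : ℂ) : (C + 1 / 3).im = C.im := by
  have : C + 1 / 3 = C + ((1 / 3 : ℝ) : ℂ) := by push_cast; ring
  rw [this, add_im, ofReal_im, add_zero]

theorem neg_cos_ge_of_mem (h0 : 0 < ε) (hφ : Real.pi / 2 + ε ≤ φ) (hφ' : φ ≤ Real.pi) :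
    Real.sin (ε / 2) ≤ -Real.cos φ :=
  sin_half_le_neg_cos h0 (by linarith) hφ'

theorem neg_ofReal_eq_ray (t : ℝ) : -(t : ℂ) = t * exp (Real.pi * I) := by
  rw [exp_pi_mul_I]; ring

theorem laplaceNeg_eq_ray (κ C : ℂ) : laplaceNeg κ C = ∫ r in Ioi (0 : ℝ),
    exp (-C * (r * exp (Real.pi * I))) * outerGerm κ (r * exp (Real.pi * I)) *
      exp (Real.pi * I) := by
  refine setIntegral_congr_fun measurableSet_Ioi fun r _ => ?_
  rw [← neg_ofReal_eq_ray, exp_pi_mul_I]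
  ring_nf

theorem laplace_borelGerm_eq (h0 : 0 < ε) (h1 : ε < 1 / 2) (κ C : ℂ) :
    ∀ t ∈ Ioi (0 : ℝ), laplaceIntegrand (Real.pi / 2 + ε) (borelGerm κ) C t =
      exp (-C * (t * exp ((Real.pi / 2 + ε : ℝ) * I))) *
        outerGerm κ (t * exp ((Real.pi / 2 + ε : ℝ) * I)) *
          exp ((Real.pi / 2 + ε : ℝ) * I) := by
  intro t ht
  have hpi := Real.pi_gt_three
  have hre : ((t : ℂ) * exp ((Real.pi / 2 + ε : ℝ) * I)).re < 0 := by
    rw [ray_re]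
    exact mul_neg_of_pos_of_neg ht (Real.cos_neg_of_pi_div_two_lt_of_lt (by linarith) (by linarith))
  have him : 0 < ((t : ℂ) * exp ((Real.pi / 2 + ε : ℝ) * I)).im := by
    rw [im_ofReal_mul, exp_ofReal_mul_I_im]
    exact mul_pos ht (Real.sin_pos_of_pos_of_lt_pi (by linarith) (by linarith))
  rw [laplaceIntegrand, borelGerm, if_pos ⟨hre, him⟩]

theorem differentiableAt_outerGerm_right {c : ℝ} {ζ : ℂ} (hc : c ≤ 1) (hc0 : 0 < c)
    (hκ : 8 * ‖κ‖ ≤ c) (hζ : ζ ∈ outerRegion c) : DifferentiableAt ℂ (outerGerm κ) ζ :=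
  DifferentiableAt.comp (g := fun p : ℂ × ℂ => outerGerm p.1 p.2) (f := fun ζ : ℂ => (κ, ζ)) ζ
    (differentiableAt_outerGerm hc hc0 hκ hζ) (by fun_prop)

theorem continuousOn_outerGerm_ray (hk : 0 < k) (hk1 : k ≤ 1) (hκ : 8 * ‖κ‖ ≤ k / 4)
    (hφ : k ≤ -Real.cos φ) :
    ContinuousOn (fun r : ℝ => outerGerm κ (r * exp (φ * I))) (Ioi 0) := by
  intro r hr
  exact (ContinuousAt.comp (g := outerGerm κ) (f := fun r : ℝ => (r : ℂ) * exp (φ * I))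
    (differentiableAt_outerGerm_right (by linarith) (by linarith) hκ
      (ray_mem_outerRegion hk hk1 hr hφ).1).continuousAt (by fun_prop)).continuousWithinAt

theorem aestronglyMeasurable_outerGerm_ray (hk : 0 < k) (hk1 : k ≤ 1) (hκ : 8 * ‖κ‖ ≤ k / 4)
    (hφ : k ≤ -Real.cos φ) : AEStronglyMeasurable (fun r : ℝ =>
      exp (-C * (r * exp (φ * I))) * outerGerm κ (r * exp (φ * I)) * exp (φ * I))
      (volume.restrict (Ioi 0)) :=
  ContinuousOn.aestronglyMeasurable ((ContinuousOn.mul (by fun_prop)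
    (continuousOn_outerGerm_ray hk hk1 hκ hφ)).mul continuousOn_const) measurableSet_Ioi

theorem integrableOn_outerGerm_ray (hk : 0 < k) (hk1 : k ≤ 1) (hκ : 8 * ‖κ‖ ≤ k / 4)
    (hφ : k ≤ -Real.cos φ) (hC : 0 < ((C + 1 / 3) * exp (φ * I)).re) : IntegrableOn (fun r : ℝ =>
      exp (-C * (r * exp (φ * I))) * outerGerm κ (r * exp (φ * I)) * exp (φ * I)) (Ioi 0) := by
  refine Integrable.mono' (integrableOn_one_add_rpow_mul_exp hC (germConst k))
    (aestronglyMeasurable_outerGerm_ray hk hk1 hκ hφ) ?_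
  filter_upwards [ae_restrict_mem measurableSet_Ioi] with r hr
  rw [norm_mul, norm_exp_ofReal_mul_I, mul_one]
  exact norm_exp_mul_outerGerm_ray_le hk hk1 hκ hφ le_rfl hr

/-- The ray integral is independent of the direction between `π/2 + ε` and `π`. -/
theorem integral_ray_eq_laplaceNeg (h0 : 0 < ε) (h1 : ε < 1 / 2)
    (hκ : 8 * ‖κ‖ ≤ Real.sin (ε / 2) / 4) (hC : C.re < -1 / 3) (hC' : C.im < 0) :
    laplace (Real.pi / 2 + ε) (borelGerm κ) C = laplaceNeg κ C := by
  have hk := sin_half_pos h0 h1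
  have hk1 := Real.sin_le_one (ε / 2)
  have hpi := Real.pi_gt_three
  rw [laplace, setIntegral_congr_fun measurableSet_Ioi (laplace_borelGerm_eq h0 h1 κ C),
    laplaceNeg_eq_ray]
  set b := min (-(C + 1 / 3).re) (-(C + 1 / 3).im) with hb
  have hD1 : (C + 1 / 3).re < 0 := by rw [add_third_re]; linarith
  have hD2 : (C + 1 / 3).im < 0 := by rwa [add_third_im]
  have hb0 : 0 < b := lt_min (by linarith) (by linarith)
  -- The sector from π/2 + ε to π contains no singularity except its vertex, where the exponent -1/2
  -- is integrable.
  refine integral_ray_eq_of_dominated (F := fun ζ => exp (-C * ζ) * outerGerm κ ζ)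
    (by linarith) (fun r hr φ hφ => ?_)
    (integrableOn_one_add_rpow_mul_exp hb0 (germConst (Real.sin (ε / 2))))
    (fun r hr φ hφ => ?_) (tendsto_mul_expBound_nhdsGT _ _) (tendsto_mul_expBound_atTop hb0 _)
  · exact DifferentiableAt.mul (by fun_prop) (differentiableAt_outerGerm_right (by linarith)
      (by linarith) hκ (ray_mem_outerRegion hk hk1 hr (neg_cos_ge_of_mem h0 hφ.1 hφ.2)).1)
  · exact norm_exp_mul_outerGerm_ray_le hk hk1 hκ (neg_cos_ge_of_mem h0 hφ.1 hφ.2)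
      (min_le_mul_exp_re hD1 hD2 (by linarith [hφ.1]) hφ.2) hr

/-! ### Turning the path upwards at -1 -/

theorem integral_Ioi_add_one (f : ℝ → ℂ) :
    ∫ t in Ioi (1 : ℝ), f t = ∫ r in Ioi (0 : ℝ), f (1 + r) := by
  have h := (measurePreserving_add_left volume (1 : ℝ)).setIntegral_preimage_emb
    (measurableEmbedding_addLeft 1) f (Ioi 1)
  rw [← h]
  congr 2
  ext r
  simp

theorem integrableOn_laplaceNeg (hκ : 8 * ‖κ‖ ≤ 1) (hC : C.re < -1 / 3) :
    IntegrableOn (fun t : ℝ => exp (C * t) * -outerGerm κ (-t)) (Ioi 0) := by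
  refine Integrable.mono' (integrableOn_one_add_rpow_mul_exp (a := -1 / 3 - C.re) (by linarith)
    (2 * (√(1 / 2))⁻¹)) (aestronglyMeasurable_laplaceNeg hκ) ?_
  filter_upwards [ae_restrict_mem measurableSet_Ioi] with t ht
  exact norm_exp_mul_outerGerm_le hκ (by linarith) ht

/-- Only the tail beyond -1 is rotated, about the vertex -1, from the direction π to π/2. The swept
quarter-plane has Re ζ ≤ -1 and contains no singularity of the germ. -/
theorem laplaceNeg_eq_laplaceLower (hk : 0 < k) (hk1 : k ≤ 1) (hκ : 8 * ‖κ‖ ≤ k / 4)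
    (hC : C.re < -1 / 3) (hC' : C.im < 0) : laplaceNeg κ C = laplaceLower κ C := by
  have hint := integrableOn_laplaceNeg (κ := κ) (by linarith) hC
  have hpi := Real.pi_gt_three
  rw [laplaceNeg, ← Ioc_union_Ioi_eq_Ioi (zero_le_one (α := ℝ)), setIntegral_union
    (Ioc_disjoint_Ioi le_rfl) measurableSet_Ioi (hint.mono_set Ioc_subset_Ioi_self)
    (hint.mono_set (Ioi_subset_Ioi zero_le_one)), laplaceLower]
  congr 1
  rw [integral_Ioi_add_one]
  have hD1 : (C + 1 / 3).re < 0 := by rw [add_third_re]; linarith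
  have hD2 : (C + 1 / 3).im < 0 := by rwa [add_third_im]
  set b := min (-(C + 1 / 3).re) (-(C + 1 / 3).im) with hb
  have hb0 : 0 < b := lt_min (by linarith) (by linarith)
  set M := germConst k * 2 * Real.exp (C.re + 1 / 3) with hM
  have hM0 : 0 ≤ M := by
    have := germConst_nonneg hk
    positivity
  have hηre : ∀ r : ℝ, 0 < r → ∀ φ ∈ Icc (Real.pi / 2) Real.pi,
      ((r : ℂ) * exp (φ * I)).re ≤ 0 := by
    intro r hr φ hφ
    rw [ray_re]
    exact mul_nonpos_of_nonneg_of_nonpos hr.le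
      (Real.cos_nonpos_of_pi_div_two_le_of_le hφ.1 (by linarith [hφ.2]))
  have key := integral_ray_eq_of_dominated (φ₁ := Real.pi / 2) (φ₂ := Real.pi)
    (F := fun η => exp (-C * (-1 + η)) * outerGerm κ (-1 + η)) (by linarith)
    (fun r hr φ hφ => ?_) (integrableOn_one_add_rpow_mul_exp hb0 M)
    (fun r hr φ hφ => ?_) (tendsto_mul_expBound_nhdsGT _ _) (tendsto_mul_expBound_atTop hb0 _)
  · rw [key]
    refine setIntegral_congr_fun measurableSet_Ioi fun r _ => ?_
    rw [exp_pi_mul_I]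
    push_cast
    ring_nf
  · have hmem : -1 + (r : ℂ) * exp (φ * I) ∈ outerRegion (k / 4) := by
      refine mem_outerRegion_of_re_le (by linarith) ?_
      rw [add_re, neg_re, one_re]
      linarith [hηre r hr φ hφ]
    exact DifferentiableAt.mul (by fun_prop) (DifferentiableAt.comp (g := outerGerm κ)
      (f := fun η : ℂ => -1 + η) _ (differentiableAt_outerGerm_right (by linarith)
      (by linarith) hκ hmem) (by fun_prop))
  · refine (norm_exp_mul_outerGerm_shift_le hk hk1 hκ (hηre r hr φ hφ)).trans ?_
    refine mul_le_mul_of_nonneg_left ?_ hM0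
    rw [mul_ray_re]
    have h3 := min_le_mul_exp_re hD1 hD2 hφ.1 hφ.2
    have h4 := Real.rpow_nonneg hr.le (-(1 / 2))
    calc Real.exp (-(r * ((C + 1 / 3) * exp (φ * I)).re)) ≤ Real.exp (-(b * r)) * 1 := by
          rw [mul_one]
          exact Real.exp_le_exp.2 (by nlinarith)
      _ ≤ _ := by gcongr; linarith

/-- On the vertical ray |e^{-Cζ}| is a constant times e^{y Im C}, and the germ is bounded there;
this converges for every C with Im C < 0, whatever Re C is. The remaining piece runs over a finite
interval. -/
theorem differentiableOn_laplaceLower (hk : 0 < k) (hk1 : k ≤ 1) (hκ : 8 * ‖κ‖ ≤ k / 4) :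
    DifferentiableOn ℂ (laplaceLower κ) {C | C.im < 0} := by
  have hpi := Real.pi_gt_three
  refine DifferentiableOn.add ?_ ?_
  · refine differentiableOn_integral_of_locally_dominated isOpen_im_neg
      (fun C _ => (aestronglyMeasurable_laplaceNeg (by linarith)).mono_measure
        (Measure.restrict_mono_set _ Ioc_subset_Ioi_self)) ?_ ?_
    · exact Eventually.of_forall fun t => by fun_prop
    · intro C _
      refine ⟨1, one_pos, _, (integrableOn_one_add_rpow_mul_exp (a := 1) one_pos
        (2 * (√(1 / 2))⁻¹ * Real.exp (|C.re| + 4))).mono_set Ioc_subset_Ioi_self, ?_⟩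
      filter_upwards [ae_restrict_mem measurableSet_Ioc] with t ht C' hC'
      obtain ⟨h1, h2, -⟩ := abs_re_im_sub_lt hC'.1
      have h3 := norm_exp_mul_outerGerm_le (κ := κ) (C := C') (a := -1 / 3 - C'.re)
        (by linarith) (by linarith) ht.1
      refine h3.trans ?_
      have h4 := Real.rpow_nonneg ht.1.le (-(1 / 2))
      rw [mul_assoc _ (Real.exp _) (Real.exp _ * _)]
      refine mul_le_mul_of_nonneg_left ?_ (by positivity)
      rw [← mul_assoc, ← Real.exp_add]
      refine mul_le_mul_of_nonneg_right (Real.exp_le_exp.2 ?_) (by positivity)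
      have h5 := le_abs_self C.re
      have h6 := abs_nonneg C.re
      nlinarith [ht.1, ht.2]
  · have hre : ∀ y : ℝ, ((y : ℂ) * exp ((Real.pi / 2 : ℝ) * I)).re = 0 := by
      intro y; rw [ray_re, Real.cos_pi_div_two, mul_zero]
    refine differentiableOn_integral_of_locally_dominated isOpen_im_neg (fun C _ => ?_) ?_ ?_
    · refine Continuous.aestronglyMeasurable ?_
      refine Continuous.mul (Continuous.mul (by fun_prop) ?_) continuous_const
      refine continuous_iff_continuousAt.2 fun y => ?_
      refine ContinuousAt.comp (g := outerGerm κ)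
        (f := fun y : ℝ => -1 + (y : ℂ) * exp ((Real.pi / 2 : ℝ) * I))
        (differentiableAt_outerGerm_right (c := k / 4) (by linarith)
        (by linarith) hκ (mem_outerRegion_of_re_le (by linarith) ?_)).continuousAt (by fun_prop)
      rw [add_re, neg_re, one_re, hre]
      norm_num
    · exact Eventually.of_forall fun t => by fun_prop
    · intro C hC
      rw [mem_ofPred_eq] at hC
      have hr : 0 < -C.im / 2 := by linarith
      refine ⟨-C.im / 2, hr, _, integrableOn_one_add_rpow_mul_exp (a := -C.im / 2) hr
        (germConst k * 2 * Real.exp (C.re + -C.im / 2 + 1 / 3)), ?_⟩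
      filter_upwards [ae_restrict_mem measurableSet_Ioi] with y hy C' hC'
      rw [mem_Ioi] at hy
      obtain ⟨h1, h2, -⟩ := abs_re_im_sub_lt hC'.1
      have h3 : C'.im ≤ C.im / 2 := by
        have h0 := mem_ball_iff_norm.1 hC'.1
        have := (abs_le.1 ((abs_im_le_norm (C' - C)).trans h0.le)).2
        rw [sub_im] at this
        linarith
      rw [norm_mul, norm_exp_ofReal_mul_I, mul_one]
      refine (norm_exp_mul_outerGerm_shift_le hk hk1 hκ (hre y).le).trans ?_
      have h4 := Real.rpow_nonneg hy.le (-(1 / 2))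
      have hG := germConst_nonneg hk
      refine mul_le_mul ?_ ?_ (Real.exp_pos _).le (by positivity)
      · gcongr
      · rw [mul_ray_re, mul_re, exp_ofReal_mul_I_re, exp_ofReal_mul_I_im, Real.cos_pi_div_two,
          Real.sin_pi_div_two, add_third_im]
        refine (Real.exp_le_exp.2 (?_ : _ ≤ -(-C.im / 2 * y))).trans ?_
        · nlinarith
        · exact le_mul_of_one_le_right (Real.exp_pos _).le (by linarith)

/-- The half-plane of convergence of the Laplace transform in the direction `θ`. -/
def convergenceRegion (θ : ℝ) : Set ℂ := {C | C.im < 0 ∧ 0 < ((C + 1 / 3) * exp (θ * I)).re}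

theorem isOpen_convergenceRegion (θ : ℝ) : IsOpen (convergenceRegion θ) :=
  isOpen_im_neg.inter (isOpen_lt continuous_const (continuous_re.comp (by fun_prop)))

theorem convex_convergenceRegion (θ : ℝ) : Convex ℝ (convergenceRegion θ) := by
  suffices h : Convex ℝ {C : ℂ | 0 < ((C + 1 / 3) * exp (θ * I)).re} from
    (convex_halfSpace_im_lt 0).inter h
  intro x hx y hy a b ha hb hab
  rw [mem_ofPred_eq] at hx hy ⊢
  have hab' : (a : ℂ) + b = 1 := by exact_mod_cast hab
  have e : (a • x + b • y + 1 / 3) * exp (θ * I) =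
      a * ((x + 1 / 3) * exp (θ * I)) + b * ((y + 1 / 3) * exp (θ * I)) := by
    rw [real_smul, real_smul]
    linear_combination (-(1 / 3) * exp (θ * I)) * hab'
  rw [e, add_re, re_ofReal_mul, re_ofReal_mul]
  rcases ha.eq_or_lt with h | h
  · rw [← h, zero_add] at hab
    rw [← h, hab]; linarith
  · have := mul_pos h hx
    have := mul_nonneg hb hy.le
    linarith

theorem integrableOn_laplaceIntegrand_borelGerm (h0 : 0 < ε) (h1 : ε < 1 / 2)
    (hκ : 8 * ‖κ‖ ≤ Real.sin (ε / 2) / 4)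
    (hC : 0 < ((C + 1 / 3) * exp ((Real.pi / 2 + ε : ℝ) * I)).re) :
    IntegrableOn (laplaceIntegrand (Real.pi / 2 + ε) (borelGerm κ) C) (Ioi 0) := by
  have hpi := Real.pi_gt_three
  exact (integrableOn_outerGerm_ray (sin_half_pos h0 h1) (Real.sin_le_one _) hκ
    (neg_cos_ge_of_mem h0 le_rfl (by linarith)) hC).congr_fun
    (fun t ht => (laplace_borelGerm_eq h0 h1 κ C t ht).symm) measurableSet_Ioi

theorem differentiableOn_laplace_borelGerm (h0 : 0 < ε) (h1 : ε < 1 / 2)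
    (hκ : 8 * ‖κ‖ ≤ Real.sin (ε / 2) / 4) :
    DifferentiableOn ℂ (laplace (Real.pi / 2 + ε) (borelGerm κ))
      (convergenceRegion (Real.pi / 2 + ε)) := by
  have hpi := Real.pi_gt_three
  have hk := sin_half_pos h0 h1
  have hk1 := Real.sin_le_one (ε / 2)
  have hφ := neg_cos_ge_of_mem (φ := Real.pi / 2 + ε) h0 le_rfl (by linarith)
  have hcongr : laplace (Real.pi / 2 + ε) (borelGerm κ) = fun C => ∫ t in Ioi (0 : ℝ),
      exp (-C * (t * exp ((Real.pi / 2 + ε : ℝ) * I))) *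
        outerGerm κ (t * exp ((Real.pi / 2 + ε : ℝ) * I)) *
          exp ((Real.pi / 2 + ε : ℝ) * I) := by
    funext C
    exact setIntegral_congr_fun measurableSet_Ioi (laplace_borelGerm_eq h0 h1 κ C)
  rw [hcongr]
  refine differentiableOn_integral_of_locally_dominated (isOpen_convergenceRegion _)
    (fun C _ => aestronglyMeasurable_outerGerm_ray hk hk1 hκ hφ) ?_ ?_
  · exact Eventually.of_forall fun t => by fun_prop
  · intro C hC
    have hC2 := hC.2
    set b := ((C + 1 / 3) * exp ((Real.pi / 2 + ε : ℝ) * I)).re with hb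
    refine ⟨b / 2, by linarith, _, integrableOn_one_add_rpow_mul_exp (a := b / 2) (by linarith)
      (germConst (Real.sin (ε / 2))), ?_⟩
    filter_upwards [ae_restrict_mem measurableSet_Ioi] with t ht C' hC'
    rw [norm_mul, norm_exp_ofReal_mul_I, mul_one]
    refine norm_exp_mul_outerGerm_ray_le hk hk1 hκ hφ ?_ ht
    have h3 := mem_ball_iff_norm.1 hC'.1
    have e : (C' + 1 / 3) * exp ((Real.pi / 2 + ε : ℝ) * I) =
        (C + 1 / 3) * exp ((Real.pi / 2 + ε : ℝ) * I) +
          (C' - C) * exp ((Real.pi / 2 + ε : ℝ) * I) := by ring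
    have h4 := (abs_le.1 (abs_re_le_norm ((C' - C) * exp ((Real.pi / 2 + ε : ℝ) * I)))).1
    rw [norm_mul, norm_exp_ofReal_mul_I, mul_one] at h4
    rw [e, add_re]
    linarith

/-- Both sides are holomorphic on the convex region of convergence and agree near -1 - i, where the
ray may be rotated to the negative axis. -/
theorem laplace_borelGerm_eq_laplaceLower (h0 : 0 < ε) (h1 : ε < 1 / 2)
    (hκ : 8 * ‖κ‖ ≤ Real.sin (ε / 2) / 4) :
    EqOn (laplace (Real.pi / 2 + ε) (borelGerm κ)) (laplaceLower κ)
      (convergenceRegion (Real.pi / 2 + ε)) := by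
  have hpi := Real.pi_gt_three
  have hk := sin_half_pos h0 h1
  have hk1 := Real.sin_le_one (ε / 2)
  have hopen : IsOpen {C : ℂ | C.re < -1 / 3 ∧ C.im < 0} := (isOpen_re_lt _).inter isOpen_im_neg
  have hmem : (-1 - I : ℂ) ∈ {C : ℂ | C.re < -1 / 3 ∧ C.im < 0} := by
    constructor <;> norm_num
  refine ((differentiableOn_laplace_borelGerm h0 h1 hκ).analyticOnNhd
    (isOpen_convergenceRegion _)).eqOn_of_preconnected_of_eventuallyEq
    (((differentiableOn_laplaceLower hk hk1 hκ).mono fun C hC => hC.1).analyticOnNhd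
    (isOpen_convergenceRegion _)) (convex_convergenceRegion _).isPreconnected
    (z₀ := -1 - I) ⟨hmem.2, ?_⟩ ?_
  · have hD1 : ((-1 - I : ℂ) + 1 / 3).re < 0 := by rw [add_third_re]; linarith [hmem.1]
    have hD2 : ((-1 - I : ℂ) + 1 / 3).im < 0 := by rw [add_third_im]; exact hmem.2
    exact (lt_min (neg_pos.2 hD1) (neg_pos.2 hD2)).trans_le
      (min_le_mul_exp_re hD1 hD2 (by linarith) (by linarith))
  · filter_upwards [hopen.mem_nhds hmem] with C hC
    rw [integral_ray_eq_laplaceNeg h0 h1 hκ hC.1 hC.2,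
      laplaceNeg_eq_laplaceLower hk hk1 hκ hC.1 hC.2]

end

/-! ### The Borel germ, its Laplace transform and its expansions -/

section

variable {p κ C : ℂ} {ε : ℝ}

theorem laplaceIntegrand_const_mul (θ : ℝ) (f : ℂ → ℂ) (p C : ℂ) :
    laplaceIntegrand θ (fun ζ => p * f ζ) C = fun t => p * laplaceIntegrand θ f C t := by
  funext t
  simp only [laplaceIntegrand]
  ring

theorem laplace_const_mul (θ : ℝ) (f : ℂ → ℂ) (p C : ℂ) :
    laplace θ (fun ζ => p * f ζ) C = p * laplace θ f C := by
  rw [laplace, laplaceIntegrand_const_mul, integral_const_mul, laplace]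

theorem isLaplace_borelGerm (h0 : 0 < ε) (h1 : ε < 1 / 2)
    (hκ : 8 * ‖κ‖ ≤ Real.sin (ε / 2) / 4) : IsLaplace (Real.pi / 2 + ε)
      (fun ζ => p * borelGerm κ ζ) (fun C => p * laplaceLower κ C) where
  analytic := (differentiableOn_laplaceLower (sin_half_pos h0 h1) (Real.sin_le_one _) hκ).const_mul p
  eq_laplace C hC hC' := by
    rw [laplaceIntegrand_const_mul, laplace_const_mul,
      laplace_borelGerm_eq_laplaceLower h0 h1 hκ ⟨hC, hC'⟩]
    exact ⟨(integrableOn_laplaceIntegrand_borelGerm h0 h1 hκ hC').const_mul p, rfl⟩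

theorem exists_isInverseBorel_borelGerm (h0 : 0 < ε) (h1 : ε < 1 / 2)
    (hκ : 8 * ‖κ‖ ≤ Real.sin (ε / 2) / 4) (p : ℂ) :
    ∃ a, IsInverseBorel (fun ζ => p * borelGerm κ ζ) a := by
  have hk := sin_half_pos h0 h1
  have hk1 := Real.sin_le_one (ε / 2)
  refine exists_isInverseBorel_of_even (F := fun k => p * evenGerm κ k)
    (analyticAt_const.mul (analyticAt_evenGerm (by linarith))) ?_ ?_
  · simp [evenGerm_neg]
  · filter_upwards [borelGerm_eq_evenGerm (by linarith) (by linarith) hκ] with ζ hζ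
    rw [hζ, mul_div_assoc]

theorem abs_arg_add_le {η' : ℝ} (hε : η' ≤ ε)
    (hC : arg C ≤ -ε - η') : |arg C + (Real.pi / 2 + ε)| ≤ Real.pi / 2 - η' := by
  have := neg_pi_lt_arg C
  rw [abs_le]
  constructor <;> linarith

theorem re_mul_exp_eq (C : ℂ) (θ : ℝ) : (C * exp (θ * I)).re = ‖C‖ * Real.cos (arg C + θ) := by
  conv_lhs => rw [← norm_mul_exp_arg_mul_I C]
  have : (‖C‖ : ℂ) * exp (arg C * I) * exp (θ * I) =
      (‖C‖ : ℂ) * exp (((arg C + θ : ℝ) : ℂ) * I) := by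
    rw [mul_assoc, ← exp_add]; push_cast; ring_nf
  rw [this, ray_re]

theorem hasAsymptoticExpansion_borelGerm (h0 : 0 < ε) (h1 : ε < 1 / 2)
    (hκ : 8 * ‖κ‖ ≤ Real.sin (ε / 2) / 4) {a : ℕ → ℂ}
    (hB : IsInverseBorel (fun ζ => p * borelGerm κ ζ) a) {η : ℝ} (hη : 0 < η) :
    HasAsymptoticExpansion {C | C.im < 0 ∧ arg C ≤ -ε - η} (fun C => p * laplaceLower κ C) a := by
  have hpi := Real.pi_gt_three
  have hk := sin_half_pos h0 h1
  have hk1 := Real.sin_le_one (ε / 2)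
  have hφ := neg_cos_ge_of_mem (φ := Real.pi / 2 + ε) h0 le_rfl (by linarith)
  -- On the sector arg C + π/2 + ε lies between -π/2 + ε and π/2 - η, so the smaller of ε and η is a
  -- margin at both ends.
  set η' := min η ε with hη'
  have hη0 : 0 < η' := lt_min hη h0
  have hηε : η' ≤ ε := min_le_right _ _
  have hσ : 0 < Real.sin η' := Real.sin_pos_of_pos_of_lt_pi hη0 (by linarith)
  have harg : ∀ C ∈ {C : ℂ | C.im < 0 ∧ arg C ≤ -ε - η},
      |arg C + (Real.pi / 2 + ε)| ≤ Real.pi / 2 - η' := fun C hC =>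
    abs_arg_add_le hηε (by linarith [hC.2, min_le_left η ε])
  have hS : ∀ C ∈ {C : ℂ | C.im < 0 ∧ arg C ≤ -ε - η},
      Real.sin η' * ‖C‖ ≤ (C * exp ((Real.pi / 2 + ε : ℝ) * I)).re := by
    intro C hC
    rw [re_mul_exp_eq, mul_comm, ← Real.cos_pi_div_two_sub, ← Real.cos_abs (arg C + _)]
    exact mul_le_mul_of_nonneg_left (Real.cos_le_cos_of_nonneg_of_le_pi (abs_nonneg _)
      (by linarith) (harg C hC)) (norm_nonneg _)
  have hray : ∀ t : ℝ, 0 < t → borelGerm κ (t * exp ((Real.pi / 2 + ε : ℝ) * I)) =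
      outerGerm κ (t * exp ((Real.pi / 2 + ε : ℝ) * I)) := by
    intro t ht
    have := laplace_borelGerm_eq h0 h1 κ 0 t ht
    rw [laplaceIntegrand] at this
    exact mul_left_cancel₀ (exp_ne_zero _) (mul_right_cancel₀ (exp_ne_zero _) this)
  -- The rate 4/3 consists of 1/3 from the growth of the germ and 1 from rewriting 1 + t^{-1/2}. The
  -- radius 1/sin η' makes Re(C e^{iθ}) ≥ 1, which outweighs the shift by 1/3.
  refine hasAsymptoticExpansion_of_isInverseBorel (θ := Real.pi / 2 + ε) (σ := Real.sin η')
    (M := ‖p‖ * (germConst (Real.sin (ε / 2)) * 2)) (b := 4 / 3) (R := (Real.sin η')⁻¹)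
    (by norm_num) (by linarith) (by linarith) hσ hB ?_ ?_ hS
    (fun C hC => (harg C hC).trans_lt (by linarith)) ?_
  · exact ((continuousOn_outerGerm_ray hk hk1 hκ hφ).congr fun t ht => hray t ht).const_mul p
  · intro t ht
    rw [hray t ht, norm_mul, mul_assoc]
    refine mul_le_mul_of_nonneg_left ?_ (norm_nonneg _)
    have h2 := norm_exp_mul_outerGerm_ray_le (C := 0) (b := -(1 / 3)) hk hk1 hκ hφ ?_ ht
    · rw [neg_zero, zero_mul, exp_zero, one_mul] at h2
      refine h2.trans ?_
      rw [mul_assoc]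
      refine mul_le_mul_of_nonneg_left ?_ (germConst_nonneg hk)
      calc Real.exp (-(-(1 / 3) * t)) * (1 + t ^ (-(1 / 2) : ℝ)) ≤
            Real.exp (-(-(1 / 3) * t)) * (2 * (t ^ (-(1 / 2) : ℝ) * Real.exp t)) := by
            gcongr; exact one_add_rpow_neg_half_le ht
        _ = 2 * (t ^ (-(1 / 2) : ℝ) * (Real.exp (-(-(1 / 3) * t)) * Real.exp t)) := by ring
        _ = _ := by rw [← Real.exp_add]; ring_nf
    · have : ((0 : ℂ) + 1 / 3) = ((1 / 3 : ℝ) : ℂ) := by push_cast; ring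
      rw [this, ray_re]
      have := Real.neg_one_le_cos (Real.pi / 2 + ε)
      linarith
  · intro C hC hR
    refine ((isLaplace_borelGerm h0 h1 hκ).eq_laplace C hC.1 ?_).2
    have h3 := hS C hC
    have h4 : 1 ≤ Real.sin η' * ‖C‖ := by
      rw [inv_le_iff_one_le_mul₀ hσ, mul_comm] at hR
      exact hR
    have e : ((1 / 3 : ℝ) : ℂ) = 1 / 3 := by push_cast; ring
    rw [add_mul, add_re, ← e, ray_re]
    have := Real.neg_one_le_cos (Real.pi / 2 + ε)
    linarith

end

/-! ### The blocks in the lower half-plane -/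

/-- The constant between the Borel germ and `Ψ`. -/
def prefactor (z : ℂ) : ℂ := 2 * scale z / √3 * (1 + asymmetry z)

/-- The Borel transform of the second block. -/
def borelPsi (z ζ : ℂ) : ℂ := prefactor z * borelGerm (asymmetry z) ζ

/-- The Laplace transform of `borelPsi z`, continued to the lower half-plane. -/
def laplacePsi (z C : ℂ) : ℂ := prefactor z * laplaceLower (asymmetry z) C

/-- The Borel transform of the first block. -/
def borelPhi (z ζ : ℂ) : ℂ := -prefactor (1 - z) * borelGerm (asymmetry (1 - z)) ζ

/-- The Laplace transform of `borelPhi z`, continued to the lower half-plane. -/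
def laplacePhi (z C : ℂ) : ℂ := -prefactor (1 - z) * laplaceLower (asymmetry (1 - z)) C

/-- The first block in the lower half-plane. -/
def lowerBlock₁ (z C : ℂ) : ℂ :=
  QPlusPow z C * (1 / (exp (2 * Real.pi * I * C) - 1)) * laplacePhi z C

/-- The second block in the lower half-plane. -/
def lowerBlock₂ (z C : ℂ) : ℂ :=
  QMinusPow z C * ((1 + exp (-2 * Real.pi * I * C)) / (1 - exp (-2 * Real.pi * I * C))) *
    laplacePsi z C + lowerBlock₁ z C

/-- The first block. -/
def block₁ (z C : ℂ) : ℂ := if C.im < 0 then lowerBlock₁ z C else blockRay z C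

/-- The second block. -/
def block₂ (z C : ℂ) : ℂ := if C.im < 0 then lowerBlock₂ z C else blockSegment z C

theorem laplacePhi_eq (z C : ℂ) : laplacePhi z C = -laplacePsi (1 - z) C := by
  rw [laplacePhi, laplacePsi, neg_mul]

theorem norm_exp_two_pi_lt_one {C : ℂ} (hC : C.im < 0) :
    ‖exp (-2 * Real.pi * I * C)‖ < 1 := by
  have : -2 * Real.pi * I * C = ((-2 * Real.pi : ℝ) : ℂ) * (I * C) := by push_cast; ring
  rw [norm_exp, this, re_ofReal_mul, I_mul_re, ← Real.exp_zero]
  exact Real.exp_lt_exp.2 (by nlinarith [Real.pi_pos])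

theorem one_sub_exp_two_pi_ne_zero {C : ℂ} (hC : C.im < 0) :
    1 - exp (-2 * Real.pi * I * C) ≠ 0 := fun h => by
  have := norm_exp_two_pi_lt_one hC
  rw [← sub_eq_zero.1 h, norm_one] at this
  exact lt_irrefl _ this

theorem exp_two_pi_mul (C : ℂ) : exp (2 * Real.pi * I * C) * exp (-2 * Real.pi * I * C) = 1 := by
  rw [← exp_add, ← exp_zero]; ring_nf

theorem exp_two_pi_sub_one_ne_zero {C : ℂ} (hC : C.im < 0) :
    exp (2 * Real.pi * I * C) - 1 ≠ 0 := fun h => one_sub_exp_two_pi_ne_zero hC <| by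
  linear_combination exp (-2 * Real.pi * I * C) * h - exp_two_pi_mul C

section

variable {z C : ℂ} {δ ε : ℝ}

/-- Since -Q_+ is the Q_- of 1 - z, the chosen branch of log Q_+ differs from a principal logarithm
by πi. -/
theorem QPlusPow_eq (h : IsGoodRadius (1 / 4) δ) (hz : z ∈ Metric.ball (1 / 2 : ℂ) δ) (C : ℂ) :
    QPlusPow z C = QMinus (1 - z) ^ C * exp (Real.pi * I * C) := by
  have hne := slitPlane_ne_zero (QMinus_mem_slitPlane h (one_sub_mem_ball hz))
  have e : -QPlus z = QMinus (1 - z) := by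
    rw [QPlus_eq (scale_ne_zero (h.mem hz)), QMinus_eq (scale_ne_zero (h.mem (one_sub_mem_ball hz))),
      scale_one_sub, asymmetry_one_sub]
    ring
  rw [QPlusPow, e, cpow_def_of_ne_zero hne, ← exp_add]
  ring_nf

theorem QMinus_cpow_mul_laplacePsi (h : IsGoodRadius (1 / 4) δ)
    (h0 : 0 < ε) (h1 : ε < 1 / 2) (hκ : ∀ z ∈ Metric.ball (1 / 2 : ℂ) δ,
      8 * ‖asymmetry z‖ ≤ Real.sin (ε / 2) / 4) (hz : z ∈ Metric.ball (1 / 2 : ℂ) δ)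
    (hC : -1 < C.re) (hC' : C.re < -1 / 3) (hCim : C.im < 0) :
    QMinus z ^ C * laplacePsi z C = -2 * I * sin (Real.pi * C) * blockRay (1 - z) C := by
  rw [← laplaceNeg_eq_blockRay h hz hC hC', laplacePsi, prefactor,
    laplaceNeg_eq_laplaceLower (sin_half_pos h0 h1) (Real.sin_le_one _) (hκ z hz) hC' hCim]

theorem two_I_mul_sin (C : ℂ) : 2 * I * sin (Real.pi * C) =
    exp (Real.pi * I * C) - exp (-(Real.pi * I * C)) := by
  have e1 : (Real.pi : ℂ) * I * C = Real.pi * C * I := by ring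
  have e2 : -(Real.pi * C * I : ℂ) = -(Real.pi * C) * I := by ring
  rw [sin, e1, ← e2]
  ring_nf
  rw [I_sq]; ring

theorem two_mul_cos (C : ℂ) : 2 * cos (Real.pi * C) =
    exp (Real.pi * I * C) + exp (-(Real.pi * I * C)) := by
  have e1 : (Real.pi : ℂ) * I * C = Real.pi * C * I := by ring
  have e2 : -(Real.pi * C * I : ℂ) = -(Real.pi * C) * I := by ring
  rw [cos, e1, ← e2]
  ring

/-- The Laplace formula is applied at 1 - z, where the reflected block is the ray block of z itself.
The phase of Q_+^C gives e^{πiC} · 2i sin(πC) = e^{2πiC} - 1. -/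
theorem lowerBlock₁_eq_blockRay (h : IsGoodRadius (1 / 4) δ)
    (h0 : 0 < ε) (h1 : ε < 1 / 2) (hκ : ∀ z ∈ Metric.ball (1 / 2 : ℂ) δ,
      8 * ‖asymmetry z‖ ≤ Real.sin (ε / 2) / 4) (hz : z ∈ Metric.ball (1 / 2 : ℂ) δ)
    (hC : -1 < C.re) (hC' : C.re < -1 / 3) (hCim : C.im < 0) :
    lowerBlock₁ z C = blockRay z C := by
  have h3 := QMinus_cpow_mul_laplacePsi h h0 h1 hκ (one_sub_mem_ball hz) hC hC' hCim
  rw [sub_sub_cancel] at h3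
  have h4 := exp_two_pi_sub_one_ne_zero hCim
  have h5 : exp (2 * Real.pi * I * C) = exp (Real.pi * I * C) * exp (Real.pi * I * C) := by
    rw [← exp_add]; ring_nf
  have h6 : exp (Real.pi * I * C) * exp (-(Real.pi * I * C)) = 1 := by
    rw [← exp_add, add_neg_cancel, exp_zero]
  have h7 := two_I_mul_sin C
  rw [lowerBlock₁, QPlusPow_eq h hz, laplacePhi_eq, mul_one_div, div_mul_eq_mul_div,
    div_eq_iff h4, h5]
  linear_combination -exp (Real.pi * I * C) * h3 + exp (Real.pi * I * C) * blockRay z C * h7 -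
    blockRay z C * h6

/-- The block of 1 - z is eliminated between the connection formula and the Laplace formula; the
quotient cos(πC)/(i sin(πC)) is the Stokes factor. -/
theorem lowerBlock₂_eq_blockSegment_of_strip (h : IsGoodRadius (1 / 4) δ)
    (h0 : 0 < ε) (h1 : ε < 1 / 2) (hκ : ∀ z ∈ Metric.ball (1 / 2 : ℂ) δ,
      8 * ‖asymmetry z‖ ≤ Real.sin (ε / 2) / 4) (hz : z ∈ Metric.ball (1 / 2 : ℂ) δ)
    (hC : -1 < C.re) (hC' : C.re < -1 / 3) (hCim : C.im < 0) :
    lowerBlock₂ z C = blockSegment z C := by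
  have h3 := QMinus_cpow_mul_laplacePsi h h0 h1 hκ hz hC hC' hCim
  have h4 := one_sub_exp_two_pi_ne_zero hCim
  have h5 : exp (-2 * Real.pi * I * C) =
      exp (-(Real.pi * I * C)) * exp (-(Real.pi * I * C)) := by
    rw [← exp_add]; ring_nf
  have h6 : exp (Real.pi * I * C) * exp (-(Real.pi * I * C)) = 1 := by
    rw [← exp_add, add_neg_cancel, exp_zero]
  have h7 := two_I_mul_sin C
  have h8 := two_mul_cos C
  rw [lowerBlock₂, lowerBlock₁_eq_blockRay h h0 h1 hκ hz hC hC' hCim,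
    blockSegment_eq_blockRay h hz hC hC', QMinusPow, mul_right_comm, h3, sub_eq_add_neg (blockRay z C),
    add_comm (blockRay z C)]
  congr 1
  rw [h5] at h4 ⊢
  rw [mul_div_assoc', div_eq_iff h4]
  set E := exp (Real.pi * I * C)
  set E' := exp (-(Real.pi * I * C))
  linear_combination (-blockRay (1 - z) C * (1 + E' * E')) * h7 +
    (blockRay (1 - z) C * (1 - E' * E')) * h8 - 2 * blockRay (1 - z) C * E' * h6

theorem differentiableOn_laplacePsi (h0 : 0 < ε) (h1 : ε < 1 / 2)
    (hκ : 8 * ‖asymmetry z‖ ≤ Real.sin (ε / 2) / 4) :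
    DifferentiableOn ℂ (laplacePsi z) {C | C.im < 0} :=
  (isLaplace_borelGerm (p := prefactor z) h0 h1 hκ).analytic

theorem differentiableOn_lowerBlock₁ (h0 : 0 < ε) (h1 : ε < 1 / 2) (hκ : ∀ z ∈ Metric.ball (1 / 2 : ℂ) δ,
      8 * ‖asymmetry z‖ ≤ Real.sin (ε / 2) / 4) (hz : z ∈ Metric.ball (1 / 2 : ℂ) δ) :
    DifferentiableOn ℂ (lowerBlock₁ z) {C | C.im < 0} := by
  have hQ : Differentiable ℂ (QPlusPow z) := by unfold QPlusPow; fun_prop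
  have hB : DifferentiableOn ℂ (laplacePhi z) {C | C.im < 0} :=
    (isLaplace_borelGerm (p := -prefactor (1 - z)) h0 h1 (hκ _ (one_sub_mem_ball hz))).analytic
  refine (hQ.differentiableOn.mul (DifferentiableOn.div (by fun_prop) (by fun_prop)
    fun C hC => exp_two_pi_sub_one_ne_zero hC)).mul hB

theorem differentiableOn_lowerBlock₂ (h : IsGoodRadius (1 / 4) δ)
    (h0 : 0 < ε) (h1 : ε < 1 / 2) (hκ : ∀ z ∈ Metric.ball (1 / 2 : ℂ) δ,
      8 * ‖asymmetry z‖ ≤ Real.sin (ε / 2) / 4) (hz : z ∈ Metric.ball (1 / 2 : ℂ) δ) :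
    DifferentiableOn ℂ (lowerBlock₂ z) {C | C.im < 0} := by
  refine DifferentiableOn.add (DifferentiableOn.mul (DifferentiableOn.mul ?_ ?_)
    (differentiableOn_laplacePsi h0 h1 (hκ z hz))) (differentiableOn_lowerBlock₁ h0 h1 hκ hz)
  · exact (differentiable_QMinus_cpow h hz).differentiableOn
  · exact DifferentiableOn.div (by fun_prop) (by fun_prop)
      fun C hC => one_sub_exp_two_pi_ne_zero hC

/-- Both expressions are holomorphic on the convex region Re C > -1, Im C < 0, and they agree on the
part that lies in the strip. -/
theorem lowerBlock₂_eq_blockSegment (h : IsGoodRadius (1 / 4) δ)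
    (h0 : 0 < ε) (h1 : ε < 1 / 2) (hκ : ∀ z ∈ Metric.ball (1 / 2 : ℂ) δ,
      8 * ‖asymmetry z‖ ≤ Real.sin (ε / 2) / 4) (hz : z ∈ Metric.ball (1 / 2 : ℂ) δ)
    (hC : -1 < C.re) (hCim : C.im < 0) :
    lowerBlock₂ z C = blockSegment z C := by
  have hopen : IsOpen {C : ℂ | -1 < C.re ∧ C.im < 0} := (isOpen_re_gt _).inter isOpen_im_neg
  have hopen' : IsOpen {C : ℂ | (-1 < C.re ∧ C.re < -1 / 3) ∧ C.im < 0} :=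
    isOpen_strip.inter isOpen_im_neg
  have hmem : ((-1 / 2 : ℝ) - I : ℂ) ∈ {C : ℂ | (-1 < C.re ∧ C.re < -1 / 3) ∧ C.im < 0} := by
    refine ⟨⟨?_, ?_⟩, ?_⟩ <;> simp <;> norm_num
  have hconv : Convex ℝ {C : ℂ | -1 < C.re ∧ C.im < 0} :=
    (convex_halfSpace_re_gt _).inter (convex_halfSpace_im_lt _)
  refine ((((differentiableOn_lowerBlock₂ h h0 h1 hκ hz).mono fun C hC => hC.2).analyticOnNhd
    hopen).eqOn_of_preconnected_of_eventuallyEq (((differentiableOn_blockSegment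
      (h.mem hz)).mono fun C hC => hC.1).analyticOnNhd hopen) hconv.isPreconnected
      ⟨hmem.1.1, hmem.2⟩ ?_) ⟨hC, hCim⟩
  filter_upwards [hopen'.mem_nhds hmem] with C hC
  exact lowerBlock₂_eq_blockSegment_of_strip h h0 h1 hκ hz hC.1.1 hC.1.2 hC.2

/-- The definition by cases is holomorphic because the two formulas agree on the overlap of the open
sets, so each set carries one formula throughout. -/
theorem isBlock₁_block₁ (h : IsGoodRadius (1 / 4) δ)
    (h0 : 0 < ε) (h1 : ε < 1 / 2) (hκ : ∀ z ∈ Metric.ball (1 / 2 : ℂ) δ,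
      8 * ‖asymmetry z‖ ≤ Real.sin (ε / 2) / 4) (hz : z ∈ Metric.ball (1 / 2 : ℂ) δ) :
    IsBlock₁ z (block₁ z) := by
  have heq : EqOn (block₁ z) (blockRay z) {C | -1 < C.re ∧ C.re < -1 / 3} := by
    intro C hC
    by_cases hCim : C.im < 0
    · rw [block₁, if_pos hCim]
      exact lowerBlock₁_eq_blockRay h h0 h1 hκ hz hC.1 hC.2 hCim
    · rw [block₁, if_neg hCim]
  have heq' : EqOn (block₁ z) (lowerBlock₁ z) {C | C.im < 0} := fun C hC => if_pos hC
  refine ⟨DifferentiableOn.union_of_isOpen ?_ ?_ isOpen_strip isOpen_im_neg,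
    fun C hC hC' => ⟨integrableOn_integrand₁ (h.mem hz) hC hC', heq ⟨hC, hC'⟩⟩⟩
  · exact (differentiableOn_blockRay (h.mem hz)).congr heq
  · exact (differentiableOn_lowerBlock₁ h0 h1 hκ hz).congr heq'

theorem block₂_eq_blockSegment (h : IsGoodRadius (1 / 4) δ)
    (h0 : 0 < ε) (h1 : ε < 1 / 2) (hκ : ∀ z ∈ Metric.ball (1 / 2 : ℂ) δ,
      8 * ‖asymmetry z‖ ≤ Real.sin (ε / 2) / 4) (hz : z ∈ Metric.ball (1 / 2 : ℂ) δ) :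
    EqOn (block₂ z) (blockSegment z) {C | -1 < C.re} := by
  intro C hC
  by_cases hCim : C.im < 0
  · rw [block₂, if_pos hCim]
    exact lowerBlock₂_eq_blockSegment h h0 h1 hκ hz hC hCim
  · rw [block₂, if_neg hCim]

theorem isBlock₂_block₂ (h : IsGoodRadius (1 / 4) δ)
    (h0 : 0 < ε) (h1 : ε < 1 / 2) (hκ : ∀ z ∈ Metric.ball (1 / 2 : ℂ) δ,
      8 * ‖asymmetry z‖ ≤ Real.sin (ε / 2) / 4) (hz : z ∈ Metric.ball (1 / 2 : ℂ) δ) :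
    IsBlock₂ z (block₂ z) := by
  have heq := block₂_eq_blockSegment h h0 h1 hκ hz
  have heq' : EqOn (block₂ z) (lowerBlock₂ z) {C | C.im < 0} := fun C hC => if_pos hC
  refine ⟨DifferentiableOn.union_of_isOpen ?_ ?_ (isOpen_re_gt _) isOpen_im_neg,
    fun C hC => ⟨integrableOn_integrand₂ (h.mem hz) hC, heq hC⟩⟩
  · exact (differentiableOn_blockSegment (h.mem hz)).congr heq
  · exact (differentiableOn_lowerBlock₂ h h0 h1 hκ hz).congr heq'

theorem laplaceIntegrand_zero_borelPsi (z C : ℂ) (t : ℝ) :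
    laplaceIntegrand 0 (borelPsi z) C t =
      prefactor z * (exp (-C * t) * innerGerm (asymmetry z) t) := by
  have : ¬((t : ℂ).re < 0 ∧ 0 < (t : ℂ).im) := fun h => by simp at h
  rw [laplaceIntegrand, ofReal_zero, zero_mul, exp_zero, mul_one, mul_one, borelPsi, borelGerm,
    if_neg this]
  ring

theorem block₂_eq_laplace (h : IsGoodRadius (1 / 4) δ)
    (h0 : 0 < ε) (h1 : ε < 1 / 2) (hκ : ∀ z ∈ Metric.ball (1 / 2 : ℂ) δ,
      8 * ‖asymmetry z‖ ≤ Real.sin (ε / 2) / 4) (hz : z ∈ Metric.ball (1 / 2 : ℂ) δ)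
    (hC : -1 < C.re) : IntegrableOn (laplaceIntegrand 0 (borelPsi z) C) (Ioi 0) ∧
      block₂ z C = QMinusPow z C * laplace 0 (borelPsi z) C := by
  constructor
  · exact ((integrableOn_laplacePos (h.asymmetry_lt z hz).le hC).const_mul (prefactor z)).congr
      (Eventually.of_forall fun t => (laplaceIntegrand_zero_borelPsi z C t).symm)
  · rw [block₂_eq_blockSegment h h0 h1 hκ hz hC, blockSegment_eq_laplacePos h hz hC, laplace,
      setIntegral_congr_fun measurableSet_Ioi
        (fun t _ => laplaceIntegrand_zero_borelPsi z C t), integral_const_mul]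
    rfl

theorem summable_exp_two_pi (hC : C.im < 0) :
    Summable (fun m : ℕ => exp (-2 * Real.pi * I * (m + 1) * C)) ∧
      ∑' m : ℕ, exp (-2 * Real.pi * I * (m + 1) * C) =
        exp (-2 * Real.pi * I * C) / (1 - exp (-2 * Real.pi * I * C)) := by
  have e : (fun m : ℕ => exp (-2 * Real.pi * I * (m + 1) * C)) =
      fun m : ℕ => exp (-2 * Real.pi * I * C) ^ m * exp (-2 * Real.pi * I * C) := by
    funext m
    rw [← pow_succ, ← exp_nat_mul]
    push_cast
    ring_nf
  have hsum := (hasSum_geometric_of_norm_lt_one (norm_exp_two_pi_lt_one hC)).mul_right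
    (exp (-2 * Real.pi * I * C))
  rw [e]
  exact ⟨hsum.summable, by rw [hsum.tsum_eq, div_eq_mul_inv, mul_comm]⟩

/-- With q = e^{-2πiC} this is (1+q)/(1-q) = 1 + 2Σ q^m together with 1/(q^{-1} - 1) = Σ q^m, over m
≥ 1. The summation index of the series starts at 0, whence m + 1. -/
theorem lowerBlock₂_eq_tsum (hC : C.im < 0) : lowerBlock₂ z C = QMinusPow z C * laplacePsi z C +
    2 * QMinusPow z C * ∑' m : ℕ, exp (-2 * Real.pi * I * (m + 1) * C) * laplacePsi z C +
      QPlusPow z C * ∑' m : ℕ, exp (-2 * Real.pi * I * (m + 1) * C) * laplacePhi z C := by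
  have h3 := one_sub_exp_two_pi_ne_zero hC
  have h4 := exp_two_pi_sub_one_ne_zero hC
  have h5 : 1 / (exp (2 * Real.pi * I * C) - 1) =
      exp (-2 * Real.pi * I * C) / (1 - exp (-2 * Real.pi * I * C)) := by
    rw [div_eq_div_iff h4 h3]
    linear_combination -exp_two_pi_mul C
  rw [tsum_mul_right, tsum_mul_right, (summable_exp_two_pi hC).2, lowerBlock₂, lowerBlock₁, h5]
  generalize exp (-2 * Real.pi * I * C) = q at *
  field_simp
  ring

end

/-! ### The root germs -/

def chebSqrt (x : ℂ) : ℂ := csqrt (1 - x) * csqrt (1 + x)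

def chebExp (x : ℂ) : ℂ := x - I * chebSqrt x

def chebLog (x : ℂ) : ℂ := log (chebExp x) / 3

/-- The normalized value `Q / (2 s³) - κ`. -/
def rootVar (z Q : ℂ) : ℂ := Q / (2 * scale z ^ 3) - asymmetry z

/-- The roots of `w (w - 1) (w - z) = Q` by the trigonometric formula, for `exp (3 u) = 1`. -/
def rootGerm (u z Q : ℂ) : ℂ := center z + 2 * scale z * cosh (u + chebLog (rootVar z Q))

section

variable {x z u Q : ℂ}

theorem chebSqrt_sq : chebSqrt x ^ 2 = (1 - x) * (1 + x) := by
  rw [chebSqrt, mul_pow, csqrt_sq, csqrt_sq]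

theorem chebExp_mul : chebExp x * (x + I * chebSqrt x) = 1 := by
  rw [chebExp]
  linear_combination -chebSqrt x ^ 2 * I_sq + chebSqrt_sq (x := x)

theorem chebExp_ne_zero : chebExp x ≠ 0 := left_ne_zero_of_mul_eq_one chebExp_mul

theorem exp_three_mul_chebLog : exp (3 * chebLog x) = chebExp x := by
  rw [chebLog, mul_div_cancel₀ _ three_ne_zero, exp_log chebExp_ne_zero]

theorem exp_neg_three_mul_chebLog : exp (-(3 * chebLog x)) = x + I * chebSqrt x := by
  rw [exp_neg, exp_three_mul_chebLog]
  exact inv_eq_of_mul_eq_one_right chebExp_mul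

theorem cosh_three_mul_chebLog : cosh (3 * chebLog x) = x := by
  rw [cosh, exp_three_mul_chebLog, exp_neg_three_mul_chebLog, chebExp]; ring

theorem sinh_three_mul_chebLog : sinh (3 * chebLog x) = -(I * chebSqrt x) := by
  rw [sinh, exp_three_mul_chebLog, exp_neg_three_mul_chebLog, chebExp]; ring

/-- In the Chebyshev normal form the equation for the root is T₃(cosh v) = cosh 3v = x, and a shift
u with e^{3u} = 1 does not change cosh 3v. -/
theorem cubic_rootGerm (hz : scale z ≠ 0) (hu : exp (3 * u) = 1) :
    cubic z (rootGerm u z Q) = Q := by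
  have hcosh : cosh (3 * (u + chebLog (rootVar z Q))) = rootVar z Q := by
    rw [mul_add]
    conv_rhs => rw [← cosh_three_mul_chebLog (x := rootVar z Q)]
    rw [cosh, cosh, neg_add, exp_add, exp_add, exp_neg (3 * u), hu, inv_one, one_mul, one_mul]
  rw [rootGerm, cubic_center_add hz, ← cosh_three_mul, hcosh, rootVar, sub_add_cancel,
    mul_div_cancel₀ _ (mul_ne_zero two_ne_zero (pow_ne_zero 3 hz))]

theorem one_sub_mem_slitPlane (hx : ‖x‖ < 1) : 1 - x ∈ slitPlane ∧ 1 + x ∈ slitPlane := by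
  have h := abs_lt.1 ((abs_re_le_norm x).trans_lt hx)
  refine ⟨Or.inl ?_, Or.inl ?_⟩
  · rw [sub_re, one_re]; linarith
  · rw [add_re, one_re]; linarith

theorem analyticAt_chebLog (hx : ‖x‖ < 1) : AnalyticAt ℂ chebLog x := by
  obtain ⟨h1, h2⟩ := one_sub_mem_slitPlane hx
  have hS : AnalyticAt ℂ chebSqrt x :=
    (AnalyticAt.comp (g := csqrt) (f := fun x : ℂ => 1 - x) (analyticAt_csqrt h1)
      (by fun_prop)).mul (AnalyticAt.comp (g := csqrt) (f := fun x : ℂ => 1 + x)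
        (analyticAt_csqrt h2) (by fun_prop))
  have hX : AnalyticAt ℂ chebExp x := analyticAt_id.sub (analyticAt_const.mul hS)
  exact (hX.clog (sub_I_mul_mem_slitPlane chebSqrt_sq h2)).div analyticAt_const three_ne_zero

theorem analyticAt_rootGerm (hκ : ‖asymmetry z‖ < 1) : AnalyticAt ℂ (rootGerm u z) 0 := by
  have hV : AnalyticAt ℂ (rootVar z) 0 := by
    unfold rootVar
    simp only [div_eq_mul_inv]
    fun_prop
  have hL : AnalyticAt ℂ (fun Q => chebLog (rootVar z Q)) 0 := by
    refine AnalyticAt.comp (g := chebLog) (analyticAt_chebLog ?_) hV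
    rwa [rootVar, zero_div, zero_sub, norm_neg]
  have hcosh : AnalyticAt ℂ (fun Q => cosh (u + chebLog (rootVar z Q))) 0 :=
    AnalyticAt.comp (g := cosh) (differentiable_cosh.analyticAt _) (analyticAt_const.add hL)
  exact analyticAt_const.add (analyticAt_const.mul hcosh)

theorem eq_root_of_cubic_eq_zero {w : ℂ} (h : cubic z w = 0) : w = 0 ∨ w = 1 ∨ w = z := by
  rw [cubic, mul_eq_zero, mul_eq_zero, sub_eq_zero, sub_eq_zero] at h
  tauto

end

/-! ### Values at `Q = 0` -/

theorem scale_half : scale (1 / 2) = √3 / 6 := by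
  obtain ⟨σ, -, hσ, hσx, -, hs, -⟩ := exists_scale_asymmetry (1 / 2)
  have h : σ = √3 / 6 := by
    have : √3 ^ 2 = 3 := Real.sq_sqrt (by norm_num)
    refine (pow_left_inj₀ hσ.le (by positivity) two_ne_zero).1 ?_
    rw [div_pow, this]
    linarith
  have e : ((1 / 2 : ℝ) : ℂ) = 1 / 2 := by norm_num
  rw [e] at hs
  rw [hs, h]
  push_cast; ring

theorem chebLog_zero : chebLog 0 = -(Real.pi / 6 * I) := by
  have h1 : csqrt 1 = 1 := by simp [csqrt]
  rw [chebLog, chebExp, chebSqrt, sub_zero, add_zero, h1, mul_one, mul_one, zero_sub, log_neg_I]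
  ring

theorem rootGerm_half (φ : ℝ) : rootGerm (φ * I) (1 / 2) 0 =
    ((1 / 2 + √3 / 3 * Real.cos (φ - Real.pi / 6) : ℝ) : ℂ) := by
  have e : (φ : ℂ) * I + -(Real.pi / 6 * I) = ((φ - Real.pi / 6 : ℝ) : ℂ) * I := by
    push_cast; ring
  rw [rootGerm, rootVar, asymmetry_half, zero_div, sub_zero, chebLog_zero, e, cosh_mul_I,
    scale_half, center]
  push_cast
  ring

theorem rootGerm_half_one : rootGerm ((0 : ℝ) * I) (1 / 2) 0 = 1 := by
  have h : √3 * √3 = 3 := Real.mul_self_sqrt (by norm_num)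
  rw [rootGerm_half, zero_sub, Real.cos_neg, Real.cos_pi_div_six]
  have : 1 / 2 + √3 / 3 * (√3 / 2) = 1 := by linear_combination 1 / 6 * h
  rw [this, ofReal_one]

theorem rootGerm_half_two : rootGerm ((2 * Real.pi / 3 : ℝ) * I) (1 / 2) 0 = 1 / 2 := by
  have e : 2 * Real.pi / 3 - Real.pi / 6 = Real.pi / 2 := by ring
  rw [rootGerm_half, e, Real.cos_pi_div_two]
  push_cast; ring

theorem rootGerm_half_zero : rootGerm ((-(2 * Real.pi / 3) : ℝ) * I) (1 / 2) 0 = 0 := by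
  have h : √3 * √3 = 3 := Real.mul_self_sqrt (by norm_num)
  have e : -(2 * Real.pi / 3) - Real.pi / 6 = -(Real.pi - Real.pi / 6) := by ring
  rw [rootGerm_half, e, Real.cos_neg, Real.cos_pi_sub, Real.cos_pi_div_six]
  have : 1 / 2 + √3 / 3 * -(√3 / 2) = 0 := by linear_combination -1 / 6 * h
  rw [this, ofReal_zero]

theorem continuousAt_rootGerm (u : ℂ) : ContinuousAt (fun z => rootGerm u z 0) (1 / 2) := by
  have hmem : (1 / 2 : ℂ) ∈ Metric.ball (1 / 2 : ℂ) (1 / 16) := half_mem_ball (by norm_num)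
  have hs := (differentiableAt_scale hmem).continuousAt
  have hκ := (differentiableAt_asymmetry hmem).continuousAt
  have hV : ContinuousAt (fun z => rootVar z 0) (1 / 2) := by
    unfold rootVar
    simp only [zero_div]
    exact continuousAt_const.sub hκ
  have hL : ContinuousAt (fun z => chebLog (rootVar z 0)) (1 / 2) := by
    refine ContinuousAt.comp (g := chebLog) (analyticAt_chebLog ?_).continuousAt hV
    rw [rootVar, zero_div, asymmetry_half, sub_zero, norm_zero]
    exact one_pos
  have hc : ContinuousAt center (1 / 2) := by unfold center; fun_prop
  exact hc.add ((continuousAt_const.mul hs).mul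
    (Complex.continuous_cosh.continuousAt.comp (continuousAt_const.add hL)))

theorem exp_three_mul_zero_mul_I : exp (3 * ((0 : ℝ) * I)) = 1 := by simp

theorem exp_three_mul_two_pi_div_three : exp (3 * ((2 * Real.pi / 3 : ℝ) * I)) = 1 := by
  have : 3 * (((2 * Real.pi / 3 : ℝ) : ℂ) * I) = 2 * Real.pi * I := by push_cast; ring
  rw [this, exp_two_pi_mul_I]

theorem exp_three_mul_neg_two_pi_div_three :
    exp (3 * ((-(2 * Real.pi / 3) : ℝ) * I)) = 1 := by
  have : 3 * (((-(2 * Real.pi / 3) : ℝ) : ℂ) * I) = -(2 * Real.pi * I) := by push_cast; ring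
  rw [this, exp_neg, exp_two_pi_mul_I, inv_one]

/-- Near `z = 1/2` the three root germs take the values `0`, `1`, `z` at `Q = 0`. -/
theorem eventually_rootGerm_zero : ∀ᶠ z in 𝓝 (1 / 2 : ℂ),
    rootGerm ((-(2 * Real.pi / 3) : ℝ) * I) z 0 = 0 ∧ rootGerm ((0 : ℝ) * I) z 0 = 1 ∧
      rootGerm ((2 * Real.pi / 3 : ℝ) * I) z 0 = z := by
  have hball : ∀ᶠ z in 𝓝 (1 / 2 : ℂ), z ∈ Metric.ball (1 / 2 : ℂ) (1 / 16) :=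
    Metric.ball_mem_nhds _ (by norm_num)
  -- At Q = 0 each germ takes one of the values 0, 1, z. At z = 1/2 these are at distance at least
  -- 1/2, so staying within 1/4 of the known value decides which one it is.
  have hnear : ∀ u : ℂ, ∀ᶠ z in 𝓝 (1 / 2 : ℂ),
      ‖rootGerm u z 0 - rootGerm u (1 / 2) 0‖ < 1 / 4 := fun u => by
    have := (continuousAt_rootGerm u).eventually_mem
      (Metric.ball_mem_nhds (rootGerm u (1 / 2) 0) (show (0 : ℝ) < 1 / 4 by norm_num))
    simpa only [mem_ball_iff_norm] using this
  filter_upwards [hball, hnear ((-(2 * Real.pi / 3) : ℝ) * I), hnear ((0 : ℝ) * I),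
    hnear ((2 * Real.pi / 3 : ℝ) * I)] with z hz h0 h1 h2
  have hs := scale_ne_zero hz
  have hz1 := (re_lt_of_mem_ball hz).1
  have hz2 : ‖z‖ < 9 / 16 := (re_lt_of_mem_ball hz).2.2.2
  have hz3 : 7 / 16 < ‖z‖ := by
    have := (re_lt_of_mem_ball hz).2.1
    exact this.trans_le ((le_abs_self _).trans (abs_re_le_norm z))
  have hz4 : 7 / 16 ≤ ‖z - 1‖ := by
    have := norm_sub_norm_le (1 : ℂ) z
    rw [norm_one, norm_sub_rev] at this
    linarith
  rw [rootGerm_half_zero] at h0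
  rw [rootGerm_half_one] at h1
  rw [rootGerm_half_two] at h2
  have e0 := eq_root_of_cubic_eq_zero
    (cubic_rootGerm (Q := 0) hs exp_three_mul_neg_two_pi_div_three)
  have e1 := eq_root_of_cubic_eq_zero (cubic_rootGerm (Q := 0) hs exp_three_mul_zero_mul_I)
  have e2 := eq_root_of_cubic_eq_zero (cubic_rootGerm (Q := 0) hs exp_three_mul_two_pi_div_three)
  refine ⟨?_, ?_, ?_⟩
  · rcases e0 with h | h | h
    · exact h
    · rw [h] at h0; norm_num at h0
    · rw [h, sub_zero] at h0; linarith
  · rcases e1 with h | h | h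
    · rw [h] at h1; norm_num at h1
    · exact h
    · rw [h] at h1; linarith
  · rcases e2 with h | h | h
    · rw [h] at h2; norm_num at h2
    · rw [h] at h2; norm_num at h2
    · exact h

/-! ### The Borel germs in terms of the roots -/

section

variable {z Q : ℂ}

theorem cosh_two_pi_div_three_add (L : ℂ) :
    cosh (((2 * Real.pi / 3 : ℝ) : ℂ) * I + L) = -(1 / 2) * cosh L + √3 / 2 * I * sinh L := by
  have e : 2 * Real.pi / 3 = Real.pi - Real.pi / 3 := by ring
  rw [cosh_add, cosh_mul_I, sinh_mul_I, ← ofReal_cos, ← ofReal_sin, e, Real.cos_pi_sub,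
    Real.sin_pi_sub, Real.cos_pi_div_three, Real.sin_pi_div_three]
  push_cast; ring

theorem cosh_neg_two_pi_div_three_add (L : ℂ) :
    cosh (((-(2 * Real.pi / 3) : ℝ) : ℂ) * I + L) = -(1 / 2) * cosh L - √3 / 2 * I * sinh L := by
  have e : ((-(2 * Real.pi / 3) : ℝ) : ℂ) * I + L =
      -(((2 * Real.pi / 3 : ℝ) : ℂ) * I + -L) := by push_cast; ring
  rw [e, cosh_neg, cosh_two_pi_div_three_add, cosh_neg, sinh_neg]; ring

theorem cosh_add_pi_div_three (L : ℂ) :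
    cosh (L + Real.pi / 3 * I) = 1 / 2 * cosh L + √3 / 2 * I * sinh L := by
  have e : (Real.pi / 3 * I : ℂ) = ((Real.pi / 3 : ℝ) : ℂ) * I := by push_cast; ring
  rw [e, cosh_add, cosh_mul_I, sinh_mul_I, ← ofReal_cos, ← ofReal_sin, Real.cos_pi_div_three,
    Real.sin_pi_div_three]
  push_cast; ring

theorem sqrt_three_mul_self : (√3 : ℂ) * √3 = 3 := by
  rw [← ofReal_mul, Real.mul_self_sqrt (by norm_num)]; norm_num

/-- The Vandermonde determinant of the roots. -/
theorem rootGerm_discriminant (z Q : ℂ) :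
    (rootGerm ((-(2 * Real.pi / 3) : ℝ) * I) z Q - rootGerm ((0 : ℝ) * I) z Q) *
      (rootGerm ((-(2 * Real.pi / 3) : ℝ) * I) z Q - rootGerm ((2 * Real.pi / 3 : ℝ) * I) z Q) *
      (rootGerm ((0 : ℝ) * I) z Q - rootGerm ((2 * Real.pi / 3 : ℝ) * I) z Q) =
      6 * √3 * scale z ^ 3 * chebSqrt (rootVar z Q) := by
  have h := sinh_three_mul_chebLog (x := rootVar z Q)
  rw [sinh_three_mul] at h
  simp only [rootGerm, cosh_two_pi_div_three_add, cosh_neg_two_pi_div_three_add, ofReal_zero,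
    zero_mul, zero_add]
  have hsq := cosh_sq (chebLog (rootVar z Q))
  generalize chebLog (rootVar z Q) = L at *
  have h3 := sqrt_three_mul_self
  linear_combination (6 * I * √3 * scale z ^ 3) * h -
    (6 * √3 * scale z ^ 3 * chebSqrt (rootVar z Q)) * I_sq +
    (18 * I * √3 * scale z ^ 3 * sinh L) * hsq -
    (2 * scale z ^ 3 * √3 * I ^ 3 * sinh L ^ 3) * h3 - (6 * √3 * scale z ^ 3 * I * sinh L ^ 3) * I_sq

/-- The roots sum to three times the center, so the numerator is three times the deviation of w₁
from it, that is 6s cosh L. -/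
theorem Psi_rootGerm (z Q : ℂ) : Psi (rootGerm ((-(2 * Real.pi / 3) : ℝ) * I) z)
    (rootGerm ((0 : ℝ) * I) z) (rootGerm ((2 * Real.pi / 3 : ℝ) * I) z) Q =
      Q * (6 * scale z * cosh (chebLog (rootVar z Q)) /
        (6 * √3 * scale z ^ 3 * chebSqrt (rootVar z Q))) := by
  rw [Psi, rootGerm_discriminant]
  congr 2
  simp only [rootGerm, cosh_two_pi_div_three_add, cosh_neg_two_pi_div_three_add, ofReal_zero,
    zero_mul, zero_add]
  ring

/-- Here the numerator is -3 times the deviation of w₀, and -cosh(L - 2πi/3) = cosh(L + πi/3). -/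
theorem Phi_rootGerm (z Q : ℂ) : Phi (rootGerm ((-(2 * Real.pi / 3) : ℝ) * I) z)
    (rootGerm ((0 : ℝ) * I) z) (rootGerm ((2 * Real.pi / 3 : ℝ) * I) z) Q =
      Q * (6 * scale z * cosh (chebLog (rootVar z Q) + Real.pi / 3 * I) /
        (6 * √3 * scale z ^ 3 * chebSqrt (rootVar z Q))) := by
  rw [Phi, rootGerm_discriminant]
  congr 2
  simp only [rootGerm, cosh_two_pi_div_three_add, cosh_neg_two_pi_div_three_add,
    cosh_add_pi_div_three, ofReal_zero, zero_mul, zero_add]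
  ring

/-- In the right half-plane the inner germ is given by the trigonometric formula. -/
theorem innerSqrt_ofReal_eq {κ : ℂ} {t : ℝ} (ht : 0 < t) :
    innerSqrt κ t = chebSqrt ((1 + κ) * exp (-(t : ℂ)) - κ) := by
  have he : Real.exp (-t) < 1 := Real.exp_lt_one_iff.2 (neg_lt_zero.2 ht)
  have e1 : 1 - ((1 + κ) * exp (-(t : ℂ)) - κ) = (1 + κ) * ((1 - Real.exp (-t) : ℝ) : ℂ) := by
    push_cast; ring
  have e2 : 1 - exp (-(t : ℂ)) = ((1 - Real.exp (-t) : ℝ) : ℂ) := by push_cast; ring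
  have e3 : 1 + ((1 + κ) * exp (-(t : ℂ)) - κ) = 1 - κ + (1 + κ) * exp (-(t : ℂ)) := by ring
  rw [innerSqrt, chebSqrt, e1, e3, csqrt_mul_ofReal (by linarith), e2, csqrt_ofReal (by linarith)]

theorem innerGerm_ofReal_eq {κ : ℂ} {t : ℝ} (ht : 0 < t) : innerGerm κ t =
    exp (-(t : ℂ)) * cosh (chebLog ((1 + κ) * exp (-(t : ℂ)) - κ)) /
      chebSqrt ((1 + κ) * exp (-(t : ℂ)) - κ) := by
  rw [innerGerm, innerExp, innerSqrt_ofReal_eq ht, chebLog, chebExp]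

theorem Psi_rootGerm_eq_borelPsi (hz : scale z ≠ 0) {t : ℝ} (ht : 0 < t) :
    Psi (rootGerm ((-(2 * Real.pi / 3) : ℝ) * I) z) (rootGerm ((0 : ℝ) * I) z)
      (rootGerm ((2 * Real.pi / 3 : ℝ) * I) z) (QMinus z * exp (-(t : ℂ))) = borelPsi z t := by
  have hx : rootVar z (QMinus z * exp (-(t : ℂ))) =
      (1 + asymmetry z) * exp (-(t : ℂ)) - asymmetry z := by
    rw [rootVar, QMinus_eq hz]; field_simp
  have hre : ¬((t : ℂ).re < 0 ∧ 0 < (t : ℂ).im) := fun h => by simp at h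
  have h3 : (√3 : ℂ) ≠ 0 := left_ne_zero_of_mul (sqrt_three_mul_self.trans_ne three_ne_zero)
  rw [Psi_rootGerm, hx, borelPsi, borelGerm, if_neg hre, innerGerm_ofReal_eq ht, prefactor,
    QMinus_eq hz]
  field_simp

/-! ### The sign change of x and the germ of the first block -/

theorem chebSqrt_neg (x : ℂ) : chebSqrt (-x) = chebSqrt x := by
  rw [chebSqrt, chebSqrt, sub_neg_eq_add, ← sub_eq_add_neg, mul_comm]

/-- For ‖x‖ ≤ 1/2 the root √(1-x²) has real part at least √3/2, which exceeds |Im x|. -/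
theorem chebExp_im_neg {x : ℂ} (hx : ‖x‖ ≤ 1 / 2) : (chebExp x).im < 0 := by
  have h := abs_le.1 ((abs_re_le_norm x).trans hx)
  have hre : 0 < (chebSqrt x).re := by
    have h1 := abs_csqrt_im_lt_re (x := 1 - x) (by rw [sub_re, one_re]; linarith)
    have h2 := abs_csqrt_im_lt_re (x := 1 + x) (by rw [add_re, one_re]; linarith)
    rw [chebSqrt, mul_re, sub_pos]
    refine (le_abs_self _).trans_lt ?_
    rw [abs_mul]
    exact mul_lt_mul'' h1 h2 (abs_nonneg _) (abs_nonneg _)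
  have hsq : 3 / 4 ≤ (chebSqrt x).re ^ 2 := by
    have h1 := congrArg re (chebSqrt_sq (x := x))
    have e : (1 - x) * (1 + x) = ((1 : ℝ) : ℂ) - x ^ 2 := by push_cast; ring
    rw [e, sub_re, ofReal_re, sq, mul_re] at h1
    have h2 := (abs_re_le_norm (x ^ 2)).trans_eq (norm_pow x 2)
    have h3 := (abs_le.1 h2).2
    nlinarith [norm_nonneg x, mul_self_nonneg (chebSqrt x).im]
  have him := (abs_le.1 ((abs_im_le_norm x).trans hx)).2
  rw [chebExp, sub_im, I_mul_im]
  nlinarith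

/-- Passing to -x replaces e^{-iα} by -e^{iα}. Since the argument of e^{-iα} is in (-π, 0), the
principal logarithm of the new number is -log - πi, and a third of it gives the shift by πi/3. -/
theorem chebLog_neg {x : ℂ} (hx : ‖x‖ ≤ 1 / 2) :
    chebLog (-x) = -(chebLog x + Real.pi / 3 * I) := by
  have him := chebExp_im_neg hx
  have hX : chebExp (-x) = exp (-log (chebExp x) - Real.pi * I) := by
    rw [exp_sub, exp_pi_mul_I, exp_neg, exp_log chebExp_ne_zero,
      ← eq_inv_of_mul_eq_one_right (chebExp_mul (x := x)), chebExp, chebSqrt_neg]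
    ring
  have hneg := arg_neg_iff.2 him
  have hgt := neg_pi_lt_arg (chebExp x)
  rw [chebLog, hX, log_exp, chebLog]
  · ring
  · simp only [sub_im, neg_im, log_im, mul_I_im, ofReal_re]
    linarith
  · simp only [sub_im, neg_im, log_im, mul_I_im, ofReal_re]
    linarith

/-- At Q = Q_+ e^{-t} the normalized variable is minus the one belonging to 1 - z; the sign change
cancels the πi/3 in the formula for Φ. The bound t ≥ 2 makes this variable at most 1/2 in modulus,
as `chebLog_neg` requires. -/
theorem Phi_rootGerm_eq_borelPhi (hz : scale z ≠ 0) (hκ : ‖asymmetry z‖ ≤ 1 / 8) {t : ℝ}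
    (ht : 2 ≤ t) : Phi (rootGerm ((-(2 * Real.pi / 3) : ℝ) * I) z) (rootGerm ((0 : ℝ) * I) z)
      (rootGerm ((2 * Real.pi / 3 : ℝ) * I) z) (QPlus z * exp (-(t : ℂ))) = borelPhi z t := by
  set κ := asymmetry (1 - z) with hκdef
  have hκz : asymmetry z = -κ := by rw [hκdef, asymmetry_one_sub, neg_neg]
  set y := (1 + κ) * exp (-(t : ℂ)) - κ with hy
  have hx : rootVar z (QPlus z * exp (-(t : ℂ))) = -y := by
    rw [rootVar, QPlus_eq hz, hy, hκz]; field_simp; ring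
  have hynorm : ‖y‖ ≤ 1 / 2 := by
    rw [hκz, norm_neg] at hκ
    have he : ‖exp (-(t : ℂ))‖ ≤ 1 / 3 := by
      rw [norm_exp, neg_re, ofReal_re, Real.exp_neg, one_div]
      exact inv_anti₀ (by norm_num) (by linarith [Real.add_one_le_exp t])
    have h1 : ‖1 + κ‖ ≤ 9 / 8 := (norm_add_le _ _).trans (by rw [norm_one]; linarith)
    calc ‖y‖ ≤ ‖1 + κ‖ * ‖exp (-(t : ℂ))‖ + ‖κ‖ := by
          rw [← norm_mul]; exact norm_sub_le _ _
      _ ≤ 9 / 8 * (1 / 3) + 1 / 8 := by gcongr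
      _ ≤ 1 / 2 := by norm_num
  have hre : ¬((t : ℂ).re < 0 ∧ 0 < (t : ℂ).im) := fun h => by simp at h
  have h3 : (√3 : ℂ) ≠ 0 := left_ne_zero_of_mul (sqrt_three_mul_self.trans_ne three_ne_zero)
  have hL : chebLog (-y) + Real.pi / 3 * I = -chebLog y := by rw [chebLog_neg hynorm]; ring
  rw [Phi_rootGerm, hx, hL, cosh_neg, chebSqrt_neg, borelPhi, ← hκdef, borelGerm, if_neg hre,
    innerGerm_ofReal_eq (by linarith), prefactor, scale_one_sub, ← hκdef, ← hy, QPlus_eq hz, hκz]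
  field_simp
  ring

end

end CoulombGas

end

/-- All objects bound by the inner existential quantifier are uniquely determined by the first
seven conditions (through the identity theorem): `w₀ w₁ w₂` as germs at `0`, `ψ` and `φ` as
`Ψ(Q_- e^{-ζ})` and `Φ(Q_+ e^{-ζ})`, `I₁` and `I₂` as the conformal blocks, `A` and `B` as the
Laplace transforms of `ψ` and `φ` along `π/2 + ε`, and then `a`, `b` as the coefficients of the
inverse Borel transforms. -/
theorem mainTheorem1 :
    ∃ ε₀ : ℝ, 0 < ε₀ ∧ ∀ ε : ℝ, 0 < ε → ε < ε₀ →
    ∃ δ : ℝ, 0 < δ ∧ ∀ z : ℂ, ‖z - 1 / 2‖ < δ →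
    ∃ w₀ w₁ w₂ ψ φ I₁ I₂ A B : ℂ → ℂ, ∃ a b : ℕ → ℂ,
      -- the objects
      CoulombGas.IsRootGerms z w₀ w₁ w₂ ∧
      CoulombGas.IsRayContinuation (CoulombGas.Psi w₀ w₁ w₂) (CoulombGas.QMinus z)
        (Real.pi / 2 + ε) ψ ∧
      CoulombGas.IsRayContinuation (CoulombGas.Phi w₀ w₁ w₂) (CoulombGas.QPlus z)
        (Real.pi / 2 + ε) φ ∧
      CoulombGas.IsBlock₁ z I₁ ∧
      CoulombGas.IsBlock₂ z I₂ ∧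
      CoulombGas.IsLaplace (Real.pi / 2 + ε) ψ A ∧
      CoulombGas.IsLaplace (Real.pi / 2 + ε) φ B ∧
      CoulombGas.IsInverseBorel ψ a ∧
      CoulombGas.IsInverseBorel φ b ∧
      -- the Borel-Laplace representations of the two blocks
      (∀ C : ℂ, -1 < C.re →
        IntegrableOn (CoulombGas.laplaceIntegrand 0 ψ C) (Ioi 0) ∧
        I₂ C = CoulombGas.QMinusPow z C * CoulombGas.laplace 0 ψ C) ∧
      (∀ C : ℂ, C.im < 0 →
        I₁ C = CoulombGas.QPlusPow z C * (1 / (exp (2 * Real.pi * I * C) - 1)) * B C) ∧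
      -- the Stokes phenomenon
      (∀ C : ℂ, C.im < 0 →
        I₂ C = CoulombGas.QMinusPow z C *
          ((1 + exp (-2 * Real.pi * I * C)) / (1 - exp (-2 * Real.pi * I * C))) * A C + I₁ C) ∧
      -- the trans-series expansion: exact resummation over `m ≥ 1`, and the asymptotic expansions
      -- of the Borel sums `A` and `B` on closed subsectors
      (∀ C : ℂ, C.im < 0 →
        Summable (fun m : ℕ => exp (-2 * Real.pi * I * (m + 1) * C)) ∧
        I₂ C = CoulombGas.QMinusPow z C * A C +
          2 * CoulombGas.QMinusPow z C *
            ∑' m : ℕ, exp (-2 * Real.pi * I * (m + 1) * C) * A C +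
          CoulombGas.QPlusPow z C *
            ∑' m : ℕ, exp (-2 * Real.pi * I * (m + 1) * C) * B C) ∧
      (∀ η : ℝ, 0 < η →
        CoulombGas.HasAsymptoticExpansion {C | C.im < 0 ∧ arg C ≤ -ε - η} A a ∧
        CoulombGas.HasAsymptoticExpansion {C | C.im < 0 ∧ arg C ≤ -ε - η} B b) := by
  refine ⟨1 / 2, by norm_num, fun ε h0 h1 => ?_⟩
  have hk := CoulombGas.sin_half_pos h0 h1
  have hk1 := Real.sin_le_one (ε / 2)
  -- The margin sin(ε/2)/4 is the constant of the inner and outer regions that contain the sectors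
  -- about the two rays; it makes δ depend on ε. A second radius, independent of ε, identifies the
  -- root germs.
  obtain ⟨δ₀, hδ₀⟩ := CoulombGas.exists_isGoodRadius (c := Real.sin (ε / 2) / 4) (by linarith)
  obtain ⟨δ₁, hδ₁, hroot⟩ := Metric.eventually_nhds_iff_ball.1 CoulombGas.eventually_rootGerm_zero
  refine ⟨min δ₀ δ₁, lt_min hδ₀.pos hδ₁, fun z hz => ?_⟩
  have hz₀ : z ∈ Metric.ball (1 / 2 : ℂ) δ₀ := mem_ball_iff_norm.2 (hz.trans_le (min_le_left _ _))
  obtain ⟨hw₀, hw₁, hw₂⟩ := hroot z (mem_ball_iff_norm.2 (hz.trans_le (min_le_right _ _)))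
  have hgood := hδ₀.mono (c' := 1 / 4) (by linarith)
  have hsmall : ∀ z ∈ Metric.ball (1 / 2 : ℂ) δ₀,
      8 * ‖CoulombGas.asymmetry z‖ ≤ Real.sin (ε / 2) / 4 := fun z hz =>
    (hδ₀.asymmetry_lt z hz).le
  have hs := CoulombGas.scale_ne_zero (hδ₀.mem hz₀)
  have hκ := hsmall z hz₀
  have hκ' := hsmall _ (CoulombGas.one_sub_mem_ball hz₀)
  obtain ⟨a, ha⟩ := CoulombGas.exists_isInverseBorel_borelGerm h0 h1 hκ (CoulombGas.prefactor z)
  obtain ⟨b, hb⟩ := CoulombGas.exists_isInverseBorel_borelGerm h0 h1 hκ'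
    (-CoulombGas.prefactor (1 - z))
  refine ⟨CoulombGas.rootGerm ((-(2 * Real.pi / 3) : ℝ) * I) z,
    CoulombGas.rootGerm ((0 : ℝ) * I) z, CoulombGas.rootGerm ((2 * Real.pi / 3 : ℝ) * I) z,
    CoulombGas.borelPsi z, CoulombGas.borelPhi z, CoulombGas.block₁ z, CoulombGas.block₂ z,
    CoulombGas.laplacePsi z, CoulombGas.laplacePhi z, a, b, ?_, ⟨?_, ?_⟩, ⟨?_, ?_⟩,
    CoulombGas.isBlock₁_block₁ hgood h0 h1 hsmall hz₀,
    CoulombGas.isBlock₂_block₂ hgood h0 h1 hsmall hz₀,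
    CoulombGas.isLaplace_borelGerm h0 h1 hκ, CoulombGas.isLaplace_borelGerm h0 h1 hκ', ha, hb,
    fun C hC => CoulombGas.block₂_eq_laplace hgood h0 h1 hsmall hz₀ hC,
    fun C hC => if_pos hC, fun C hC => ?_, fun C hC => ?_, fun η hη =>
    ⟨CoulombGas.hasAsymptoticExpansion_borelGerm h0 h1 hκ ha hη,
      CoulombGas.hasAsymptoticExpansion_borelGerm h0 h1 hκ' hb hη⟩⟩
  · have hκ1 : ‖CoulombGas.asymmetry z‖ < 1 := by linarith
    exact ⟨CoulombGas.analyticAt_rootGerm hκ1, CoulombGas.analyticAt_rootGerm hκ1,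
      CoulombGas.analyticAt_rootGerm hκ1, hw₀, hw₁, hw₂,
      .of_forall fun _ => CoulombGas.cubic_rootGerm hs
        CoulombGas.exp_three_mul_neg_two_pi_div_three,
      .of_forall fun _ => CoulombGas.cubic_rootGerm hs CoulombGas.exp_three_mul_zero_mul_I,
      .of_forall fun _ => CoulombGas.cubic_rootGerm hs CoulombGas.exp_three_mul_two_pi_div_three⟩
  · exact ⟨1, one_pos, ε / 2, half_pos h0, fun ζ hζ =>
      analyticAt_const.mul (CoulombGas.analyticOnNhd_borelGerm h0 h1 hκ ζ hζ)⟩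
  · filter_upwards [eventually_gt_atTop 0] with t ht
    exact (CoulombGas.Psi_rootGerm_eq_borelPsi hs ht).symm
  · exact ⟨1, one_pos, ε / 2, half_pos h0, fun ζ hζ =>
      analyticAt_const.mul (CoulombGas.analyticOnNhd_borelGerm h0 h1 hκ' ζ hζ)⟩
  · filter_upwards [eventually_ge_atTop 2] with t ht
    exact (CoulombGas.Phi_rootGerm_eq_borelPhi hs (by linarith) ht).symm
  · rw [CoulombGas.block₂, CoulombGas.block₁, if_pos hC, if_pos hC, CoulombGas.lowerBlock₂]
  · refine ⟨(CoulombGas.summable_exp_two_pi hC).1, ?_⟩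
    rw [CoulombGas.block₂, if_pos hC]
    exact CoulombGas.lowerBlock₂_eq_tsum hC
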